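/- Double categories are small and strict, and double functors are strict. $\mathrm{DblCat}$ is the category of double categories and double functors. A double category is an *equipment* if each of its vertical morphisms has both a (horizontal) companion and a (horizontal) conjoint. For double categories $\mathbb X,\mathbb A$, the *pseudo hom double category* $\llbracket\mathbb X,\mathbb A\rrbracket_{\mathrm{ps}}$ has as objects the double functors $\mathbb X\to\mathbb A$, as horizontal (vertical) morphisms the horizontal (vertical) pseudo natural transformations, and as squares the modifications. Let $E_{\mathrm{adj}}$ be the free-living adjoint equivalence, a 2-category with objects $0,1$, and let $\mathrm{Sq}\,E_{\mathrm{adj}}$ be its double category of squares. For a 2-category $\mathcal C$, let $\mathbb H\mathcal C$ (resp. $\mathbb V\mathcal C$) be $\mathcal C$ regarded as a double category whose only vertical (resp. horizontal) morphisms are identities; let $\mathbb 2$ be the category with a single non-identity arrow $0\to1$, and let $\Sigma I$ be the free-living invertible 2-cell. A double functor is a *naive fibration* if it has the right lifting property with respect to the five double functors $\mathbb 1\to\mathbb V E_{\mathrm{adj}}$ (inclusion of an object), $\mathbb V\mathbb 2\to\mathrm{Sq}\,\mathbb 2$, $\mathbb V\mathbb 2\to(\mathrm{Sq}\,\mathbb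 2)^{\mathrm{hop}}$ (where $\mathrm{hop}$ denotes the horizontal dual), $\mathbb H\mathbb 2\to\mathbb H\Sigma I$ and $\mathbb V\mathbb 2\to\mathbb V\Sigma I$. A double functor $F:\mathbb A\to\mathbb B$ is a *double biequivalence* if 1. for every object $B$ of $\mathbb B$ there are an object $A$ of $\mathbb A$ and a vertical equivalence $B\to FA$; 2. for all objects $A,C$ of $\mathbb A$, every vertical morphism $FA\to FC$ of $\mathbb B$ is 2-isomorphic, through a horizontally invertible square whose top and bottom are identities, to $Fu$ for some vertical morphism $u:A\to C$ of $\mathbb A$; 3. for every horizontal morphism $f$ of $\mathbb B$ there are a horizontal morphism $g$ of $\mathbb A$ and a weakly vertically invertible square in $\mathbb B$ with top $f$ and bottom $Fg$, whose sides are vertical equivalences; 4. $F$ is fully faithful on squares. **Proposition.** Let $\mathbb A$ be an equipment. Then: * the pseudo hom double category $\llbracket\mathrm{Sq}\,E_{\mathrm{adj}},\mathbb A\rrbracket_{\mathrm{ps}}$ is an equipment; that is, every vertical pseudo natural transformation between double functors $\mathrm{Sq}\,E_{\mathrm{adj}}\to\mathbb A$ has a companion and a conjoint in it; * the double functors $$\mathbb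 A\xrightarrow{\;w\;}\llbracket\mathrm{Sq}\,E_{\mathrm{adj}},\mathbb A\rrbracket_{\mathrm{ps}}\xrightarrow{\;p\;}\mathbb A\times\mathbb A$$ induced by $\mathbb 1\sqcup\mathbb 1\to\mathrm{Sq}\,E_{\mathrm{adj}}\to\mathbb 1$ (so $w$ takes constant values and $p$ evaluates at the objects $0$ and $1$) form a path object for $\mathbb A$: the composite $p\circ w$ is the diagonal of $\mathbb A$, $w$ is a double biequivalence (between equipments), and $p$ is a naive fibration. -/

import Mathlib

open CategoryTheory

set_option linter.unusedVariables false

universe u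

/-! ### Small categories, presented by a type of objects and a type of morphisms -/

/-- A category with type of objects `O` and type of (all) morphisms `M`.  The composite
`comp f g h` is written in diagrammatic order and is defined only for composable pairs. -/
structure CatStr (O M : Type u) where
  dom : M → O
  cod : M → O
  id : O → M
  comp : ∀ f g : M, cod f = dom g → M
  dom_id : ∀ a, dom (id a) = a
  cod_id : ∀ a, cod (id a) = a
  dom_comp : ∀ f g h, dom (comp f g h) = dom f
  cod_comp : ∀ f g h, cod (comp f g h) = cod g
  id_comp : ∀ a f h, comp (id a) f h = f
  comp_id : ∀ f a h, comp f (id a) h = f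
  assoc : ∀ f g k (h₁ : cod f = dom g) (h₂ : cod g = dom k),
    comp (comp f g h₁) k ((cod_comp f g h₁).trans h₂) =
      comp f (comp g k h₂) (h₁.trans (dom_comp g k h₂).symm)

namespace CatStr

variable {O M : Type u} (C : CatStr O M)

open Classical in
/-- Diagrammatic composition `f` then `g`, extended to all pairs of morphisms by the value `f` at
non-composable pairs.  It is only ever used at composable pairs; it serves to write equations
without carrying along proofs of composability. -/
noncomputable def cc (f g : M) : M :=
  if h : C.cod f = C.dom g then C.comp f g h else f

theorem cc_eq {f g : M} (h : C.cod f = C.dom g) : C.cc f g = C.comp f g h := dif_pos h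

theorem dom_cc (f g : M) : C.dom (C.cc f g) = C.dom f := by
  unfold cc; split
  · exact C.dom_comp _ _ _
  · rfl

theorem cod_cc {f g : M} (h : C.cod f = C.dom g) : C.cod (C.cc f g) = C.cod g := by
  rw [C.cc_eq h]; exact C.cod_comp _ _ _

theorem id_cc {a : O} {f : M} (h : a = C.dom f) : C.cc (C.id a) f = f := by
  rw [C.cc_eq ((C.cod_id a).trans h)]; exact C.id_comp _ _ _

theorem cc_id {a : O} {f : M} (h : C.cod f = a) : C.cc f (C.id a) = f := by
  rw [C.cc_eq (h.trans (C.dom_id a).symm)]; exact C.comp_id _ _ _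

theorem cc_assoc {f g k : M} (h₁ : C.cod f = C.dom g) (h₂ : C.cod g = C.dom k) :
    C.cc (C.cc f g) k = C.cc f (C.cc g k) := by
  rw [C.cc_eq ((C.cod_cc h₁).trans h₂), C.cc_eq (h₁.trans (C.dom_cc g k).symm)]
  simp only [C.cc_eq h₁, C.cc_eq h₂]
  exact C.assoc _ _ _ _ _

/-- `f` is an isomorphism. -/
def IsIso (f : M) : Prop :=
  ∃ g, C.dom g = C.cod f ∧ C.cod g = C.dom f ∧
    C.cc f g = C.id (C.dom f) ∧ C.cc g f = C.id (C.cod f)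

theorem isIso_id (a : O) : C.IsIso (C.id a) :=
  ⟨C.id a, by rw [C.dom_id, C.cod_id], by rw [C.dom_id, C.cod_id],
    by rw [C.cc_id (C.cod_id a), C.dom_id], by rw [C.cc_id (C.cod_id a), C.cod_id]⟩

theorem isIso_cc {f g : M} (hf : C.IsIso f) (hg : C.IsIso g) (h : C.cod f = C.dom g) :
    C.IsIso (C.cc f g) := by
  obtain ⟨f', f1, f2, f3, f4⟩ := hf
  obtain ⟨g', g1, g2, g3, g4⟩ := hg
  have hgf : C.cod g' = C.dom f' := by rw [g2, f1, h]
  refine ⟨C.cc g' f', ?_, ?_, ?_, ?_⟩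
  · rw [C.dom_cc, C.cod_cc h, g1]
  · rw [C.dom_cc, C.cod_cc hgf, f2]
  · rw [C.cc_assoc h (by rw [C.dom_cc, g1]), ← C.cc_assoc g1.symm hgf, g3,
      C.id_cc (by rw [f1, h]), f3, C.dom_cc]
  · rw [C.cc_assoc hgf (by rw [C.dom_cc, f2]), ← C.cc_assoc f2 h, f4,
      C.id_cc h, g4, C.cod_cc h]

/-- Opposite category. -/
def op : CatStr O M where
  dom := C.cod
  cod := C.dom
  id := C.id
  comp f g h := C.comp g f h.symm
  dom_id := C.cod_id
  cod_id := C.dom_id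
  dom_comp f g h := C.cod_comp _ _ _
  cod_comp f g h := C.dom_comp _ _ _
  id_comp a f h := C.comp_id _ _ _
  comp_id f a h := C.id_comp _ _ _
  assoc f g k h₁ h₂ := (C.assoc _ _ _ _ _).symm

theorem op_cc {f g : M} (h : C.dom f = C.cod g) : C.op.cc f g = C.cc g f := by
  rw [C.cc_eq h.symm, C.op.cc_eq h]; rfl

/-- Product category. -/
def prod {O' M' : Type u} (D : CatStr O' M') : CatStr (O × O') (M × M') where
  dom f := (C.dom f.1, D.dom f.2)
  cod f := (C.cod f.1, D.cod f.2)
  id a := (C.id a.1, D.id a.2)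
  comp f g h := (C.comp f.1 g.1 (congrArg Prod.fst h), D.comp f.2 g.2 (congrArg Prod.snd h))
  dom_id a := by simp only [C.dom_id, D.dom_id]
  cod_id a := by simp only [C.cod_id, D.cod_id]
  dom_comp f g h := by simp only [C.dom_comp, D.dom_comp]
  cod_comp f g h := by simp only [C.cod_comp, D.cod_comp]
  id_comp a f h := by simp only [C.id_comp, D.id_comp]
  comp_id f a h := by simp only [C.comp_id, D.comp_id]
  assoc f g k h₁ h₂ := Prod.ext (C.assoc _ _ _ _ _) (D.assoc _ _ _ _ _)

theorem prod_cc {O' M' : Type u} (D : CatStr O' M') {f g : M × M'}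
    (h : (C.prod D).cod f = (C.prod D).dom g) :
    (C.prod D).cc f g = (C.cc f.1 g.1, D.cc f.2 g.2) := by
  rw [(C.prod D).cc_eq h, C.cc_eq (congrArg Prod.fst h), D.cc_eq (congrArg Prod.snd h)]; rfl

/-- The maps `o` (on objects) and `m` (on morphisms) form a functor from `C` to `D`. -/
structure IsFun {O M O' M' : Type u} (C : CatStr O M) (D : CatStr O' M')
    (o : O → O') (m : M → M') : Prop where
  dom : ∀ f, D.dom (m f) = o (C.dom f)
  cod : ∀ f, D.cod (m f) = o (C.cod f)
  id : ∀ a, m (C.id a) = D.id (o a)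
  cc : ∀ f g, C.cod f = C.dom g → m (C.cc f g) = D.cc (m f) (m g)

theorem IsFun.of_comp {O M O' M' : Type u} {C : CatStr O M} {D : CatStr O' M'} {o : O → O'}
    {m : M → M'} (dom : ∀ f, D.dom (m f) = o (C.dom f)) (cod : ∀ f, D.cod (m f) = o (C.cod f))
    (id : ∀ a, m (C.id a) = D.id (o a))
    (comp : ∀ f g (h : C.cod f = C.dom g) (h' : D.cod (m f) = D.dom (m g)),
      m (C.comp f g h) = D.comp (m f) (m g) h') : IsFun C D o m where
  dom := dom
  cod := cod
  id := id
  cc f g h := by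
    have h' : D.cod (m f) = D.dom (m g) := by rw [cod, dom, h]
    rw [C.cc_eq h, D.cc_eq h', comp f g h h']

theorem IsFun.map_comp {O M O' M' : Type u} {C : CatStr O M} {D : CatStr O' M'} {o : O → O'}
    {m : M → M'} (k : IsFun C D o m) (f g : M) (h : C.cod f = C.dom g)
    (h' : D.cod (m f) = D.dom (m g)) : m (C.comp f g h) = D.comp (m f) (m g) h' := by
  rw [← C.cc_eq h, ← D.cc_eq h', k.cc f g h]

theorem IsFun.comp {O M O' M' O'' M'' : Type u} {C : CatStr O M} {D : CatStr O' M'}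
    {E : CatStr O'' M''} {o : O → O'} {m : M → M'} {o' : O' → O''} {m' : M' → M''}
    (h' : IsFun D E o' m') (h : IsFun C D o m) : IsFun C E (fun a => o' (o a)) (fun f => m' (m f))
    where
  dom f := by rw [h'.dom, h.dom]
  cod f := by rw [h'.cod, h.cod]
  id a := by rw [h.id, h'.id]
  cc f g e := by rw [h.cc f g e, h'.cc _ _ (by rw [h.cod, h.dom, e])]

theorem IsFun.op {O M O' M' : Type u} {C : CatStr O M} {D : CatStr O' M'} {o : O → O'}
    {m : M → M'} (h : IsFun C D o m) : IsFun C.op D.op o m where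
  dom := h.cod
  cod := h.dom
  id := h.id
  cc f g e := by
    have e' : C.dom f = C.cod g := e
    rw [C.op_cc e', D.op_cc (by rw [h.dom, h.cod, e']), h.cc g f e'.symm]

theorem IsFun.prod {O M O' M' P N P' N' : Type u} {C : CatStr O M} {D : CatStr O' M'}
    {C' : CatStr P N} {D' : CatStr P' N'} {o : O → O'} {m : M → M'} {p : P → P'} {n : N → N'}
    (h : IsFun C D o m) (k : IsFun C' D' p n) :
    IsFun (C.prod C') (D.prod D') (fun a => (o a.1, p a.2)) (fun f => (m f.1, n f.2)) where
  dom f := Prod.ext (h.dom _) (k.dom _)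
  cod f := Prod.ext (h.cod _) (k.cod _)
  id a := Prod.ext (h.id _) (k.id _)
  cc f g e := by
    have e1 := congrArg Prod.fst e
    have e2 := congrArg Prod.snd e
    rw [C.prod_cc C' e, D.prod_cc D' (Prod.ext (by exact (h.cod _).trans ((congrArg o e1).trans
      (h.dom _).symm)) (by exact (k.cod _).trans ((congrArg p e2).trans (k.dom _).symm)))]
    exact Prod.ext (h.cc _ _ e1) (k.cc _ _ e2)

theorem IsFun.pair {O M O' M' P' N' : Type u} {C : CatStr O M} {D : CatStr O' M'}
    {D' : CatStr P' N'} {o : O → O'} {m : M → M'} {p : O → P'} {n : M → N'}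
    (h : IsFun C D o m) (k : IsFun C D' p n) :
    IsFun C (D.prod D') (fun a => (o a, p a)) (fun f => (m f, n f)) where
  dom f := Prod.ext (h.dom _) (k.dom _)
  cod f := Prod.ext (h.cod _) (k.cod _)
  id a := Prod.ext (h.id _) (k.id _)
  cc f g e := by
    rw [D.prod_cc D' (Prod.ext (by exact (h.cod _).trans ((congrArg o e).trans
      (h.dom _).symm)) (by exact (k.cod _).trans ((congrArg p e).trans (k.dom _).symm)))]
    exact Prod.ext (h.cc _ _ e) (k.cc _ _ e)

theorem IsFun.const {O M O' M' : Type u} (C : CatStr O M) (D : CatStr O' M') (a : O') :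
    IsFun C D (fun _ => a) (fun _ => D.id a) where
  dom f := D.dom_id a
  cod f := D.cod_id a
  id _ := rfl
  cc f g e := (D.cc_id (D.cod_id a)).symm

end CatStr

/-! ### Double categories and double functors -/

/-- A (strict, small) double category: objects, horizontal morphisms, vertical morphisms and
squares.  A square `α` has a top `sqv.dom α` and a bottom `sqv.cod α` (horizontal morphisms), and
a left side `sqh.dom α` and a right side `sqh.cod α` (vertical morphisms).  Squares compose
horizontally (`sqh`) along vertical morphisms and vertically (`sqv`) along horizontal morphisms. -/
structure DblCat where
  Obj : Type u
  Hor : Type u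
  Ver : Type u
  Sq : Type u
  hor : CatStr Obj Hor
  ver : CatStr Obj Ver
  sqh : CatStr Ver Sq
  sqv : CatStr Hor Sq
  /-- taking tops is functorial for horizontal composition; likewise bottoms, left and right
  sides, and identity squares -/
  top_fun : CatStr.IsFun sqh hor ver.dom sqv.dom
  bot_fun : CatStr.IsFun sqh hor ver.cod sqv.cod
  lft_fun : CatStr.IsFun sqv ver hor.dom sqh.dom
  rgt_fun : CatStr.IsFun sqv ver hor.cod sqh.cod
  vid_fun : CatStr.IsFun hor sqh ver.id sqv.id
  hid_fun : CatStr.IsFun ver sqv hor.id sqh.id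
  interchange : ∀ α β γ δ : Sq, sqh.cod α = sqh.dom β → sqh.cod γ = sqh.dom δ →
    sqv.cod α = sqv.dom γ → sqv.cod β = sqv.dom δ →
    sqv.cc (sqh.cc α β) (sqh.cc γ δ) = sqh.cc (sqv.cc α γ) (sqv.cc β δ)

namespace DblCat

/-- The top side of a square. -/
abbrev top (A : DblCat.{u}) (α : A.Sq) : A.Hor := A.sqv.dom α
/-- The bottom side of a square. -/
abbrev bot (A : DblCat.{u}) (α : A.Sq) : A.Hor := A.sqv.cod α
/-- The left side of a square. -/
abbrev lft (A : DblCat.{u}) (α : A.Sq) : A.Ver := A.sqh.dom α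
/-- The right side of a square. -/
abbrev rgt (A : DblCat.{u}) (α : A.Sq) : A.Ver := A.sqh.cod α
/-- Horizontal composition of squares: `α` on the left of `β`. -/
noncomputable abbrev hc (A : DblCat.{u}) (α β : A.Sq) : A.Sq := A.sqh.cc α β
/-- Vertical composition of squares: `α` on top of `β`. -/
noncomputable abbrev vc (A : DblCat.{u}) (α β : A.Sq) : A.Sq := A.sqv.cc α β
/-- The vertical identity square `e_f` of a horizontal morphism. -/
abbrev vid (A : DblCat.{u}) (f : A.Hor) : A.Sq := A.sqv.id f
/-- The horizontal identity square `id_u` of a vertical morphism. -/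
abbrev hid (A : DblCat.{u}) (u : A.Ver) : A.Sq := A.sqh.id u

/-- `α` has the top `f`, the bottom `g`, the left side `u` and the right side `v`. -/
structure HasBdry (A : DblCat.{u}) (α : A.Sq) (f g : A.Hor) (u v : A.Ver) : Prop where
  top : A.top α = f
  bot : A.bot α = g
  lft : A.lft α = u
  rgt : A.rgt α = v

/-- The transpose of a double category exchanges the horizontal and the vertical direction. -/
@[reducible] def transpose (A : DblCat.{u}) : DblCat.{u} where
  Obj := A.Obj
  Hor := A.Ver
  Ver := A.Hor
  Sq := A.Sq
  hor := A.ver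
  ver := A.hor
  sqh := A.sqv
  sqv := A.sqh
  top_fun := A.lft_fun
  bot_fun := A.rgt_fun
  lft_fun := A.top_fun
  rgt_fun := A.bot_fun
  vid_fun := A.hid_fun
  hid_fun := A.vid_fun
  interchange α β γ δ h₁ h₂ h₃ h₄ := (A.interchange α γ β δ h₃ h₄ h₁ h₂).symm

/-- The horizontal dual of a double category exchanges the sources and the targets of the
horizontal morphisms, and the left and right sides of squares. -/
def hop (A : DblCat.{u}) : DblCat.{u} where
  Obj := A.Obj
  Hor := A.Hor
  Ver := A.Ver
  Sq := A.Sq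
  hor := A.hor.op
  ver := A.ver
  sqh := A.sqh.op
  sqv := A.sqv
  top_fun := A.top_fun.op
  bot_fun := A.bot_fun.op
  lft_fun := A.rgt_fun
  rgt_fun := A.lft_fun
  vid_fun := A.vid_fun.op
  hid_fun := A.hid_fun
  interchange α β γ δ h₁ h₂ h₃ h₄ := by
    have h₁' : A.sqh.dom α = A.sqh.cod β := h₁
    have h₂' : A.sqh.dom γ = A.sqh.cod δ := h₂
    rw [A.sqh.op_cc h₁', A.sqh.op_cc h₂', A.sqh.op_cc]
    · exact A.interchange _ _ _ _ h₁'.symm h₂'.symm h₄ h₃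
    · rw [A.lft_fun.cc _ _ h₃, A.rgt_fun.cc _ _ h₄, h₁', h₂']

/-- The product of two double categories. -/
def prod (A B : DblCat.{u}) : DblCat.{u} where
  Obj := A.Obj × B.Obj
  Hor := A.Hor × B.Hor
  Ver := A.Ver × B.Ver
  Sq := A.Sq × B.Sq
  hor := A.hor.prod B.hor
  ver := A.ver.prod B.ver
  sqh := A.sqh.prod B.sqh
  sqv := A.sqv.prod B.sqv
  top_fun := A.top_fun.prod B.top_fun
  bot_fun := A.bot_fun.prod B.bot_fun
  lft_fun := A.lft_fun.prod B.lft_fun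
  rgt_fun := A.rgt_fun.prod B.rgt_fun
  vid_fun := A.vid_fun.prod B.vid_fun
  hid_fun := A.hid_fun.prod B.hid_fun
  interchange α β γ δ h₁ h₂ h₃ h₄ := by
    have a1 := congrArg Prod.fst h₁
    have a2 := congrArg Prod.fst h₂
    have a3 := congrArg Prod.fst h₃
    have a4 := congrArg Prod.fst h₄
    have b1 := congrArg Prod.snd h₁
    have b2 := congrArg Prod.snd h₂
    have b3 := congrArg Prod.snd h₃
    have b4 := congrArg Prod.snd h₄
    rw [CatStr.prod_cc _ _ h₁, CatStr.prod_cc _ _ h₂, CatStr.prod_cc _ _ h₃,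
      CatStr.prod_cc _ _ h₄, CatStr.prod_cc, CatStr.prod_cc]
    · exact Prod.ext (A.interchange _ _ _ _ a1 a2 a3 a4) (B.interchange _ _ _ _ b1 b2 b3 b4)
    · refine Prod.ext ?_ ?_
      · exact (A.rgt_fun.cc _ _ a3).trans ((congrArg₂ A.ver.cc a1 a2).trans (A.lft_fun.cc _ _ a4).symm)
      · exact (B.rgt_fun.cc _ _ b3).trans ((congrArg₂ B.ver.cc b1 b2).trans (B.lft_fun.cc _ _ b4).symm)
    · refine Prod.ext ?_ ?_
      · exact (A.bot_fun.cc _ _ a1).trans ((congrArg₂ A.hor.cc a3 a4).trans (A.top_fun.cc _ _ a2).symm)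
      · exact (B.bot_fun.cc _ _ b1).trans ((congrArg₂ B.hor.cc b3 b4).trans (B.top_fun.cc _ _ b2).symm)

end DblCat

/-- A (strict) double functor. -/
@[ext]
structure DblFunctor (A B : DblCat.{u}) where
  obj : A.Obj → B.Obj
  hor : A.Hor → B.Hor
  ver : A.Ver → B.Ver
  sq : A.Sq → B.Sq
  hor_fun : CatStr.IsFun A.hor B.hor obj hor
  ver_fun : CatStr.IsFun A.ver B.ver obj ver
  sqh_fun : CatStr.IsFun A.sqh B.sqh ver sq
  sqv_fun : CatStr.IsFun A.sqv B.sqv hor sq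

namespace DblFunctor

/-- A double functor seen as a double functor between the transposes. -/
@[reducible] def transpose {A B : DblCat.{u}} (F : DblFunctor A B) :
    DblFunctor A.transpose B.transpose where
  obj := F.obj
  hor := F.ver
  ver := F.hor
  sq := F.sq
  hor_fun := F.ver_fun
  ver_fun := F.hor_fun
  sqh_fun := F.sqv_fun
  sqv_fun := F.sqh_fun

/-- The double functor constant at the object `a`. -/
def const (X A : DblCat.{u}) (a : A.Obj) : DblFunctor X A where
  obj _ := a
  hor _ := A.hor.id a
  ver _ := A.ver.id a
  sq _ := A.vid (A.hor.id a)
  hor_fun := CatStr.IsFun.const _ _ _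
  ver_fun := CatStr.IsFun.const _ _ _
  sqh_fun := by
    have h := CatStr.IsFun.const X.sqh A.sqh (A.ver.id a)
    rwa [← A.vid_fun.id] at h
  sqv_fun := CatStr.IsFun.const _ _ _

/-- The double functor into a product with the given components. -/
def pair {X A B : DblCat.{u}} (F : DblFunctor X A) (G : DblFunctor X B) :
    DblFunctor X (A.prod B) where
  obj a := (F.obj a, G.obj a)
  hor a := (F.hor a, G.hor a)
  ver a := (F.ver a, G.ver a)
  sq a := (F.sq a, G.sq a)
  hor_fun := F.hor_fun.pair G.hor_fun
  ver_fun := F.ver_fun.pair G.ver_fun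
  sqh_fun := F.sqh_fun.pair G.sqh_fun
  sqv_fun := F.sqv_fun.pair G.sqv_fun

end DblFunctor

/-- The category of double categories and double functors. -/
instance : Category DblCat.{u} where
  Hom A B := DblFunctor A B
  id A :=
    { obj := fun a => a
      hor := fun f => f
      ver := fun u => u
      sq := fun α => α
      hor_fun := ⟨fun _ => rfl, fun _ => rfl, fun _ => rfl, fun _ _ _ => rfl⟩
      ver_fun := ⟨fun _ => rfl, fun _ => rfl, fun _ => rfl, fun _ _ _ => rfl⟩
      sqh_fun := ⟨fun _ => rfl, fun _ => rfl, fun _ => rfl, fun _ _ _ => rfl⟩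
      sqv_fun := ⟨fun _ => rfl, fun _ => rfl, fun _ => rfl, fun _ _ _ => rfl⟩ }
  comp F G :=
    { obj := fun a => G.obj (F.obj a)
      hor := fun f => G.hor (F.hor f)
      ver := fun u => G.ver (F.ver u)
      sq := fun α => G.sq (F.sq α)
      hor_fun := G.hor_fun.comp F.hor_fun
      ver_fun := G.ver_fun.comp F.ver_fun
      sqh_fun := G.sqh_fun.comp F.sqh_fun
      sqv_fun := G.sqv_fun.comp F.sqv_fun }

/-! ### Pseudo natural transformations and modifications -/

/-- A horizontal pseudo natural transformation from `src` to `tgt`. -/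
@[ext]
structure HorPs (X A : DblCat.{u}) where
  src : DblFunctor X A
  tgt : DblFunctor X A
  /-- the components at objects -/
  app : X.Obj → A.Hor
  /-- the components at vertical morphisms -/
  appVer : X.Ver → A.Sq
  /-- the components at horizontal morphisms -/
  appHor : X.Hor → A.Sq
  dom_app : ∀ a, A.hor.dom (app a) = src.obj a
  cod_app : ∀ a, A.hor.cod (app a) = tgt.obj a
  appVer_bdry : ∀ w, A.HasBdry (appVer w) (app (X.ver.dom w)) (app (X.ver.cod w))
    (src.ver w) (tgt.ver w)
  appHor_bdry : ∀ f, A.HasBdry (appHor f)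
    (A.hor.cc (app (X.hor.dom f)) (tgt.hor f)) (A.hor.cc (src.hor f) (app (X.hor.cod f)))
    (A.ver.id (src.obj (X.hor.dom f))) (A.ver.id (tgt.obj (X.hor.cod f)))
  /-- the components at horizontal morphisms are vertically invertible -/
  appHor_iso : ∀ f, A.sqv.IsIso (appHor f)
  appVer_id : ∀ a, appVer (X.ver.id a) = A.vid (app a)
  appVer_cc : ∀ w z, X.ver.cod w = X.ver.dom z →
    appVer (X.ver.cc w z) = A.vc (appVer w) (appVer z)
  appHor_id : ∀ a, appHor (X.hor.id a) = A.vid (app a)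
  appHor_cc : ∀ f g, X.hor.cod f = X.hor.dom g →
    appHor (X.hor.cc f g) = A.vc (A.hc (appHor f) (A.vid (tgt.hor g)))
      (A.hc (A.vid (src.hor f)) (appHor g))
  naturality : ∀ α : X.Sq,
    A.vc (A.hc (appVer (X.lft α)) (tgt.sq α)) (appHor (X.bot α)) =
      A.vc (appHor (X.top α)) (A.hc (src.sq α) (appVer (X.rgt α)))

/-- A vertical pseudo natural transformation is a horizontal pseudo natural transformation between
the transposed double functors. -/
abbrev VerPs (X A : DblCat.{u}) := HorPs X.transpose A.transpose

/-- The source of a vertical pseudo natural transformation. -/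
abbrev VerPs.dom {X A : DblCat.{u}} (r : VerPs X A) : DblFunctor X A := r.src.transpose

/-- The target of a vertical pseudo natural transformation. -/
abbrev VerPs.cod {X A : DblCat.{u}} (r : VerPs X A) : DblFunctor X A := r.tgt.transpose

namespace DblCat

variable (A : DblCat.{u})

theorem hasBdry_hid {w : A.Ver} {a b : A.Obj} (ha : A.ver.dom w = a) (hb : A.ver.cod w = b) :
    A.HasBdry (A.hid w) (A.hor.id a) (A.hor.id b) w w :=
  ⟨by rw [← ha]; exact A.top_fun.id w, by rw [← hb]; exact A.bot_fun.id w,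
    A.sqh.dom_id w, A.sqh.cod_id w⟩

theorem hasBdry_vid {f : A.Hor} {a b : A.Obj} (ha : A.hor.dom f = a) (hb : A.hor.cod f = b) :
    A.HasBdry (A.vid f) f f (A.ver.id a) (A.ver.id b) :=
  ⟨A.sqv.dom_id f, A.sqv.cod_id f, by rw [← ha]; exact A.lft_fun.id f,
    by rw [← hb]; exact A.rgt_fun.id f⟩

variable {A}

namespace HasBdry

variable {α β γ δ : A.Sq} {f g f' g' k : A.Hor} {p q r p' q' : A.Ver}

theorem hc (h : A.HasBdry α f g p q) (h' : A.HasBdry β f' g' q r) :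
    A.HasBdry (A.hc α β) (A.hor.cc f f') (A.hor.cc g g') p r := by
  have e : A.sqh.cod α = A.sqh.dom β := h.rgt.trans h'.lft.symm
  exact ⟨(A.top_fun.cc _ _ e).trans (congrArg₂ _ h.top h'.top),
    (A.bot_fun.cc _ _ e).trans (congrArg₂ _ h.bot h'.bot),
    (A.sqh.dom_cc _ _).trans h.lft, (A.sqh.cod_cc e).trans h'.rgt⟩

theorem vc (h : A.HasBdry α f g p q) (h' : A.HasBdry β g k p' q') :
    A.HasBdry (A.vc α β) f k (A.ver.cc p p') (A.ver.cc q q') := by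
  have e : A.sqv.cod α = A.sqv.dom β := h.bot.trans h'.top.symm
  exact ⟨(A.sqv.dom_cc _ _).trans h.top, (A.sqv.cod_cc e).trans h'.bot,
    (A.lft_fun.cc _ _ e).trans (congrArg₂ _ h.lft h'.lft),
    (A.rgt_fun.cc _ _ e).trans (congrArg₂ _ h.rgt h'.rgt)⟩

theorem transpose (h : A.HasBdry α f g p q) : A.transpose.HasBdry α p q f g :=
  ⟨h.lft, h.rgt, h.top, h.bot⟩

theorem tl (h : A.HasBdry α f g p q) : A.hor.dom f = A.ver.dom p := by
  rw [← h.top, ← h.lft]; exact A.top_fun.dom α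
theorem tr (h : A.HasBdry α f g p q) : A.hor.cod f = A.ver.dom q := by
  rw [← h.top, ← h.rgt]; exact A.top_fun.cod α
theorem bl (h : A.HasBdry α f g p q) : A.hor.dom g = A.ver.cod p := by
  rw [← h.bot, ← h.lft]; exact A.bot_fun.dom α
theorem br (h : A.HasBdry α f g p q) : A.hor.cod g = A.ver.cod q := by
  rw [← h.bot, ← h.rgt]; exact A.bot_fun.cod α

theorem interchange {l m : A.Hor} {r' : A.Ver}
    (h1 : A.HasBdry α f g p q) (h2 : A.HasBdry β f' g' q r)
    (h3 : A.HasBdry γ g l p' q') (h4 : A.HasBdry δ g' m q' r') :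
    A.vc (A.hc α β) (A.hc γ δ) = A.hc (A.vc α γ) (A.vc β δ) :=
  A.interchange _ _ _ _ (h1.rgt.trans h2.lft.symm) (h3.rgt.trans h4.lft.symm)
    (h1.bot.trans h3.top.symm) (h2.bot.trans h4.top.symm)

theorem hassoc {l m : A.Hor} (h1 : A.HasBdry α f g p q) (h2 : A.HasBdry β f' g' q r)
    (h3 : A.HasBdry γ l m r p') : A.hc (A.hc α β) γ = A.hc α (A.hc β γ) :=
  A.sqh.cc_assoc (h1.rgt.trans h2.lft.symm) (h2.rgt.trans h3.lft.symm)

theorem vassoc {l : A.Hor} {r' : A.Ver} (h1 : A.HasBdry α f g p q) (h2 : A.HasBdry β g k p' q')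
    (h3 : A.HasBdry γ k l r r') : A.vc (A.vc α β) γ = A.vc α (A.vc β γ) :=
  A.sqv.cc_assoc (h1.bot.trans h2.top.symm) (h2.bot.trans h3.top.symm)

theorem vid_vc (h : A.HasBdry α f g p q) : A.vc (A.vid f) α = α := A.sqv.id_cc h.top.symm
theorem vc_vid (h : A.HasBdry α f g p q) : A.vc α (A.vid g) = α := A.sqv.cc_id h.bot
theorem hid_hc (h : A.HasBdry α f g p q) : A.hc (A.hid p) α = α := A.sqh.id_cc h.lft.symm
theorem hc_hid (h : A.HasBdry α f g p q) : A.hc α (A.hid q) = α := A.sqh.cc_id h.rgt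

theorem vid_hc_vid {f g : A.Hor} (e : A.hor.cod f = A.hor.dom g) :
    A.hc (A.vid f) (A.vid g) = A.vid (A.hor.cc f g) := (A.vid_fun.cc _ _ e).symm
theorem hid_vc_hid {p q : A.Ver} (e : A.ver.cod p = A.ver.dom q) :
    A.vc (A.hid p) (A.hid q) = A.hid (A.ver.cc p q) := (A.hid_fun.cc _ _ e).symm

theorem cast (h : A.HasBdry α f g p q) (e1 : f = f') (e2 : g = g') (e3 : p = p') (e4 : q = q') :
    A.HasBdry α f' g' p' q' := by subst e1 e2 e3 e4; exact h

/-- A horizontal composite of vertically invertible squares is vertically invertible. -/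
theorem isIso_hc {a b c : A.Obj} (h : A.HasBdry α f g (A.ver.id a) (A.ver.id b))
    (h' : A.HasBdry β f' g' (A.ver.id b) (A.ver.id c))
    (i : A.sqv.IsIso α) (i' : A.sqv.IsIso β) : A.sqv.IsIso (A.hc α β) := by
  obtain ⟨α', a1, a2, a3, a4⟩ := i
  obtain ⟨β', b1, b2, b3, b4⟩ := i'
  have side : ∀ {x y : A.Sq} {s t : A.Hor} {m n : A.Obj},
      A.HasBdry x s t (A.ver.id m) (A.ver.id n) → A.top y = t → A.bot y = s →
      A.vc x y = A.vid s → A.HasBdry y t s (A.ver.id m) (A.ver.id n) := by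
    intro x y s t m n hx y1 y2 e
    have hs : A.hor.dom s = m := by rw [hx.tl, A.ver.dom_id]
    have hs' : A.hor.cod s = n := by rw [hx.tr, A.ver.dom_id]
    have ht : A.hor.dom t = m := by rw [hx.bl, A.ver.cod_id]
    have ht' : A.hor.cod t = n := by rw [hx.br, A.ver.cod_id]
    have hy : A.HasBdry y t s (A.lft y) (A.rgt y) := ⟨y1, y2, rfl, rfl⟩
    have hv := hasBdry_vid A hs hs'
    have hxy := hx.vc hy
    refine hy.cast rfl rfl ?_ ?_
    · have := hxy.lft.symm.trans ((congrArg A.lft e).trans hv.lft)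
      rwa [A.ver.id_cc (ht.symm.trans hy.tl)] at this
    · have := hxy.rgt.symm.trans ((congrArg A.rgt e).trans hv.rgt)
      rwa [A.ver.id_cc (ht'.symm.trans hy.tr)] at this
  have hα' := side h (a1.trans h.bot) (a2.trans h.top) (a3.trans (congrArg _ h.top))
  have hβ' := side h' (b1.trans h'.bot) (b2.trans h'.top) (b3.trans (congrArg _ h'.top))
  have hh := h.hc h'
  have hh' := hα'.hc hβ'
  have e1 : A.hor.cod f = A.hor.dom f' := by rw [h.tr, h'.tl]
  have e2 : A.hor.cod g = A.hor.dom g' := by rw [h.br, h'.bl]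
  refine ⟨A.hc α' β', hh'.top.trans hh.bot.symm, hh'.bot.trans hh.top.symm, ?_, ?_⟩
  · refine (h.interchange h' hα' hβ').trans ?_
    have : A.vc α α' = A.vid f := a3.trans (congrArg _ h.top)
    rw [this]
    have : A.vc β β' = A.vid f' := b3.trans (congrArg _ h'.top)
    rw [this]
    exact (A.vid_fun.cc _ _ e1).symm.trans (congrArg _ hh.top.symm)
  · refine (hα'.interchange hβ' h h').trans ?_
    have : A.vc α' α = A.vid g := a4.trans (congrArg _ h.bot)
    rw [this]
    have : A.vc β' β = A.vid g' := b4.trans (congrArg _ h'.bot)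
    rw [this]
    exact (A.vid_fun.cc _ _ e2).symm.trans (congrArg _ hh.bot.symm)

end HasBdry

/-- Exchange of two squares placed diagonally. -/
theorem diag_exchange {α β : A.Sq} {f g f' g' : A.Hor} {a b c : A.Obj}
    (h : A.HasBdry α f g (A.ver.id a) (A.ver.id b))
    (h' : A.HasBdry β f' g' (A.ver.id b) (A.ver.id c)) :
    A.vc (A.hc (A.vid f) β) (A.hc α (A.vid g')) = A.hc α β ∧
      A.vc (A.hc α (A.vid f')) (A.hc (A.vid g) β) = A.hc α β := by
  have f1 := hasBdry_vid A (h.tl.trans (A.ver.dom_id a)) (h.tr.trans (A.ver.dom_id b))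
  have f2 := hasBdry_vid A (h.bl.trans (A.ver.cod_id a)) (h.br.trans (A.ver.cod_id b))
  have f3 := hasBdry_vid A (h'.tl.trans (A.ver.dom_id b)) (h'.tr.trans (A.ver.dom_id c))
  have f4 := hasBdry_vid A (h'.bl.trans (A.ver.cod_id b)) (h'.br.trans (A.ver.cod_id c))
  constructor
  · rw [f1.interchange h' h f4, h.vid_vc, h'.vc_vid]
  · rw [h.interchange f3 f2 h', h.vc_vid, h'.vid_vc]

theorem ids_of {α : A.Sq} {f g : A.Hor} {a b : A.Obj}
    (h : A.HasBdry α f g (A.ver.id a) (A.ver.id b)) :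
    (A.hor.dom f = a ∧ A.hor.cod f = b) ∧ A.hor.dom g = a ∧ A.hor.cod g = b :=
  ⟨⟨h.tl.trans (A.ver.dom_id a), h.tr.trans (A.ver.dom_id b)⟩,
    h.bl.trans (A.ver.cod_id a), h.br.trans (A.ver.cod_id b)⟩

/-- The pasting identity for the composite of two horizontal pseudo natural transformations at a
composite of horizontal morphisms. -/
theorem paste_cc {K₁ H₁ K₂ H₂ : A.Sq} {hA kA Hf Gf kB Ff hB Hg Gg kC Fg hC : A.Hor}
    {F0 F1 G0 G1 G2 H1 H2 : A.Obj}
    (dhA : A.hor.dom hA = F0) (chA : A.hor.cod hA = G0)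
    (dhB : A.hor.dom hB = F1) (chB : A.hor.cod hB = G1)
    (dkB : A.hor.dom kB = G1) (ckB : A.hor.cod kB = H1)
    (dkC : A.hor.dom kC = G2) (ckC : A.hor.cod kC = H2)
    (dFf : A.hor.dom Ff = F0) (cFf : A.hor.cod Ff = F1)
    (dGf : A.hor.dom Gf = G0) (cGf : A.hor.cod Gf = G1)
    (dGg : A.hor.dom Gg = G1) (cGg : A.hor.cod Gg = G2)
    (dHg : A.hor.dom Hg = H1) (cHg : A.hor.cod Hg = H2)
    (bK₁ : A.HasBdry K₁ (A.hor.cc kA Hf) (A.hor.cc Gf kB) (A.ver.id G0) (A.ver.id H1))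
    (bH₁ : A.HasBdry H₁ (A.hor.cc hA Gf) (A.hor.cc Ff hB) (A.ver.id F0) (A.ver.id G1))
    (bK₂ : A.HasBdry K₂ (A.hor.cc kB Hg) (A.hor.cc Gg kC) (A.ver.id G1) (A.ver.id H2))
    (bH₂ : A.HasBdry H₂ (A.hor.cc hB Gg) (A.hor.cc Fg hC) (A.ver.id F1) (A.ver.id G2)) :
    A.vc (A.hc (A.vid hA) (A.vc (A.hc K₁ (A.vid Hg)) (A.hc (A.vid Gf) K₂)))
        (A.hc (A.vc (A.hc H₁ (A.vid Gg)) (A.hc (A.vid Ff) H₂)) (A.vid kC)) =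
      A.vc (A.hc (A.vc (A.hc (A.vid hA) K₁) (A.hc H₁ (A.vid kB))) (A.vid Hg))
        (A.hc (A.vid Ff) (A.vc (A.hc (A.vid hB) K₂) (A.hc H₂ (A.vid kC)))) := by
  have vhA := hasBdry_vid A dhA chA
  have vhB := hasBdry_vid A dhB chB
  have vkB := hasBdry_vid A dkB ckB
  have vkC := hasBdry_vid A dkC ckC
  have vFf := hasBdry_vid A dFf cFf
  have vGf := hasBdry_vid A dGf cGf
  have vGg := hasBdry_vid A dGg cGg
  have vHg := hasBdry_vid A dHg cHg
  have a1 : A.hor.cc (A.hor.cc Gf kB) Hg = A.hor.cc Gf (A.hor.cc kB Hg) :=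
    A.hor.cc_assoc (cGf.trans dkB.symm) (ckB.trans dHg.symm)
  have a2 : A.hor.cc (A.hor.cc Ff hB) Gg = A.hor.cc Ff (A.hor.cc hB Gg) :=
    A.hor.cc_assoc (cFf.trans dhB.symm) (chB.trans dGg.symm)
  have a3 : A.hor.cc (A.hor.cc hA Gf) kB = A.hor.cc hA (A.hor.cc Gf kB) :=
    A.hor.cc_assoc (chA.trans dGf.symm) (cGf.trans dkB.symm)
  have a4 : A.hor.cc (A.hor.cc hB Gg) kC = A.hor.cc hB (A.hor.cc Gg kC) :=
    A.hor.cc_assoc (chB.trans dGg.symm) (cGg.trans dkC.symm)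
  have a5 : A.hor.cc (A.hor.cc hA Gf) (A.hor.cc kB Hg) =
      A.hor.cc hA (A.hor.cc Gf (A.hor.cc kB Hg)) :=
    A.hor.cc_assoc (chA.trans dGf.symm) (by rw [A.hor.dom_cc, cGf, dkB])
  have a6 : A.hor.cc (A.hor.cc Ff hB) (A.hor.cc Gg kC) =
      A.hor.cc (A.hor.cc Ff (A.hor.cc hB Gg)) kC := by
    rw [← a2, A.hor.cc_assoc (by rw [A.hor.cod_cc (cFf.trans dhB.symm), chB, dGg])
      (cGg.trans dkC.symm)]
  -- the four layers
  have P := vhA.hc (bK₁.hc vHg)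
  have Q1 := vhA.hc (vGf.hc bK₂)
  have Q2 := (bH₁.hc vGg).hc vkC
  have R := (vFf.hc bH₂).hc vkC
  have Q := bH₁.hc bK₂
  have e1 : A.hc (A.vid hA) (A.vc (A.hc K₁ (A.vid Hg)) (A.hc (A.vid Gf) K₂)) =
      A.vc (A.hc (A.vid hA) (A.hc K₁ (A.vid Hg))) (A.hc (A.vid hA) (A.hc (A.vid Gf) K₂)) := by
    refine Eq.trans ?_ (vhA.interchange (bK₁.hc vHg) vhA ((vGf.hc bK₂).cast a1.symm rfl rfl rfl)).symm
    rw [vhA.vid_vc]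
  have e2 : A.hc (A.vc (A.hc H₁ (A.vid Gg)) (A.hc (A.vid Ff) H₂)) (A.vid kC) =
      A.vc (A.hc (A.hc H₁ (A.vid Gg)) (A.vid kC)) (A.hc (A.hc (A.vid Ff) H₂) (A.vid kC)) := by
    refine Eq.trans ?_ ((bH₁.hc vGg).interchange vkC ((vFf.hc bH₂).cast a2.symm rfl rfl rfl) vkC).symm
    rw [vkC.vid_vc]
  have e3 : A.hc (A.vc (A.hc (A.vid hA) K₁) (A.hc H₁ (A.vid kB))) (A.vid Hg) =
      A.vc (A.hc (A.hc (A.vid hA) K₁) (A.vid Hg)) (A.hc (A.hc H₁ (A.vid kB)) (A.vid Hg)) := by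
    refine Eq.trans ?_ ((vhA.hc bK₁).interchange vHg ((bH₁.hc vkB).cast a3 rfl rfl rfl) vHg).symm
    rw [vHg.vid_vc]
  have e4 : A.hc (A.vid Ff) (A.vc (A.hc (A.vid hB) K₂) (A.hc H₂ (A.vid kC))) =
      A.vc (A.hc (A.vid Ff) (A.hc (A.vid hB) K₂)) (A.hc (A.vid Ff) (A.hc H₂ (A.vid kC))) := by
    refine Eq.trans ?_ (vFf.interchange (vhB.hc bK₂) vFf ((bH₂.hc vkC).cast a4 rfl rfl rfl)).symm
    rw [vFf.vid_vc]
  have q1 : A.hc (A.vid hA) (A.hc (A.vid Gf) K₂) = A.hc (A.vid (A.hor.cc hA Gf)) K₂ := by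
    rw [← HasBdry.vid_hc_vid (chA.trans dGf.symm), vhA.hassoc vGf bK₂]
  have q2 : A.hc (A.hc H₁ (A.vid Gg)) (A.vid kC) = A.hc H₁ (A.vid (A.hor.cc Gg kC)) := by
    rw [← HasBdry.vid_hc_vid (cGg.trans dkC.symm), bH₁.hassoc vGg vkC]
  have s1 : A.hc (A.hc H₁ (A.vid kB)) (A.vid Hg) = A.hc H₁ (A.vid (A.hor.cc kB Hg)) := by
    rw [← HasBdry.vid_hc_vid (ckB.trans dHg.symm), bH₁.hassoc vkB vHg]
  have s2 : A.hc (A.vid Ff) (A.hc (A.vid hB) K₂) = A.hc (A.vid (A.hor.cc Ff hB)) K₂ := by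
    rw [← HasBdry.vid_hc_vid (cFf.trans dhB.symm), vFf.hassoc vhB bK₂]
  have d := diag_exchange bH₁ bK₂
  have r : A.hc (A.vid Ff) (A.hc H₂ (A.vid kC)) = A.hc (A.hc (A.vid Ff) H₂) (A.vid kC) :=
    (vFf.hassoc bH₂ vkC).symm
  rw [e1, e2, e3, e4, r, vhA.hassoc bK₁ vHg]
  have four : ∀ {p a b c : A.Sq}, A.bot p = A.top a → A.bot a = A.top b → A.bot b = A.top c →
      A.vc (A.vc p a) (A.vc b c) = A.vc p (A.vc (A.vc a b) c) := by
    intro p a b c h1 h2 h3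
    exact (A.sqv.cc_assoc h1 (h2.trans (A.sqv.dom_cc b c).symm)).trans
      (congrArg _ (A.sqv.cc_assoc h2 h3).symm)
  have S1 := (bH₁.hc vkB).hc vHg
  have S2 := vFf.hc (vhB.hc bK₂)
  have vt := (ids_of bK₂).1
  have vb := (ids_of bK₂).2
  have X1 : A.HasBdry (A.hc H₁ (A.vid (A.hor.cc kB Hg))) _ _ _ _ :=
    bH₁.hc (hasBdry_vid A vt.1 vt.2)
  have X2 : A.HasBdry (A.hc (A.vid (A.hor.cc Ff hB)) K₂) _ _ _ _ :=
    (hasBdry_vid A (ids_of bH₁).2.1 (ids_of bH₁).2.2).hc bK₂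
  have X3 : A.HasBdry (A.hc (A.vid (A.hor.cc hA Gf)) K₂) _ _ _ _ :=
    (hasBdry_vid A (ids_of bH₁).1.1 (ids_of bH₁).1.2).hc bK₂
  have X4 : A.HasBdry (A.hc H₁ (A.vid (A.hor.cc Gg kC))) _ _ _ _ :=
    bH₁.hc (hasBdry_vid A vb.1 vb.2)
  have a7 : A.hor.cc hA (A.hor.cc (A.hor.cc Gf kB) Hg) =
      A.hor.cc (A.hor.cc hA Gf) (A.hor.cc kB Hg) := by rw [a1, a5]
  rw [q1, q2, s1, s2,
    four (P.bot.trans (a7.trans X3.top.symm)) (X3.bot.trans X4.top.symm)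
      (X4.bot.trans (a6.trans R.top.symm)),
    four (P.bot.trans (a7.trans X1.top.symm)) (X1.bot.trans X2.top.symm)
      (X2.bot.trans (a6.trans R.top.symm)), d.1, d.2]

/-- The pasting identity behind the naturality of the composite of two horizontal pseudo natural
transformations, and behind the horizontal composition of modifications. -/
theorem paste_nat {hu ku Fα Gα Hα hv kv Kf Kg Lf Lg : A.Sq}
    {hA hA' kA kA' hB hB' kB kB' Ff Fg Gf Gg Hf Hg : A.Hor} {Fu Gu Hu Fv Gv Hv : A.Ver}
    {F0 F0' F1 G0 G0' G1 G1' H1 H1' : A.Obj}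
    (dhA : A.hor.dom hA = F0) (chA : A.hor.cod hA = G0)
    (dhA' : A.hor.dom hA' = F0') (chA' : A.hor.cod hA' = G0')
    (dkB : A.hor.dom kB = G1) (ckB : A.hor.cod kB = H1)
    (dkB' : A.hor.dom kB' = G1') (ckB' : A.hor.cod kB' = H1')
    (chB : A.hor.cod hB = G1) (cGg : A.hor.cod Gg = G1') (dGg : A.hor.dom Gg = G0')
    (cGf : A.hor.cod Gf = G1) (dGf : A.hor.dom Gf = G0)
    (dhB : A.hor.dom hB = F1) (cFf : A.hor.cod Ff = F1)
    (bhu : A.HasBdry hu hA hA' Fu Gu) (bku : A.HasBdry ku kA kA' Gu Hu)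
    (bFα : A.HasBdry Fα Ff Fg Fu Fv) (bGα : A.HasBdry Gα Gf Gg Gu Gv)
    (bHα : A.HasBdry Hα Hf Hg Hu Hv)
    (bhv : A.HasBdry hv hB hB' Fv Gv) (bkv : A.HasBdry kv kB kB' Gv Hv)
    (bLf : A.HasBdry Lf (A.hor.cc hA Gf) (A.hor.cc Ff hB) (A.ver.id F0) (A.ver.id G1))
    (bLg : A.HasBdry Lg (A.hor.cc hA' Gg) (A.hor.cc Fg hB') (A.ver.id F0') (A.ver.id G1'))
    (bKf : A.HasBdry Kf (A.hor.cc kA Hf) (A.hor.cc Gf kB) (A.ver.id G0) (A.ver.id H1))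
    (bKg : A.HasBdry Kg (A.hor.cc kA' Hg) (A.hor.cc Gg kB') (A.ver.id G0') (A.ver.id H1'))
    (N1 : A.vc (A.hc hu Gα) Lg = A.vc Lf (A.hc Fα hv))
    (N2 : A.vc (A.hc ku Hα) Kg = A.vc Kf (A.hc Gα kv)) :
    A.vc (A.hc (A.hc hu ku) Hα) (A.vc (A.hc (A.vid hA') Kg) (A.hc Lg (A.vid kB'))) =
      A.vc (A.vc (A.hc (A.vid hA) Kf) (A.hc Lf (A.vid kB))) (A.hc Fα (A.hc hv kv)) := by
  have vhA := hasBdry_vid A dhA chA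
  have vhA' := hasBdry_vid A dhA' chA'
  have vkB := hasBdry_vid A dkB ckB
  have vkB' := hasBdry_vid A dkB' ckB'
  have a1 : A.hor.cc hA' (A.hor.cc Gg kB') = A.hor.cc (A.hor.cc hA' Gg) kB' :=
    (A.hor.cc_assoc (chA'.trans dGg.symm) (cGg.trans dkB'.symm)).symm
  have a2 : A.hor.cc hA (A.hor.cc Gf kB) = A.hor.cc (A.hor.cc hA Gf) kB :=
    (A.hor.cc_assoc (chA.trans dGf.symm) (cGf.trans dkB.symm)).symm
  have a3 : A.hor.cc (A.hor.cc Ff hB) kB = A.hor.cc Ff (A.hor.cc hB kB) :=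
    A.hor.cc_assoc (cFf.trans dhB.symm) (chB.trans dkB.symm)
  have L1 := bhu.hc (bku.hc bHα)
  have L2 := vhA'.hc bKg
  have L3 := (bLg.hc vkB').cast a1.symm rfl rfl rfl
  have R1 := (vhA.hc bKf).cast rfl a2 rfl rfl
  have R2 := bLf.hc vkB
  have R3 := (bFα.hc (bhv.hc bkv)).cast a3.symm rfl rfl rfl
  have M := bhu.hc (bGα.hc bkv)
  rw [bhu.hassoc bku bHα, ← L1.vassoc L2 L3, bhu.interchange (bku.hc bHα) vhA' bKg, bhu.vc_vid, N2]
  have s1 : A.hc hu (A.vc Kf (A.hc Gα kv)) =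
      A.vc (A.hc (A.vid hA) Kf) (A.hc hu (A.hc Gα kv)) := by
    rw [vhA.interchange bKf bhu (bGα.hc bkv), bhu.vid_vc]
  rw [s1, ← bhu.hassoc bGα bkv]
  have M' := ((bhu.hc bGα).hc bkv)
  rw [R1.vassoc M' (bLg.hc vkB'), (bhu.hc bGα).interchange bkv bLg vkB', bkv.vc_vid, N1]
  have s2 : A.hc (A.vc Lf (A.hc Fα hv)) kv = A.vc (A.hc Lf (A.vid kB)) (A.hc (A.hc Fα hv) kv) := by
    rw [bLf.interchange vkB (bFα.hc bhv) bkv, bkv.vid_vc]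
  rw [s2, bFα.hassoc bhv bkv, R1.vassoc R2 R3]

end DblCat

namespace HorPs

variable {X A : DblCat.{u}}

theorem src_vid_bdry (F : DblFunctor X A) (f : X.Hor) :
    A.HasBdry (A.vid (F.hor f)) (F.hor f) (F.hor f) (A.ver.id (F.obj (X.hor.dom f)))
      (A.ver.id (F.obj (X.hor.cod f))) :=
  DblCat.hasBdry_vid A (F.hor_fun.dom f) (F.hor_fun.cod f)

theorem src_hid_bdry (F : DblFunctor X A) (w : X.Ver) :
    A.HasBdry (A.hid (F.ver w)) (A.hor.id (F.obj (X.ver.dom w))) (A.hor.id (F.obj (X.ver.cod w)))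
      (F.ver w) (F.ver w) :=
  DblCat.hasBdry_hid A (F.ver_fun.dom w) (F.ver_fun.cod w)

theorem sq_bdry (F : DblFunctor X A) (α : X.Sq) :
    A.HasBdry (F.sq α) (F.hor (X.top α)) (F.hor (X.bot α)) (F.ver (X.lft α)) (F.ver (X.rgt α)) :=
  ⟨F.sqv_fun.dom α, F.sqv_fun.cod α, F.sqh_fun.dom α, F.sqh_fun.cod α⟩

theorem app_vid_bdry (h : HorPs X A) (a : X.Obj) :
    A.HasBdry (A.vid (h.app a)) (h.app a) (h.app a) (A.ver.id (h.src.obj a))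
      (A.ver.id (h.tgt.obj a)) :=
  DblCat.hasBdry_vid A (h.dom_app a) (h.cod_app a)

/-- The identity horizontal transformation. -/
def id (F : DblFunctor X A) : HorPs X A where
  src := F
  tgt := F
  app a := A.hor.id (F.obj a)
  appVer w := A.hid (F.ver w)
  appHor f := A.vid (F.hor f)
  dom_app a := A.hor.dom_id _
  cod_app a := A.hor.cod_id _
  appVer_bdry w := src_hid_bdry F w
  appHor_bdry f := (src_vid_bdry F f).cast (A.hor.id_cc (F.hor_fun.dom f).symm).symm
    (A.hor.cc_id (F.hor_fun.cod f)).symm rfl rfl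
  appHor_iso f := A.sqv.isIso_id _
  appVer_id a := (congrArg _ (F.ver_fun.id a)).trans (A.vid_fun.id _).symm
  appVer_cc w z h := (congrArg _ (F.ver_fun.cc w z h)).trans
    (A.hid_fun.cc _ _ (by rw [F.ver_fun.cod, F.ver_fun.dom, h]))
  appHor_id a := congrArg _ (F.hor_fun.id a)
  appHor_cc f g h := by
    have e : A.hor.cod (F.hor f) = A.hor.dom (F.hor g) := by rw [F.hor_fun.cod, F.hor_fun.dom, h]
    rw [F.hor_fun.cc f g h, DblCat.HasBdry.vid_hc_vid e]
    exact (A.sqv.id_cc (A.sqv.dom_id _).symm).symm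
  naturality α := by
    have s := sq_bdry F α
    rw [s.hid_hc, s.hc_hid, s.vc_vid, s.vid_vc]

/-- Composition of horizontal pseudo natural transformations. -/
noncomputable def comp (h k : HorPs X A) (e : h.tgt = k.src) : HorPs X A where
  src := h.src
  tgt := k.tgt
  app a := A.hor.cc (h.app a) (k.app a)
  appVer w := A.hc (h.appVer w) (k.appVer w)
  appHor f := A.vc (A.hc (A.vid (h.app (X.hor.dom f))) (k.appHor f))
    (A.hc (h.appHor f) (A.vid (k.app (X.hor.cod f))))
  dom_app a := by rw [A.hor.dom_cc, h.dom_app]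
  cod_app a := by rw [A.hor.cod_cc (by rw [h.cod_app, k.dom_app, e]), k.cod_app]
  appVer_bdry w := (h.appVer_bdry w).hc (e ▸ k.appVer_bdry w)
  appHor_bdry f := by
    have b1 := (h.app_vid_bdry (X.hor.dom f)).hc ((k.appHor_bdry f).cast rfl rfl (by rw [e]) rfl)
    have b2 := (h.appHor_bdry f).hc ((k.app_vid_bdry (X.hor.cod f)).cast rfl rfl (by rw [e]) rfl)
    have c1 : A.hor.cod (h.app (X.hor.dom f)) = A.hor.dom (k.app (X.hor.dom f)) := by
      rw [h.cod_app, e, k.dom_app]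
    have c2 := (k.cod_app (X.hor.dom f)).trans (k.tgt.hor_fun.dom f).symm
    have c3 := (h.src.hor_fun.cod f).trans (h.dom_app (X.hor.cod f)).symm
    have c4 : A.hor.cod (h.app (X.hor.cod f)) = A.hor.dom (k.app (X.hor.cod f)) := by
      rw [h.cod_app, e, k.dom_app]
    have c5 : A.hor.cod (h.app (X.hor.dom f)) = A.hor.dom (k.src.hor f) := by
      rw [h.cod_app, k.src.hor_fun.dom, e]
    have c6 : A.hor.cod (k.src.hor f) = A.hor.dom (k.app (X.hor.cod f)) := by
      rw [k.dom_app, k.src.hor_fun.cod]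
    refine (b1.vc (b2.cast ?_ rfl rfl rfl)).cast ?_ ?_ ?_ ?_
    · rw [e, A.hor.cc_assoc c5 c6]
    · exact (A.hor.cc_assoc c1 c2).symm
    · exact A.hor.cc_assoc c3 c4
    · exact A.ver.id_cc (A.ver.dom_id _).symm
    · exact A.ver.id_cc (A.ver.dom_id _).symm
  appHor_iso f := by
    have b1 := (h.app_vid_bdry (X.hor.dom f))
    have b1' := k.appHor_bdry f
    rw [← e] at b1'
    have b2 := (h.appHor_bdry f)
    have b2' := k.app_vid_bdry (X.hor.cod f)
    rw [← e] at b2'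
    refine A.sqv.isIso_cc (b1.isIso_hc b1' (A.sqv.isIso_id _) (k.appHor_iso f))
      (b2.isIso_hc b2' (h.appHor_iso f) (A.sqv.isIso_id _)) ?_
    refine (b1.hc b1').bot.trans (Eq.trans ?_ (b2.hc b2').top.symm)
    rw [A.hor.cc_assoc (by rw [h.cod_app, h.tgt.hor_fun.dom]) (by rw [h.tgt.hor_fun.cod, k.dom_app, e])]
  appVer_id a := by
    rw [h.appVer_id, k.appVer_id]
    exact DblCat.HasBdry.vid_hc_vid (by rw [h.cod_app, k.dom_app, e])
  appVer_cc w z hz := by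
    rw [h.appVer_cc w z hz, k.appVer_cc w z hz]
    have z1 := h.appVer_bdry z
    have z2 := k.appVer_bdry z
    rw [← hz] at z1
    rw [← hz, ← e] at z2
    have w2 := k.appVer_bdry w
    rw [← e] at w2
    exact ((h.appVer_bdry w).interchange w2 z1 z2).symm
  appHor_id a := by
    have c : A.hor.cod (h.app a) = A.hor.dom (k.app a) := by rw [h.cod_app, k.dom_app, e]
    rw [h.appHor_id, k.appHor_id, X.hor.dom_id, X.hor.cod_id, DblCat.HasBdry.vid_hc_vid c]
    exact A.sqv.id_cc (A.sqv.dom_id _).symm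
  appHor_cc f g hg := by
    have hg0 := h.src.hor_fun.cc f g hg
    have hg1 := X.hor.dom_cc f g
    have hg2 := X.hor.cod_cc hg
    have bH₂ := h.appHor_bdry g
    have bK₂ := k.appHor_bdry g
    rw [← hg] at bH₂ bK₂
    rw [← e] at bK₂
    have bK₁ := k.appHor_bdry f
    rw [← e] at bK₁
    rw [h.appHor_cc f g hg, k.appHor_cc f g hg, hg1, hg2, ← e, ← hg]
    refine DblCat.paste_cc (h.dom_app _) (h.cod_app _) (h.dom_app _) (h.cod_app _)
      (k.dom_app _ |>.trans (by rw [e])) (k.cod_app _) (k.dom_app _ |>.trans (by rw [e]))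
      (k.cod_app _) (h.src.hor_fun.dom f) (h.src.hor_fun.cod f) (h.tgt.hor_fun.dom f)
      (h.tgt.hor_fun.cod f) (h.tgt.hor_fun.dom g |>.trans (by rw [hg])) (h.tgt.hor_fun.cod g)
      (k.tgt.hor_fun.dom g |>.trans (by rw [hg])) (k.tgt.hor_fun.cod g) bK₁ (h.appHor_bdry f)
      bK₂ bH₂
  naturality α := by
    have t1 : X.hor.dom (X.top α) = X.ver.dom (X.lft α) := X.top_fun.dom α
    have t2 : X.hor.cod (X.top α) = X.ver.dom (X.rgt α) := X.top_fun.cod α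
    have t3 : X.hor.dom (X.bot α) = X.ver.cod (X.lft α) := X.bot_fun.dom α
    have t4 : X.hor.cod (X.bot α) = X.ver.cod (X.rgt α) := X.bot_fun.cod α
    have bKf := k.appHor_bdry (X.top α)
    have bKg := k.appHor_bdry (X.bot α)
    have bLf := h.appHor_bdry (X.top α)
    have bLg := h.appHor_bdry (X.bot α)
    have bku := k.appVer_bdry (X.lft α)
    have bkv := k.appVer_bdry (X.rgt α)
    have N2 := k.naturality α
    rw [← e] at bKf bKg bku bkv N2
    rw [t1, t2] at bLf bKf
    rw [t3, t4] at bLg bKg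
    rw [t1, t2, t3, t4]
    exact DblCat.paste_nat (h.dom_app _) (h.cod_app _) (h.dom_app _) (h.cod_app _)
      (k.dom_app _ |>.trans (by rw [e])) (k.cod_app _) (k.dom_app _ |>.trans (by rw [e]))
      (k.cod_app _) (h.cod_app _) (h.tgt.hor_fun.cod _ |>.trans (by rw [t4]))
      (h.tgt.hor_fun.dom _ |>.trans (by rw [t3]))
      (h.tgt.hor_fun.cod _ |>.trans (by rw [t2]))
      (h.tgt.hor_fun.dom _ |>.trans (by rw [t1]))
      (h.dom_app _) (h.src.hor_fun.cod _ |>.trans (by rw [t2]))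
      (h.appVer_bdry _) bku (sq_bdry h.src α) (sq_bdry h.tgt α) (sq_bdry k.tgt α)
      (h.appVer_bdry _) bkv bLf bLg bKf bKg (h.naturality α) N2

end HorPs

namespace HorPs

variable {X A : DblCat.{u}}

theorem id_comp (F : DblFunctor X A) (h : HorPs X A) (e : (HorPs.id F).tgt = h.src) :
    comp (HorPs.id F) h e = h := by
  have e' : F = h.src := e
  subst e'
  refine HorPs.ext rfl rfl ?_ ?_ ?_
  · funext a
    exact A.hor.id_cc (h.dom_app a).symm
  · funext w
    exact (h.appVer_bdry w).hid_hc
  · funext f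
    have b := h.appHor_bdry f
    have v := h.app_vid_bdry (X.hor.cod f)
    have s := src_vid_bdry h.src f
    have i : A.vid (A.hor.id (h.src.obj (X.hor.dom f))) =
      A.hid (A.ver.id (h.src.obj (X.hor.dom f))) := A.vid_fun.id _
    change A.vc (A.hc (A.vid (A.hor.id (h.src.obj (X.hor.dom f)))) (h.appHor f))
      (A.hc (A.vid (h.src.hor f)) (A.vid (h.app (X.hor.cod f)))) = h.appHor f
    rw [i, b.hid_hc, DblCat.HasBdry.vid_hc_vid (by rw [h.src.hor_fun.cod, h.dom_app]), b.vc_vid]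

theorem comp_id (F : DblFunctor X A) (h : HorPs X A) (e : h.tgt = (HorPs.id F).src) :
    comp h (HorPs.id F) e = h := by
  have e' : h.tgt = F := e
  subst e'
  refine HorPs.ext rfl rfl ?_ ?_ ?_
  · funext a
    exact A.hor.cc_id (h.cod_app a)
  · funext w
    exact (h.appVer_bdry w).hc_hid
  · funext f
    have b := h.appHor_bdry f
    have i : A.vid (A.hor.id (h.tgt.obj (X.hor.cod f))) =
      A.hid (A.ver.id (h.tgt.obj (X.hor.cod f))) := A.vid_fun.id _
    change A.vc (A.hc (A.vid (h.app (X.hor.dom f))) (A.vid (h.tgt.hor f)))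
      (A.hc (h.appHor f) (A.vid (A.hor.id (h.tgt.obj (X.hor.cod f))))) = h.appHor f
    rw [i, b.hc_hid, DblCat.HasBdry.vid_hc_vid (by rw [h.tgt.hor_fun.dom, h.cod_app]), b.vid_vc]

theorem comp_assoc (h k l : HorPs X A) (e₁ : h.tgt = k.src) (e₂ : k.tgt = l.src) :
    comp (comp h k e₁) l e₂ = comp h (comp k l e₂) e₁ := by
  refine HorPs.ext rfl rfl ?_ ?_ ?_
  · funext a
    exact A.hor.cc_assoc (by rw [h.cod_app, k.dom_app, e₁]) (by rw [k.cod_app, l.dom_app, e₂])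
  · funext w
    have b2 := k.appVer_bdry w
    have b3 := l.appVer_bdry w
    rw [← e₁] at b2
    rw [← e₂] at b3
    exact (h.appVer_bdry w).hassoc b2 b3
  · funext f
    have h0 := h.app_vid_bdry (X.hor.dom f)
    have h1 := h.appHor_bdry f
    have k0 := k.app_vid_bdry (X.hor.dom f)
    have k1 := k.appHor_bdry f
    have k2 := k.app_vid_bdry (X.hor.cod f)
    have l1 := l.appHor_bdry f
    have l2 := l.app_vid_bdry (X.hor.cod f)
    rw [← e₁] at k0 k1 k2
    rw [← e₂] at l1 l2
    have c0 : A.hor.cod (h.app (X.hor.dom f)) = A.hor.dom (k.app (X.hor.dom f)) := by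
      rw [h.cod_app, k.dom_app, e₁]
    have c2 : A.hor.cod (k.app (X.hor.cod f)) = A.hor.dom (l.app (X.hor.cod f)) := by
      rw [k.cod_app, l.dom_app, e₂]
    have d1 : A.hor.cod (k.app (X.hor.dom f)) = A.hor.dom (k.tgt.hor f) := by
      rw [k.cod_app, k.tgt.hor_fun.dom]
    have d2 : A.hor.cod (k.tgt.hor f) = A.hor.dom (l.app (X.hor.cod f)) := by
      rw [k.tgt.hor_fun.cod, e₂, l.dom_app]
    have d3 : A.hor.cod (h.app (X.hor.dom f)) = A.hor.dom (h.tgt.hor f) := by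
      rw [h.cod_app, h.tgt.hor_fun.dom]
    have d4 : A.hor.cod (h.tgt.hor f) = A.hor.dom (k.app (X.hor.cod f)) := by
      rw [h.tgt.hor_fun.cod, e₁, k.dom_app]
    change A.vc (A.hc (A.vid (A.hor.cc (h.app (X.hor.dom f)) (k.app (X.hor.dom f)))) (l.appHor f))
        (A.hc (A.vc (A.hc (A.vid (h.app (X.hor.dom f))) (k.appHor f))
          (A.hc (h.appHor f) (A.vid (k.app (X.hor.cod f))))) (A.vid (l.app (X.hor.cod f)))) =
      A.vc (A.hc (A.vid (h.app (X.hor.dom f)))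
        (A.vc (A.hc (A.vid (k.app (X.hor.dom f))) (l.appHor f))
          (A.hc (k.appHor f) (A.vid (l.app (X.hor.cod f))))))
        (A.hc (h.appHor f) (A.vid (A.hor.cc (k.app (X.hor.cod f)) (l.app (X.hor.cod f)))))
    have b1 := k0.hc l1
    have b2 := (k1.hc l2).cast (A.hor.cc_assoc d1 d2) rfl rfl rfl
    have b3 := (h1.hc k2).cast (A.hor.cc_assoc d3 d4) rfl rfl rfl
    rw [← DblCat.HasBdry.vid_hc_vid c0, ← DblCat.HasBdry.vid_hc_vid c2, h0.hassoc k0 l1,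
      ← h1.hassoc k2 l2]
    have s1 : A.hc (A.vc (A.hc (A.vid (h.app (X.hor.dom f))) (k.appHor f))
          (A.hc (h.appHor f) (A.vid (k.app (X.hor.cod f))))) (A.vid (l.app (X.hor.cod f))) =
        A.vc (A.hc (A.hc (A.vid (h.app (X.hor.dom f))) (k.appHor f)) (A.vid (l.app (X.hor.cod f))))
          (A.hc (A.hc (h.appHor f) (A.vid (k.app (X.hor.cod f)))) (A.vid (l.app (X.hor.cod f)))) := by
      rw [(h0.hc k1).interchange l2 b3 l2, l2.vid_vc]
    have s2 : A.hc (A.vid (h.app (X.hor.dom f)))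
        (A.vc (A.hc (A.vid (k.app (X.hor.dom f))) (l.appHor f))
          (A.hc (k.appHor f) (A.vid (l.app (X.hor.cod f))))) =
        A.vc (A.hc (A.vid (h.app (X.hor.dom f))) (A.hc (A.vid (k.app (X.hor.dom f))) (l.appHor f)))
          (A.hc (A.vid (h.app (X.hor.dom f))) (A.hc (k.appHor f) (A.vid (l.app (X.hor.cod f))))) := by
      rw [h0.interchange b1 h0 b2, h0.vid_vc]
    rw [s1, s2, h0.hassoc k1 l2]
    have t2 := h0.hc b2
    have t3 := (b3.hc l2)
    have a : A.hor.cc (h.app (X.hor.dom f)) (A.hor.cc (A.hor.cc (h.tgt.hor f)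
        (k.app (X.hor.cod f))) (l.app (X.hor.cod f))) =
        A.hor.cc (A.hor.cc (h.app (X.hor.dom f)) (A.hor.cc (h.tgt.hor f)
          (k.app (X.hor.cod f)))) (l.app (X.hor.cod f)) :=
      (A.hor.cc_assoc (by rw [A.hor.dom_cc, d3])
        (by rw [A.hor.cod_cc d4, c2])).symm
    exact ((h0.hc b1).vassoc t2 (t3.cast a.symm rfl rfl rfl)).symm

theorem comp_congr {h h' k k' : HorPs X A} (p : h = h') (q : k = k') (e : h.tgt = k.src)
    (e' : h'.tgt = k'.src) : comp h k e = comp h' k' e' := by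
  subst p q; rfl

end HorPs

/-- A modification in a square of horizontal and vertical pseudo natural transformations. -/
@[ext]
structure PsMod (X A : DblCat.{u}) where
  top : HorPs X A
  bot : HorPs X A
  lft : VerPs X A
  rgt : VerPs X A
  tl : top.src = lft.dom
  tr : top.tgt = rgt.dom
  bl : bot.src = lft.cod
  br : bot.tgt = rgt.cod
  /-- the components at objects -/
  app : X.Obj → A.Sq
  app_bdry : ∀ a, A.HasBdry (app a) (top.app a) (bot.app a) (lft.app a) (rgt.app a)
  /-- coherence for vertical morphisms; `lft.appHor w` and `rgt.appHor w` are the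
  horizontally invertible components of the vertical pseudo natural transformations -/
  ver_coh : ∀ w : X.Ver,
    A.hc (lft.appHor w) (A.vc (top.appVer w) (app (X.ver.cod w))) =
      A.hc (A.vc (app (X.ver.dom w)) (bot.appVer w)) (rgt.appHor w)
  /-- coherence for horizontal morphisms -/
  hor_coh : ∀ f : X.Hor,
    A.vc (top.appHor f) (A.hc (lft.appVer f) (app (X.hor.cod f))) =
      A.vc (A.hc (app (X.hor.dom f)) (rgt.appVer f)) (bot.appHor f)

namespace PsMod

variable {X A : DblCat.{u}}

/-- A modification seen as a modification between the transposes. -/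
@[reducible] def transpose (m : PsMod X A) : PsMod X.transpose A.transpose where
  top := m.lft
  bot := m.rgt
  lft := m.top
  rgt := m.bot
  tl := (congrArg DblFunctor.transpose m.tl).symm
  tr := (congrArg DblFunctor.transpose m.bl).symm
  bl := (congrArg DblFunctor.transpose m.tr).symm
  br := (congrArg DblFunctor.transpose m.br).symm
  app := m.app
  app_bdry a := (m.app_bdry a).transpose
  ver_coh f := m.hor_coh f
  hor_coh w := m.ver_coh w

theorem top_comp (m n : PsMod X A) (e : m.rgt = n.lft) : m.top.tgt = n.top.src := by
  rw [m.tr, n.tl, e]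

theorem bot_comp (m n : PsMod X A) (e : m.rgt = n.lft) : m.bot.tgt = n.bot.src := by
  rw [m.br, n.bl, e]

/-- The identity modification on a vertical pseudo natural transformation. -/
def hid (r : VerPs X A) : PsMod X A where
  top := HorPs.id r.dom
  bot := HorPs.id r.cod
  lft := r
  rgt := r
  tl := rfl
  tr := rfl
  bl := rfl
  br := rfl
  app a := A.hid (r.app a)
  app_bdry a := DblCat.hasBdry_hid A (r.dom_app a) (r.cod_app a)
  ver_coh w := by
    have b := (r.appHor_bdry w).transpose
    have e1 : A.ver.cod (r.src.hor w) = A.ver.dom (r.app (X.ver.cod w)) :=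
      (r.src.hor_fun.cod w).trans (r.dom_app _).symm
    have e2 : A.ver.cod (r.app (X.ver.dom w)) = A.ver.dom (r.tgt.hor w) :=
      (r.cod_app _).trans (r.tgt.hor_fun.dom w).symm
    change A.hc (r.appHor w) (A.vc (A.hid (r.src.hor w)) (A.hid (r.app (X.ver.cod w)))) =
      A.hc (A.vc (A.hid (r.app (X.ver.dom w))) (A.hid (r.tgt.hor w))) (r.appHor w)
    rw [DblCat.HasBdry.hid_vc_hid e1, DblCat.HasBdry.hid_vc_hid e2]
    exact b.hc_hid.trans b.hid_hc.symm
  hor_coh f := by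
    have b := (r.appVer_bdry f).transpose
    change A.vc (A.vid (r.src.ver f)) (A.hc (r.appVer f) (A.hid (r.app (X.hor.cod f)))) =
      A.vc (A.hc (A.hid (r.app (X.hor.dom f))) (r.appVer f)) (A.vid (r.tgt.ver f))
    have h1 : A.hc (r.appVer f) (A.hid (r.app (X.hor.cod f))) = r.appVer f := b.hc_hid
    have h2 : A.hc (A.hid (r.app (X.hor.dom f))) (r.appVer f) = r.appVer f := b.hid_hc
    rw [h1, h2]
    exact b.vid_vc.trans b.vc_vid.symm

/-- Horizontal composition of modifications. -/
noncomputable def hcomp (m n : PsMod X A) (e : m.rgt = n.lft) : PsMod X A where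
  top := HorPs.comp m.top n.top (m.top_comp n e)
  bot := HorPs.comp m.bot n.bot (m.bot_comp n e)
  lft := m.lft
  rgt := n.rgt
  tl := m.tl
  tr := n.tr
  bl := m.bl
  br := n.br
  app a := A.hc (m.app a) (n.app a)
  app_bdry a := (m.app_bdry a).hc (e ▸ n.app_bdry a)
  ver_coh w := by
    have tl : m.top.src.ver w = m.lft.src.hor w := congrArg (fun F => DblFunctor.ver F w) m.tl
    have tm : m.top.tgt.ver w = m.rgt.src.hor w := congrArg (fun F => DblFunctor.ver F w) m.tr
    have tm' : n.top.src.ver w = m.rgt.src.hor w := by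
      rw [e]; exact congrArg (fun F => DblFunctor.ver F w) n.tl
    have bl : m.bot.src.ver w = m.lft.tgt.hor w := congrArg (fun F => DblFunctor.ver F w) m.bl
    have bm : m.bot.tgt.ver w = m.rgt.tgt.hor w := congrArg (fun F => DblFunctor.ver F w) m.br
    have bm' : n.bot.src.ver w = m.rgt.tgt.hor w := by
      rw [e]; exact congrArg (fun F => DblFunctor.ver F w) n.bl
    have br : n.bot.tgt.ver w = n.rgt.tgt.hor w := congrArg (fun F => DblFunctor.ver F w) n.br
    have bL := (m.lft.appHor_bdry w).transpose
    have bS := (m.rgt.appHor_bdry w).transpose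
    have bT := (n.rgt.appHor_bdry w).transpose
    have a1 := (m.top.appVer_bdry w).cast rfl rfl tl tm
    have a2 := (n.top.appVer_bdry w).cast rfl rfl tm' rfl
    have b1 := (m.bot.appVer_bdry w).cast rfl rfl bl bm
    have b2 := (n.bot.appVer_bdry w).cast rfl rfl bm' br
    have m0 := m.app_bdry (X.ver.dom w)
    have m1 := m.app_bdry (X.ver.cod w)
    have n0 := n.app_bdry (X.ver.dom w)
    have n1 := n.app_bdry (X.ver.cod w)
    rw [← e] at n0 n1
    have q1 := m.ver_coh w
    have q2 := n.ver_coh w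
    rw [← e] at q2
    have c1 := bL.hassoc (a1.vc m1) (a2.vc n1)
    have c2 := (m0.vc b1).hassoc bS (a2.vc n1)
    have c3 := (m0.vc b1).hassoc (n0.vc b2) bT
    have i1 := a1.interchange a2 m1 n1
    have i2 := m0.interchange n0 b1 b2
    refine (congrArg (A.hc (m.lft.appHor w)) i1).trans (c1.symm.trans ?_)
    refine Eq.trans ?_ (congrArg (fun x => A.hc x (n.rgt.appHor w)) i2).symm
    exact (congrArg (fun x => A.hc x _) q1).trans (c2.trans
      ((congrArg (A.hc _) q2).trans c3.symm))
  hor_coh f := by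
    have e1 : m.top.tgt = n.top.src := by rw [m.tr, n.tl, e]
    have e2 : m.bot.tgt = n.bot.src := by rw [m.br, n.bl, e]
    have tl : m.top.src.hor f = m.lft.src.ver f := congrArg (fun F => DblFunctor.hor F f) m.tl
    have tm : m.top.tgt.hor f = m.rgt.src.ver f := congrArg (fun F => DblFunctor.hor F f) m.tr
    have tr : n.top.tgt.hor f = n.rgt.src.ver f := congrArg (fun F => DblFunctor.hor F f) n.tr
    have bl : m.bot.src.hor f = m.lft.tgt.ver f := congrArg (fun F => DblFunctor.hor F f) m.bl
    have bm : m.bot.tgt.hor f = m.rgt.tgt.ver f := congrArg (fun F => DblFunctor.hor F f) m.br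
    have br : n.bot.tgt.hor f = n.rgt.tgt.ver f := congrArg (fun F => DblFunctor.hor F f) n.br
    have bku := n.app_bdry (X.hor.dom f)
    have bkv := n.app_bdry (X.hor.cod f)
    have bFα := (m.lft.appVer_bdry f).transpose.cast tl.symm bl.symm rfl rfl
    have bGα := (m.rgt.appVer_bdry f).transpose.cast tm.symm bm.symm rfl rfl
    have bHα := (n.rgt.appVer_bdry f).transpose.cast tr.symm br.symm rfl rfl
    rw [← e] at bku bkv
    have bLf := m.top.appHor_bdry f
    have bLg := m.bot.appHor_bdry f
    have bKf := n.top.appHor_bdry f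
    have bKg := n.bot.appHor_bdry f
    rw [← e1] at bKf
    rw [← e2] at bKg
    have N2 := n.hor_coh f
    rw [← e] at N2
    exact (DblCat.paste_nat (m.top.dom_app _) (m.top.cod_app _) (m.bot.dom_app _) (m.bot.cod_app _)
      ((n.top.dom_app _).trans (by rw [e1])) (n.top.cod_app _)
      ((n.bot.dom_app _).trans (by rw [e2])) (n.bot.cod_app _)
      (m.top.cod_app _) (m.bot.tgt.hor_fun.cod f) (m.bot.tgt.hor_fun.dom f)
      (m.top.tgt.hor_fun.cod f) (m.top.tgt.hor_fun.dom f) (m.top.dom_app _)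
      (m.top.src.hor_fun.cod f) (m.app_bdry _) bku bFα bGα bHα (m.app_bdry _) bkv bLf bLg bKf bKg
      (m.hor_coh f).symm N2.symm).symm

end PsMod

section
variable (X A : DblCat.{u})

/-- Objects and horizontal morphisms of the pseudo hom double category. -/
noncomputable def horPsCat : CatStr (DblFunctor X A) (HorPs X A) where
  dom := HorPs.src
  cod := HorPs.tgt
  id := HorPs.id
  comp := HorPs.comp
  dom_id _ := rfl
  cod_id _ := rfl
  dom_comp _ _ _ := rfl
  cod_comp _ _ _ := rfl
  id_comp := HorPs.id_comp
  comp_id h F e := HorPs.comp_id F h e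
  assoc := HorPs.comp_assoc

/-- Objects and vertical morphisms of the pseudo hom double category. -/
noncomputable def verPsCat : CatStr (DblFunctor X A) (VerPs X A) where
  dom := VerPs.dom
  cod := VerPs.cod
  id F := HorPs.id F.transpose
  comp h k e := HorPs.comp h k (congrArg DblFunctor.transpose e)
  dom_id _ := rfl
  cod_id _ := rfl
  dom_comp _ _ _ := rfl
  cod_comp _ _ _ := rfl
  id_comp F h e := HorPs.id_comp F.transpose h (congrArg DblFunctor.transpose e)
  comp_id h F e := HorPs.comp_id F.transpose h (congrArg DblFunctor.transpose e)
  assoc h k l e₁ e₂ := HorPs.comp_assoc h k l (congrArg DblFunctor.transpose e₁)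
    (congrArg DblFunctor.transpose e₂)

/-- Horizontal composition of modifications. -/
noncomputable def modHorCat : CatStr (VerPs X A) (PsMod X A) where
  dom := PsMod.lft
  cod := PsMod.rgt
  id := PsMod.hid
  comp := PsMod.hcomp
  dom_id _ := rfl
  cod_id _ := rfl
  dom_comp _ _ _ := rfl
  cod_comp _ _ _ := rfl
  id_comp r m e := by
    have e' : r = m.lft := e
    subst e'
    refine PsMod.ext ?_ ?_ rfl rfl ?_
    · exact HorPs.id_comp m.lft.dom m.top m.tl.symm
    · exact HorPs.id_comp m.lft.cod m.bot m.bl.symm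
    · funext a
      exact (m.app_bdry a).hid_hc
  comp_id m r e := by
    have e' : m.rgt = r := e
    subst e'
    refine PsMod.ext ?_ ?_ rfl rfl ?_
    · exact HorPs.comp_id m.rgt.dom m.top m.tr
    · exact HorPs.comp_id m.rgt.cod m.bot m.br
    · funext a
      exact (m.app_bdry a).hc_hid
  assoc m n k e₁ e₂ := by
    refine PsMod.ext ?_ ?_ rfl rfl ?_
    · exact HorPs.comp_assoc m.top n.top k.top (m.top_comp n e₁) (n.top_comp k e₂)
    · exact HorPs.comp_assoc m.bot n.bot k.bot (m.bot_comp n e₁) (n.bot_comp k e₂)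
    · funext a
      have b2 := n.app_bdry a
      rw [← e₁] at b2
      have b3 := k.app_bdry a
      rw [← e₂] at b3
      exact (m.app_bdry a).hassoc b2 b3

/-- Vertical composition of modifications. -/
noncomputable def modVerCat : CatStr (HorPs X A) (PsMod X A) where
  dom := PsMod.top
  cod := PsMod.bot
  id h := PsMod.transpose ((modHorCat X.transpose A.transpose).id h)
  comp m n e := PsMod.transpose ((modHorCat X.transpose A.transpose).comp m.transpose n.transpose e)
  dom_id _ := rfl
  cod_id _ := rfl
  dom_comp _ _ _ := rfl
  cod_comp _ _ _ := rfl
  id_comp h m e :=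
    congrArg PsMod.transpose ((modHorCat X.transpose A.transpose).id_comp h m.transpose e)
  comp_id m h e :=
    congrArg PsMod.transpose ((modHorCat X.transpose A.transpose).comp_id m.transpose h e)
  assoc m n k e₁ e₂ := congrArg PsMod.transpose
    ((modHorCat X.transpose A.transpose).assoc m.transpose n.transpose k.transpose e₁ e₂)

/-- The pseudo hom double category: double functors, horizontal and vertical pseudo natural
transformations, and modifications. -/
noncomputable def psHom : DblCat.{u} where
  Obj := DblFunctor X A
  Hor := HorPs X A
  Ver := VerPs X A
  Sq := PsMod X A
  hor := horPsCat X A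
  ver := verPsCat X A
  sqh := modHorCat X A
  sqv := modVerCat X A
  top_fun := CatStr.IsFun.of_comp (fun m => m.tl) (fun m => m.tr) (fun _ => rfl)
    (fun _ _ _ _ => rfl)
  bot_fun := CatStr.IsFun.of_comp (fun m => m.bl) (fun m => m.br) (fun _ => rfl)
    (fun _ _ _ _ => rfl)
  lft_fun := CatStr.IsFun.of_comp (fun m => m.tl.symm) (fun m => m.bl.symm) (fun _ => rfl)
    (fun _ _ _ _ => rfl)
  rgt_fun := CatStr.IsFun.of_comp (fun m => m.tr.symm) (fun m => m.br.symm) (fun _ => rfl)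
    (fun _ _ _ _ => rfl)
  vid_fun := CatStr.IsFun.of_comp (fun m => rfl) (fun m => rfl)
    (fun F => PsMod.ext (HorPs.ext rfl rfl rfl rfl rfl) (HorPs.ext rfl rfl rfl rfl rfl)
      (HorPs.ext rfl rfl rfl rfl rfl) (HorPs.ext rfl rfl rfl rfl rfl)
      (funext fun a => A.vid_fun.id _))
    (fun h k e e' => PsMod.ext rfl rfl rfl rfl (funext fun a =>
      A.vid_fun.cc _ _ (by
        have e1 : h.tgt = k.src := e
        rw [h.cod_app, k.dom_app, e1])))
  hid_fun := CatStr.IsFun.of_comp (fun m => rfl) (fun m => rfl)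
    (fun F => PsMod.ext (HorPs.ext rfl rfl rfl rfl rfl) (HorPs.ext rfl rfl rfl rfl rfl)
      (HorPs.ext rfl rfl rfl rfl rfl) (HorPs.ext rfl rfl rfl rfl rfl)
      (funext fun a => A.hid_fun.id _))
    (fun h k e e' => PsMod.ext rfl rfl rfl rfl (funext fun a =>
      A.hid_fun.cc _ _ (by
        have e1 : h.cod = k.dom := e
        have e2 : h.tgt.obj a = k.src.obj a := congrArg (fun F => DblFunctor.obj F a) e1
        exact (h.cod_app a).trans (e2.trans (k.dom_app a).symm))))
  interchange α β γ δ h₁ h₂ h₃ h₄ := by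
    have k₁ : α.rgt = β.lft := h₁
    have k₂ : γ.rgt = δ.lft := h₂
    have k₃ : α.bot = γ.top := h₃
    have k₄ : β.bot = δ.top := h₄
    have p : (modVerCat X A).cod ((modHorCat X A).comp α β h₁) =
        (modVerCat X A).dom ((modHorCat X A).comp γ δ h₂) := by
      exact HorPs.comp_congr k₃ k₄ (α.bot_comp β k₁) (γ.top_comp δ k₂)
    have q : (modHorCat X A).cod ((modVerCat X A).comp α γ h₃) =
        (modHorCat X A).dom ((modVerCat X A).comp β δ h₄) := by
      exact HorPs.comp_congr k₁ k₂ (α.transpose.bot_comp γ.transpose k₃)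
        (β.transpose.top_comp δ.transpose k₄)
    rw [(modHorCat X A).cc_eq h₁, (modHorCat X A).cc_eq h₂, (modVerCat X A).cc_eq h₃,
      (modVerCat X A).cc_eq h₄, (modVerCat X A).cc_eq p, (modHorCat X A).cc_eq q]
    refine PsMod.ext rfl rfl rfl rfl (funext fun a => ?_)
    have b2 := β.app_bdry a
    have b3 := γ.app_bdry a
    have b4 := δ.app_bdry a
    rw [← k₁] at b2
    rw [← k₃] at b3
    rw [← k₂, ← k₄] at b4
    exact (α.app_bdry a).interchange b2 b3 b4

end

/-! ### Equipments and double biequivalences -/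

namespace DblCat

/-- `(f, w, φ, ψ)` is a companion pair. -/
structure IsCompanionPair (A : DblCat.{u}) (f : A.Hor) (w : A.Ver) (φ ψ : A.Sq) : Prop where
  φ_bdry : A.HasBdry φ f (A.hor.id (A.ver.cod w)) w (A.ver.id (A.ver.cod w))
  ψ_bdry : A.HasBdry ψ (A.hor.id (A.ver.dom w)) f (A.ver.id (A.ver.dom w)) w
  hor_eq : A.hc ψ φ = A.vid f
  ver_eq : A.vc ψ φ = A.hid w

/-- `(f, w, ε, η)` is a conjoint pair; here `f` goes from the target of `w` to its source. -/
structure IsConjointPair (A : DblCat.{u}) (f : A.Hor) (w : A.Ver) (ε η : A.Sq) : Prop where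
  ε_bdry : A.HasBdry ε f (A.hor.id (A.ver.cod w)) (A.ver.id (A.ver.cod w)) w
  η_bdry : A.HasBdry η (A.hor.id (A.ver.dom w)) f w (A.ver.id (A.ver.dom w))
  hor_eq : A.hc ε η = A.vid f
  ver_eq : A.vc η ε = A.hid w

/-- A double category is an equipment if every vertical morphism has a companion and a
conjoint. -/
def IsEquipment (A : DblCat.{u}) : Prop :=
  ∀ w : A.Ver, (∃ f φ ψ, A.IsCompanionPair f w φ ψ) ∧ (∃ f ε η, A.IsConjointPair f w ε η)

/-- `α` is a 2-isomorphism from `w` to `z` in the 2-category of objects, vertical morphisms and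
squares whose top and bottom are identities. -/
structure IsVertIso (A : DblCat.{u}) (α : A.Sq) (w z : A.Ver) : Prop where
  bdry : A.HasBdry α (A.hor.id (A.ver.dom w)) (A.hor.id (A.ver.cod w)) w z
  iso : A.sqh.IsIso α

/-- `w` is a vertical equivalence, that is, an equivalence in the 2-category of objects, vertical
morphisms and squares whose top and bottom are identities. -/
def IsVertEquiv (A : DblCat.{u}) (w : A.Ver) : Prop :=
  ∃ (z : A.Ver) (η ε : A.Sq), A.ver.dom z = A.ver.cod w ∧ A.ver.cod z = A.ver.dom w ∧
    A.IsVertIso η (A.ver.id (A.ver.dom w)) (A.ver.cc w z) ∧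
    A.IsVertIso ε (A.ver.cc z w) (A.ver.id (A.ver.cod w))

/-- `α` is a weakly vertically invertible square. -/
def IsWeaklyVertInv (A : DblCat.{u}) (α : A.Sq) : Prop :=
  ∃ (γ η η' ε ε' : A.Sq),
    A.top γ = A.bot α ∧ A.bot γ = A.top α ∧
    A.IsVertIso η (A.ver.id (A.hor.dom (A.bot α))) (A.ver.cc (A.lft γ) (A.lft α)) ∧
    A.IsVertIso η' (A.ver.id (A.hor.cod (A.bot α))) (A.ver.cc (A.rgt γ) (A.rgt α)) ∧
    A.IsVertIso ε (A.ver.cc (A.lft α) (A.lft γ)) (A.ver.id (A.hor.dom (A.top α))) ∧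
    A.IsVertIso ε' (A.ver.cc (A.rgt α) (A.rgt γ)) (A.ver.id (A.hor.cod (A.top α))) ∧
    A.hc η (A.vc γ α) = A.hc (A.vid (A.bot α)) η' ∧
    A.hc ε (A.vid (A.top α)) = A.hc (A.vc α γ) ε'

end DblCat

/-- Double biequivalences. -/
structure DblFunctor.IsBiequivalence {A B : DblCat.{u}} (F : DblFunctor A B) : Prop where
  /-- surjective on objects up to vertical equivalence -/
  w1 : ∀ b : B.Obj, ∃ (a : A.Obj) (v : B.Ver),
    B.ver.dom v = b ∧ B.ver.cod v = F.obj a ∧ B.IsVertEquiv v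
  /-- full on vertical morphisms up to 2-isomorphism -/
  w2 : ∀ (a c : A.Obj) (v : B.Ver), B.ver.dom v = F.obj a → B.ver.cod v = F.obj c →
    ∃ (w : A.Ver) (β : B.Sq), A.ver.dom w = a ∧ A.ver.cod w = c ∧ B.IsVertIso β v (F.ver w)
  /-- surjective on horizontal morphisms up to weakly vertically invertible squares -/
  w3 : ∀ f : B.Hor, ∃ (g : A.Hor) (β : B.Sq), B.top β = f ∧ B.bot β = F.hor g ∧
    B.IsVertEquiv (B.lft β) ∧ B.IsVertEquiv (B.rgt β) ∧ B.IsWeaklyVertInv β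
  /-- fully faithful on squares -/
  w4 : ∀ (f g : A.Hor) (v w : A.Ver) (β : B.Sq),
    A.hor.dom f = A.ver.dom v → A.hor.cod f = A.ver.dom w →
    A.hor.dom g = A.ver.cod v → A.hor.cod g = A.ver.cod w →
    B.HasBdry β (F.hor f) (F.hor g) (F.ver v) (F.ver w) →
    ∃! α : A.Sq, A.HasBdry α f g v w ∧ F.sq α = β

/-! ### Double categories of squares

A category `C` is regarded as a 2-category with exactly one 2-cell between any two parallel
morphisms (so any two parallel morphisms are isomorphic, in a unique way). -/

/-- Quadruples of morphisms of `C` that form the boundary of a square.  They are the squares of the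
double category `Sq C`: a 2-cell from `top` then `rgt` to `lft` then `bot` exists and is unique. -/
@[ext]
structure Quad {O M : Type u} (C : CatStr O M) : Type u where
  top : M
  bot : M
  lft : M
  rgt : M
  tl : C.dom top = C.dom lft
  tr : C.cod top = C.dom rgt
  bl : C.dom bot = C.cod lft
  br : C.cod bot = C.cod rgt

/-- Parallel pairs of morphisms of `C`; these are the 2-cells. -/
@[ext]
structure ParPair {O M : Type u} (C : CatStr O M) : Type u where
  fst : M
  snd : M
  dom_eq : C.dom fst = C.dom snd
  cod_eq : C.cod fst = C.cod snd

namespace DblCat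

variable {O M : Type u} (C : CatStr O M)

/-- Horizontal composition of squares in `Sq C`. -/
def quadHor : CatStr M (Quad C) where
  dom := Quad.lft
  cod := Quad.rgt
  id w := ⟨C.id (C.dom w), C.id (C.cod w), w, w, C.dom_id _, C.cod_id _, C.dom_id _, C.cod_id _⟩
  comp p q h := ⟨C.comp p.top q.top (by rw [p.tr, q.tl, h]),
    C.comp p.bot q.bot (by rw [p.br, q.bl, h]), p.lft, q.rgt,
    by rw [C.dom_comp, p.tl], by rw [C.cod_comp, q.tr],
    by rw [C.dom_comp, p.bl], by rw [C.cod_comp, q.br]⟩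
  dom_id _ := rfl
  cod_id _ := rfl
  dom_comp _ _ _ := rfl
  cod_comp _ _ _ := rfl
  id_comp w p h := Quad.ext (C.id_comp _ _ _) (C.id_comp _ _ _) h rfl
  comp_id p w h := Quad.ext (C.comp_id _ _ _) (C.comp_id _ _ _) rfl h.symm
  assoc _ _ _ _ _ := Quad.ext (C.assoc _ _ _ _ _) (C.assoc _ _ _ _ _) rfl rfl

/-- Vertical composition of squares in `Sq C`. -/
def quadVer : CatStr M (Quad C) where
  dom := Quad.top
  cod := Quad.bot
  id f := ⟨f, f, C.id (C.dom f), C.id (C.cod f), (C.dom_id _).symm, (C.dom_id _).symm,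
    (C.cod_id _).symm, (C.cod_id _).symm⟩
  comp p q h := ⟨p.top, q.bot, C.comp p.lft q.lft (by rw [← p.bl, ← q.tl, h]),
    C.comp p.rgt q.rgt (by rw [← p.br, ← q.tr, h]),
    by rw [C.dom_comp, p.tl], by rw [C.dom_comp, p.tr],
    by rw [C.cod_comp, q.bl], by rw [C.cod_comp, q.br]⟩
  dom_id _ := rfl
  cod_id _ := rfl
  dom_comp _ _ _ := rfl
  cod_comp _ _ _ := rfl
  id_comp f p h := Quad.ext h rfl (C.id_comp _ _ _) (C.id_comp _ _ _)
  comp_id p f h := Quad.ext rfl h.symm (C.comp_id _ _ _) (C.comp_id _ _ _)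
  assoc _ _ _ _ _ := Quad.ext rfl rfl (C.assoc _ _ _ _ _) (C.assoc _ _ _ _ _)

/-- The double category `Sq C`: horizontal and vertical morphisms are the morphisms of `C`, and
squares are the 2-cells from the composite `top` then `rgt` to the composite `lft` then `bot`. -/
def sqOf : DblCat.{u} where
  Obj := O
  Hor := M
  Ver := M
  Sq := Quad C
  hor := C
  ver := C
  sqh := quadHor C
  sqv := quadVer C
  top_fun := CatStr.IsFun.of_comp (fun p => p.tl) (fun p => p.tr) (fun _ => rfl)
    (fun _ _ _ _ => rfl)
  bot_fun := CatStr.IsFun.of_comp (fun p => p.bl) (fun p => p.br) (fun _ => rfl)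
    (fun _ _ _ _ => rfl)
  lft_fun := CatStr.IsFun.of_comp (fun p => p.tl.symm) (fun p => p.bl.symm) (fun _ => rfl)
    (fun _ _ _ _ => rfl)
  rgt_fun := CatStr.IsFun.of_comp (fun p => p.tr.symm) (fun p => p.br.symm) (fun _ => rfl)
    (fun _ _ _ _ => rfl)
  vid_fun := CatStr.IsFun.of_comp (fun _ => rfl) (fun _ => rfl)
    (fun a => Quad.ext (congrArg C.id (C.dom_id a).symm) (congrArg C.id (C.cod_id a).symm)
      (congrArg C.id (C.dom_id a)) (congrArg C.id (C.cod_id a)))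
    (fun f g h h' => Quad.ext rfl rfl (congrArg C.id (C.dom_comp f g h))
      (congrArg C.id (C.cod_comp f g h)))
  hid_fun := CatStr.IsFun.of_comp (fun _ => rfl) (fun _ => rfl)
    (fun a => Quad.ext (congrArg C.id (C.dom_id a)) (congrArg C.id (C.cod_id a))
      (congrArg C.id (C.dom_id a).symm) (congrArg C.id (C.cod_id a).symm))
    (fun f g h h' => Quad.ext (congrArg C.id (C.dom_comp f g h))
      (congrArg C.id (C.cod_comp f g h)) rfl rfl)
  interchange α β γ δ h₁ h₂ h₃ h₄ := by
    have p : (quadVer C).cod ((quadHor C).comp α β h₁) =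
        (quadVer C).dom ((quadHor C).comp γ δ h₂) := by
      change C.comp α.bot β.bot _ = C.comp γ.top δ.top _
      simp only [show α.bot = γ.top from h₃, show β.bot = δ.top from h₄]
    have q : (quadHor C).cod ((quadVer C).comp α γ h₃) =
        (quadHor C).dom ((quadVer C).comp β δ h₄) := by
      change C.comp α.rgt γ.rgt _ = C.comp β.lft δ.lft _
      simp only [show α.rgt = β.lft from h₁, show γ.rgt = δ.lft from h₂]
    rw [(quadHor C).cc_eq h₁, (quadHor C).cc_eq h₂, (quadVer C).cc_eq h₃, (quadVer C).cc_eq h₄,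
      (quadVer C).cc_eq p, (quadHor C).cc_eq q]
    rfl

/-- The discrete category on a type. -/
def discCat (O : Type u) : CatStr O O where
  dom a := a
  cod a := a
  id a := a
  comp a _ _ := a
  dom_id _ := rfl
  cod_id _ := rfl
  dom_comp _ _ _ := rfl
  cod_comp _ _ h := h
  id_comp _ _ h := h
  comp_id _ _ _ := rfl
  assoc _ _ _ _ _ := rfl

/-- Horizontal composition of 2-cells. -/
def pairHor : CatStr O (ParPair C) where
  dom p := C.dom p.fst
  cod p := C.cod p.fst
  id a := ⟨C.id a, C.id a, rfl, rfl⟩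
  comp p q h := ⟨C.comp p.fst q.fst h, C.comp p.snd q.snd (by rw [← p.cod_eq, ← q.dom_eq, h]),
    by rw [C.dom_comp, C.dom_comp, p.dom_eq], by rw [C.cod_comp, C.cod_comp, q.cod_eq]⟩
  dom_id _ := C.dom_id _
  cod_id _ := C.cod_id _
  dom_comp _ _ _ := C.dom_comp _ _ _
  cod_comp _ _ _ := C.cod_comp _ _ _
  id_comp a p h := ParPair.ext (C.id_comp _ _ _) (C.id_comp _ _ _)
  comp_id p w h := ParPair.ext (C.comp_id _ _ _) (C.comp_id _ _ _)
  assoc _ _ _ _ _ := ParPair.ext (C.assoc _ _ _ _ _) (C.assoc _ _ _ _ _)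

/-- Vertical composition of 2-cells. -/
def pairVer : CatStr M (ParPair C) where
  dom := ParPair.fst
  cod := ParPair.snd
  id f := ⟨f, f, rfl, rfl⟩
  comp p q h := ⟨p.fst, q.snd, by rw [p.dom_eq, h, q.dom_eq], by rw [p.cod_eq, h, q.cod_eq]⟩
  dom_id _ := rfl
  cod_id _ := rfl
  dom_comp _ _ _ := rfl
  cod_comp _ _ _ := rfl
  id_comp f p h := ParPair.ext h rfl
  comp_id p f h := ParPair.ext rfl h.symm
  assoc _ _ _ _ _ := rfl

/-- The double category `ℍ C`: horizontal morphisms are the morphisms of `C`, there are no vertical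
morphisms besides identities, and squares are the 2-cells. -/
def horOf : DblCat.{u} where
  Obj := O
  Hor := M
  Ver := O
  Sq := ParPair C
  hor := C
  ver := discCat O
  sqh := pairHor C
  sqv := pairVer C
  top_fun := CatStr.IsFun.of_comp (fun _ => rfl) (fun _ => rfl) (fun _ => rfl)
    (fun _ _ _ _ => rfl)
  bot_fun := CatStr.IsFun.of_comp (fun p => p.dom_eq.symm) (fun p => p.cod_eq.symm) (fun _ => rfl)
    (fun _ _ _ _ => rfl)
  lft_fun := CatStr.IsFun.of_comp (fun _ => rfl) (fun p => p.dom_eq) (fun f => rfl)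
    (fun _ _ _ _ => rfl)
  rgt_fun := CatStr.IsFun.of_comp (fun _ => rfl) (fun p => p.cod_eq) (fun f => rfl)
    (fun _ _ _ _ => rfl)
  vid_fun := CatStr.IsFun.of_comp (fun _ => rfl) (fun _ => rfl) (fun _ => rfl)
    (fun _ _ _ _ => rfl)
  hid_fun := CatStr.IsFun.of_comp (fun _ => rfl) (fun _ => rfl) (fun _ => rfl)
    (fun f g h _ => ParPair.ext rfl (congrArg C.id (show f = g from h)))
  interchange α β γ δ h₁ h₂ h₃ h₄ := by
    have p : (pairVer C).cod ((pairHor C).comp α β h₁) =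
        (pairVer C).dom ((pairHor C).comp γ δ h₂) := by
      change C.comp α.snd β.snd _ = C.comp γ.fst δ.fst _
      simp only [show α.snd = γ.fst from h₃, show β.snd = δ.fst from h₄]
    have q : (pairHor C).cod ((pairVer C).comp α γ h₃) =
        (pairHor C).dom ((pairVer C).comp β δ h₄) := h₁
    rw [(pairHor C).cc_eq h₁, (pairHor C).cc_eq h₂, (pairVer C).cc_eq h₃, (pairVer C).cc_eq h₄,
      (pairVer C).cc_eq p, (pairHor C).cc_eq q]
    rfl

/-- The double category `𝕍 C`: the transpose of `ℍ C`. -/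
def verOf : DblCat.{u} := (horOf C).transpose

/-- The inclusion `𝕍 C ⟶ Sq C`. -/
def verToSq : DblFunctor (verOf C) (sqOf C) where
  obj a := a
  hor := C.id
  ver w := w
  sq p := ⟨C.id (C.dom p.fst), C.id (C.cod p.fst), p.fst, p.snd, C.dom_id _,
    by rw [C.cod_id, p.dom_eq], C.dom_id _, by rw [C.cod_id, p.cod_eq]⟩
  hor_fun := CatStr.IsFun.of_comp (fun a => C.dom_id a) (fun a => C.cod_id a) (fun _ => rfl)
    (fun a b h h' => (C.comp_id (C.id a) b h').symm)
  ver_fun := CatStr.IsFun.of_comp (fun _ => rfl) (fun _ => rfl) (fun _ => rfl)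
    (fun _ _ _ _ => rfl)
  sqh_fun := CatStr.IsFun.of_comp (fun _ => rfl) (fun _ => rfl) (fun _ => rfl)
    (fun p q h h' => Quad.ext (C.comp_id _ _ _).symm (C.comp_id _ _ _).symm rfl rfl)
  sqv_fun := CatStr.IsFun.of_comp (fun _ => rfl) (fun _ => rfl)
    (fun a => Quad.ext (congrArg C.id (C.dom_id a)) (congrArg C.id (C.cod_id a))
      (congrArg C.id (C.dom_id a).symm) (congrArg C.id (C.cod_id a).symm))
    (fun p q h h' => Quad.ext (congrArg C.id (C.dom_comp p.fst q.fst h))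
      (congrArg C.id (C.cod_comp p.fst q.fst h)) rfl rfl)

/-- The inclusion of `𝕍 C` into the horizontal dual of `Sq C`. -/
def verToSqHop : DblFunctor (verOf C) (sqOf C).hop where
  obj a := a
  hor := C.id
  ver w := w
  sq p := ⟨C.id (C.dom p.fst), C.id (C.cod p.fst), p.snd, p.fst,
    by rw [C.dom_id, p.dom_eq], C.cod_id _, by rw [C.dom_id, p.cod_eq], C.cod_id _⟩
  hor_fun := CatStr.IsFun.of_comp (fun a => C.cod_id a) (fun a => C.dom_id a) (fun _ => rfl)
    (fun a b h h' => (C.id_comp b (C.id a) h'.symm).symm)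
  ver_fun := CatStr.IsFun.of_comp (fun _ => rfl) (fun _ => rfl) (fun _ => rfl)
    (fun _ _ _ _ => rfl)
  sqh_fun := CatStr.IsFun.of_comp (fun _ => rfl) (fun _ => rfl) (fun _ => rfl)
    (fun p q h h' => Quad.ext (C.id_comp _ _ _).symm (C.id_comp _ _ _).symm rfl rfl)
  sqv_fun := CatStr.IsFun.of_comp (fun _ => rfl) (fun _ => rfl)
    (fun a => Quad.ext (congrArg C.id (C.dom_id a)) (congrArg C.id (C.cod_id a))
      (congrArg C.id (C.dom_id a).symm) (congrArg C.id (C.cod_id a).symm))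
    (fun p q h h' => Quad.ext (congrArg C.id (C.dom_comp p.fst q.fst h))
      (congrArg C.id (C.cod_comp p.fst q.fst h)) rfl rfl)

/-- A functor `C ⟶ D` induces a double functor `ℍ C ⟶ ℍ D`. -/
def horMap {C : CatStr O M} {O' M' : Type u} {D : CatStr O' M'} {o : O → O'} {m : M → M'}
    (h : CatStr.IsFun C D o m) : DblFunctor (horOf C) (horOf D) where
  obj := o
  hor := m
  ver := o
  sq p := ⟨m p.fst, m p.snd, by rw [h.dom, h.dom, p.dom_eq], by rw [h.cod, h.cod, p.cod_eq]⟩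
  hor_fun := h
  ver_fun := CatStr.IsFun.of_comp (fun _ => rfl) (fun _ => rfl) (fun _ => rfl)
    (fun _ _ _ _ => rfl)
  sqh_fun := CatStr.IsFun.of_comp (fun p => h.dom p.fst) (fun p => h.cod p.fst)
    (fun a => ParPair.ext (h.id a) (h.id a))
    (fun p q e e' => ParPair.ext (h.map_comp _ _ e e')
      (h.map_comp _ _ _ _))
  sqv_fun := CatStr.IsFun.of_comp (fun _ => rfl) (fun _ => rfl) (fun _ => rfl)
    (fun _ _ _ _ => rfl)

end DblCat

/-! ### The free-living shapes -/

/-- A type with two elements. -/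
inductive Two : Type u
  | zero
  | one

/-- The other element. -/
def Two.flip : Two.{u} → Two.{u}
  | .zero => .one
  | .one => .zero

/-- The alternating word of length `len` in the two generators `zero ⟶ one` and `one ⟶ zero`,
starting at the object `start`. -/
@[ext]
structure AltWord : Type u where
  start : Two.{u}
  len : ℕ

/-- The free category on two arrows `zero ⟶ one` and `one ⟶ zero`: its morphisms are the alternating
words in the two generators, composed by concatenation.  Regarded as a 2-category with exactly
one 2-cell between any two parallel morphisms, it is the free-living adjoint equivalence
`E_adj`: any two parallel composites of whiskerings of the unit, the counit and their
inverses are identified by the triangle identities. -/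
def eAdjCat : CatStr Two.{u} AltWord.{u} where
  dom w := w.start
  cod w := Two.flip^[w.len] w.start
  id a := ⟨a, 0⟩
  comp w z _ := ⟨w.start, w.len + z.len⟩
  dom_id _ := rfl
  cod_id _ := rfl
  dom_comp _ _ _ := rfl
  cod_comp w z h := by
    change Two.flip^[w.len + z.len] w.start = Two.flip^[z.len] z.start
    rw [Nat.add_comm, Function.iterate_add_apply]
    exact congrArg _ h
  id_comp a w h := AltWord.ext h (Nat.zero_add _)
  comp_id w a h := rfl
  assoc w z y _ _ := AltWord.ext rfl (Nat.add_assoc _ _ _)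

/-- Morphisms of the free category on a family of parallel arrows indexed by `K`. -/
inductive ArrMor (K : Type u) : Type u
  | idn (a : Two.{u})
  | arr (k : K)

/-- The free category on a `K`-indexed family of parallel arrows `zero ⟶ one`. -/
def arrCat (K : Type u) : CatStr Two.{u} (ArrMor K) where
  dom
    | .idn a => a
    | .arr _ => .zero
  cod
    | .idn a => a
    | .arr _ => .one
  id := .idn
  comp f g _ :=
    match f with
    | .idn _ => g
    | .arr k => .arr k
  dom_id _ := rfl
  cod_id _ := rfl
  dom_comp f g h := by cases f <;> first | rfl | exact h.symm
  cod_comp f g h := by cases f <;> cases g <;> first | rfl | exact h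
  id_comp _ _ _ := rfl
  comp_id f a h := by
    cases f
    · exact congrArg ArrMor.idn h.symm
    · rfl
  assoc f g k _ _ := by cases f <;> rfl

/-- The arrow category `𝟚`. -/
abbrev arrowCat : CatStr Two.{u} (ArrMor PUnit.{u + 1}) := arrCat PUnit

/-- Two parallel arrows; with exactly one 2-cell between any two parallel morphisms, this is the
suspension `Σ I` of the free-living isomorphism `I`, that is, the free-living invertible
2-cell. -/
abbrev susIso : CatStr Two.{u} (ArrMor Two.{u}) := arrCat Two

/-- The inclusion of `𝟚` into `Σ I` as the source of the invertible 2-cell. -/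
theorem arrow_to_susIso : CatStr.IsFun arrowCat.{u} susIso.{u} (fun a => a)
    (fun f => match f with
      | .idn a => .idn a
      | .arr _ => .arr .zero) := by
  refine CatStr.IsFun.of_comp ?_ ?_ ?_ ?_
  · rintro (_ | _) <;> rfl
  · rintro (_ | _) <;> rfl
  · intro a; rfl
  · rintro (_ | _) g h h' <;> rfl

/-- The terminal category. -/
def unitCat : CatStr PUnit.{u + 1} PUnit.{u + 1} := DblCat.discCat PUnit

namespace DblCat

/-- The terminal double category. -/
def one : DblCat.{u} := sqOf unitCat

/-- The double category `Sq E_adj`. -/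
def sqEAdj : DblCat.{u} := sqOf eAdjCat

end DblCat

/-- The generating anodyne extensions. -/
inductive GenAnodyne : MorphismProperty DblCat.{u}
  /-- the inclusion of an object into `𝕍 E_adj` -/
  | obj : GenAnodyne (X := DblCat.one) (Y := DblCat.verOf eAdjCat)
      (DblFunctor.const DblCat.one (DblCat.verOf eAdjCat) Two.zero)
  /-- `𝕍 𝟚 ⟶ Sq 𝟚` -/
  | companion : GenAnodyne (X := DblCat.verOf arrowCat) (Y := DblCat.sqOf arrowCat)
      (DblCat.verToSq arrowCat)
  /-- the inclusion of `𝕍 𝟚` into the horizontal dual of `Sq 𝟚` -/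
  | conjoint : GenAnodyne (X := DblCat.verOf arrowCat) (Y := (DblCat.sqOf arrowCat).hop)
      (DblCat.verToSqHop arrowCat)
  /-- `ℍ 𝟚 ⟶ ℍ Σ I` -/
  | horIso : GenAnodyne (X := DblCat.horOf arrowCat) (Y := DblCat.horOf susIso)
      (DblCat.horMap arrow_to_susIso)
  /-- `𝕍 𝟚 ⟶ 𝕍 Σ I` -/
  | verIso : GenAnodyne (X := DblCat.verOf arrowCat) (Y := DblCat.verOf susIso)
      (DblCat.horMap arrow_to_susIso).transpose

/-- Naive fibrations: the double functors with the right lifting property with respect to the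
generating anodyne extensions. -/
def naiveFib : MorphismProperty DblCat.{u} := GenAnodyne.rlp

/-- The weak equivalences between equipments: the double biequivalences. -/
def weqEquipment : MorphismProperty DblCat.{u} :=
  fun A B F => A.IsEquipment ∧ B.IsEquipment ∧ DblFunctor.IsBiequivalence F

/-! ### The path object -/

/-- The diagonal of a double category. -/
def diagonal (A : DblCat.{u}) : A ⟶ A.prod A := DblFunctor.pair (𝟙 A) (𝟙 A)

/-- `A ⟶ P ⟶ A × A` is a path object for `A`: a factorization of the diagonal into a weak
equivalence between equipments followed by a naive fibration. -/
structure IsPathObject {A P : DblCat.{u}} (w : A ⟶ P) (p : P ⟶ A.prod A) : Prop where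
  fac : w ≫ p = diagonal A
  weq : weqEquipment w
  fib : naiveFib p

section
variable (X A : DblCat.{u})

/-- Evaluation at an object of `X`. -/
noncomputable def evalAt (x : X.Obj) : DblFunctor (psHom X A) A where
  obj F := F.obj x
  hor h := h.app x
  ver r := r.app x
  sq m := m.app x
  hor_fun := CatStr.IsFun.of_comp (fun h => h.dom_app x) (fun h => h.cod_app x) (fun _ => rfl)
    (fun h k e e' => A.hor.cc_eq e')
  ver_fun := CatStr.IsFun.of_comp (fun h => h.dom_app x) (fun h => h.cod_app x) (fun _ => rfl)
    (fun h k e e' => A.ver.cc_eq e')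
  sqh_fun := CatStr.IsFun.of_comp (fun m => (m.app_bdry x).lft) (fun m => (m.app_bdry x).rgt)
    (fun _ => rfl) (fun m n e e' => A.sqh.cc_eq e')
  sqv_fun := CatStr.IsFun.of_comp (fun m => (m.app_bdry x).top) (fun m => (m.app_bdry x).bot)
    (fun _ => rfl) (fun m n e e' => A.sqv.cc_eq e')

variable {A}

/-- The horizontal pseudo natural transformation between constant double functors that is constant
at the horizontal morphism `f`. -/
def HorPs.const (f : A.Hor) : HorPs X A where
  src := DblFunctor.const X A (A.hor.dom f)
  tgt := DblFunctor.const X A (A.hor.cod f)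
  app _ := f
  appVer _ := A.vid f
  appHor _ := A.vid f
  dom_app _ := rfl
  cod_app _ := rfl
  appVer_bdry _ := DblCat.hasBdry_vid A rfl rfl
  appHor_bdry _ := (DblCat.hasBdry_vid A rfl rfl).cast (A.hor.cc_id rfl).symm
    (A.hor.id_cc rfl).symm rfl rfl
  appHor_iso _ := A.sqv.isIso_id f
  appVer_id _ := rfl
  appVer_cc _ _ _ := (DblCat.hasBdry_vid A rfl rfl).vc_vid.symm
  appHor_id _ := rfl
  appHor_cc _ _ _ := by
    change A.vid f = A.vc (A.hc (A.vid f) (A.vid (A.hor.id _)))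
      (A.hc (A.vid (A.hor.id _)) (A.vid f))
    rw [DblCat.HasBdry.vid_hc_vid (A.hor.dom_id _).symm, DblCat.HasBdry.vid_hc_vid (A.hor.cod_id _),
      A.hor.cc_id rfl, A.hor.id_cc rfl]
    exact (DblCat.hasBdry_vid A rfl rfl).vc_vid.symm
  naturality _ := by
    change A.vc (A.hc (A.vid f) (A.vid (A.hor.id _))) (A.vid f) =
      A.vc (A.vid f) (A.hc (A.vid (A.hor.id _)) (A.vid f))
    rw [DblCat.HasBdry.vid_hc_vid (A.hor.dom_id _).symm, DblCat.HasBdry.vid_hc_vid (A.hor.cod_id _),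
      A.hor.cc_id rfl, A.hor.id_cc rfl]

theorem DblFunctor.const_transpose (a : A.Obj) :
    (DblFunctor.const X.transpose A.transpose a).transpose = DblFunctor.const X A a :=
  DblFunctor.ext rfl rfl rfl (funext fun _ => (A.vid_fun.id a).symm)

theorem HorPs.const_id (a : A.Obj) :
    HorPs.const X (A.hor.id a) = HorPs.id (DblFunctor.const X A a) :=
  HorPs.ext (congrArg (DblFunctor.const X A) (A.hor.dom_id a))
    (congrArg (DblFunctor.const X A) (A.hor.cod_id a)) rfl
    (funext fun _ => A.vid_fun.id a) rfl

theorem HorPs.const_comp (f g : A.Hor) (h : A.hor.cod f = A.hor.dom g)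
    (h' : (HorPs.const X f).tgt = (HorPs.const X g).src) :
    HorPs.const X (A.hor.comp f g h) = HorPs.comp (HorPs.const X f) (HorPs.const X g) h' := by
  refine HorPs.ext (congrArg (DblFunctor.const X A) (A.hor.dom_comp f g h))
    (congrArg (DblFunctor.const X A) (A.hor.cod_comp f g h))
    (funext fun _ => (A.hor.cc_eq h).symm) (funext fun _ => ?_) (funext fun _ => ?_)
  · change A.vid (A.hor.comp f g h) = A.hc (A.vid f) (A.vid g)
    rw [DblCat.HasBdry.vid_hc_vid h, A.hor.cc_eq h]
  · change A.vid (A.hor.comp f g h) =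
      A.vc (A.hc (A.vid f) (A.vid g)) (A.hc (A.vid f) (A.vid g))
    rw [DblCat.HasBdry.vid_hc_vid h, A.hor.cc_eq h]
    exact (A.sqv.id_cc (A.sqv.dom_id _).symm).symm

/-- The modification that is constant at the square `α`. -/
def PsMod.const (α : A.Sq) : PsMod X A where
  top := HorPs.const X (A.top α)
  bot := HorPs.const X (A.bot α)
  lft := HorPs.const X.transpose (A := A.transpose) (A.lft α)
  rgt := HorPs.const X.transpose (A := A.transpose) (A.rgt α)
  tl := (congrArg _ (A.top_fun.dom α)).trans (DblFunctor.const_transpose X _).symm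
  tr := (congrArg _ (A.top_fun.cod α)).trans (DblFunctor.const_transpose X _).symm
  bl := (congrArg _ (A.bot_fun.dom α)).trans (DblFunctor.const_transpose X _).symm
  br := (congrArg _ (A.bot_fun.cod α)).trans (DblFunctor.const_transpose X _).symm
  app _ := α
  app_bdry _ := ⟨rfl, rfl, rfl, rfl⟩
  ver_coh _ := by
    have b : A.HasBdry α (A.top α) (A.bot α) (A.lft α) (A.rgt α) := ⟨rfl, rfl, rfl, rfl⟩
    change A.hc (A.hid (A.lft α)) (A.vc (A.vid (A.top α)) α) =
      A.hc (A.vc α (A.vid (A.bot α))) (A.hid (A.rgt α))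
    rw [b.vid_vc, b.vc_vid, b.hid_hc, b.hc_hid]
  hor_coh _ := by
    have b : A.HasBdry α (A.top α) (A.bot α) (A.lft α) (A.rgt α) := ⟨rfl, rfl, rfl, rfl⟩
    change A.vc (A.vid (A.top α)) (A.hc (A.hid (A.lft α)) α) =
      A.vc (A.hc α (A.hid (A.rgt α))) (A.vid (A.bot α))
    rw [b.hid_hc, b.hc_hid, b.vid_vc, b.vc_vid]

theorem PsMod.const_hid (w : A.Ver) :
    PsMod.const X (A.hid w) = PsMod.hid (HorPs.const X.transpose (A := A.transpose) w) := by
  have b := DblCat.hasBdry_hid A (w := w) rfl rfl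
  refine PsMod.ext ?_ ?_ (congrArg (HorPs.const X.transpose (A := A.transpose)) b.lft)
    (congrArg (HorPs.const X.transpose (A := A.transpose)) b.rgt) rfl
  · exact (congrArg (HorPs.const X) b.top).trans ((HorPs.const_id X _).trans
      (congrArg HorPs.id (DblFunctor.const_transpose X _).symm))
  · exact (congrArg (HorPs.const X) b.bot).trans ((HorPs.const_id X _).trans
      (congrArg HorPs.id (DblFunctor.const_transpose X _).symm))

theorem PsMod.const_hcomp (α β : A.Sq) (h : A.rgt α = A.lft β)
    (h' : (PsMod.const X α).rgt = (PsMod.const X β).lft) :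
    PsMod.const X (A.sqh.comp α β h) = PsMod.hcomp (PsMod.const X α) (PsMod.const X β) h' := by
  have e1 : A.hor.cod (A.top α) = A.hor.dom (A.top β) := by
    rw [A.top_fun.cod, A.top_fun.dom]; exact congrArg _ h
  have e2 : A.hor.cod (A.bot α) = A.hor.dom (A.bot β) := by
    rw [A.bot_fun.cod, A.bot_fun.dom]; exact congrArg _ h
  have t : A.top (A.sqh.comp α β h) = A.hor.comp (A.top α) (A.top β) e1 := by
    rw [← A.hor.cc_eq e1, ← A.sqh.cc_eq h]; exact A.top_fun.cc _ _ h
  have b : A.bot (A.sqh.comp α β h) = A.hor.comp (A.bot α) (A.bot β) e2 := by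
    rw [← A.hor.cc_eq e2, ← A.sqh.cc_eq h]; exact A.bot_fun.cc _ _ h
  refine PsMod.ext ?_ ?_
    (congrArg (HorPs.const X.transpose (A := A.transpose)) (A.sqh.dom_comp _ _ h))
    (congrArg (HorPs.const X.transpose (A := A.transpose)) (A.sqh.cod_comp _ _ h))
    (funext fun _ => (A.sqh.cc_eq h).symm)
  · exact (congrArg (HorPs.const X) t).trans (HorPs.const_comp X _ _ e1 (PsMod.top_comp _ _ h'))
  · exact (congrArg (HorPs.const X) b).trans (HorPs.const_comp X _ _ e2 (PsMod.bot_comp _ _ h'))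

variable (A)

/-- The double functor that sends everything to the corresponding constant data.  It is induced by
`X ⟶ 𝟙`. -/
noncomputable def constPs : DblFunctor A (psHom X A) where
  obj a := DblFunctor.const X A a
  hor f := HorPs.const X f
  ver w := HorPs.const X.transpose (A := A.transpose) w
  sq α := PsMod.const X α
  hor_fun := CatStr.IsFun.of_comp (fun _ => rfl) (fun _ => rfl) (HorPs.const_id X)
    (HorPs.const_comp X)
  ver_fun := CatStr.IsFun.of_comp (fun _ => DblFunctor.const_transpose X _)
    (fun _ => DblFunctor.const_transpose X _)
    (fun a => (HorPs.const_id X.transpose (A := A.transpose) a).trans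
      (congrArg HorPs.id (congrArg DblFunctor.transpose (DblFunctor.const_transpose X a))))
    (fun f g h h' => HorPs.const_comp X.transpose (A := A.transpose) f g h
      (congrArg DblFunctor.transpose h'))
  sqh_fun := CatStr.IsFun.of_comp (fun _ => rfl) (fun _ => rfl) (PsMod.const_hid X)
    (PsMod.const_hcomp X)
  sqv_fun := CatStr.IsFun.of_comp (fun _ => rfl) (fun _ => rfl)
    (fun f => congrArg PsMod.transpose (PsMod.const_hid X.transpose (A := A.transpose) f))
    (fun α β h h' => congrArg PsMod.transpose
      (PsMod.const_hcomp X.transpose (A := A.transpose) α β h h'))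

end

/-- The pseudo hom double category from `Sq E_adj` to `A`. -/
noncomputable def pathObj (A : DblCat.{u}) : DblCat.{u} := psHom DblCat.sqEAdj A

/-- The double functor from `A` to its path object induced by `Sq E_adj ⟶ 𝟙`. -/
noncomputable def pathConst (A : DblCat.{u}) : A ⟶ pathObj A := constPs DblCat.sqEAdj A

/-- The double functor from the path object to `A × A` induced by the inclusion
`𝟙 ⊔ 𝟙 ⟶ Sq E_adj` of the two objects. -/
noncomputable def pathEval (A : DblCat.{u}) : pathObj A ⟶ A.prod A :=
  DblFunctor.pair (evalAt DblCat.sqEAdj A Two.zero) (evalAt DblCat.sqEAdj A Two.one)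

/-! The shape `Sq E_adj` is codiscrete: parallel morphisms of `E_adj` are connected by exactly one
2-cell, so every compatible boundary in `Sq E_adj` has exactly one filler (`isCodisc_sqOf`). Hence a
transformation with values in it may be prescribed by arbitrary components at objects
(`IsCodisc.exists_horPs`), and pseudo hom double categories with values in it are again codiscrete
(`isCodisc_psHom`). Words from each object to `0` and back therefore give a vertical transformation
τ from the identity to the constant double functor at `0`, together with an inverse up to
isomorphism, and both have companions and conjoints. This is the contraction of `Sq E_adj` onto `0`
(`exists_contraction_sqEAdj`).

The equipment property and the claims on `w` follow from the contraction alone. Postcomposition with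
a double functor `F` is itself a double functor, so it carries τ to a vertical equivalence `leg F`
from `F` to the constant at `F 0` that has a companion and a conjoint. A vertical transformation
between constant double functors is isomorphic to a constant one, through its own pseudo naturality
components at τ (`exists_mod_const`, `vIso_const`). Conjugating by legs, every vertical
transformation is isomorphic to a composite of a leg, a constant one and an inverse leg
(`exists_vIso`). Companions and conjoints are preserved by double functors and stable under
composition and vertical 2-isomorphism, so the path object is an equipment. For the biequivalence,
the legs give surjectivity on objects; `vIso_const` gives fullness on vertical morphisms; the
interchange cell of a horizontal transformation with τ is the required weakly vertically invertible
square; and the coherence of a modification between constants at τ forces its components to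
coincide.

For the fibration property, two lifting facts carry the argument. A transformation can be
transported along any family of isomorphisms out of its components (`exists_transport`); as `0` and
`1` are all the objects of the shape, invertible cells lift along `p` in both directions. Vertical
equivalences out of `F 0` and `F 1` lift to one out of `F` (`vEquivLift_pathEval`): conjugating the
image of the arrow `0 → 1` gives an equivalence between the targets, and an equivalence extends to
`Sq E_adj` once companions exist (`exists_sqEAdj_functor`). The five lifting problems then reduce to
universal properties. Lifting a companion with prescribed image means correcting an arbitrary
companion by an isomorphism (`lift_companion`), and conjoints are companions in the horizontal dual.
A double functor out of `𝕍 E_adj` amounts to a vertical equivalence with chosen inverse and one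
structure isomorphism, so the first generator needs only lifts of equivalences and of vertical
2-isomorphisms (`rlp_obj`).

The double functors out of `𝕍 E_adj` and `Sq C` are built by one method: the image of a cell is
defined as the unique solution of an equation, and functoriality holds because the solutions are
closed under identities and pasting. -/

/-! ### Boundaries of composites -/

namespace CatStr

attribute [grind =] CatStr.dom_cc CatStr.cod_cc CatStr.id_cc CatStr.cc_id CatStr.dom_id
  CatStr.cod_id CatStr.cc_assoc

theorem cc_mid {O M : Type u} (C : CatStr O M) {a b c d : M} (h₁ : C.cod a = C.dom b)
    (h₂ : C.cod b = C.dom c) (h₃ : C.cod c = C.dom d) :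
    C.cc (C.cc a b) (C.cc c d) = C.cc a (C.cc (C.cc b c) d) := by
  rw [C.cc_assoc h₁ (by grind), C.cc_assoc h₂ h₃]

end CatStr

namespace DblCat

section
variable (A : DblCat.{u})

theorem top_hc {α β : A.Sq} (h : A.rgt α = A.lft β) :
    A.top (A.hc α β) = A.hor.cc (A.top α) (A.top β) := A.top_fun.cc _ _ h
theorem bot_hc {α β : A.Sq} (h : A.rgt α = A.lft β) :
    A.bot (A.hc α β) = A.hor.cc (A.bot α) (A.bot β) := A.bot_fun.cc _ _ h
theorem lft_vc {α β : A.Sq} (h : A.bot α = A.top β) :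
    A.lft (A.vc α β) = A.ver.cc (A.lft α) (A.lft β) := A.lft_fun.cc _ _ h
theorem rgt_vc {α β : A.Sq} (h : A.bot α = A.top β) :
    A.rgt (A.vc α β) = A.ver.cc (A.rgt α) (A.rgt β) := A.rgt_fun.cc _ _ h
theorem top_hid (w : A.Ver) : A.top (A.hid w) = A.hor.id (A.ver.dom w) := A.top_fun.id w
theorem bot_hid (w : A.Ver) : A.bot (A.hid w) = A.hor.id (A.ver.cod w) := A.bot_fun.id w
theorem lft_vid (f : A.Hor) : A.lft (A.vid f) = A.ver.id (A.hor.dom f) := A.lft_fun.id f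
theorem rgt_vid (f : A.Hor) : A.rgt (A.vid f) = A.ver.id (A.hor.cod f) := A.rgt_fun.id f
theorem dom_top (α : A.Sq) : A.hor.dom (A.top α) = A.ver.dom (A.lft α) := A.top_fun.dom α
theorem cod_top (α : A.Sq) : A.hor.cod (A.top α) = A.ver.dom (A.rgt α) := A.top_fun.cod α
theorem dom_bot (α : A.Sq) : A.hor.dom (A.bot α) = A.ver.cod (A.lft α) := A.bot_fun.dom α
theorem cod_bot (α : A.Sq) : A.hor.cod (A.bot α) = A.ver.cod (A.rgt α) := A.bot_fun.cod α
theorem vid_cc {f g : A.Hor} (e : A.hor.cod f = A.hor.dom g) :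
    A.vid (A.hor.cc f g) = A.hc (A.vid f) (A.vid g) := A.vid_fun.cc _ _ e
theorem hid_cc {f g : A.Ver} (e : A.ver.cod f = A.ver.dom g) :
    A.hid (A.ver.cc f g) = A.vc (A.hid f) (A.hid g) := A.hid_fun.cc _ _ e
theorem vid_id (a : A.Obj) : A.vid (A.hor.id a) = A.hid (A.ver.id a) := A.vid_fun.id a

theorem hid_id (a : A.Obj) : A.hid (A.ver.id a) = A.vid (A.hor.id a) := (A.vid_fun.id a).symm

attribute [grind =] hid_id top_hc bot_hc lft_vc rgt_vc top_hid bot_hid lft_vid rgt_vid vid_cc hid_cc vid_id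
attribute [grind →] HasBdry.top HasBdry.bot HasBdry.lft HasBdry.rgt
grind_pattern dom_top => A.sqv.dom α
grind_pattern cod_top => A.sqv.dom α
grind_pattern dom_bot => A.sqv.cod α
grind_pattern cod_bot => A.sqv.cod α

end

variable {A : DblCat.{u}}

theorem ichg {α β γ δ : A.Sq} (h₁ : A.rgt α = A.lft β) (h₂ : A.rgt γ = A.lft δ)
    (h₃ : A.bot α = A.top γ) (h₄ : A.bot β = A.top δ) :
    A.vc (A.hc α β) (A.hc γ δ) = A.hc (A.vc α γ) (A.vc β δ) := A.interchange _ _ _ _ h₁ h₂ h₃ h₄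

theorem hassoc {α β γ : A.Sq} (h₁ : A.rgt α = A.lft β) (h₂ : A.rgt β = A.lft γ) :
    A.hc (A.hc α β) γ = A.hc α (A.hc β γ) := A.sqh.cc_assoc h₁ h₂

theorem hmid {α β γ δ : A.Sq} (h₁ : A.rgt α = A.lft β) (h₂ : A.rgt β = A.lft γ)
    (h₃ : A.rgt γ = A.lft δ) :
    A.hc (A.hc α β) (A.hc γ δ) = A.hc α (A.hc (A.hc β γ) δ) := A.sqh.cc_mid h₁ h₂ h₃

theorem vassoc {α β γ : A.Sq} (h₁ : A.bot α = A.top β) (h₂ : A.bot β = A.top γ) :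
    A.vc (A.vc α β) γ = A.vc α (A.vc β γ) := A.sqv.cc_assoc h₁ h₂

/-- Vertical whiskering on the right distributes over horizontal composition. -/
theorem hc_vc_hid {α β : A.Sq} {q : A.Ver} (h : A.rgt α = A.lft β)
    (h₁ : A.bot α = A.hor.id (A.ver.dom q)) (h₂ : A.bot β = A.hor.id (A.ver.dom q)) :
    A.vc (A.hc α β) (A.hid q) = A.hc (A.vc α (A.hid q)) (A.vc β (A.hid q)) := by
  rw [← ichg h (by grind) (by grind) (by grind)]
  grind

/-- Vertical whiskering on the left distributes over horizontal composition. -/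
theorem hid_vc_hc {α β : A.Sq} {q : A.Ver} (h : A.rgt α = A.lft β)
    (h₁ : A.top α = A.hor.id (A.ver.cod q)) (h₂ : A.top β = A.hor.id (A.ver.cod q)) :
    A.vc (A.hid q) (A.hc α β) = A.hc (A.vc (A.hid q) α) (A.vc (A.hid q) β) := by
  rw [← ichg (by grind) h (by grind) (by grind)]
  grind

/-- Horizontal whiskering on the right distributes over vertical composition. -/
theorem vc_hc_vid {α β : A.Sq} {f : A.Hor} (h : A.bot α = A.top β)
    (h₁ : A.rgt α = A.ver.id (A.hor.dom f)) (h₂ : A.rgt β = A.ver.id (A.hor.dom f)) :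
    A.hc (A.vc α β) (A.vid f) = A.vc (A.hc α (A.vid f)) (A.hc β (A.vid f)) := by
  rw [ichg (by grind) (by grind) h (by grind)]
  grind

/-- Horizontal whiskering on the left distributes over vertical composition. -/
theorem vid_hc_vc {α β : A.Sq} {f : A.Hor} (h : A.bot α = A.top β)
    (h₁ : A.lft α = A.ver.id (A.hor.cod f)) (h₂ : A.lft β = A.ver.id (A.hor.cod f)) :
    A.hc (A.vid f) (A.vc α β) = A.vc (A.hc (A.vid f) α) (A.hc (A.vid f) β) := by
  rw [ichg (by grind) (by grind) (by grind) h]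
  grind

/-- Two squares placed diagonally compose in the same way vertically and horizontally. -/
theorem vc_eq_hc {α β : A.Sq} {a : A.Obj} (h₁ : A.bot α = A.hor.id a) (h₂ : A.rgt α = A.ver.id a)
    (h₃ : A.top β = A.hor.id a) (h₄ : A.lft β = A.ver.id a) : A.vc α β = A.hc α β := by
  -- Fill the off-diagonal corners of a two by two grid with identity squares: collapsing rows first
  -- or columns first gives the two composites.
  have := ichg (A := A) (α := α) (β := A.hid (A.ver.id a)) (γ := A.hid (A.ver.id a)) (δ := β)
    (by grind) (by grind) (by grind) (by grind)
  grind

/-- Exchange of squares with identity top and bottom sides. -/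
theorem whisker_exchange {α β : A.Sq} {a : A.Obj} (h₁ : A.bot α = A.hor.id a)
    (h₂ : A.top β = A.hor.id a) :
    A.hc (A.vc α (A.hid (A.lft β))) (A.vc (A.hid (A.rgt α)) β) = A.vc α β ∧
    A.hc (A.vc (A.hid (A.lft α)) β) (A.vc α (A.hid (A.rgt β))) = A.vc α β := by
  constructor
  · rw [← ichg (by grind) (by grind) (by grind) (by grind)]
    grind
  · rw [← ichg (by grind) (by grind) (by grind) (by grind)]
    grind

/-! ### Vertical 2-isomorphisms -/

namespace IsVertIso

variable {α β : A.Sq} {w z y : A.Ver}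

attribute [grind →] IsVertIso.bdry

theorem dom_eq (h : A.IsVertIso α w z) : A.ver.dom z = A.ver.dom w := by
  have := h.bdry; grind
theorem cod_eq (h : A.IsVertIso α w z) : A.ver.cod z = A.ver.cod w := by
  have := h.bdry; grind
attribute [grind →] dom_eq cod_eq

/-- The inverse of a vertical 2-isomorphism. -/
theorem exists_inv (h : A.IsVertIso α w z) :
    ∃ β, A.IsVertIso β z w ∧ A.hc α β = A.hid w ∧ A.hc β α = A.hid z := by
  obtain ⟨β, h1, h2, h3, h4⟩ := h.iso
  have hb := h.bdry
  replace h3 : A.hc α β = _ := h3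
  -- `IsIso` prescribes only the sides of the inverse. Its top and bottom are recovered from those
  -- of the composite with `α`, which is an identity square.
  have t : A.hor.cc (A.top α) (A.top β) = A.top (A.hid w) := by
    refine (A.top_hc (by grind)).symm.trans ?_
    rw [h3]; grind
  have b : A.hor.cc (A.bot α) (A.bot β) = A.bot (A.hid w) := by
    refine (A.bot_hc (by grind)).symm.trans ?_
    rw [h3]; grind
  refine ⟨β, ⟨⟨by grind, by grind, by grind, by grind⟩, ⟨α, by grind, by grind, by grind, by grind⟩⟩,
    by grind, by grind⟩

theorem refl (w : A.Ver) : A.IsVertIso (A.hid w) w w :=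
  ⟨⟨by grind, by grind, by grind, by grind⟩, A.sqh.isIso_id w⟩

theorem trans (h : A.IsVertIso α w z) (h' : A.IsVertIso β z y) : A.IsVertIso (A.hc α β) w y :=
  ⟨⟨by grind, by grind, by grind, by grind⟩, A.sqh.isIso_cc h.iso h'.iso (by grind)⟩

/-- Only the sides of the candidate inverse need to be known, since `IsIso` for horizontal
composition does not mention its top and bottom. -/
theorem of_inv (hb : A.HasBdry α (A.hor.id (A.ver.dom w)) (A.hor.id (A.ver.cod w)) w z)
    (h₁ : A.lft β = z) (h₂ : A.rgt β = w) (h₃ : A.hc α β = A.hid w)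
    (h₄ : A.hc β α = A.hid z) : A.IsVertIso α w z :=
  ⟨hb, β, by grind, by grind, by grind, by grind⟩

theorem vcomp {w' z' : A.Ver} (h : A.IsVertIso α w z) (h' : A.IsVertIso β w' z')
    (e : A.ver.cod w = A.ver.dom w') :
    A.IsVertIso (A.vc α β) (A.ver.cc w w') (A.ver.cc z z') := by
  obtain ⟨γ, g1, g2, g3⟩ := h.exists_inv
  obtain ⟨δ, d1, d2, d3⟩ := h'.exists_inv
  have e1 : A.hc (A.vc α β) (A.vc γ δ) = A.hid (A.ver.cc w w') := by
    rw [← ichg (by grind) (by grind) (by grind) (by grind)]; grind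
  have e2 : A.hc (A.vc γ δ) (A.vc α β) = A.hid (A.ver.cc z z') := by
    rw [← ichg (by grind) (by grind) (by grind) (by grind)]; grind
  exact of_inv ⟨by grind, by grind, by grind, by grind⟩ (by grind) (by grind) e1 e2

end IsVertIso

/-- Two vertical morphisms are isomorphic through a horizontally invertible square with identity
top and bottom. -/
def VIso (A : DblCat.{u}) (w z : A.Ver) : Prop := ∃ α, A.IsVertIso α w z

namespace VIso

variable {w z y w' z' : A.Ver}

theorem refl (w : A.Ver) : A.VIso w w := ⟨_, IsVertIso.refl w⟩
theorem of_eq (h : w = z) : A.VIso w z := h ▸ refl w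
theorem symm (h : A.VIso w z) : A.VIso z w := by
  obtain ⟨α, h⟩ := h
  obtain ⟨β, h', -⟩ := h.exists_inv
  exact ⟨β, h'⟩
theorem trans (h : A.VIso w z) (h' : A.VIso z y) : A.VIso w y := by
  obtain ⟨α, h⟩ := h
  obtain ⟨β, h'⟩ := h'
  exact ⟨_, h.trans h'⟩
theorem cc (h : A.VIso w z) (h' : A.VIso w' z') (e : A.ver.cod w = A.ver.dom w') :
    A.VIso (A.ver.cc w w') (A.ver.cc z z') := by
  obtain ⟨α, h⟩ := h
  obtain ⟨β, h'⟩ := h'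
  exact ⟨_, h.vcomp h' e⟩
theorem dom_eq (h : A.VIso w z) : A.ver.dom z = A.ver.dom w := h.elim fun _ h => h.dom_eq
theorem cod_eq (h : A.VIso w z) : A.ver.cod z = A.ver.cod w := h.elim fun _ h => h.cod_eq
attribute [grind →] dom_eq cod_eq

end VIso

/-- `z` is inverse to `w` up to 2-isomorphism. -/
structure IsVertInv (A : DblCat.{u}) (w z : A.Ver) : Prop where
  dom_eq : A.ver.dom z = A.ver.cod w
  cod_eq : A.ver.cod z = A.ver.dom w
  inv : A.VIso (A.ver.cc w z) (A.ver.id (A.ver.dom w))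
  inv' : A.VIso (A.ver.cc z w) (A.ver.id (A.ver.cod w))

/-- The structure isomorphisms may be chosen independently of each other, so mere existence is
enough and no triangle identity has to be carried along. -/
theorem isVertEquiv_iff {w : A.Ver} : A.IsVertEquiv w ↔ ∃ z, A.IsVertInv w z := by
  constructor
  · rintro ⟨z, η, ε, h1, h2, h3, h4⟩
    exact ⟨z, h1, h2, VIso.symm ⟨η, h3⟩, ⟨ε, h4⟩⟩
  · rintro ⟨z, h1, h2, h3, h4⟩
    obtain ⟨η, h3⟩ := h3.symm
    obtain ⟨ε, h4⟩ := h4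
    exact ⟨z, η, ε, h1, h2, h3, h4⟩

namespace IsVertInv

variable {w z w' z' : A.Ver}

attribute [grind →] dom_eq cod_eq

theorem symm (h : A.IsVertInv w z) : A.IsVertInv z w := by
  refine ⟨by grind, by grind, ?_, ?_⟩
  · have := h.inv'
    rwa [← h.dom_eq] at this
  · have := h.inv
    rwa [← h.cod_eq] at this

theorem isVertEquiv (h : A.IsVertInv w z) : A.IsVertEquiv w := isVertEquiv_iff.2 ⟨z, h⟩

/-- `w w' z' z` is isomorphic to `w z` if `w' z'` is isomorphic to an identity. -/
theorem cc_aux (h : A.VIso (A.ver.cc w' z') (A.ver.id (A.ver.dom w')))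
    (h₁ : A.ver.cod w = A.ver.dom w') (h₂ : A.ver.cod w' = A.ver.dom z')
    (h₃ : A.ver.cod z' = A.ver.dom z) :
    A.VIso (A.ver.cc (A.ver.cc w w') (A.ver.cc z' z)) (A.ver.cc w z) := by
  rw [A.ver.cc_mid h₁ h₂ h₃]
  have h4 : A.ver.dom z = A.ver.dom w' := by grind
  refine (VIso.cc (VIso.refl w) (VIso.cc h (VIso.refl z) (by grind)) (by grind)).trans ?_
  exact VIso.of_eq (by grind)

theorem cc (h : A.IsVertInv w z) (h' : A.IsVertInv w' z') (e : A.ver.cod w = A.ver.dom w') :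
    A.IsVertInv (A.ver.cc w w') (A.ver.cc z' z) := by
  have i := h.inv
  have i' := h'.inv'
  have e1 : A.VIso (A.ver.cc z w) (A.ver.id (A.ver.dom z)) := by
    have := h.inv'
    rwa [← h.dom_eq] at this
  refine ⟨by grind, by grind, ?_, ?_⟩
  · refine (cc_aux h'.inv e (by grind) (by grind)).trans ?_
    rwa [A.ver.dom_cc]
  · refine (cc_aux e1 (by grind) (by grind) (by grind)).trans ?_
    rwa [A.ver.cod_cc e]

theorem of_vIso (h : A.IsVertInv w z) (i : A.VIso w w') : A.IsVertInv w' z := by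
  have hi := h.inv
  have hi' := h.inv'
  refine ⟨by grind, by grind, ?_, ?_⟩
  · rw [i.dom_eq]
    exact (VIso.cc i.symm (VIso.refl z) (by grind)).trans hi
  · rw [i.cod_eq]
    exact (VIso.cc (VIso.refl z) i.symm (by grind)).trans hi'

end IsVertInv

theorem IsVertEquiv.cc {w w' : A.Ver} (h : A.IsVertEquiv w) (h' : A.IsVertEquiv w')
    (e : A.ver.cod w = A.ver.dom w') : A.IsVertEquiv (A.ver.cc w w') := by
  obtain ⟨z, h⟩ := isVertEquiv_iff.1 h
  obtain ⟨z', h'⟩ := isVertEquiv_iff.1 h'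
  exact (h.cc h' e).isVertEquiv

theorem IsVertEquiv.of_vIso {w w' : A.Ver} (h : A.IsVertEquiv w) (i : A.VIso w w') :
    A.IsVertEquiv w' := by
  obtain ⟨z, h⟩ := isVertEquiv_iff.1 h
  exact (h.of_vIso i).isVertEquiv

/-! ### Whiskering by a vertical equivalence -/

/-- Conjugating by an isomorphism `ε : z g ≅ id`. -/
theorem whisker_conj {ε γ : A.Sq} {v : A.Ver} {b : A.Obj} (hε : A.IsVertIso ε v (A.ver.id b))
    (hγ : A.top γ = A.hor.id b) :
    A.hc (A.vc (A.hid v) γ) (A.vc ε (A.hid (A.rgt γ))) = A.hc (A.vc ε (A.hid (A.lft γ))) γ := by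
  have := hε.bdry
  have h1 := whisker_exchange (A := A) (α := ε) (β := γ) (a := b) (by grind) hγ
  rw [this.lft, this.rgt] at h1
  rw [h1.2, ← h1.1]
  grind

/-- If `z` is inverse to `g`, whiskering further by `z` amounts to whiskering by `z g`. Through an
isomorphism from `z g` to the identity this is conjugate to doing nothing, and conjugation by an
isomorphism is injective. -/
theorem whisker_inj {g : A.Ver} (hg : A.IsVertEquiv g) {γ γ' : A.Sq}
    (h : A.top γ = A.hor.id (A.ver.cod g)) (h' : A.top γ' = A.hor.id (A.ver.cod g))
    (hl : A.lft γ = A.lft γ') (hr : A.rgt γ = A.rgt γ')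
    (e : A.vc (A.hid g) γ = A.vc (A.hid g) γ') : γ = γ' := by
  obtain ⟨z, hz⟩ := isVertEquiv_iff.1 hg
  obtain ⟨ε, hε⟩ := hz.inv'
  have e2 : A.vc (A.hid (A.ver.cc z g)) γ = A.vc (A.hid (A.ver.cc z g)) γ' := by
    rw [A.hid_cc hz.cod_eq, vassoc (by grind) (by grind), vassoc (by grind) (by grind), e]
  have c1 := whisker_conj hε h
  have c2 := whisker_conj hε h'
  rw [e2, hl, hr, c2] at c1
  have i : A.IsVertIso (A.vc ε (A.hid (A.lft γ'))) (A.ver.cc (A.ver.cc z g) (A.lft γ'))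
      (A.ver.cc (A.ver.id (A.ver.cod g)) (A.lft γ')) :=
    hε.vcomp (IsVertIso.refl _) (by grind)
  obtain ⟨δ, hδ, -, d⟩ := i.exists_inv
  have bδ := hδ.bdry
  have hb := i.bdry
  have hl' : A.ver.cc (A.ver.id (A.ver.cod g)) (A.lft γ') = A.lft γ' := by grind
  rw [hl'] at d hb
  have t1 : A.hc (A.hc δ (A.vc ε (A.hid (A.lft γ')))) γ =
      A.hc (A.hc δ (A.vc ε (A.hid (A.lft γ')))) γ' := by
    rw [hassoc (by grind) (by grind), hassoc (by grind) (by grind), ← c1]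
  grind

/-- A preimage of `δ` is found by whiskering `δ` with an inverse `z` of `g` and conjugating by the
isomorphism from `z g` to the identity. -/
theorem whisker_surj {g : A.Ver} (hg : A.IsVertEquiv g) {δ : A.Sq} {p q : A.Ver}
    (ht : A.top δ = A.hor.id (A.ver.dom g)) (hp : A.ver.dom p = A.ver.cod g)
    (hq : A.ver.dom q = A.ver.cod g) (hl : A.lft δ = A.ver.cc g p) (hr : A.rgt δ = A.ver.cc g q) :
    ∃ γ, A.HasBdry γ (A.hor.id (A.ver.cod g)) (A.bot δ) p q ∧ A.vc (A.hid g) γ = δ := by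
  obtain ⟨z, hz⟩ := isVertEquiv_iff.1 hg
  obtain ⟨ε, hε⟩ := hz.inv'
  have hb := hε.bdry
  have hp' : A.ver.cc (A.ver.id (A.ver.cod g)) p = p := by grind
  have hq' : A.ver.cc (A.ver.id (A.ver.cod g)) q = q := by grind
  have ip := hε.vcomp (IsVertIso.refl p) (by grind)
  have iq := hε.vcomp (IsVertIso.refl q) (by grind)
  rw [hp'] at ip
  rw [hq'] at iq
  obtain ⟨ε', hε', e1, e2⟩ := ip.exists_inv
  have bp := ip.bdry
  have bq := iq.bdry
  have bp' := hε'.bdry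
  have azp : A.ver.cc (A.ver.cc z g) p = A.ver.cc z (A.ver.cc g p) := by grind
  have azq : A.ver.cc (A.ver.cc z g) q = A.ver.cc z (A.ver.cc g q) := by grind
  have bδ : A.HasBdry (A.vc (A.hid z) δ) (A.hor.id (A.ver.dom z)) (A.bot δ)
    (A.ver.cc (A.ver.cc z g) p) (A.ver.cc (A.ver.cc z g) q) :=
    ⟨by grind, by grind, by grind, by grind⟩
  have bγ : A.HasBdry (A.hc ε' (A.hc (A.vc (A.hid z) δ) (A.vc ε (A.hid q))))
      (A.hor.id (A.ver.cod g)) (A.bot δ) p q := 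
    ⟨by grind, by grind, by grind, by grind⟩
  refine ⟨_, bγ, ?_⟩
  generalize hγ : A.hc ε' (A.hc (A.vc (A.hid z) δ) (A.vc ε (A.hid q))) = γ at *
  have hγt : A.top γ = A.hor.id (A.ver.cod g) := bγ.top
  -- Whiskering by `z` is faithful as well, so it suffices to compare after whiskering with `z`.
  -- This takes the place of a triangle identity.
  apply whisker_inj hz.symm.isVertEquiv (by grind) (by grind) (by grind) (by grind)
  have c := whisker_conj hε hγt
  rw [bγ.lft, bγ.rgt] at c
  have e3 : A.hc (A.vc ε (A.hid p)) γ = A.hc (A.vc (A.hid z) δ) (A.vc ε (A.hid q)) := by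
    rw [← hγ, ← hassoc (by grind) (by grind), e1]
    grind
  rw [e3] at c
  obtain ⟨κ, hκ, k1, k2⟩ := iq.exists_inv
  have bκ := hκ.bdry
  have c2 := congrArg (A.hc · κ) c
  rw [hassoc (by grind) (by grind), hassoc (by grind) (by grind), k1] at c2
  rw [← vassoc (by grind) (by grind), ← A.hid_cc (by grind)]
  grind
end DblCat

/-! ### Functors out of the free category on two opposite arrows -/

/-- The image of the alternating word of length `n` starting at `x`. -/
noncomputable def wordAux {O M : Type u} (C : CatStr O M) (o : Two.{u} → O) (m : Two.{u} → M) :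
    ℕ → Two.{u} → M
  | 0, x => C.id (o x)
  | n + 1, x => C.cc (m x) (wordAux C o m n x.flip)

/-- The functor from `E_adj` with prescribed values on the two generators. -/
noncomputable def wordMap {O M : Type u} (C : CatStr O M) (o : Two.{u} → O) (m : Two.{u} → M)
    (w : AltWord.{u}) : M := wordAux C o m w.len w.start

section
variable {O M : Type u} {C : CatStr O M} {o : Two.{u} → O} {m : Two.{u} → M}

theorem eAdj_cc (x : Two.{u}) (n k : ℕ) :
    eAdjCat.cc ⟨x, n⟩ ⟨Two.flip^[n] x, k⟩ = ⟨x, n + k⟩ := by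
  rw [eAdjCat.cc_eq rfl]; rfl

theorem dom_wordAux (hd : ∀ x, C.dom (m x) = o x) (n : ℕ) (x : Two.{u}) :
    C.dom (wordAux C o m n x) = o x := by
  cases n with
  | zero => exact C.dom_id _
  | succ n => rw [wordAux, C.dom_cc, hd]

theorem cod_wordAux (hd : ∀ x, C.dom (m x) = o x) (hc : ∀ x, C.cod (m x) = o x.flip) (n : ℕ) :
    ∀ x : Two.{u}, C.cod (wordAux C o m n x) = o (Two.flip^[n] x) := by
  induction n with
  | zero => intro x; exact C.cod_id _
  | succ n ih =>
    intro x
    rw [wordAux, C.cod_cc (by rw [hc, dom_wordAux hd]), ih, Function.iterate_succ_apply]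

theorem wordAux_add (hd : ∀ x, C.dom (m x) = o x) (hc : ∀ x, C.cod (m x) = o x.flip) (n k : ℕ) :
    ∀ x : Two.{u}, wordAux C o m (n + k) x =
      C.cc (wordAux C o m n x) (wordAux C o m k (Two.flip^[n] x)) := by
  induction n with
  | zero =>
    intro x
    rw [Nat.zero_add]
    exact (C.id_cc (dom_wordAux hd k x).symm).symm
  | succ n ih =>
    intro x
    rw [Nat.succ_add, wordAux, wordAux, ih, C.cc_assoc, Function.iterate_succ_apply]
    · rw [hc, dom_wordAux hd]
    · rw [cod_wordAux hd hc, dom_wordAux hd, Function.iterate_succ_apply]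

/-- Existence half of the freeness of `eAdjCat` on its two letters. -/
theorem wordMap_isFun (hd : ∀ x, C.dom (m x) = o x) (hc : ∀ x, C.cod (m x) = o x.flip) :
    CatStr.IsFun eAdjCat C o (wordMap C o m) where
  dom w := dom_wordAux hd _ _
  cod w := cod_wordAux hd hc _ _
  id a := rfl
  cc := by
    rintro ⟨x, n⟩ ⟨y, k⟩ (rfl : Two.flip^[n] x = y)
    rw [eAdj_cc]
    exact wordAux_add hd hc n k x

theorem wordMap_letter (hc : ∀ x, C.cod (m x) = o x.flip) (x : Two.{u}) :
    wordMap C o m ⟨x, 1⟩ = m x :=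
  C.cc_id (hc x)

/-- Uniqueness half of freeness: a word is the composite of its letters. -/
theorem CatStr.IsFun.eq_wordMap {n : AltWord.{u} → M} (h : CatStr.IsFun eAdjCat C o n) :
    n = wordMap C o (fun x => n ⟨x, 1⟩) := by
  funext ⟨x, k⟩
  induction k generalizing x with
  | zero => exact h.id x
  | succ k ih =>
    have e := eAdj_cc x 1 k
    rw [Nat.add_comm 1 k] at e
    refine ((congrArg n e).symm.trans (h.cc _ _ rfl)).trans ?_
    exact congrArg _ (ih x.flip)

end

/-! ### Double functors out of `𝕍 C` when each object is equivalent to a fixed one -/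

namespace DblCat

/-- A functor `W` from `C` to the category of vertical morphisms of `P`, with a pseudo cocone `c`
under a fixed object consisting of equivalences. -/
structure VertCone {O M : Type u} (C : CatStr O M) (P : DblCat.{u}) where
  obj : O → P.Obj
  ver : M → P.Ver
  leg : O → P.Ver
  cell : M → P.Sq
  ver_fun : CatStr.IsFun C P.ver obj ver
  cod_leg : ∀ x, P.ver.cod (leg x) = obj x
  leg_equiv : ∀ x, P.IsVertEquiv (leg x)
  cell_iso : ∀ w, P.IsVertIso (cell w) (P.ver.cc (leg (C.dom w)) (ver w)) (leg (C.cod w))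
  cell_cc : ∀ w z, C.cod w = C.dom z →
    cell (C.cc w z) = P.hc (P.vc (cell w) (P.hid (ver z))) (cell z)

namespace VertCone

variable {O M : Type u} {C : CatStr O M} {P : DblCat.{u}} (K : VertCone C P)

/-- The square `γ` is the comparison of the images of the parallel morphisms `w` and `z`. -/
structure IsCell (γ : P.Sq) (w z : M) : Prop where
  bdry : P.HasBdry γ (P.hor.id (K.obj (C.dom w))) (P.hor.id (K.obj (C.cod w))) (K.ver w) (K.ver z)
  dom_eq : C.dom w = C.dom z
  cod_eq : C.cod w = C.cod z
  eq : P.hc (P.vc (P.hid (K.leg (C.dom w))) γ) (K.cell z) = K.cell w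

variable {K}

attribute [grind →] IsCell.bdry IsCell.dom_eq IsCell.cod_eq

variable (K) in
theorem cell_bdry (w : M) : P.HasBdry (K.cell w) (P.hor.id (P.ver.dom (K.leg (C.dom w))))
    (P.hor.id (K.obj (C.cod w))) (P.ver.cc (K.leg (C.dom w)) (K.ver w)) (K.leg (C.cod w)) := by
  have h := (K.cell_iso w).bdry
  have h1 := K.ver_fun.dom w
  have h2 := K.ver_fun.cod w
  have h3 := K.cod_leg (C.dom w)
  exact h.cast (by grind) (by grind) rfl rfl

/-- Since the cell of `z` is invertible, the defining equation determines the whiskering of `γ` by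
the leg, and whiskering by an equivalence is faithful. -/
theorem IsCell.unique {γ γ' : P.Sq} {w z : M}
    (h : K.IsCell γ w z) (h' : K.IsCell γ' w z) : γ = γ' := by
  have b := h.bdry
  have b' := h'.bdry
  have l := K.cod_leg (C.dom w)
  refine whisker_inj (K.leg_equiv (C.dom w)) (by grind) (by grind) (by grind) (by grind) ?_
  obtain ⟨δ, hδ, d, -⟩ := (K.cell_iso z).exists_inv
  have bz := K.cell_bdry z
  have bδ := hδ.bdry
  have e := h.eq.trans h'.eq.symm
  have e2 := congrArg (P.hc · δ) e
  rw [hassoc (by grind) (by grind), hassoc (by grind) (by grind), d] at e2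
  grind

-- The cell of `w` followed by the inverse of the cell of `z` is the desired comparison already
-- whiskered by the leg, and whiskering by an equivalence is full.
variable (K) in
theorem exists_cell {w z : M} (hd : C.dom w = C.dom z) (hc : C.cod w = C.cod z) :
    ∃ γ, K.IsCell γ w z := by
  obtain ⟨δ, hδ, d, d'⟩ := (K.cell_iso z).exists_inv
  have bz := K.cell_bdry z
  have bw := K.cell_bdry w
  have bδ := hδ.bdry
  have l := K.cod_leg (C.dom w)
  have w1 := K.ver_fun.dom w
  have w2 := K.ver_fun.cod w
  have z1 := K.ver_fun.dom z
  obtain ⟨γ, h1, h2⟩ := whisker_surj (K.leg_equiv (C.dom w)) (δ := P.hc (K.cell w) δ)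
    (p := K.ver w) (q := K.ver z) (by grind) (by grind) (by grind) (by grind) (by grind)
  refine ⟨γ, ⟨by grind, by grind, by grind, by grind⟩, by grind, by grind, ?_⟩
  rw [h2, hassoc (by grind) (by grind), d']
  grind

theorem IsCell.cast {γ γ' : P.Sq} {w z : M} (h : K.IsCell γ w z) (e : γ = γ') : K.IsCell γ' w z :=
  e ▸ h

/-- Comparison cells are closed under identities and under both compositions. As they are unique,
this makes the choice of one for each pair of parallel morphisms functorial. -/
theorem IsCell.refl (w : M) : K.IsCell (P.hid (K.ver w)) w w := by
  have w1 := K.ver_fun.dom w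
  have w2 := K.ver_fun.cod w
  have l := K.cod_leg (C.dom w)
  have bw := K.cell_bdry w
  refine ⟨⟨by grind, by grind, by grind, by grind⟩, by grind, by grind, ?_⟩
  rw [← P.hid_cc (by grind)]
  grind

theorem IsCell.hc {γ δ : P.Sq} {w z y : M} (h : K.IsCell γ w z) (h' : K.IsCell δ z y) : K.IsCell (P.hc γ δ) w y := by
  have b := h.bdry
  have b' := h'.bdry
  have l := K.cod_leg (C.dom w)
  have by' := K.cell_bdry y
  have w1 := K.ver_fun.dom y
  have e1 := h.eq
  have e2 := h'.eq
  refine ⟨⟨by grind, by grind, by grind, by grind⟩, by grind, by grind, ?_⟩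
  rw [hid_vc_hc (by grind) (by grind) (by grind), hassoc (by grind) (by grind)]
  grind

theorem IsCell.vc {γ δ : P.Sq} {w z w' z' : M} (h : K.IsCell γ w w') (h' : K.IsCell δ z z')
    (e : C.cod w = C.dom z) :
    K.IsCell (P.vc γ δ) (C.cc w z) (C.cc w' z') := by
  have b := h.bdry
  have b' := h'.bdry
  have l := K.cod_leg (C.dom w)
  have l' := K.cod_leg (C.cod w)
  have bw := K.cell_bdry w
  have bw' := K.cell_bdry w'
  have bz := K.cell_bdry z
  have bz' := K.cell_bdry z'
  have w1 := K.ver_fun.dom w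
  have z1 := K.ver_fun.dom z
  have w1' := K.ver_fun.dom w'
  have z1' := K.ver_fun.dom z'
  have w2 := K.ver_fun.cod w
  have w2' := K.ver_fun.cod w'
  have e1 := h.eq
  have e2 := h'.eq
  have f1 := K.ver_fun.cc w z e
  have f2 := K.ver_fun.cc w' z' (by grind)
  refine ⟨⟨by grind, by grind, by grind, by grind⟩, by grind, by grind, ?_⟩
  -- The equation for `γ` creates the cell of `w`; then `δ` slides past that cell by exchange, so
  -- that the equation for `δ` becomes applicable.
  have a1 : P.hc (P.vc (P.vc (P.hid (K.leg (C.dom w))) γ) δ) (P.vc (K.cell w') (P.hid (K.ver z'))) =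
      P.hc (P.vc (K.cell w) (P.hid (K.ver z))) (P.vc (P.hid (K.leg (C.cod w))) δ) := by
    have x := (whisker_exchange (A := P) (α := K.cell w) (β := δ) (a := K.obj (C.cod w)) (by grind)
      (by grind)).1
    rw [b'.lft, bw.rgt] at x
    rw [← ichg (by grind) (by grind) (by grind) (by grind), e1, x]
    grind
  rw [K.cell_cc _ _ e, K.cell_cc w' z' (by grind), C.dom_cc, ← hassoc (by grind) (by grind),
    ← vassoc (by grind) (by grind), a1, hassoc (by grind) (by grind), ← e2, e]

/-- The image of a 2-cell under the double functor determined by a cone. -/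
noncomputable def sq (K : VertCone C P) (p : ParPair C) : P.Sq :=
  (K.exists_cell p.dom_eq p.cod_eq).choose

theorem sq_isCell (K : VertCone C P) (p : ParPair C) : K.IsCell (K.sq p) p.fst p.snd :=
  (K.exists_cell p.dom_eq p.cod_eq).choose_spec

theorem sq_eq {p : ParPair C} {γ : P.Sq} (h : K.IsCell γ p.fst p.snd) : K.sq p = γ :=
  (K.sq_isCell p).unique h

/-- The double functor determined by a cone. -/
noncomputable def toFunctor (K : VertCone C P) : DblFunctor (verOf C) P where
  obj := K.obj
  hor a := P.hor.id (K.obj a)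
  ver := K.ver
  sq := K.sq
  hor_fun := CatStr.IsFun.of_comp (fun a => P.hor.dom_id _) (fun a => P.hor.cod_id _)
    (fun _ => rfl) (fun a b h h' => by rw [P.hor.comp_id]; rfl)
  ver_fun := K.ver_fun
  sqh_fun := CatStr.IsFun.of_comp (fun p => (K.sq_isCell p).bdry.lft)
    (fun p => (K.sq_isCell p).bdry.rgt) (fun w => sq_eq (IsCell.refl w))
    (fun p q h h' => by
      rw [← P.sqh.cc_eq]
      have e : p.snd = q.fst := h
      have h1 := K.sq_isCell p
      rw [e] at h1
      exact sq_eq (h1.hc (K.sq_isCell q)))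
  sqv_fun := CatStr.IsFun.of_comp (fun p => (K.sq_isCell p).bdry.top)
    (fun p => (K.sq_isCell p).bdry.bot)
    (fun a => by
      have := IsCell.refl (K := K) (C.id a)
      refine sq_eq (p := ⟨C.id a, C.id a, rfl, rfl⟩) (this.cast ?_)
      exact (congrArg P.hid (K.ver_fun.id a)).trans (P.hid_id _))
    (fun p q h h' => by
      rw [← P.sqv.cc_eq]
      have h2 : C.cod p.snd = C.dom q.snd := p.cod_eq.symm.trans (Eq.trans h q.dom_eq)
      have := (K.sq_isCell p).vc (K.sq_isCell q) h
      rw [C.cc_eq h, C.cc_eq h2] at this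
      exact sq_eq (p := (verOf C).sqv.comp p q h) this)

end VertCone

end DblCat

/-! ### Double functors preserve composites and boundaries -/

namespace DblFunctor
variable {A B : DblCat.{u}} (F : DblFunctor A B)

theorem sq_hc {α β : A.Sq} (h : A.rgt α = A.lft β) : F.sq (A.hc α β) = B.hc (F.sq α) (F.sq β) :=
  F.sqh_fun.cc _ _ h
theorem sq_vc {α β : A.Sq} (h : A.bot α = A.top β) : F.sq (A.vc α β) = B.vc (F.sq α) (F.sq β) :=
  F.sqv_fun.cc _ _ h
theorem sq_hid (w : A.Ver) : F.sq (A.hid w) = B.hid (F.ver w) := F.sqh_fun.id w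
theorem sq_vid (f : A.Hor) : F.sq (A.vid f) = B.vid (F.hor f) := F.sqv_fun.id f
theorem top_sq (α : A.Sq) : B.top (F.sq α) = F.hor (A.top α) := F.sqv_fun.dom α
theorem bot_sq (α : A.Sq) : B.bot (F.sq α) = F.hor (A.bot α) := F.sqv_fun.cod α
theorem lft_sq (α : A.Sq) : B.lft (F.sq α) = F.ver (A.lft α) := F.sqh_fun.dom α
theorem rgt_sq (α : A.Sq) : B.rgt (F.sq α) = F.ver (A.rgt α) := F.sqh_fun.cod α
theorem dom_hor (f : A.Hor) : B.hor.dom (F.hor f) = F.obj (A.hor.dom f) := F.hor_fun.dom f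
theorem cod_hor (f : A.Hor) : B.hor.cod (F.hor f) = F.obj (A.hor.cod f) := F.hor_fun.cod f
theorem dom_ver (w : A.Ver) : B.ver.dom (F.ver w) = F.obj (A.ver.dom w) := F.ver_fun.dom w
theorem cod_ver (w : A.Ver) : B.ver.cod (F.ver w) = F.obj (A.ver.cod w) := F.ver_fun.cod w
theorem hor_id (a : A.Obj) : F.hor (A.hor.id a) = B.hor.id (F.obj a) := F.hor_fun.id a
theorem ver_id (a : A.Obj) : F.ver (A.ver.id a) = B.ver.id (F.obj a) := F.ver_fun.id a
theorem hor_cc {f g : A.Hor} (h : A.hor.cod f = A.hor.dom g) :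
    F.hor (A.hor.cc f g) = B.hor.cc (F.hor f) (F.hor g) := F.hor_fun.cc _ _ h
theorem ver_cc {f g : A.Ver} (h : A.ver.cod f = A.ver.dom g) :
    F.ver (A.ver.cc f g) = B.ver.cc (F.ver f) (F.ver g) := F.ver_fun.cc _ _ h

attribute [grind =] sq_hc sq_vc sq_hid sq_vid top_sq bot_sq lft_sq rgt_sq dom_hor cod_hor dom_ver
  cod_ver hor_id ver_id hor_cc ver_cc

theorem map_bdry {α : A.Sq} {f g : A.Hor} {v w : A.Ver} (h : A.HasBdry α f g v w) :
    B.HasBdry (F.sq α) (F.hor f) (F.hor g) (F.ver v) (F.ver w) :=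
  ⟨by grind, by grind, by grind, by grind⟩

theorem map_isVertIso {α : A.Sq} {v w : A.Ver} (h : A.IsVertIso α v w) :
    B.IsVertIso (F.sq α) (F.ver v) (F.ver w) := by
  obtain ⟨β, hβ, e1, e2⟩ := h.exists_inv
  have b := hβ.bdry
  have b' := h.bdry
  have e1' := congrArg F.sq e1
  have e2' := congrArg F.sq e2
  rw [F.sq_hc (by grind), F.sq_hid] at e1' e2'
  exact .of_inv ⟨by grind, by grind, by grind, by grind⟩ (by grind) (by grind) e1' e2'

theorem map_vIso {v w : A.Ver} (h : A.VIso v w) : B.VIso (F.ver v) (F.ver w) :=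
  h.elim fun _ h => ⟨_, F.map_isVertIso h⟩

theorem map_isVertInv {v w : A.Ver} (h : A.IsVertInv v w) : B.IsVertInv (F.ver v) (F.ver w) := by
  have h1 := F.map_vIso h.inv
  have h2 := F.map_vIso h.inv'
  rw [F.ver_cc (by grind), F.ver_id, ← F.dom_ver] at h1
  rw [F.ver_cc (by grind), F.ver_id, ← F.cod_ver] at h2
  exact ⟨by grind, by grind, h1, h2⟩

theorem map_isVertEquiv {w : A.Ver} (h : A.IsVertEquiv w) : B.IsVertEquiv (F.ver w) := by
  obtain ⟨z, h⟩ := DblCat.isVertEquiv_iff.1 h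
  exact (F.map_isVertInv h).isVertEquiv

theorem map_isCompanionPair {f : A.Hor} {w : A.Ver} {φ ψ : A.Sq} (h : A.IsCompanionPair f w φ ψ) :
    B.IsCompanionPair (F.hor f) (F.ver w) (F.sq φ) (F.sq ψ) := by
  have h1 := F.map_bdry h.φ_bdry
  have h2 := F.map_bdry h.ψ_bdry
  have b1 := h.φ_bdry
  have b2 := h.ψ_bdry
  refine ⟨h1.cast rfl (by grind) rfl (by grind), h2.cast (by grind) rfl (by grind) rfl, ?_, ?_⟩
  · rw [← F.sq_hc (by grind), h.hor_eq, F.sq_vid]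
  · rw [← F.sq_vc (by grind), h.ver_eq, F.sq_hid]

theorem map_isConjointPair {f : A.Hor} {w : A.Ver} {ε η : A.Sq} (h : A.IsConjointPair f w ε η) :
    B.IsConjointPair (F.hor f) (F.ver w) (F.sq ε) (F.sq η) := by
  have h1 := F.map_bdry h.ε_bdry
  have h2 := F.map_bdry h.η_bdry
  have b1 := h.ε_bdry
  have b2 := h.η_bdry
  refine ⟨h1.cast rfl (by grind) (by grind) rfl, h2.cast (by grind) rfl rfl (by grind), ?_, ?_⟩
  · rw [← F.sq_hc (by grind), h.hor_eq, F.sq_vid]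
  · rw [← F.sq_vc (by grind), h.ver_eq, F.sq_hid]

end DblFunctor

namespace DblCat

/-! ### Double functors out of `𝕍 E_adj` -/

/-- An equivalence in the vertical 2-category, with one of the two structure isomorphisms. -/
@[ext]
structure VertAdj (P : DblCat.{u}) where
  obj : Two.{u} → P.Obj
  arr : Two.{u} → P.Ver
  cell : P.Sq
  dom_arr : ∀ x, P.ver.dom (arr x) = obj x
  cod_arr : ∀ x, P.ver.cod (arr x) = obj x.flip
  equiv : P.IsVertEquiv (arr .zero)
  cell_iso : P.IsVertIso cell (P.ver.cc (arr .zero) (arr .one)) (P.ver.id (obj .zero))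

namespace VertAdj

variable {P : DblCat.{u}} (D : VertAdj P)

/-- The image of the alternating word of length `n` starting at `x`. -/
noncomputable def wrd (n : ℕ) (x : Two.{u}) : P.Ver := wordAux P.ver D.obj D.arr n x

theorem dom_wrd (n : ℕ) (x : Two.{u}) : P.ver.dom (D.wrd n x) = D.obj x :=
  dom_wordAux D.dom_arr n x

theorem cod_wrd (n : ℕ) (x : Two.{u}) : P.ver.cod (D.wrd n x) = D.obj (Two.flip^[n] x) :=
  cod_wordAux D.dom_arr D.cod_arr n x

/-- The legs of the cone determined by an equivalence. -/
def leg : Two.{u} → P.Ver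
  | .zero => P.ver.id (D.obj .zero)
  | .one => D.arr .zero

/-- The generating cells of the cone determined by an equivalence. -/
def step : Two.{u} → P.Sq
  | .zero => P.hid (D.arr .zero)
  | .one => D.cell

theorem cod_leg (x : Two.{u}) : P.ver.cod (D.leg x) = D.obj x := by
  cases x
  · exact P.ver.cod_id _
  · exact D.cod_arr .zero

theorem isVertEquiv_id (a : P.Obj) : P.IsVertEquiv (P.ver.id a) := by
  refine IsVertInv.isVertEquiv (z := P.ver.id a) ⟨by grind, by grind, ?_, ?_⟩ <;>
  exact VIso.of_eq (by grind)

theorem leg_equiv (x : Two.{u}) : P.IsVertEquiv (D.leg x) := by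
  cases x
  · exact isVertEquiv_id _
  · exact D.equiv

theorem step_iso (x : Two.{u}) :
    P.IsVertIso (D.step x) (P.ver.cc (D.leg x) (D.arr x)) (D.leg x.flip) := by
  cases x
  · have := IsVertIso.refl (A := P) (D.arr .zero)
    have e : P.ver.cc (D.leg .zero) (D.arr .zero) = D.arr .zero :=
      P.ver.id_cc (D.dom_arr .zero).symm
    rw [e]
    exact this
  · exact D.cell_iso

/-- The cells of the cone determined by an equivalence. -/
noncomputable def cells : ℕ → Two.{u} → P.Sq
  | 0, x => P.hid (D.leg x)
  | n + 1, x => P.hc (P.vc (D.step x) (P.hid (D.wrd n x.flip))) (cells n x.flip)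

theorem cells_iso (n : ℕ) : ∀ x : Two.{u}, P.IsVertIso (D.cells n x)
    (P.ver.cc (D.leg x) (D.wrd n x)) (D.leg (Two.flip^[n] x)) := by
  induction n with
  | zero =>
    intro x
    have e : P.ver.cc (D.leg x) (D.wrd 0 x) = D.leg x := P.ver.cc_id (D.cod_leg x)
    rw [e]
    exact IsVertIso.refl _
  | succ n ih =>
    intro x
    have h1 := (D.step_iso x).vcomp (IsVertIso.refl (D.wrd n x.flip))
      (by rw [P.ver.cod_cc, D.cod_arr, D.dom_wrd]; rw [D.cod_leg, D.dom_arr])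
    have e : P.ver.cc (P.ver.cc (D.leg x) (D.arr x)) (D.wrd n x.flip) =
        P.ver.cc (D.leg x) (D.wrd (n + 1) x) :=
      P.ver.cc_assoc (by rw [D.cod_leg, D.dom_arr]) (by rw [D.cod_arr, D.dom_wrd])
    rw [e] at h1
    exact h1.trans (ih x.flip)

/-- The cells are built letter by letter from the left, so this compatibility with concatenation
follows by induction on the first word; it supplies `cell_cc` for the cone. -/
theorem cells_add (n k : ℕ) : ∀ x : Two.{u}, D.cells (n + k) x =
    P.hc (P.vc (D.cells n x) (P.hid (D.wrd k (Two.flip^[n] x)))) (D.cells k (Two.flip^[n] x)) := by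
  induction n with
  | zero =>
    intro x
    have h := (D.cells_iso k x).bdry
    have h1 := D.cod_leg x
    have h2 := D.dom_wrd k x
    rw [Nat.zero_add]
    change D.cells k x = P.hc (P.vc (P.hid (D.leg x)) (P.hid (D.wrd k x))) (D.cells k x)
    rw [← P.hid_cc (by grind)]
    grind
  | succ n ih =>
    intro x
    rw [Nat.succ_add]
    change P.hc (P.vc (D.step x) (P.hid (D.wrd (n + k) x.flip))) (D.cells (n + k) x.flip) =
      P.hc (P.vc (P.hc (P.vc (D.step x) (P.hid (D.wrd n x.flip))) (D.cells n x.flip))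
        (P.hid (D.wrd k (Two.flip^[n] x.flip)))) (D.cells k (Two.flip^[n] x.flip))
    have e : D.wrd (n + k) x.flip = P.ver.cc (D.wrd n x.flip) (D.wrd k (Two.flip^[n] x.flip)) :=
      wordAux_add D.dom_arr D.cod_arr n k x.flip
    have a1 := D.dom_wrd n x.flip
    have a2 := D.cod_wrd n x.flip
    have a3 := D.dom_wrd k (Two.flip^[n] x.flip)
    have a4 := D.cod_leg x
    have a5 := D.cod_leg x.flip
    have a6 := D.cod_leg (Two.flip^[n] x.flip)
    have b1 := (D.step_iso x).bdry
    have b2 := (D.cells_iso n x.flip).bdry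
    have b3 := (D.cells_iso k (Two.flip^[n] x.flip)).bdry
    have a7 := D.dom_arr x
    have a8 := D.cod_arr x
    rw [ih, e, P.hid_cc (by grind), hc_vc_hid (by grind) (by grind) (by grind),
      ← vassoc (by grind) (by grind), ← hassoc (by grind) (by grind)]

/-- The cone determined by an equivalence. -/
noncomputable def toCone : VertCone eAdjCat P where
  obj := D.obj
  ver := wordMap P.ver D.obj D.arr
  leg := D.leg
  cell w := D.cells w.len w.start
  ver_fun := wordMap_isFun D.dom_arr D.cod_arr
  cod_leg := D.cod_leg
  leg_equiv := D.leg_equiv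
  cell_iso w := D.cells_iso w.len w.start
  cell_cc := by
    rintro ⟨x, n⟩ ⟨y, k⟩ (rfl : Two.flip^[n] x = y)
    rw [eAdj_cc]
    exact D.cells_add n k x

/-- The double functor from `𝕍 E_adj` determined by an equivalence. -/
noncomputable def toFunctor : DblFunctor (verOf eAdjCat) P := D.toCone.toFunctor

theorem toFunctor_ver_letter (x : Two.{u}) : D.toFunctor.ver ⟨x, 1⟩ = D.arr x :=
  wordMap_letter D.cod_arr x

theorem cells_one (x : Two.{u}) : D.cells 1 x = D.step x := by
  have a4 := D.cod_leg x
  have a5 := D.cod_leg x.flip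
  have b1 := (D.step_iso x).bdry
  have a7 := D.dom_arr x
  have a8 := D.cod_arr x
  change P.hc (P.vc (D.step x) (P.hid (P.ver.id (D.obj x.flip)))) (P.hid (D.leg x.flip)) = D.step x
  grind

end VertAdj

section
variable {O M : Type u} (C : CatStr O M)

theorem verOf_hc {p q : ParPair C} (h : p.snd = q.fst) :
    (verOf C).hc p q = ⟨p.fst, q.snd, by rw [p.dom_eq, h, q.dom_eq],
      by rw [p.cod_eq, h, q.cod_eq]⟩ := (verOf C).sqh.cc_eq h

theorem verOf_vc_fst {p q : ParPair C} (h : C.cod p.fst = C.dom q.fst) :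
    ParPair.fst ((verOf C).vc p q) = C.cc p.fst q.fst := by
  have h1 := (verOf C).sqv.cc_eq h
  have h2 := C.cc_eq h
  exact (congrArg ParPair.fst h1).trans h2.symm

theorem verOf_vc_snd {p q : ParPair C} (h : C.cod p.fst = C.dom q.fst) :
    ParPair.snd ((verOf C).vc p q) = C.cc p.snd q.snd := by
  have h1 := (verOf C).sqv.cc_eq h
  have h2 := C.cc_eq (f := p.snd) (g := q.snd) (p.cod_eq.symm.trans (h.trans q.dom_eq))
  exact (congrArg ParPair.snd h1).trans h2.symm

/-- Parallel morphisms of `C` have exactly one 2-cell in each direction, so reversing the pair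
inverts it. -/
theorem verOf_isVertIso (p : ParPair C) : (verOf C).IsVertIso p p.fst p.snd := by
  refine ⟨⟨rfl, rfl, rfl, rfl⟩, ⟨p.snd, p.fst, p.dom_eq.symm, p.cod_eq.symm⟩, rfl, rfl, ?_, ?_⟩
  · exact verOf_hc C rfl
  · exact verOf_hc C rfl

end

/-- Functors from `𝕍 C` preserve the isomorphy of parallel morphisms. -/
theorem map_verOf_vIso {O M : Type u} {C : CatStr O M} {P : DblCat.{u}}
    (T : DblFunctor (verOf C) P) (p : ParPair C) :
    P.IsVertIso (T.sq p) (T.ver p.fst) (T.ver p.snd) :=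
  T.map_isVertIso (verOf_isVertIso C p)

/-- Opposite generators are mutually inverse equivalences. -/
theorem map_eAdj_isVertInv {P : DblCat.{u}} (T : DblFunctor (verOf eAdjCat) P) (x : Two.{u}) :
    P.IsVertInv (T.ver ⟨x, 1⟩) (T.ver ⟨x.flip, 1⟩) := by
  refine T.map_isVertInv (A := verOf eAdjCat) (v := ⟨x, 1⟩) (w := ⟨x.flip, 1⟩) ⟨rfl, ?_, ?_, ?_⟩
  · cases x <;> rfl
  · refine ⟨⟨⟨x, 2⟩, ⟨x, 0⟩, rfl, by cases x <;> rfl⟩, ?_⟩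
    have e : (verOf eAdjCat).ver.cc (⟨x, 1⟩ : AltWord.{u}) ⟨x.flip, 1⟩ = (⟨x, 2⟩ : AltWord.{u}) :=
      eAdj_cc x 1 1
    rw [e]
    exact verOf_isVertIso eAdjCat _
  · refine ⟨⟨⟨x.flip, 2⟩, ⟨x.flip, 0⟩, rfl, by cases x <;> rfl⟩, ?_⟩
    have e : (verOf eAdjCat).ver.cc (⟨x.flip, 1⟩ : AltWord.{u}) ⟨x, 1⟩ =
        (⟨x.flip, 2⟩ : AltWord.{u}) := by
      have := eAdj_cc x.flip 1 1
      cases x <;> exact this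
    rw [e]
    exact verOf_isVertIso eAdjCat _

namespace VertAdj

variable {P : DblCat.{u}}

/-- The equivalence that is the image of the universal one. -/
def ofFunctor (T : DblFunctor (verOf eAdjCat) P) : VertAdj P where
  obj := T.obj
  arr x := T.ver ⟨x, 1⟩
  cell := T.sq ⟨⟨.zero, 2⟩, ⟨.zero, 0⟩, rfl, rfl⟩
  dom_arr x := T.ver_fun.dom ⟨x, 1⟩
  cod_arr x := T.ver_fun.cod ⟨x, 1⟩
  equiv := (map_eAdj_isVertInv T .zero).isVertEquiv
  cell_iso := by
    have h := map_verOf_vIso T ⟨⟨.zero, 2⟩, ⟨.zero, 0⟩, rfl, rfl⟩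
    have e := T.ver_fun.cc ⟨.zero, 1⟩ ⟨.one, 1⟩ rfl
    have e2 : (verOf eAdjCat).ver.cc (⟨.zero, 1⟩ : AltWord.{u}) ⟨.one, 1⟩ =
      (⟨.zero, 2⟩ : AltWord.{u}) := eAdj_cc .zero 1 1
    have e3 := T.ver_fun.id .zero
    rw [e2] at e
    rw [← e, ← e3]
    exact h

/-- The word from `zero` to `x` that is a leg of the universal cone. -/
def legWord (x : Two.{u}) : AltWord.{u} := ⟨.zero, match x with | .zero => 0 | .one => 1⟩

theorem cod_legWord (x : Two.{u}) : eAdjCat.cod (legWord x) = x := by cases x <;> rfl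

theorem cc_legWord (x : Two.{u}) (n : ℕ) :
    eAdjCat.cc (legWord x) ⟨x, n⟩ = ⟨.zero, (legWord x).len + n⟩ := by
  cases x
  · exact eAdj_cc .zero 0 n
  · exact eAdj_cc .zero 1 n

/-- The universal comparison cell. -/
def cellPair (n : ℕ) (x : Two.{u}) : ParPair eAdjCat.{u} :=
  ⟨⟨.zero, (legWord x).len + n⟩, legWord (Two.flip^[n] x), rfl, by
    rw [cod_legWord]
    have h : Two.flip^[n + (legWord x).len] Two.zero = Two.flip^[n] x := by
      rw [Function.iterate_add_apply]; exact congrArg _ (cod_legWord x)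
    rw [Nat.add_comm] at h
    exact h⟩

theorem leg_ofFunctor (T : DblFunctor (verOf eAdjCat) P) (x : Two.{u}) :
    (ofFunctor T).leg x = T.ver (legWord x) := by
  cases x
  · exact (T.ver_fun.id .zero).symm
  · rfl

/-- In `𝕍 E_adj` the recursive pasting that defines the cells of the cone is the unique 2-cell with
its boundary. The double functor `T` preserves this pasting. -/
theorem cells_ofFunctor (T : DblFunctor (verOf eAdjCat) P) (n : ℕ) :
    ∀ x : Two.{u}, (ofFunctor T).cells n x = T.sq (cellPair n x) := by
  induction n with
  | zero =>
    intro x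
    change P.hid ((ofFunctor T).leg x) = _
    rw [leg_ofFunctor]
    exact (T.sqh_fun.id (legWord x)).symm
  | succ n ih =>
    intro x
    have es : (ofFunctor T).step x = T.sq (cellPair 1 x) := by
      cases x
      · exact (T.sqh_fun.id ⟨.zero, 1⟩).symm
      · rfl
    have ew : (ofFunctor T).wrd n x.flip = T.ver ⟨x.flip, n⟩ :=
      (congrFun (CatStr.IsFun.eq_wordMap (C := P.ver) T.ver_fun) ⟨x.flip, n⟩).symm
    change P.hc (P.vc ((ofFunctor T).step x) (P.hid ((ofFunctor T).wrd n x.flip)))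
      ((ofFunctor T).cells n x.flip) = _
    have hc1 : eAdjCat.cod (cellPair 1 x).fst = x.flip :=
      (cellPair 1 x).cod_eq.trans (cod_legWord _)
    have e1 : ParPair.fst ((verOf eAdjCat).vc (cellPair 1 x) ((verOf eAdjCat).hid ⟨x.flip, n⟩)) =
        (cellPair (n + 1) x).fst := by
      refine (verOf_vc_fst eAdjCat (p := cellPair 1 x) (q := (verOf eAdjCat).hid ⟨x.flip, n⟩)
        hc1).trans ?_
      have := eAdj_cc .zero ((legWord x).len + 1) n
      rw [show Two.flip^[(legWord x).len + 1] Two.zero = x.flip from hc1] at this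
      exact this.trans (AltWord.ext rfl (by simp only [cellPair]; omega))
    have e2 : ParPair.snd ((verOf eAdjCat).vc (cellPair 1 x) ((verOf eAdjCat).hid ⟨x.flip, n⟩)) =
        (cellPair n x.flip).fst := by
      refine (verOf_vc_snd eAdjCat (p := cellPair 1 x) (q := (verOf eAdjCat).hid ⟨x.flip, n⟩)
        hc1).trans ?_
      exact cc_legWord x.flip n
    have E : (verOf eAdjCat).hc ((verOf eAdjCat).vc (cellPair 1 x)
        ((verOf eAdjCat).hid ⟨x.flip, n⟩)) (cellPair n x.flip) = cellPair (n + 1) x := by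
      refine (verOf_hc eAdjCat e2).trans (ParPair.ext e1 rfl)
    refine Eq.trans ?_ (congrArg T.sq E)
    refine Eq.trans ?_ (T.sq_hc (α := (verOf eAdjCat).vc (cellPair 1 x)
      ((verOf eAdjCat).hid ⟨x.flip, n⟩)) (β := cellPair n x.flip) e2).symm
    refine congrArg₂ P.hc ?_ (ih _)
    refine Eq.trans ?_ (T.sq_vc (α := cellPair 1 x) (β := (verOf eAdjCat).hid ⟨x.flip, n⟩)
      hc1).symm
    exact congrArg₂ P.vc es ((congrArg P.hid ew).trans (T.sq_hid _).symm)

/-- The values of `T` on 2-cells satisfy the equation that characterises comparison cells, because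
that equation already holds in `𝕍 E_adj`, where 2-cells are unique, and `T` preserves pasting. The
solution is unique. -/
theorem eq_toFunctor (T : DblFunctor (verOf eAdjCat) P) : T = (ofFunctor T).toFunctor := by
  have hv : T.ver = (ofFunctor T).toFunctor.ver := CatStr.IsFun.eq_wordMap (C := P.ver) T.ver_fun
  refine DblFunctor.ext rfl ?_ hv ?_
  · funext a
    exact T.hor_fun.id a
  · funext p
    refine (VertCone.sq_eq ?_).symm
    rcases p with ⟨⟨x, n⟩, ⟨y, k⟩, h1, h2⟩
    obtain rfl : x = y := h1
    have hb := (map_verOf_vIso T ⟨⟨x, n⟩, ⟨x, k⟩, rfl, h2⟩).bdry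
    have hc : (verOf eAdjCat).bot ((verOf eAdjCat).hid (legWord x)) =
        (verOf eAdjCat).top (⟨⟨x, n⟩, ⟨x, k⟩, rfl, h2⟩ : ParPair eAdjCat) := cod_legWord x
    have e1 := (verOf_vc_fst eAdjCat (p := (verOf eAdjCat).hid (legWord x))
      (q := ⟨⟨x, n⟩, ⟨x, k⟩, rfl, h2⟩) hc).trans (cc_legWord x n)
    have e2 := (verOf_vc_snd eAdjCat (p := (verOf eAdjCat).hid (legWord x))
      (q := ⟨⟨x, n⟩, ⟨x, k⟩, rfl, h2⟩) hc).trans (cc_legWord x k)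
    -- The universal instance of the characterising equation; in `𝕍 E_adj` only the boundaries of
    -- the two sides need to be compared.
    have E : (verOf eAdjCat).hc ((verOf eAdjCat).vc ((verOf eAdjCat).hid (legWord x))
        (⟨⟨x, n⟩, ⟨x, k⟩, rfl, h2⟩ : ParPair eAdjCat)) (cellPair k x) = cellPair n x := by
      refine (verOf_hc eAdjCat (q := cellPair k x) e2).trans (ParPair.ext e1 ?_)
      exact congrArg legWord h2.symm
    have ew : ∀ w : AltWord.{u}, (ofFunctor T).toCone.ver w = T.ver w := fun w =>
      (congrFun hv w).symm
    refine ⟨?_, rfl, h2, ?_⟩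
    · refine hb.cast ?_ ?_ (ew _).symm (ew _).symm
      · exact congrArg P.hor.id (T.ver_fun.dom ⟨x, n⟩)
      · exact congrArg P.hor.id (T.ver_fun.cod ⟨x, n⟩)
    · change P.hc (P.vc (P.hid ((ofFunctor T).leg x)) (T.sq ⟨⟨x, n⟩, ⟨x, k⟩, rfl, h2⟩))
        ((ofFunctor T).cells k x) = (ofFunctor T).cells n x
      rw [cells_ofFunctor, cells_ofFunctor, leg_ofFunctor]
      refine Eq.trans ?_ (congrArg T.sq E)
      refine Eq.trans ?_ (T.sq_hc (β := cellPair k x) e2).symm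
      refine congrArg (P.hc · _) ?_
      refine Eq.trans ?_ (T.sq_vc hc).symm
      exact congrArg (P.vc · _) (T.sq_hid _).symm

/-- One of the two structure isomorphisms is enough data: all other 2-cells are forced by it. This
is how a lift against the inclusion of an object into `𝕍 E_adj` is recognised as having the right
image. -/
theorem functor_ext {T T' : DblFunctor (verOf eAdjCat) P} (h₀ : T.obj = T'.obj)
    (h₁ : ∀ x, T.ver ⟨x, 1⟩ = T'.ver ⟨x, 1⟩)
    (h₂ : T.sq ⟨⟨.zero, 2⟩, ⟨.zero, 0⟩, rfl, rfl⟩ = T'.sq ⟨⟨.zero, 2⟩, ⟨.zero, 0⟩, rfl, rfl⟩) :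
    T = T' := by
  rw [eq_toFunctor T, eq_toFunctor T']
  exact congrArg toFunctor (VertAdj.ext h₀ (funext h₁) h₂)

variable (D : VertAdj P)

/-- The leg at `zero` is an identity, so the given isomorphism itself solves the equation for the
comparison from the word of length two to the empty word. -/
theorem toFunctor_cell :
    D.toFunctor.sq ⟨⟨.zero, 2⟩, ⟨.zero, 0⟩, rfl, rfl⟩ = D.cell := by
  have hb := D.cell_iso.bdry
  have d0 := D.dom_arr .zero
  have d1 := D.dom_arr .one
  have c0 : P.ver.cod (D.arr .zero) = D.obj .one := D.cod_arr .zero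
  have c1 : P.ver.cod (D.arr .one) = D.obj .zero := D.cod_arr .one
  refine VertCone.sq_eq ⟨hb.cast ?_ ?_ ?_ rfl, rfl, rfl, ?_⟩
  · exact congrArg P.hor.id ((P.ver.dom_cc _ _).trans d0)
  · exact congrArg P.hor.id ((P.ver.cod_cc (c0.trans d1.symm)).trans c1)
  · exact (congrArg (P.ver.cc _) (P.ver.cc_id c1)).symm
  · change P.hc (P.vc (P.hid (P.ver.id (D.obj .zero))) D.cell) (P.hid (P.ver.id (D.obj .zero))) =
      P.hc (P.vc (P.hid (D.arr .zero)) (P.hid (P.ver.cc (D.arr .one) (P.ver.id (D.obj .zero)))))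
        (D.cells 1 .one)
    rw [cells_one, P.ver.cc_id c1, ← P.hid_cc (by grind)]
    change _ = P.hc _ D.cell
    grind

end VertAdj
end DblCat

/-! ### Companions -/

namespace DblCat

section
variable {A : DblCat.{u}}

attribute [grind →] IsCompanionPair.φ_bdry IsCompanionPair.ψ_bdry IsCompanionPair.hor_eq
  IsCompanionPair.ver_eq

namespace IsCompanionPair

variable {f f' : A.Hor} {w w' : A.Ver} {φ ψ φ' ψ' : A.Sq}

theorem dom_hor (h : A.IsCompanionPair f w φ ψ) : A.hor.dom f = A.ver.dom w := by
  have := h.φ_bdry; grind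
theorem cod_hor (h : A.IsCompanionPair f w φ ψ) : A.hor.cod f = A.ver.cod w := by
  have := h.φ_bdry; grind
attribute [grind →] dom_hor cod_hor

theorem id (a : A.Obj) : A.IsCompanionPair (A.hor.id a) (A.ver.id a) (A.vid (A.hor.id a))
    (A.vid (A.hor.id a)) :=
  ⟨⟨by grind, by grind, by grind, by grind⟩, ⟨by grind, by grind, by grind, by grind⟩,
    by grind, by grind⟩

theorem cc (h : A.IsCompanionPair f w φ ψ) (h' : A.IsCompanionPair f' w' φ' ψ')
    (e : A.ver.cod w = A.ver.dom w') :
    A.IsCompanionPair (A.hor.cc f f') (A.ver.cc w w') (A.hc (A.vc φ (A.hid w')) φ')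
      (A.hc ψ (A.vc (A.hid w) ψ')) := by
  have a1 := h.φ_bdry
  have a2 := h.ψ_bdry
  have a1' := h'.φ_bdry
  have a2' := h'.ψ_bdry
  refine ⟨⟨by grind, by grind, by grind, by grind⟩, ⟨by grind, by grind, by grind, by grind⟩,
    ?_, ?_⟩
  · have e1 : A.hc (A.vc (A.hid w) ψ') (A.vc φ (A.hid w')) = A.hc φ ψ' := by
      have x := vc_eq_hc (A := A) (α := φ) (β := ψ') (a := A.ver.cod w) (by grind) (by grind)
        (by grind) (by grind)
      rw [← ichg (by grind) (by grind) (by grind) (by grind), ← x]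
      grind
    have e2 : A.hc ψ (A.hc (A.hc φ ψ') φ') = A.hc (A.hc ψ φ) (A.hc ψ' φ') :=
      (hmid (by grind) (by grind) (by grind)).symm
    rw [hmid (by grind) (by grind) (by grind), e1, e2, h.hor_eq, h'.hor_eq,
      A.vid_cc (by grind)]
  · rw [ichg (by grind) (by grind) (by grind) (by grind)]
    grind

/-- Companions are invariant under vertical 2-isomorphisms. -/
theorem of_isVertIso {α β : A.Sq} (h : A.IsCompanionPair f w φ ψ) (hα : A.IsVertIso α w w')
    (hβ : A.IsVertIso β w' w) (e : A.hc α β = A.hid w) (e' : A.hc β α = A.hid w') :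
    A.IsCompanionPair f w' (A.hc β φ) (A.hc ψ α) := by
  have a1 := h.φ_bdry
  have a2 := h.ψ_bdry
  have b1 := hα.bdry
  have b2 := hβ.bdry
  refine ⟨⟨by grind, by grind, by grind, by grind⟩, ⟨by grind, by grind, by grind, by grind⟩,
    ?_, ?_⟩
  · rw [hmid (by grind) (by grind) (by grind)]
    grind
  · have e1 : A.vc (A.hc ψ α) (A.hc β φ) =
        A.vc (A.hc (A.hid (A.ver.id (A.ver.dom w))) (A.hc ψ α))
          (A.hc β (A.hc φ (A.hid (A.ver.id (A.ver.cod w))))) := by grind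
    rw [e1, ichg (by grind) (by grind) (by grind) (by grind),
      ichg (by grind) (by grind) (by grind) (by grind)]
    grind

end IsCompanionPair

/-- `w` has a companion. -/
def HasComp (A : DblCat.{u}) (w : A.Ver) : Prop := ∃ f φ ψ, A.IsCompanionPair f w φ ψ

theorem HasComp.cc {w w' : A.Ver} (h : A.HasComp w) (h' : A.HasComp w')
    (e : A.ver.cod w = A.ver.dom w') : A.HasComp (A.ver.cc w w') := by
  obtain ⟨f, φ, ψ, h⟩ := h
  obtain ⟨f', φ', ψ', h'⟩ := h'
  exact ⟨_, _, _, h.cc h' e⟩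

theorem HasComp.of_vIso {w w' : A.Ver} (h : A.HasComp w) (i : A.VIso w w') : A.HasComp w' := by
  obtain ⟨f, φ, ψ, h⟩ := h
  obtain ⟨α, hα⟩ := i
  obtain ⟨β, hβ, e, e'⟩ := hα.exists_inv
  exact ⟨_, _, _, h.of_isVertIso hα hβ e e'⟩

end

/-! ### The category of companion pairs -/

/-- A companion pair. -/
@[ext]
structure Comp (A : DblCat.{u}) where
  hor : A.Hor
  ver : A.Ver
  φ : A.Sq
  ψ : A.Sq
  pair : A.IsCompanionPair hor ver φ ψ

/-- Companion pairs compose. -/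
noncomputable def compCat (A : DblCat.{u}) : CatStr A.Obj (Comp A) where
  dom k := A.ver.dom k.ver
  cod k := A.ver.cod k.ver
  id a := ⟨_, _, _, _, IsCompanionPair.id a⟩
  comp k l e := ⟨_, _, _, _, k.pair.cc l.pair e⟩
  dom_id a := A.ver.dom_id a
  cod_id a := A.ver.cod_id a
  dom_comp k l e := A.ver.dom_cc _ _
  cod_comp k l e := A.ver.cod_cc e
  id_comp a k e := by
    have h := k.pair
    have b1 := h.φ_bdry
    have b2 := h.ψ_bdry
    have e' : a = A.ver.dom k.ver := (A.ver.cod_id a).symm.trans e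
    apply Comp.ext <;> dsimp only <;> grind
  comp_id k a e := by
    have h := k.pair
    have b1 := h.φ_bdry
    have b2 := h.ψ_bdry
    have e' : A.ver.cod k.ver = a := e.trans (A.ver.dom_id a)
    apply Comp.ext <;> dsimp only <;> grind
  assoc k l m e₁ e₂ := by
    have h := k.pair
    have b1 := h.φ_bdry
    have b2 := h.ψ_bdry
    have h' := l.pair
    have b1' := h'.φ_bdry
    have b2' := h'.ψ_bdry
    have h'' := m.pair
    have b1'' := h''.φ_bdry
    have b2'' := h''.ψ_bdry
    apply Comp.ext <;> dsimp only
    · grind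
    · grind
    · rw [hc_vc_hid (by grind) (by grind) (by grind), A.hid_cc e₂, hassoc (by grind) (by grind),
        vassoc (by grind) (by grind)]
    · rw [hid_vc_hc (by grind) (by grind) (by grind), A.hid_cc e₁, hassoc (by grind) (by grind),
        vassoc (by grind) (by grind)]

end DblCat

/-! ### Extending a double functor on `𝕍 C` to `Sq C` along companions -/

namespace DblCat

section
variable {O M : Type u} (C : CatStr O M)

theorem sqOf_hc {p q : Quad C} (h : p.rgt = q.lft) :
    ((sqOf C).hc p q : Quad C).top = C.cc p.top q.top ∧
    ((sqOf C).hc p q : Quad C).bot = C.cc p.bot q.bot ∧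
    ((sqOf C).hc p q : Quad C).lft = p.lft ∧ ((sqOf C).hc p q : Quad C).rgt = q.rgt :=
  ⟨(sqOf C).top_hc h, (sqOf C).bot_hc h, (sqOf C).sqh.dom_cc _ _, (sqOf C).sqh.cod_cc h⟩

theorem sqOf_vc {p q : Quad C} (h : p.bot = q.top) :
    ((sqOf C).vc p q : Quad C).top = p.top ∧ ((sqOf C).vc p q : Quad C).bot = q.bot ∧
    ((sqOf C).vc p q : Quad C).lft = C.cc p.lft q.lft ∧
    ((sqOf C).vc p q : Quad C).rgt = C.cc p.rgt q.rgt :=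
  ⟨(sqOf C).sqv.dom_cc _ _, (sqOf C).sqv.cod_cc h, (sqOf C).lft_vc h, (sqOf C).rgt_vc h⟩

end

/-- A double functor on `𝕍 C` with a functorial choice of companions. -/
structure VertComp {O M : Type u} (C : CatStr O M) (A : DblCat.{u}) where
  T : DblFunctor (verOf C) A
  comp : M → Comp A
  isFun : CatStr.IsFun C (compCat A) T.obj comp
  ver_eq : ∀ f, (comp f).ver = T.ver f

namespace VertComp

variable {O M : Type u} {C : CatStr O M} {A : DblCat.{u}}

/-- The 2-cell that is parallel to a square of `Sq C`. -/
noncomputable def pair (p : Quad C) : (verOf C).Sq :=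
  ⟨C.cc p.lft p.bot, C.cc p.top p.rgt, by rw [C.dom_cc, C.dom_cc, p.tl],
    by rw [C.cod_cc p.bl.symm, C.cod_cc p.tr, p.br]⟩

variable (K : VertComp C A)

/-- The horizontal image of a morphism. -/
def hor (f : M) : A.Hor := (K.comp f).hor
/-- The vertical image of a morphism. -/
def ver (f : M) : A.Ver := K.T.ver f
/-- The first companion square. -/
def φ (f : M) : A.Sq := (K.comp f).φ
/-- The second companion square. -/
def ψ (f : M) : A.Sq := (K.comp f).ψ

theorem isPair (f : M) : A.IsCompanionPair (K.hor f) (K.ver f) (K.φ f) (K.ψ f) := by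
  have := (K.comp f).pair
  rw [K.ver_eq] at this
  exact this

theorem ψ_bdry (f : M) : A.HasBdry (K.ψ f) (A.hor.id (K.T.obj (C.dom f))) (K.hor f)
    (A.ver.id (K.T.obj (C.dom f))) (K.ver f) := by
  have h := (K.isPair f).ψ_bdry
  have e : A.ver.dom (K.ver f) = K.T.obj (C.dom f) := K.T.ver_fun.dom f
  rwa [e] at h

theorem φ_bdry (f : M) : A.HasBdry (K.φ f) (K.hor f) (A.hor.id (K.T.obj (C.cod f)))
    (K.ver f) (A.ver.id (K.T.obj (C.cod f))) := by
  have h := (K.isPair f).φ_bdry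
  have e : A.ver.cod (K.ver f) = K.T.obj (C.cod f) := K.T.ver_fun.cod f
  rwa [e] at h

theorem dom_ver (f : M) : A.ver.dom (K.ver f) = K.T.obj (C.dom f) := K.T.ver_fun.dom f
theorem cod_ver (f : M) : A.ver.cod (K.ver f) = K.T.obj (C.cod f) := K.T.ver_fun.cod f
theorem dom_hor (f : M) : A.hor.dom (K.hor f) = K.T.obj (C.dom f) := by
  rw [(K.isPair f).dom_hor, dom_ver]
theorem cod_hor (f : M) : A.hor.cod (K.hor f) = K.T.obj (C.cod f) := by
  rw [(K.isPair f).cod_hor, cod_ver]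
theorem ver_cc {f g : M} (h : C.cod f = C.dom g) :
    K.ver (C.cc f g) = A.ver.cc (K.ver f) (K.ver g) := K.T.ver_fun.cc f g h

theorem comp_cc {f g : M} (h : C.cod f = C.dom g) :
    K.comp (C.cc f g) = (compCat A).comp (K.comp f) (K.comp g)
      (by rw [K.isFun.cod, K.isFun.dom, h]) := by
  rw [K.isFun.cc _ _ h, (compCat A).cc_eq]

theorem hor_cc {f g : M} (h : C.cod f = C.dom g) :
    K.hor (C.cc f g) = A.hor.cc (K.hor f) (K.hor g) := congrArg Comp.hor (K.comp_cc h)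

theorem ψ_cc {f g : M} (h : C.cod f = C.dom g) :
    K.ψ (C.cc f g) = A.hc (K.ψ f) (A.vc (A.hid (K.ver f)) (K.ψ g)) := by
  have := congrArg Comp.ψ (K.comp_cc h)
  rw [ver, ← K.ver_eq]
  exact this

theorem hor_id (a : O) : K.hor (C.id a) = A.hor.id (K.T.obj a) :=
  congrArg Comp.hor (K.isFun.id a)
theorem ver_id (a : O) : K.ver (C.id a) = A.ver.id (K.T.obj a) := K.T.ver_fun.id a
theorem ψ_id (a : O) : K.ψ (C.id a) = A.vid (A.hor.id (K.T.obj a)) :=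
  congrArg Comp.ψ (K.isFun.id a)

/-- The 2-cell of `A` that is the image of the 2-cell parallel to a square. -/
noncomputable def cell (p : Quad C) : A.Sq := K.T.sq (pair p)

theorem cell_bdry (p : Quad C) : A.HasBdry (K.cell p) (A.hor.id (K.T.obj (C.dom p.lft)))
    (A.hor.id (K.T.obj (C.cod p.bot))) (A.ver.cc (K.ver p.lft) (K.ver p.bot))
    (A.ver.cc (K.ver p.top) (K.ver p.rgt)) := by
  have h := (map_verOf_vIso K.T (pair p)).bdry
  have e1 : K.T.ver (pair p).fst = A.ver.cc (K.ver p.lft) (K.ver p.bot) := K.ver_cc p.bl.symm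
  have e2 : K.T.ver (pair p).snd = A.ver.cc (K.ver p.top) (K.ver p.rgt) := K.ver_cc p.tr
  have e3 := K.dom_ver p.lft
  have e4 := K.cod_ver p.bot
  have e5 := K.cod_ver p.lft
  have e6 := K.dom_ver p.bot
  have e7 := p.bl
  exact h.cast (by grind) (by grind) e1 e2

/-- The square `β` is the image of the square `p` of `Sq C`. -/
structure IsImg (β : A.Sq) (p : Quad C) : Prop where
  bdry : A.HasBdry β (K.hor p.top) (K.hor p.bot) (K.ver p.lft) (K.ver p.rgt)
  eq : A.vc (K.ψ p.top) β = A.hc (A.vc (A.hid (K.ver p.lft)) (K.ψ p.bot)) (K.cell p)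

attribute [grind →] IsImg.bdry

variable {K}

/-- A square is recovered from its composite below `ψ` by pasting `φ` on the right, because `ψ`
followed by `φ` is the vertical identity of the top side. -/
theorem IsImg.unique {β β' : A.Sq} {p : Quad C} (h : K.IsImg β p) (h' : K.IsImg β' p) :
    β = β' := by
  have key : ∀ γ, K.IsImg γ p →
      γ = A.hc (A.vc (K.ψ p.top) γ) (A.vc (K.φ p.top) (A.hid (K.ver p.rgt))) := by
    intro γ hγ
    have b := hγ.bdry
    have k := K.isPair p.top
    have b1 := K.φ_bdry p.top
    have b2 := K.ψ_bdry p.top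
    have e1 := p.tr
    have e2 := K.dom_ver p.rgt
    have e3 := k.hor_eq
    rw [← ichg (by grind) (by grind) (by grind) (by grind), k.hor_eq]
    grind
  rw [key β h, key β' h', h.eq, h'.eq]

variable (K) in
/-- The image of a square of `Sq C`. -/
noncomputable def sq (p : Quad C) : A.Sq :=
  A.hc (A.vc (A.hid (K.ver p.lft)) (K.ψ p.bot))
    (A.hc (K.cell p) (A.vc (K.φ p.top) (A.hid (K.ver p.rgt))))

/-- Putting `ψ` on top of the explicit formula meets the factor `φ`; the vertical companion identity
turns the two into an identity, leaving the prescribed right-hand side. -/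
theorem sq_isImg (p : Quad C) : K.IsImg (K.sq p) p := by
  have k := K.isPair p.top
  have b1 := K.φ_bdry p.top
  have b2 := K.ψ_bdry p.top
  have b3 := K.ψ_bdry p.bot
  have bc := K.cell_bdry p
  have e1 := p.tl
  have e2 := p.tr
  have e3 := p.bl
  have e4 := p.br
  have d1 := K.dom_ver p.lft
  have d2 := K.cod_ver p.lft
  have d3 := K.dom_ver p.rgt
  have d4 := K.cod_ver p.rgt
  have d5 := K.dom_ver p.top
  have d6 := K.cod_ver p.top
  have bX : A.HasBdry (A.hc (A.vc (A.hid (K.ver p.lft)) (K.ψ p.bot)) (K.cell p))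
      (A.hor.id (K.T.obj (C.dom p.lft))) (K.hor p.bot) (K.ver p.lft)
      (A.ver.cc (K.ver p.top) (K.ver p.rgt)) := by
    have d7 := K.cod_hor p.bot
    exact ⟨by grind, by grind, by grind, by grind⟩
  have e : K.sq p = A.hc (A.hc (A.vc (A.hid (K.ver p.lft)) (K.ψ p.bot)) (K.cell p))
      (A.vc (K.φ p.top) (A.hid (K.ver p.rgt))) := by
    rw [hassoc (by grind) (by grind)]; rfl
  generalize hX : A.hc (A.vc (A.hid (K.ver p.lft)) (K.ψ p.bot)) (K.cell p) = X at *
  have d8 := K.dom_hor p.top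
  have d9 := K.cod_hor p.bot
  refine ⟨?_, ?_⟩
  · rw [e]
    exact ⟨by grind, by grind, by grind, by grind⟩
  · rw [e, hX]
    have e5 : K.ψ p.top = A.hc (A.hid (A.ver.id (K.T.obj (C.dom p.top)))) (K.ψ p.top) := by grind
    rw [e5, ichg (by grind) (by grind) (by grind) (by grind), ← vassoc (by grind) (by grind),
      k.ver_eq, ← A.hid_cc (by grind), A.hid_id]
    grind

theorem sq_eq {p : Quad C} {β : A.Sq} (h : K.IsImg β p) : K.sq p = β :=
  (sq_isImg p).unique h

/-- Since images are unique, preservation of identities and of composites is checked on the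
characterising equation. Here the parallel 2-cell is an identity. -/
theorem isImg_hid (w : M) : K.IsImg (A.hid (K.ver w)) ((quadHor C).id w) := by
  have e : K.cell ((quadHor C).id w) = A.hid (K.ver w) := by
    refine Eq.trans (congrArg K.T.sq ?_) (K.T.sqh_fun.id w)
    exact ParPair.ext (C.cc_id rfl) (C.id_cc rfl)
  have d1 := K.dom_ver w
  have d2 := K.cod_ver w
  have b := hasBdry_hid A d1 d2
  refine ⟨b.cast (K.hor_id _).symm (K.hor_id _).symm rfl rfl, ?_⟩
  rw [e]
  change A.vc (K.ψ (C.id (C.dom w))) (A.hid (K.ver w)) =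
    A.hc (A.vc (A.hid (K.ver w)) (K.ψ (C.id (C.cod w)))) (A.hid (K.ver w))
  rw [K.ψ_id, K.ψ_id]
  grind

theorem isImg_vid (f : M) : K.IsImg (A.vid (K.hor f)) ((quadVer C).id f) := by
  have e : K.cell ((quadVer C).id f) = A.hid (K.ver f) := by
    refine Eq.trans (congrArg K.T.sq ?_) (K.T.sqh_fun.id f)
    exact ParPair.ext (C.id_cc rfl) (C.cc_id rfl)
  have b := hasBdry_vid A (K.dom_hor f) (K.cod_hor f)
  have b' := K.ψ_bdry f
  refine ⟨b.cast rfl rfl (K.ver_id _).symm (K.ver_id _).symm, ?_⟩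
  rw [e]
  change A.vc (K.ψ f) (A.vid (K.hor f)) =
    A.hc (A.vc (A.hid (K.ver (C.id (C.dom f)))) (K.ψ f)) (A.hid (K.ver f))
  rw [K.ver_id]
  grind

/-- The parallel 2-cell of a pasted square is the composite of two whiskered 2-cells: replace first
the left then bottom sides of `p`, then those of `q`. As 2-cells of `C` are unique, only boundaries
are compared. -/
theorem pair_hc {p q : Quad C} (h : p.rgt = q.lft) :
    pair ((sqOf C).hc p q) = (verOf C).hc ((verOf C).vc (pair p) ((verOf C).hid q.bot))
      ((verOf C).vc ((verOf C).hid p.top) (pair q)) := by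
  obtain ⟨h1, h2, h3, h4⟩ := sqOf_hc C h
  have a1 : C.cod (pair p).fst = C.dom q.bot := by
    refine (C.cod_cc p.bl.symm).trans ?_
    rw [p.br, q.bl, h]
  have a2 : C.cod p.top = C.dom (pair q).fst := by
    refine Eq.trans ?_ (C.dom_cc _ _).symm
    rw [p.tr, h]
  have x1 := verOf_vc_fst C (p := pair p) (q := (verOf C).hid q.bot) a1
  have x2 := verOf_vc_snd C (p := pair p) (q := (verOf C).hid q.bot) a1
  have x3 := verOf_vc_fst C (p := (verOf C).hid p.top) (q := pair q) a2
  have x4 := verOf_vc_snd C (p := (verOf C).hid p.top) (q := pair q) a2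
  have ht := p.tr
  have hb := q.bl
  have hb' := p.bl
  have hr := p.br
  have ht' := q.tr
  have ht'' := q.tl
  have x5 : ParPair.snd ((verOf C).vc (pair p) ((verOf C).hid q.bot)) =
      ParPair.fst ((verOf C).vc ((verOf C).hid p.top) (pair q)) := by
    refine x2.trans (Eq.trans ?_ x3.symm)
    change C.cc (C.cc p.top p.rgt) q.bot = C.cc p.top (C.cc q.lft q.bot)
    grind
  refine Eq.trans ?_ (verOf_hc C x5).symm
  refine ParPair.ext (Eq.trans ?_ x1.symm) (Eq.trans ?_ x4.symm)
  · change C.cc (Quad.lft ((sqOf C).hc p q)) (Quad.bot ((sqOf C).hc p q)) =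
      C.cc (C.cc p.lft p.bot) q.bot
    rw [h3, h2]
    grind
  · change C.cc (Quad.top ((sqOf C).hc p q)) (Quad.rgt ((sqOf C).hc p q)) =
      C.cc p.top (C.cc q.top q.rgt)
    rw [h1, h4]
    grind

/-- As for horizontal pasting, but the 2-cell of the lower square is used first. -/
theorem pair_vc {p q : Quad C} (h : p.bot = q.top) :
    pair ((sqOf C).vc p q) = (verOf C).hc ((verOf C).vc ((verOf C).hid p.lft) (pair q))
      ((verOf C).vc (pair p) ((verOf C).hid q.rgt)) := by
  obtain ⟨h1, h2, h3, h4⟩ := sqOf_vc C h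
  have a1 : C.cod (pair p).fst = C.dom q.rgt := by
    refine (C.cod_cc p.bl.symm).trans ?_
    rw [h, q.tr]
  have a2 : C.cod p.lft = C.dom (pair q).fst := by
    refine Eq.trans ?_ (C.dom_cc _ _).symm
    rw [← p.bl, h, q.tl]
  have x1 := verOf_vc_fst C (p := (verOf C).hid p.lft) (q := pair q) a2
  have x2 := verOf_vc_snd C (p := (verOf C).hid p.lft) (q := pair q) a2
  have x3 := verOf_vc_fst C (p := pair p) (q := (verOf C).hid q.rgt) a1
  have x4 := verOf_vc_snd C (p := pair p) (q := (verOf C).hid q.rgt) a1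
  have ht := p.tr
  have hb := q.bl
  have hb' := p.bl
  have hr := p.br
  have ht' := q.tr
  have ht'' := q.tl
  have x5 : ParPair.snd ((verOf C).vc ((verOf C).hid p.lft) (pair q)) =
      ParPair.fst ((verOf C).vc (pair p) ((verOf C).hid q.rgt)) := by
    refine x2.trans (Eq.trans ?_ x3.symm)
    change C.cc p.lft (C.cc q.top q.rgt) = C.cc (C.cc p.lft p.bot) q.rgt
    grind
  refine Eq.trans ?_ (verOf_hc C x5).symm
  refine ParPair.ext (Eq.trans ?_ x1.symm) (Eq.trans ?_ x4.symm)
  · change C.cc (Quad.lft ((sqOf C).vc p q)) (Quad.bot ((sqOf C).vc p q)) =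
      C.cc p.lft (C.cc q.lft q.bot)
    rw [h3, h2]
    grind
  · change C.cc (Quad.top ((sqOf C).vc p q)) (Quad.rgt ((sqOf C).vc p q)) =
      C.cc (C.cc p.top p.rgt) q.rgt
    rw [h1, h4]
    grind

theorem cell_hc {p q : Quad C} (h : p.rgt = q.lft) :
    K.cell ((sqOf C).hc p q) = A.hc (A.vc (K.cell p) (A.hid (K.ver q.bot)))
      (A.vc (A.hid (K.ver p.top)) (K.cell q)) := by
  have a1 : C.cod (pair p).fst = C.dom q.bot := by
    refine (C.cod_cc p.bl.symm).trans ?_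
    rw [p.br, q.bl, h]
  have a2 : C.cod p.top = C.dom (pair q).fst := by
    refine Eq.trans ?_ (C.dom_cc _ _).symm
    rw [p.tr, h]
  refine (congrArg K.T.sq (pair_hc h)).trans ?_
  have x2 := verOf_vc_snd C (p := pair p) (q := (verOf C).hid q.bot) a1
  have x3 := verOf_vc_fst C (p := (verOf C).hid p.top) (q := pair q) a2
  have ht := p.tr
  have hr := p.br
  have hb := q.bl
  have x5 : ParPair.snd ((verOf C).vc (pair p) ((verOf C).hid q.bot)) =
      ParPair.fst ((verOf C).vc ((verOf C).hid p.top) (pair q)) := by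
    refine x2.trans (Eq.trans ?_ x3.symm)
    change C.cc (C.cc p.top p.rgt) q.bot = C.cc p.top (C.cc q.lft q.bot)
    grind
  refine (K.T.sq_hc x5).trans (congrArg₂ A.hc ?_ ?_)
  · exact (K.T.sq_vc (α := pair p) (β := (verOf C).hid q.bot) a1).trans
      (congrArg (A.vc _) (K.T.sq_hid _))
  · exact (K.T.sq_vc (α := (verOf C).hid p.top) (β := pair q) a2).trans
      (congrArg (A.vc · _) (K.T.sq_hid _))

theorem cell_vc {p q : Quad C} (h : p.bot = q.top) :
    K.cell ((sqOf C).vc p q) = A.hc (A.vc (A.hid (K.ver p.lft)) (K.cell q))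
      (A.vc (K.cell p) (A.hid (K.ver q.rgt))) := by
  have a1 : C.cod (pair p).fst = C.dom q.rgt := by
    refine (C.cod_cc p.bl.symm).trans ?_
    rw [h, q.tr]
  have a2 : C.cod p.lft = C.dom (pair q).fst := by
    refine Eq.trans ?_ (C.dom_cc _ _).symm
    rw [← p.bl, h, q.tl]
  refine (congrArg K.T.sq (pair_vc h)).trans ?_
  have x2 := verOf_vc_snd C (p := (verOf C).hid p.lft) (q := pair q) a2
  have x3 := verOf_vc_fst C (p := pair p) (q := (verOf C).hid q.rgt) a1
  have hb' := p.bl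
  have hr := p.br
  have ht' := q.tr
  have x5 : ParPair.snd ((verOf C).vc ((verOf C).hid p.lft) (pair q)) =
      ParPair.fst ((verOf C).vc (pair p) ((verOf C).hid q.rgt)) := by
    refine x2.trans (Eq.trans ?_ x3.symm)
    change C.cc p.lft (C.cc q.top q.rgt) = C.cc (C.cc p.lft p.bot) q.rgt
    grind
  refine (K.T.sq_hc x5).trans (congrArg₂ A.hc ?_ ?_)
  · exact (K.T.sq_vc (α := (verOf C).hid p.lft) (β := pair q) a2).trans
      (congrArg (A.vc · _) (K.T.sq_hid _))
  · exact (K.T.sq_vc (α := pair p) (β := (verOf C).hid q.rgt) a1).trans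
      (congrArg (A.vc _) (K.T.sq_hid _))

theorem IsImg.hc {β δ : A.Sq} {p q : Quad C} (hβ : K.IsImg β p) (hδ : K.IsImg δ q)
    (h : p.rgt = q.lft) : K.IsImg (A.hc β δ) ((sqOf C).hc p q) := by
  obtain ⟨h1, h2, h3, h4⟩ := sqOf_hc C h
  have et : C.cod p.top = C.dom q.top := by rw [p.tr, q.tl, h]
  have eb : C.cod p.bot = C.dom q.bot := by rw [p.br, q.bl, h]
  have b1 := hβ.bdry
  have b2 := hδ.bdry
  have bp := K.cell_bdry p
  have bq := K.cell_bdry q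
  have c1 := K.ψ_bdry p.top
  have c2 := K.ψ_bdry q.top
  have c3 := K.ψ_bdry p.bot
  have c4 := K.ψ_bdry q.bot
  have d1 := K.dom_ver p.top
  have d2 := K.cod_ver p.top
  have d3 := K.dom_ver p.lft
  have d4 := K.cod_ver p.lft
  have d5 := K.dom_ver q.lft
  have d6 := K.cod_ver q.lft
  have d7 := K.dom_ver p.bot
  have d8 := K.cod_ver p.bot
  have d9 := K.dom_ver q.bot
  have e1 := p.tl
  have e2 := p.tr
  have e3 := p.bl
  have e4 := p.br
  have e5 := q.tl
  have e6 := q.bl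
  refine ⟨(b1.hc (h ▸ b2)).cast (by rw [h1, K.hor_cc et]) (by rw [h2, K.hor_cc eb]) (by rw [h3])
    (by rw [h4]), ?_⟩
  rw [h1, h2, h3, cell_hc h, K.ψ_cc et, K.ψ_cc eb]
  rw [ichg (by grind) (by grind) (by grind) (by grind), hβ.eq, vassoc (by grind) (by grind), hδ.eq,
    hid_vc_hc (by grind) (by grind) (by grind), hid_vc_hc (by grind) (by grind) (by grind),
    hmid (by grind) (by grind) (by grind)]
  -- The characterising equations of both squares have been inserted. What is left is to move the
  -- 2-cell of `p` past the companion square of the bottom of `q`.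
  have x := whisker_exchange (A := A) (α := K.cell p) (β := K.ψ q.bot) (a := K.T.obj (C.cod p.bot))
    (by grind) (by grind)
  have y := x.1.trans x.2.symm
  rw [bp.lft, bp.rgt, c4.lft, c4.rgt] at y
  have z : A.hc (K.cell p) (A.vc (A.hid (K.ver p.top)) (A.vc (A.hid (K.ver q.lft)) (K.ψ q.bot))) =
      A.hc (A.vc (A.hid (K.ver p.lft)) (A.vc (A.hid (K.ver p.bot)) (K.ψ q.bot)))
        (A.vc (K.cell p) (A.hid (K.ver q.bot))) := by
    rw [← h, ← vassoc (by grind) (by grind), ← A.hid_cc (by grind), ← vassoc (by grind) (by grind),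
      ← A.hid_cc (by grind), ← y]
    grind
  rw [z, hmid (by grind) (by grind) (by grind), hassoc (by grind) (by grind)]

theorem IsImg.vc {β δ : A.Sq} {p q : Quad C} (hβ : K.IsImg β p) (hδ : K.IsImg δ q)
    (h : p.bot = q.top) : K.IsImg (A.vc β δ) ((sqOf C).vc p q) := by
  obtain ⟨h1, h2, h3, h4⟩ := sqOf_vc C h
  have el : C.cod p.lft = C.dom q.lft := by rw [← p.bl, ← q.tl, h]
  have er : C.cod p.rgt = C.dom q.rgt := by rw [← p.br, ← q.tr, h]
  have b1 := hβ.bdry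
  have b2 := hδ.bdry
  have bp := K.cell_bdry p
  have bq := K.cell_bdry q
  have c1 := K.ψ_bdry p.top
  have c2 := K.ψ_bdry q.top
  have c3 := K.ψ_bdry p.bot
  have c4 := K.ψ_bdry q.bot
  have d1 := K.dom_ver p.top
  have d2 := K.cod_ver p.top
  have d3 := K.dom_ver p.lft
  have d4 := K.cod_ver p.lft
  have d5 := K.dom_ver q.lft
  have d6 := K.cod_ver q.lft
  have d7 := K.dom_ver p.bot
  have d8 := K.cod_ver p.bot
  have d9 := K.dom_ver q.rgt
  have d10 := K.cod_ver p.rgt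
  have d11 := K.dom_ver q.bot
  have e1 := p.tl
  have e2 := p.tr
  have e3 := p.bl
  have e4 := p.br
  have e5 := q.tl
  have e6 := q.bl
  have e7 := q.tr
  refine ⟨((h ▸ b1).vc b2).cast (by rw [h1]) (by rw [h2]) (by rw [h3, K.ver_cc el])
    (by rw [h4, K.ver_cc er]), ?_⟩
  rw [h1, h2, h3, cell_vc h, K.ver_cc el]
  -- Insert an identity on the right of `δ`, so that interchange distributes `δ` below the companion
  -- square and leaves the 2-cell of `p` whiskered by the right side of `q`.
  have s1 : A.vc (A.hc (A.vc (A.hid (K.ver p.lft)) (K.ψ p.bot)) (K.cell p)) δ =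
      A.hc (A.vc (A.hid (K.ver p.lft)) (A.vc (K.ψ q.top) δ))
        (A.vc (K.cell p) (A.hid (K.ver q.rgt))) := by
    have : δ = A.hc δ (A.hid (K.ver q.rgt)) := by grind
    conv_lhs => rw [this]
    rw [ichg (by grind) (by grind) (by grind) (by grind), vassoc (by grind) (by grind), h]
  rw [← vassoc (by grind) (by grind), hβ.eq, s1, hδ.eq,
    hid_vc_hc (by grind) (by grind) (by grind), hassoc (by grind) (by grind),
    ← vassoc (by grind) (by grind), ← A.hid_cc (by grind)]

/-- The double functor determined by a functorial choice of companions. -/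
noncomputable def toFunctor (K : VertComp C A) : DblFunctor (sqOf C) A where
  obj := K.T.obj
  hor := K.hor
  ver := K.ver
  sq := K.sq
  hor_fun := ⟨K.dom_hor, K.cod_hor, K.hor_id, fun _ _ h => K.hor_cc h⟩
  ver_fun := K.T.ver_fun
  sqh_fun := ⟨fun p => (sq_isImg p).bdry.lft, fun p => (sq_isImg p).bdry.rgt,
    fun w => sq_eq (isImg_hid w), fun p q h => sq_eq ((sq_isImg p).hc (sq_isImg q) h)⟩
  sqv_fun := ⟨fun p => (sq_isImg p).bdry.top, fun p => (sq_isImg p).bdry.bot,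
    fun f => sq_eq (isImg_vid f), fun p q h => sq_eq ((sq_isImg p).vc (sq_isImg q) h)⟩

end VertComp

/-- In a double category with companions, an equivalence extends to a double functor on
`Sq E_adj`. -/
theorem exists_sqEAdj_functor {A : DblCat.{u}} (hA : ∀ w, A.HasComp w) (o : Two.{u} → A.Obj)
    {g : A.Ver} (hd : A.ver.dom g = o .zero) (hc : A.ver.cod g = o .one) (hg : A.IsVertEquiv g) :
    ∃ G : DblFunctor sqEAdj A, G.obj = o ∧ G.ver ⟨.zero, 1⟩ = g := by
  obtain ⟨z, hz⟩ := isVertEquiv_iff.1 hg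
  obtain ⟨H, hH⟩ := hz.inv
  let D : VertAdj A :=
    { obj := o
      arr := fun x => match x with
        | .zero => g
        | .one => z
      cell := H
      dom_arr := by rintro (_ | _); exacts [hd, hz.dom_eq.trans hc]
      cod_arr := by rintro (_ | _); exacts [hc, hz.cod_eq.trans hd]
      equiv := hg
      cell_iso := hd ▸ hH }
  -- Only the companions of the two letters are used. They are extended to all words by freeness in
  -- the category of companion pairs, since companions chosen separately for all words need not
  -- compose strictly.
  choose f φ ψ h using hA
  let k : A.Ver → Comp A := fun w => ⟨f w, w, φ w, ψ w, h w⟩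
  have hk : CatStr.IsFun eAdjCat (compCat A) o (wordMap (compCat A) o fun x => k (D.arr x)) :=
    wordMap_isFun D.dom_arr D.cod_arr
  have hv : CatStr.IsFun (compCat A) A.ver id Comp.ver :=
    CatStr.IsFun.of_comp (fun _ => rfl) (fun _ => rfl) (fun _ => rfl)
      (fun k l e e' => A.ver.cc_eq e)
  have hv' := hv.comp hk
  let K : VertComp eAdjCat A :=
    { T := D.toFunctor
      comp := wordMap (compCat A) o fun x => k (D.arr x)
      isFun := hk
      ver_eq := by
        -- Both the vertical part of the companion functor and the vertical part of `D.toFunctor`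
        -- are the word map on the same two letters.
        have e := hv'.eq_wordMap
        have e2 : ∀ x, (wordMap (compCat A) o (fun x => k (D.arr x)) ⟨x, 1⟩).ver = D.arr x := by
          intro x
          rw [wordMap_letter]
          exact D.cod_arr
        simp only [e2] at e
        exact congrFun e }
  exact ⟨K.toFunctor, rfl, D.toFunctor_ver_letter .zero⟩

end DblCat

/-! ### Horizontal duals and conjoints -/

/-- A double functor seen as a double functor between the horizontal duals. -/
def DblFunctor.hop {A B : DblCat.{u}} (F : DblFunctor A B) : DblFunctor A.hop B.hop where
  obj := F.obj
  hor := F.hor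
  ver := F.ver
  sq := F.sq
  hor_fun := F.hor_fun.op
  ver_fun := F.ver_fun
  sqh_fun := F.sqh_fun.op
  sqv_fun := F.sqv_fun

theorem CatStr.inv_unique {O M : Type u} (C : CatStr O M) {l k m : M} (h₁ : C.cod l = C.dom k)
    (h₂ : C.cod k = C.dom m) (e₁ : C.cc l k = C.id (C.dom l)) (e₂ : C.cc k m = C.id (C.cod m)) :
    l = m := by
  have a := C.cc_assoc h₁ h₂
  have d := C.dom_cc k m
  have d' := C.cod_cc h₁
  rw [e₂, C.dom_id] at d
  rw [e₁, C.cod_id] at d'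
  rw [e₁, e₂, C.id_cc (d'.trans h₂), C.cc_id (h₁.trans d.symm)] at a
  exact a.symm

namespace DblCat

section
variable {A : DblCat.{u}}

theorem hop_hc {α β : A.Sq} (h : A.lft α = A.rgt β) : A.hop.hc α β = A.hc β α :=
  A.sqh.op_cc h

/-- Reversing the horizontal direction exchanges the two kinds of pairs. All facts on conjoints are
obtained from companions in this way. -/
theorem isConjointPair_iff {f : A.Hor} {w : A.Ver} {ε η : A.Sq} :
    A.IsConjointPair f w ε η ↔ A.hop.IsCompanionPair f w ε η := by
  constructor
  · rintro ⟨⟨a1, a2, a3, a4⟩, ⟨b1, b2, b3, b4⟩, h1, h2⟩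
    exact ⟨⟨a1, a2, a4, a3⟩, ⟨b1, b2, b4, b3⟩,
      (hop_hc (A := A) (α := η) (β := ε) (b3.trans a4.symm)).trans h1, h2⟩
  · rintro ⟨⟨a1, a2, a3, a4⟩, ⟨b1, b2, b3, b4⟩, h1, h2⟩
    exact ⟨⟨a1, a2, a4, a3⟩, ⟨b1, b2, b4, b3⟩,
      (hop_hc (A := A) (α := η) (β := ε) (Eq.trans b4 a3.symm)).symm.trans h1, h2⟩

/-- `w` has a conjoint. -/
def HasConj (A : DblCat.{u}) (w : A.Ver) : Prop := ∃ f ε η, A.IsConjointPair f w ε η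

theorem hasConj_iff {w : A.Ver} : A.HasConj w ↔ A.hop.HasComp w := by
  simp only [HasConj, HasComp, isConjointPair_iff]
  rfl

theorem IsVertIso.hop {α : A.Sq} {w z : A.Ver} (h : A.IsVertIso α w z) :
    A.hop.IsVertIso α z w := by
  obtain ⟨β, hβ, e1, e2⟩ := h.exists_inv
  have b := h.bdry
  have b' := hβ.bdry
  refine .of_inv (A := A.hop) (β := β) ⟨b.top.trans ?_, b.bot.trans ?_, b.rgt, b.lft⟩ b'.rgt
    b'.lft ?_ ?_
  · exact congrArg A.hor.id h.dom_eq.symm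
  · exact congrArg A.hor.id h.cod_eq.symm
  · exact (hop_hc (b.lft.trans b'.rgt.symm)).trans e2
  · exact (hop_hc (b'.lft.trans b.rgt.symm)).trans e1

theorem VIso.hop {w z : A.Ver} (h : A.VIso w z) : A.hop.VIso w z := by
  obtain ⟨α, h⟩ := h
  exact VIso.symm ⟨α, h.hop⟩

theorem HasConj.cc {w w' : A.Ver} (h : A.HasConj w) (h' : A.HasConj w')
    (e : A.ver.cod w = A.ver.dom w') : A.HasConj (A.ver.cc w w') :=
  hasConj_iff.2 ((hasConj_iff.1 h).cc (hasConj_iff.1 h') e)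

theorem HasConj.of_vIso {w w' : A.Ver} (h : A.HasConj w) (i : A.VIso w w') : A.HasConj w' :=
  hasConj_iff.2 ((hasConj_iff.1 h).of_vIso i.hop)

end

/-! ### Lifting of isomorphisms -/

/-- Vertical 2-isomorphisms lift along `p`. -/
def VIsoLift {P B : DblCat.{u}} (p : DblFunctor P B) : Prop :=
  ∀ (v : P.Ver) (z : B.Ver) (κ : B.Sq), B.IsVertIso κ (p.ver v) z →
    ∃ (v' : P.Ver) (K : P.Sq), P.IsVertIso K v v' ∧ p.sq K = κ

section
variable {P B : DblCat.{u}} {p : DblFunctor P B}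

/-- A vertically invertible square between horizontal morphisms has identities as sides, and the
horizontal dual only exchanges these two sides. -/
theorem transpose_hop_isVertIso {A : DblCat.{u}} {α : A.Sq} {f g : A.Hor} :
    A.hop.transpose.IsVertIso α f g ↔ A.transpose.IsVertIso α f g :=
  ⟨fun ⟨⟨a1, a2, a3, a4⟩, i⟩ => ⟨⟨a2, a1, a3, a4⟩, i⟩,
    fun ⟨⟨a1, a2, a3, a4⟩, i⟩ => ⟨⟨a2, a1, a3, a4⟩, i⟩⟩

theorem vIsoLift_hop (h : VIsoLift p.transpose) : VIsoLift p.hop.transpose := by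
  intro v z κ hκ
  obtain ⟨v', K, hK, e⟩ := h v z κ (transpose_hop_isVertIso.1 hκ)
  exact ⟨v', K, transpose_hop_isVertIso.2 hK, e⟩

/-- The notion is symmetric in the two directions, the two companion equations being exchanged. Thus
invariance under changing `w` by an isomorphism also yields invariance under changing `f`. -/
theorem isCompanionPair_transpose {A : DblCat.{u}} {f : A.Hor} {w : A.Ver} {φ ψ : A.Sq}
    (h : A.IsCompanionPair f w φ ψ) : A.transpose.IsCompanionPair w f φ ψ := by
  have a := h.φ_bdry
  have b := h.ψ_bdry
  refine ⟨⟨a.lft, a.rgt.trans ?_, a.top, a.bot.trans ?_⟩,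
    ⟨b.lft.trans ?_, b.rgt, b.top.trans ?_, b.bot⟩, h.ver_eq, h.hor_eq⟩
  · exact congrArg A.ver.id h.cod_hor.symm
  · exact congrArg A.hor.id h.cod_hor.symm
  · exact congrArg A.ver.id h.dom_hor.symm
  · exact congrArg A.hor.id h.dom_hor.symm

/-- Two companions of `w` are related by a canonical square, and these equations say that it is
compatible with the structure squares of both pairs. -/
theorem vc_comparison {A : DblCat.{u}} {f f' : A.Hor} {w : A.Ver} {φ ψ φ' ψ' : A.Sq}
    (h : A.IsCompanionPair f w φ ψ) (h' : A.IsCompanionPair f' w φ' ψ') :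
    A.vc (A.hc ψ φ') φ = φ' ∧ A.vc ψ' (A.hc ψ φ') = ψ := by
  have a := h.φ_bdry
  have b := h.ψ_bdry
  have a' := h'.φ_bdry
  have b' := h'.ψ_bdry
  constructor
  · have e : φ = A.hc φ (A.hid (A.ver.id (A.ver.cod w))) := by grind
    conv_lhs => rw [e]
    rw [ichg (by grind) (by grind) (by grind) (by grind)]
    grind
  · have e : ψ' = A.hc (A.hid (A.ver.id (A.ver.dom w))) ψ' := by grind
    conv_lhs => rw [e]
    rw [ichg (by grind) (by grind) (by grind) (by grind)]
    grind

theorem vc_comparison_inv {A : DblCat.{u}} {f f' : A.Hor} {w : A.Ver} {φ ψ φ' ψ' : A.Sq}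
    (h : A.IsCompanionPair f w φ ψ) (h' : A.IsCompanionPair f' w φ' ψ') :
    A.vc (A.hc ψ φ') (A.hc ψ' φ) = A.vid f' := by
  have a := h.φ_bdry
  have b := h.ψ_bdry
  have a' := h'.φ_bdry
  have b' := h'.ψ_bdry
  have e : A.hc ψ φ' = A.hc (A.hid (A.ver.id (A.ver.dom w))) (A.hc ψ φ') := by grind
  rw [e, ichg (by grind) (by grind) (by grind) (by grind), (vc_comparison h h').1]
  grind

theorem comparison_isVertIso {A : DblCat.{u}} {f f' : A.Hor} {w : A.Ver} {φ ψ φ' ψ' : A.Sq}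
    (h : A.IsCompanionPair f w φ ψ) (h' : A.IsCompanionPair f' w φ' ψ') :
    A.transpose.IsVertIso (A.hc ψ φ') f' f := by
  have a := h.φ_bdry
  have b := h.ψ_bdry
  have a' := h'.φ_bdry
  have b' := h'.ψ_bdry
  have e := h.dom_hor
  have e' := h'.dom_hor
  have c := h.cod_hor
  have c' := h'.cod_hor
  have hb : A.HasBdry (A.hc ψ φ') f' f (A.ver.id (A.hor.dom f')) (A.ver.id (A.hor.cod f')) :=
    ⟨by grind, by grind, by grind, by grind⟩
  have hb' : A.HasBdry (A.hc ψ' φ) f f' (A.ver.id (A.hor.dom f')) (A.ver.id (A.hor.cod f')) :=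
    ⟨by grind, by grind, by grind, by grind⟩
  exact .of_inv hb.transpose hb'.top hb'.bot (vc_comparison_inv h h') (vc_comparison_inv h' h)

/-- Companions lift with prescribed image. -/
theorem lift_companion (hp : VIsoLift p.transpose) {w : P.Ver} (hw : P.HasComp w) {f : B.Hor}
    {φ ψ : B.Sq} (h : B.IsCompanionPair f (p.ver w) φ ψ) :
    ∃ f' φ' ψ', P.IsCompanionPair f' w φ' ψ' ∧ p.hor f' = f ∧ p.sq φ' = φ ∧ p.sq ψ' = ψ := by
  obtain ⟨k, φ₀, ψ₀, h₀⟩ := hw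
  have h₁ := p.map_isCompanionPair h₀
  -- Any companion `k` of `w` has an image canonically isomorphic to the prescribed companion `f`.
  -- Lifting this isomorphism replaces `k` by a `k'` lying over `f`.
  obtain ⟨k', K, hK, e⟩ := hp k f _ (comparison_isVertIso h h₁)
  obtain ⟨L, hL, e1, e2⟩ := hK.exists_inv
  -- In the transpose, `K` is an isomorphism between the vertical morphisms `k` and `k'`, so the
  -- companion structure moves along it while `w` stays fixed.
  have hc := (isCompanionPair_transpose h₀).of_isVertIso hK hL e1 e2
  have hc' : P.IsCompanionPair k' w (P.vc L φ₀) (P.vc ψ₀ K) := isCompanionPair_transpose hc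
  have b := h₀.φ_bdry
  have b' := h₀.ψ_bdry
  have bK := hK.bdry
  have bL := hL.bdry
  have a := h.φ_bdry
  have a' := h.ψ_bdry
  have a1 := h₁.φ_bdry
  have a1' := h₁.ψ_bdry
  replace e : p.sq K = _ := e
  have f1 : p.hor k' = f := by
    refine (congrArg p.hor bK.rgt.symm).trans ((p.bot_sq K).symm.trans ?_)
    rw [e]
    exact (comparison_isVertIso h h₁).bdry.rgt
  -- By uniqueness of inverses, the inverse of the lifted isomorphism lies over the opposite
  -- canonical comparison.
  have eL : p.sq L = B.hc (p.sq ψ₀) φ := by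
    have i : P.vc K L = P.vid k := e1
    have i' : B.vc (p.sq L) (p.sq K) = B.vid f := by
      rw [← p.sq_vc (bL.rgt.trans bK.lft.symm), ← f1]
      exact (congrArg p.sq e2).trans (p.sq_vid k')
    have t : B.top (p.sq L) = f := by rw [p.top_sq, ← f1]; exact congrArg p.hor bL.lft
    have t' : B.bot (p.sq L) = p.hor k := by rw [p.bot_sq]; exact congrArg p.hor bL.rgt
    have hb := (comparison_isVertIso h h₁).bdry
    have hb' := (comparison_isVertIso h₁ h).bdry
    refine B.sqv.inv_unique (k := B.hc ψ (p.sq φ₀)) (t'.trans hb.lft.symm)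
      (hb.rgt.trans hb'.lft.symm) ?_ ?_
    · rw [← e]; exact i'.trans (congrArg B.vid t.symm)
    · exact (vc_comparison_inv h h₁).trans (congrArg B.vid hb'.rgt.symm)
  refine ⟨k', _, _, hc', f1, ?_, ?_⟩
  · rw [p.sq_vc (bL.rgt.trans b.top.symm), eL]
    exact (vc_comparison h₁ h).1
  · rw [p.sq_vc (b'.bot.trans bK.lft.symm), e]
    exact (vc_comparison h h₁).2

end
end DblCat

/-- Composition of double functors. -/
abbrev DblFunctor.comp {A B C : DblCat.{u}} (F : DblFunctor A B) (G : DblFunctor B C) :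
    DblFunctor A C := CategoryStruct.comp (obj := DblCat.{u}) F G

namespace DblCat

/-! ### Lifting problems against the generating anodyne extensions -/

theorem hasLiftingProperty_of {X Y P B : DblCat.{u}} (i : DblFunctor X Y) (p : DblFunctor P B)
    (h : ∀ (T : DblFunctor X P) (R : DblFunctor Y B), T.comp p = i.comp R →
      ∃ L : DblFunctor Y P, i.comp L = T ∧ L.comp p = R) :
    @HasLiftingProperty DblCat.{u} _ X Y P B i p where
  sq_hasLift {T R} sq := by
    obtain ⟨L, h₁, h₂⟩ := h T R sq.w
    exact ⟨⟨⟨L, h₁, h₂⟩⟩⟩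

/-- Double functors out of `𝕍 𝟚` are determined by the vertical arrow. -/
theorem verOf_arrow_ext {P : DblCat.{u}} {T T' : DblFunctor (verOf arrowCat) P}
    (h₀ : ∀ a, T.obj a = T'.obj a) (h₁ : T.ver (.arr ⟨⟩) = T'.ver (.arr ⟨⟩)) : T = T' := by
  have hv : ∀ f, T.ver f = T'.ver f := by
    rintro (a | ⟨⟩)
    · exact (T.ver_id a).trans ((congrArg _ (h₀ a)).trans (T'.ver_id a).symm)
    · exact h₁
  refine DblFunctor.ext (funext h₀) (funext fun a => ?_) (funext hv) (funext ?_)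
  · exact (T.hor_id a).trans ((congrArg _ (h₀ a)).trans (T'.hor_id a).symm)
  · have key : ∀ f, T.sq ⟨f, f, rfl, rfl⟩ = T'.sq ⟨f, f, rfl, rfl⟩ := fun f =>
      (T.sq_hid f).trans ((congrArg _ (hv f)).trans (T'.sq_hid f).symm)
    rintro ⟨a | ⟨⟩, b | ⟨⟩, hd, hc⟩
    · have hd : a = b := hd
      subst hd; exact key _
    · have hd : a = .zero := hd
      have hc : a = .one := hc
      cases hd.symm.trans hc
    · have hd : .zero = b := hd
      have hc : .one = b := hc
      cases hd.trans hc.symm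
    · exact key _

/-- The generating 2-cell of `𝕍 Σ I`. -/
def susCell (x y : Two.{u}) : (verOf susIso.{u}).Sq := ⟨.arr x, .arr y, rfl, rfl⟩

/-- Double functors out of `𝕍 Σ I` are determined by the invertible 2-cell. -/
theorem verOf_susIso_ext {P : DblCat.{u}} {T T' : DblFunctor (verOf susIso) P}
    (h₀ : ∀ a, T.obj a = T'.obj a) (h₁ : ∀ x, T.ver (.arr x) = T'.ver (.arr x))
    (h₂ : T.sq (susCell .zero .one) = T'.sq (susCell .zero .one)) : T = T' := by
  have hv : ∀ f, T.ver f = T'.ver f := by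
    rintro (a | x)
    · exact (T.ver_id a).trans ((congrArg _ (h₀ a)).trans (T'.ver_id a).symm)
    · exact h₁ x
  refine DblFunctor.ext (funext h₀) (funext fun a => ?_) (funext hv) (funext ?_)
  · exact (T.hor_id a).trans ((congrArg _ (h₀ a)).trans (T'.hor_id a).symm)
  · have key : ∀ f, T.sq ⟨f, f, rfl, rfl⟩ = T'.sq ⟨f, f, rfl, rfl⟩ := fun f =>
      (T.sq_hid f).trans ((congrArg _ (hv f)).trans (T'.sq_hid f).symm)
    have e : ∀ (F : DblFunctor (verOf susIso) P) (x y : Two.{u}),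
        P.hc (F.sq (susCell x y)) (F.sq (susCell y x)) = P.hid (F.ver (.arr x)) := fun F x y =>
      ((F.sq_hc (α := susCell x y) (β := susCell y x) rfl).symm.trans
        (congrArg F.sq (verOf_hc _ (p := susCell x y) (q := susCell y x) rfl))).trans
        (F.sq_hid (.arr x))
    have l : ∀ (F : DblFunctor (verOf susIso) P) (x y : Two.{u}),
        P.lft (F.sq (susCell x y)) = F.ver (.arr x) := fun F x y => F.lft_sq _
    have r : ∀ (F : DblFunctor (verOf susIso) P) (x y : Two.{u}),
        P.rgt (F.sq (susCell x y)) = F.ver (.arr y) := fun F x y => F.rgt_sq _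
    -- The reversed 2-cell has no freedom of its own, being the inverse of the generating one.
    have inv : T.sq (susCell .one .zero) = T'.sq (susCell .one .zero) := by
      refine P.sqh.inv_unique (k := T.sq (susCell .zero .one))
        ((r _ _ _).trans (l _ _ _).symm) ?_ ((e _ _ _).trans (congrArg _ (l _ _ _).symm)) ?_
      · exact (r _ _ _).trans ((h₁ _).trans (l _ _ _).symm)
      · rw [h₂]
        exact (e _ _ _).trans (congrArg _ (r _ _ _).symm)
    rintro ⟨a | x, b | y, hd, hc⟩
    · have hd : a = b := hd
      subst hd; exact key _
    · have hd : a = .zero := hd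
      have hc : a = .one := hc
      cases hd.symm.trans hc
    · have hd : .zero = b := hd
      have hc : .one = b := hc
      cases hd.trans hc.symm
    · cases x <;> cases y
      exacts [key _, h₂, inv, key _]

/-- The double functor out of `𝕍 Σ I` given by a family of 2-cells. -/
def susFunctor {P : DblCat.{u}} (o : Two.{u} → P.Obj) (v : Two.{u} → P.Ver)
    (c : Two.{u} → Two.{u} → P.Sq) (hd : ∀ x, P.ver.dom (v x) = o .zero)
    (hc : ∀ x, P.ver.cod (v x) = o .one)
    (hb : ∀ x y, P.HasBdry (c x y) (P.hor.id (o .zero)) (P.hor.id (o .one)) (v x) (v y))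
    (hi : ∀ x, c x x = P.hid (v x)) (hcc : ∀ x y z, P.hc (c x y) (c y z) = c x z) :
    DblFunctor (verOf susIso.{u}) P where
  obj := o
  hor a := P.hor.id (o a)
  ver
    | .idn a => P.ver.id (o a)
    | .arr x => v x
  sq p := match p.fst, p.snd with
    | .arr x, .arr y => c x y
    -- No parallel pair has this shape. The value is a default whose left side, top and bottom fit
    -- the case distinctions below.
    | .arr x, .idn _ => c x x
    | .idn a, _ => P.hid (P.ver.id (o a))
  hor_fun := ⟨fun a => P.hor.dom_id _, fun a => P.hor.cod_id _, fun _ => rfl, fun f g h => by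
    rw [P.hor.cc_id (by rw [P.hor.cod_id]; exact congrArg o h)]
    exact congrArg (fun a => P.hor.id (o a)) ((CatStr.cc_eq _ h).trans rfl)⟩
  ver_fun := by
    refine ⟨?_, ?_, fun _ => rfl, ?_⟩
    · rintro (a | x)
      exacts [P.ver.dom_id _, hd x]
    · rintro (a | x)
      exacts [P.ver.cod_id _, hc x]
    · intro f g h
      rw [show (verOf susIso).ver.cc f g = _ from CatStr.cc_eq _ h]
      rcases f with a | x <;> rcases g with b | y
      · have h : a = b := h
        subst h
        exact (P.ver.cc_id (P.ver.cod_id _)).symm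
      · have h : a = .zero := h
        subst h
        exact (P.ver.id_cc (hd y).symm).symm
      · have h : .one = b := h
        subst h
        exact (P.ver.cc_id (hc x)).symm
      · cases h
  sqh_fun := by
    have b := hb
    have i : ∀ a, P.hid (P.ver.id (o a)) = P.vid (P.hor.id (o a)) := fun a => P.hid_id _
    refine ⟨?_, ?_, ?_, ?_⟩
    · rintro ⟨a | x, b | y, hd, hc⟩
      · exact P.sqh.dom_id _
      · exact P.sqh.dom_id _
      · exact (hb _ _).lft
      · exact (hb _ _).lft
    · rintro ⟨a | x, b | y, hd, hc⟩
      · have hd : a = b := hd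
        subst hd; exact P.sqh.cod_id _
      · have hd : a = .zero := hd
        have hc : a = .one := hc
        cases hd.symm.trans hc
      · have hd : .zero = b := hd
        have hc : .one = b := hc
        cases hd.trans hc.symm
      · exact (hb _ _).rgt
    · rintro (a | x)
      exacts [rfl, hi x]
    · rintro ⟨f, g, hd, hc⟩ ⟨f', g', hd', hc'⟩ h
      have h : g = f' := h
      subst h
      rw [show (verOf susIso).sqh.cc _ _ = _ from verOf_hc _ rfl]
      rcases f with a | x <;> rcases g with b | y <;> rcases g' with b' | y'
      · have hd : a = b := hd
        subst hd; exact (P.sqh.id_cc (P.sqh.dom_id _).symm).symm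
      · have hd : b = .zero := hd'
        have hc : b = .one := hc'
        cases hd.symm.trans hc
      · have hd : a = .zero := hd
        have hc : a = .one := hc
        cases hd.symm.trans hc
      · have hd : a = .zero := hd
        have hc : a = .one := hc
        cases hd.symm.trans hc
      · have hd : .zero = b := hd
        have hc : .one = b := hc
        cases hd.trans hc.symm
      · have hd : .zero = b := hd
        have hc : .one = b := hc
        cases hd.trans hc.symm
      · have hd : .zero = b' := hd'
        have hc : .one = b' := hc'
        cases hd.trans hc.symm
      · exact (hcc _ _ _).symm
  sqv_fun := by
    refine ⟨?_, ?_, fun a => P.hid_id _, ?_⟩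
    · rintro ⟨a | x, b | y, hd, hc⟩
      · exact (P.top_hid _).trans (congrArg _ (P.ver.dom_id _))
      · exact (P.top_hid _).trans (congrArg _ (P.ver.dom_id _))
      · exact (hb _ _).top
      · exact (hb _ _).top
    · rintro ⟨a | x, b | y, hd, hc⟩
      · exact (P.bot_hid _).trans (congrArg _ (P.ver.cod_id _))
      · exact (P.bot_hid _).trans (congrArg _ (P.ver.cod_id _))
      · exact (hb _ _).bot
      · exact (hb _ _).bot
    · rintro ⟨f, g, hd, hc⟩ ⟨f', g', hd', hc'⟩ h
      rw [show (verOf susIso).sqv.cc _ _ = _ from CatStr.cc_eq _ h]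
      rcases f with a | x <;> rcases g with b | y
      · have hd : a = b := hd
        subst hd
        rcases f' with a' | x' <;> rcases g' with b' | y'
        · have h : a = a' := h
          subst h
          refine (P.sqv.id_cc ?_).symm.trans (congrArg (P.vc · _) (P.hid_id _).symm)
          exact ((P.top_hid _).trans (congrArg _ (P.ver.dom_id _))).symm
        · have hd : a' = .zero := hd'
          have hc : a' = .one := hc'
          cases hd.symm.trans hc
        · have hd : .zero = b' := hd'
          have hc : .one = b' := hc'
          cases hd.trans hc.symm
        · have h : a = .zero := h
          subst h
          refine (P.sqv.id_cc ?_).symm.trans (congrArg (P.vc · _) (P.hid_id _).symm)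
          exact (hb _ _).top.symm
      · have hd : a = .zero := hd
        have hc : a = .one := hc
        cases hd.symm.trans hc
      · have hd : .zero = b := hd
        have hc : .one = b := hc
        cases hd.trans hc.symm
      · rcases f' with a' | x' <;> rcases g' with b' | y'
        · have h : .one = a' := h
          subst h
          refine (P.sqv.cc_id ?_).symm.trans (congrArg (P.vc _ ·) (P.hid_id _).symm)
          exact (hb _ _).bot
        · have h : .one = a' := h
          have hd' : a' = .zero := hd'
          cases h.trans hd'
        · cases h
        · cases h

/-- Lift the invertible 2-cell prescribed in the base; the lift, its inverse and two identities are
all the generating data needed on `𝕍 Σ I`. Agreement is recorded on generators only, so that the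
vertical and, after transposition, the horizontal lifting problem can both use it. -/
theorem exists_lift_susIso {P B : DblCat.{u}} {p : DblFunctor P B} (hp : VIsoLift p)
    (T : DblFunctor (verOf arrowCat) P) (R : DblFunctor (verOf susIso) B)
    (h₀ : ∀ a, R.obj a = p.obj (T.obj a)) (h₁ : R.ver (.arr .zero) = p.ver (T.ver (.arr ⟨⟩))) :
    ∃ L : DblFunctor (verOf susIso) P, (∀ a, L.obj a = T.obj a) ∧
      L.ver (.arr .zero) = T.ver (.arr ⟨⟩) ∧ (∀ a, p.obj (L.obj a) = R.obj a) ∧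
      (∀ x, p.ver (L.ver (.arr x)) = R.ver (.arr x)) ∧
      p.sq (L.sq (susCell .zero .one)) = R.sq (susCell .zero .one) := by
  have hκ := R.map_isVertIso (verOf_isVertIso _ (susCell .zero .one))
  have hκ' : B.IsVertIso (R.sq (susCell .zero .one)) (R.ver (.arr .zero)) (R.ver (.arr .one)) := hκ
  rw [h₁] at hκ'
  obtain ⟨v', K, hK, e⟩ := hp _ _ _ hκ'
  obtain ⟨L, hL, e1, e2⟩ := hK.exists_inv
  have bK := hK.bdry
  have bL := hL.bdry
  have d : P.ver.dom (T.ver (.arr ⟨⟩)) = T.obj .zero := T.dom_ver _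
  have c : P.ver.cod (T.ver (.arr ⟨⟩)) = T.obj .one := T.cod_ver _
  have d' := hK.dom_eq.trans d
  have c' := hK.cod_eq.trans c
  rw [d, c] at bK
  rw [d', c'] at bL
  let v : Two.{u} → P.Ver := fun x => match x with
    | .zero => T.ver (.arr ⟨⟩)
    | .one => v'
  let cell : Two.{u} → Two.{u} → P.Sq := fun x y => match x, y with
    | .zero, .zero => P.hid (T.ver (.arr ⟨⟩))
    | .one, .one => P.hid v'
    | .zero, .one => K
    | .one, .zero => L
  refine ⟨susFunctor T.obj v cell ?_ ?_ ?_ ?_ ?_, fun _ => rfl, rfl, fun a => (h₀ a).symm, ?_, e⟩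
  · rintro (_ | _); exacts [d, d']
  · rintro (_ | _); exacts [c, c']
  · rintro (_ | _) (_ | _)
    exacts [hasBdry_hid P d c, bK, bL, hasBdry_hid P d' c']
  · rintro (_ | _) <;> rfl
  · rintro (_ | _) (_ | _) (_ | _)
    · exact P.sqh.id_cc (P.sqh.dom_id _).symm
    · exact bK.hid_hc
    · exact e1
    · exact bK.hc_hid
    · exact bL.hc_hid
    · exact e2
    · exact bL.hid_hc
    · exact P.sqh.id_cc (P.sqh.dom_id _).symm
  · rintro (_ | _)
    · exact h₁.symm
    · have := bK.rgt
      change p.ver v' = _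
      rw [← this, ← p.rgt_sq, e]
      exact R.rgt_sq _


section
variable {P B : DblCat.{u}} {p : DblFunctor P B}

theorem rlp_verIso (hp : VIsoLift p) :
    @HasLiftingProperty DblCat.{u} _ _ _ P B (horMap arrow_to_susIso).transpose p := by
  refine hasLiftingProperty_of _ _ fun T R h => ?_
  obtain ⟨L, h1, h2, h3, h4, h5⟩ := exists_lift_susIso hp T R
    (fun a => (congrFun (congrArg DblFunctor.obj h) a).symm)
    (congrFun (congrArg DblFunctor.ver h) (.arr ⟨⟩)).symm
  exact ⟨L, verOf_arrow_ext h1 h2, verOf_susIso_ext h3 h4 h5⟩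

theorem rlp_horIso (hp : VIsoLift p.transpose) :
    @HasLiftingProperty DblCat.{u} _ _ _ P B (horMap arrow_to_susIso) p := by
  refine hasLiftingProperty_of _ _ fun T R h => ?_
  obtain ⟨L, h1, h2, h3, h4, h5⟩ := exists_lift_susIso hp T.transpose R.transpose
    (fun a => (congrFun (congrArg DblFunctor.obj h) a).symm)
    (congrFun (congrArg DblFunctor.hor h) (.arr ⟨⟩)).symm
  let L' : DblFunctor (horOf susIso) P := DblFunctor.transpose (B := P.transpose) L
  refine ⟨L', ?_, ?_⟩
  · have := verOf_arrow_ext (T := ((horMap arrow_to_susIso).transpose).comp L) (T' := T.transpose) h1 h2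
    exact congrArg (DblFunctor.transpose (A := verOf arrowCat) (B := P.transpose)) this
  · have := verOf_susIso_ext (T := L.comp p.transpose) (T' := R.transpose) h3 h4 h5
    exact congrArg (DblFunctor.transpose (A := verOf susIso) (B := B.transpose)) this

/-- The first companion square of the arrow in `Sq 𝟚`. -/
def arrowφ : Quad arrowCat.{u} := ⟨.arr ⟨⟩, .idn .one, .arr ⟨⟩, .idn .one, rfl, rfl, rfl, rfl⟩
/-- The second companion square of the arrow in `Sq 𝟚`. -/
def arrowψ : Quad arrowCat.{u} := ⟨.idn .zero, .arr ⟨⟩, .idn .zero, .arr ⟨⟩, rfl, rfl, rfl, rfl⟩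

theorem arrow_isCompanionPair :
    (sqOf arrowCat.{u}).IsCompanionPair (.arr ⟨⟩) (.arr ⟨⟩) arrowφ arrowψ :=
  ⟨⟨rfl, rfl, rfl, rfl⟩, ⟨rfl, rfl, rfl, rfl⟩, (CatStr.cc_eq _ rfl).trans rfl,
    (CatStr.cc_eq _ rfl).trans rfl⟩

/-- `Sq 𝟚` is the free-living companion pair: apart from identity squares it contains only the two
structure squares. -/
theorem sqOf_arrow_ext {T T' : DblFunctor (sqOf arrowCat) P}
    (h₀ : ∀ a, T.obj a = T'.obj a) (h₁ : T.hor (.arr ⟨⟩) = T'.hor (.arr ⟨⟩))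
    (h₂ : T.ver (.arr ⟨⟩) = T'.ver (.arr ⟨⟩)) (h₃ : T.sq arrowφ = T'.sq arrowφ)
    (h₄ : T.sq arrowψ = T'.sq arrowψ) : T = T' := by
  have hh : ∀ f, T.hor f = T'.hor f := by
    rintro (a | ⟨⟩)
    · exact (T.hor_id a).trans ((congrArg _ (h₀ a)).trans (T'.hor_id a).symm)
    · exact h₁
  have hv : ∀ f, T.ver f = T'.ver f := by
    rintro (a | ⟨⟩)
    · exact (T.ver_id a).trans ((congrArg _ (h₀ a)).trans (T'.ver_id a).symm)
    · exact h₂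
  have eh : ∀ f, T.sq ((sqOf arrowCat).hid f) = T'.sq ((sqOf arrowCat).hid f) := fun f =>
      (T.sq_hid f).trans ((congrArg _ (hv f)).trans (T'.sq_hid f).symm)
  have ev : ∀ f, T.sq ((sqOf arrowCat).vid f) = T'.sq ((sqOf arrowCat).vid f) := fun f =>
      (T.sq_vid f).trans ((congrArg _ (hh f)).trans (T'.sq_vid f).symm)
  refine DblFunctor.ext (funext h₀) (funext hh) (funext hv) (funext ?_)
  rintro ⟨a | ⟨⟩, b | ⟨⟩, c | ⟨⟩, d | ⟨⟩, k1, k2, k3, k4⟩ <;>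
    simp only [arrCat] at k1 k2 k3 k4 <;> subst_vars <;>
    first
    | exact eh (.idn _)
    | exact eh (.arr _)
    | exact ev (.arr _)
    | exact h₃
    | exact h₄
    | contradiction

namespace VertComp

variable {O M : Type u} {C : CatStr O M} {A : DblCat.{u}} (K : VertComp C A)

theorem cell_of_eq {p : Quad C} {w : M} (h : pair p = ⟨w, w, rfl, rfl⟩) :
    K.cell p = A.hid (K.ver w) :=
  (congrArg K.T.sq h).trans (K.T.sq_hid w)

/-- The 2-cell parallel to this square is an identity, so the equation for its image reduces to the
vertical companion identity. The double functor built from chosen companions thus takes the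
structure squares to the chosen ones. -/
theorem sq_φ (f : M) (h₁ h₂ h₃ h₄) :
    K.sq ⟨f, C.id (C.cod f), f, C.id (C.cod f), h₁, h₂, h₃, h₄⟩ = K.φ f := by
  refine sq_eq ⟨(K.φ_bdry f).cast rfl (K.hor_id _).symm rfl (K.ver_id _).symm, ?_⟩
  have b := K.φ_bdry f
  have c := K.isPair f
  rw [K.cell_of_eq (w := f) (ParPair.ext (show C.cc _ _ = _ from C.cc_id rfl)
    (show C.cc _ _ = _ from C.cc_id rfl))]
  change A.vc (K.ψ f) (K.φ f) = A.hc (A.vc (A.hid (K.ver f)) (K.ψ (C.id (C.cod f)))) _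
  rw [K.ψ_id, c.ver_eq]
  have := K.cod_ver f
  grind

theorem sq_ψ (f : M) (h₁ h₂ h₃ h₄) :
    K.sq ⟨C.id (C.dom f), f, C.id (C.dom f), f, h₁, h₂, h₃, h₄⟩ = K.ψ f := by
  refine sq_eq ⟨(K.ψ_bdry f).cast (K.hor_id _).symm rfl (K.ver_id _).symm rfl, ?_⟩
  have b := K.ψ_bdry f
  have c := K.isPair f
  rw [K.cell_of_eq (w := f) (ParPair.ext (show C.cc _ _ = _ from C.id_cc rfl)
    (show C.cc _ _ = _ from C.id_cc rfl))]
  change A.vc (K.ψ (C.id (C.dom f))) (K.ψ f) =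
    A.hc (A.vc (A.hid (K.ver (C.id (C.dom f)))) (K.ψ f)) _
  rw [K.ψ_id, K.ver_id]
  have := K.dom_ver f
  grind

end VertComp

/-- The problem is to find a companion of the given vertical arrow over a prescribed companion pair,
which `lift_companion` does. A functorial choice of companions on `𝟚` is a single pair besides
identities. -/
theorem exists_lift_companion (hp : VIsoLift p.transpose)
    (T : DblFunctor (verOf arrowCat) P) (hT : P.HasComp (T.ver (.arr ⟨⟩)))
    (R : DblFunctor (sqOf arrowCat) B) (h₀ : ∀ a, p.obj (T.obj a) = R.obj a)
    (h₁ : p.ver (T.ver (.arr ⟨⟩)) = R.ver (.arr ⟨⟩)) :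
    ∃ L : DblFunctor (sqOf arrowCat) P, (∀ a, L.obj a = T.obj a) ∧
      L.ver (.arr ⟨⟩) = T.ver (.arr ⟨⟩) ∧ L.comp p = R := by
  have h := R.map_isCompanionPair arrow_isCompanionPair
  rw [← h₁] at h
  obtain ⟨f', φ', ψ', h', e1, e2, e3⟩ := lift_companion hp hT h
  have d : P.ver.dom (T.ver (.arr ⟨⟩)) = T.obj .zero := T.dom_ver _
  have c : P.ver.cod (T.ver (.arr ⟨⟩)) = T.obj .one := T.cod_ver _
  let comp : ArrMor PUnit.{u + 1} → Comp P := fun f => match f with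
    | .idn a => (compCat P).id (T.obj a)
    | .arr _ => ⟨f', T.ver (.arr ⟨⟩), φ', ψ', h'⟩
  let K : VertComp arrowCat P :=
    { T := T
      comp := comp
      isFun := by
        refine CatStr.IsFun.of_comp ?_ ?_ (fun _ => rfl) ?_
        · rintro (a | ⟨⟩)
          exacts [(compCat P).dom_id _, d]
        · rintro (a | ⟨⟩)
          exacts [(compCat P).cod_id _, c]
        · rintro (a | ⟨⟩) (b | ⟨⟩) k k'
          · have k : a = b := k
            subst k
            exact ((compCat P).id_comp _ _ _).symm
          · have k : a = .zero := k
            subst k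
            exact ((compCat P).id_comp _ _ _).symm
          · have k : .one = b := k
            subst k
            exact ((compCat P).comp_id _ _ _).symm
          · cases k
      ver_eq := by
        rintro (a | ⟨⟩)
        exacts [(T.ver_id a).symm, rfl] }
  refine ⟨K.toFunctor, fun _ => rfl, rfl, sqOf_arrow_ext h₀ e1 h₁ ?_ ?_⟩
  · exact (congrArg p.sq (K.sq_φ (.arr ⟨⟩) _ _ _ _)).trans e2
  · exact (congrArg p.sq (K.sq_ψ (.arr ⟨⟩) _ _ _ _)).trans e3

theorem rlp_companion (hp : VIsoLift p.transpose) (hP : ∀ w, P.HasComp w) :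
    @HasLiftingProperty DblCat.{u} _ _ _ P B (verToSq arrowCat) p := by
  refine hasLiftingProperty_of _ _ fun T R h => ?_
  obtain ⟨L, h1, h2, h3⟩ := exists_lift_companion hp T (hP _) R
    (fun a => (congrFun (congrArg DblFunctor.obj h) a))
    (congrFun (congrArg DblFunctor.ver h) (.arr ⟨⟩))
  exact ⟨L, verOf_arrow_ext h1 h2, h3⟩

/-- The double functor to the horizontal dual with the same values on morphisms. -/
def verOfHop {O M : Type u} {C : CatStr O M} (T : DblFunctor (verOf C) P) :
    DblFunctor (verOf C) P.hop where
  obj := T.obj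
  hor := T.hor
  ver := T.ver
  -- The dual exchanges the left and right sides of squares while the vertical morphisms stay put,
  -- so each 2-cell has to be sent to the image of its inverse.
  sq p := T.sq ⟨p.snd, p.fst, p.dom_eq.symm, p.cod_eq.symm⟩
  hor_fun := ⟨T.cod_hor, T.dom_hor, T.hor_id, fun f g h => by
    have h' : P.hor.dom (T.hor f) = P.hor.cod (T.hor g) := by
      rw [T.dom_hor, T.cod_hor]; exact congrArg T.obj h
    refine Eq.trans ?_ (P.hor.op_cc h').symm
    refine Eq.trans (congrArg T.hor ?_) (T.hor_cc (Eq.symm h))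
    have h : f = g := h
    subst h; rfl⟩
  ver_fun := T.ver_fun
  sqh_fun := ⟨fun p => T.rgt_sq _, fun p => T.lft_sq _, T.sq_hid, fun f g h => by
    have h : f.snd = g.fst := h
    have e : P.lft (T.sq ⟨f.snd, f.fst, f.dom_eq.symm, f.cod_eq.symm⟩) =
        P.rgt (T.sq ⟨g.snd, g.fst, g.dom_eq.symm, g.cod_eq.symm⟩) :=
      (T.lft_sq _).trans ((congrArg T.ver h).trans
        (T.rgt_sq ⟨g.snd, g.fst, g.dom_eq.symm, g.cod_eq.symm⟩).symm)
    refine Eq.trans ?_ (hop_hc e).symm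
    refine Eq.trans (congrArg T.sq ?_) (T.sq_hc (Eq.symm h))
    rw [verOf_hc C (Eq.symm h)]
    rw [show (verOf C).sqh.cc f g = _ from verOf_hc C h]⟩
  sqv_fun := by
    refine ⟨fun p => (T.top_sq _).trans (congrArg T.hor p.dom_eq.symm),
      fun p => (T.bot_sq _).trans (congrArg T.hor p.cod_eq.symm), T.sq_vid, fun f g h => ?_⟩
    have h1 : C.cod f.fst = C.dom g.fst := h
    have h2 : C.cod f.snd = C.dom g.snd := f.cod_eq.symm.trans (h1.trans g.dom_eq)
    refine Eq.trans (congrArg T.sq ?_) (T.sq_vc (by exact h2))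
    refine ParPair.ext ?_ ?_
    · exact (verOf_vc_snd C h1).trans (verOf_vc_fst C (p := ⟨f.snd, f.fst, f.dom_eq.symm, f.cod_eq.symm⟩)
        (q := ⟨g.snd, g.fst, g.dom_eq.symm, g.cod_eq.symm⟩) h2).symm
    · exact (verOf_vc_fst C h1).trans (verOf_vc_snd C (p := ⟨f.snd, f.fst, f.dom_eq.symm, f.cod_eq.symm⟩)
        (q := ⟨g.snd, g.fst, g.dom_eq.symm, g.cod_eq.symm⟩) h2).symm

/-- The horizontal dual of this lifting problem is the one for companions, and the hypotheses on `p`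
and on the vertical morphisms dualise. -/
theorem rlp_conjoint (hp : VIsoLift p.transpose) (hP : ∀ w, P.HasConj w) :
    @HasLiftingProperty DblCat.{u} _ _ _ P B (verToSqHop arrowCat) p := by
  refine hasLiftingProperty_of _ _ fun T R h => ?_
  obtain ⟨L, h1, h2, h3⟩ := exists_lift_companion (p := p.hop) (vIsoLift_hop hp) (verOfHop T)
    (hasConj_iff.1 (hP _)) (DblFunctor.hop R : DblFunctor (sqOf arrowCat).hop.hop B.hop)
    (fun a => (congrFun (congrArg DblFunctor.obj h) a))
    (congrFun (congrArg DblFunctor.ver h) (.arr ⟨⟩))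
  refine ⟨(DblFunctor.hop L : DblFunctor (sqOf arrowCat).hop P.hop.hop), verOf_arrow_ext h1 h2, ?_⟩
  exact congrArg (DblFunctor.hop (A := sqOf arrowCat) (B := B.hop)) h3

/-- Vertical equivalences lift along `p`. -/
def VEquivLift {P B : DblCat.{u}} (p : DblFunctor P B) : Prop :=
  ∀ (a : P.Obj) (z : B.Ver), B.IsVertEquiv z → B.ver.dom z = p.obj a →
    ∃ σ, P.IsVertEquiv σ ∧ P.ver.dom σ = a ∧ p.ver σ = z

/-- Whiskering by an equivalence is full and faithful, hence it also reflects invertibility: the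
inverse descends by fullness and is an inverse by faithfulness. -/
theorem whisker_isVertIso {A : DblCat.{u}} {g p q : A.Ver} (hg : A.IsVertEquiv g) {δ : A.Sq}
    (hp : A.ver.dom p = A.ver.cod g) (hq : A.ver.dom q = A.ver.cod g)
    (hδ : A.IsVertIso δ (A.ver.cc g p) (A.ver.cc g q)) :
    ∃ γ, A.IsVertIso γ p q ∧ A.vc (A.hid g) γ = δ := by
  obtain ⟨δ', hδ', e1, e2⟩ := hδ.exists_inv
  have b := hδ.bdry
  have b' := hδ'.bdry
  obtain ⟨γ, hγ, i⟩ := whisker_surj hg (δ := δ) (by grind) hp hq b.lft b.rgt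
  obtain ⟨γ', hγ', i'⟩ := whisker_surj hg (δ := δ') (by grind) hq hp b'.lft b'.rgt
  have c1 : A.hc γ γ' = A.hid p := by
    apply whisker_inj hg (by grind) (by grind) (by grind) (by grind)
    rw [hid_vc_hc (by grind) (by grind) (by grind)]
    grind
  have c2 : A.hc γ' γ = A.hid q := by
    apply whisker_inj hg (by grind) (by grind) (by grind) (by grind)
    rw [hid_vc_hc (by grind) (by grind) (by grind)]
    grind
  refine ⟨γ, .of_inv (hγ.cast (congrArg _ hp.symm) ?_ rfl rfl) hγ'.lft hγ'.rgt c1 c2, i⟩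
  have := b.bot
  have := A.ver.cod_cc hp.symm
  grind

theorem one_ext {T T' : DblFunctor one P} (h : T.obj = T'.obj) : T = T' := by
  have hv : T.ver = T'.ver := funext fun a =>
    (T.ver_id a).trans ((congrArg _ (congrFun h a)).trans (T'.ver_id a).symm)
  refine DblFunctor.ext h (funext fun a => ?_) hv (funext fun a => ?_)
  · exact (T.hor_id a).trans ((congrArg _ (congrFun h a)).trans (T'.hor_id a).symm)
  · exact (T.sq_hid a.lft).trans ((congrArg _ (congrFun hv a.lft)).trans (T'.sq_hid a.lft).symm)

/-- Lift the first arrow to an equivalence σ and choose any inverse of it with one structure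
isomorphism `H`. The image of this inverse is isomorphic to the prescribed second arrow in such a
way that `H` matches the prescribed cell. Lifting that isomorphism and modifying `H` by it gives an
equivalence lying exactly over the given one. -/
theorem rlp_obj (hp : VIsoLift p) (hp' : VEquivLift p) :
    @HasLiftingProperty DblCat.{u} _ _ _ P B
      (DblFunctor.const DblCat.one (verOf eAdjCat) Two.zero) p := by
  refine hasLiftingProperty_of _ _ fun T R h => ?_
  have h₀ : p.obj (T.obj ⟨⟩) = R.obj .zero := congrFun (congrArg DblFunctor.obj h) ⟨⟩
  have hR := map_eAdj_isVertInv R .zero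
  have dR : B.ver.dom (R.ver ⟨.zero, 1⟩) = R.obj .zero := R.dom_ver _
  have cR : B.ver.cod (R.ver ⟨.zero, 1⟩) = R.obj .one := R.cod_ver _
  have dR' : B.ver.dom (R.ver ⟨.one, 1⟩) = R.obj .one := R.dom_ver _
  have cR' : B.ver.cod (R.ver ⟨.one, 1⟩) = R.obj .zero := R.cod_ver _
  have hcell : B.IsVertIso (R.sq ⟨⟨.zero, 2⟩, ⟨.zero, 0⟩, rfl, rfl⟩)
      (B.ver.cc (R.ver ⟨.zero, 1⟩) (R.ver ⟨.one, 1⟩)) (B.ver.id (R.obj .zero)) := by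
    have := R.map_isVertIso (verOf_isVertIso _ ⟨⟨.zero, 2⟩, ⟨.zero, 0⟩, rfl, rfl⟩)
    have e : R.ver ⟨.zero, 2⟩ = B.ver.cc (R.ver ⟨.zero, 1⟩) (R.ver ⟨.one, 1⟩) :=
      (congrArg R.ver (eAdj_cc .zero 1 1).symm).trans (R.ver_cc rfl)
    have e' : R.ver ⟨.zero, 0⟩ = B.ver.id (R.obj .zero) := R.ver_id .zero
    rw [← e, ← e']; exact this
  obtain ⟨σ, hσ, dσ, pσ⟩ := hp' (T.obj ⟨⟩) (R.ver ⟨.zero, 1⟩) hR.isVertEquiv (dR.trans h₀.symm)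
  obtain ⟨σ', hi⟩ := isVertEquiv_iff.1 hσ
  obtain ⟨H, hH⟩ := hi.inv
  have pH := p.map_isVertIso hH
  rw [p.ver_cc hi.dom_eq.symm, p.ver_id, dσ, h₀, pσ] at pH
  obtain ⟨cellinv, hcinv, i1, i2⟩ := hcell.exists_inv
  have dσ' : B.ver.dom (p.ver σ') = B.ver.cod (R.ver ⟨.zero, 1⟩) := by
    rw [p.dom_ver, hi.dom_eq, ← pσ, p.cod_ver]
  -- Both the image of σ' and the second arrow are inverse to the first arrow. The resulting
  -- isomorphism between their whiskerings by the first arrow descends to κ.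
  obtain ⟨κ, hκ, eκ⟩ := whisker_isVertIso hR.isVertEquiv dσ' (dR'.trans cR.symm) (pH.trans hcinv)
  obtain ⟨σ'', K, hK, pK⟩ := hp _ _ _ hκ
  obtain ⟨K', hK', k1, k2⟩ := hK.exists_inv
  have pσ'' : p.ver σ'' = R.ver ⟨.one, 1⟩ := by
    rw [← hK.bdry.rgt, ← p.rgt_sq, pK]
    exact hκ.bdry.rgt
  have bK := hK.bdry
  have bK' := hK'.bdry
  have bH := hH.bdry
  have bκ := hκ.bdry
  have bc := hcell.bdry
  have bci := hcinv.bdry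
  have bpH := pH.bdry
  have hW := (IsVertIso.refl σ).vcomp hK' (by grind)
  have hD := hW.trans hH
  let D : VertAdj P :=
    { obj := fun x => match x with
        | .zero => T.obj ⟨⟩
        | .one => P.ver.cod σ
      arr := fun x => match x with
        | .zero => σ
        | .one => σ''
      cell := P.hc (P.vc (P.hid σ) K') H
      dom_arr := by rintro (_ | _); exacts [dσ, hK.dom_eq.trans hi.dom_eq]
      cod_arr := by rintro (_ | _); exacts [rfl, (hK.cod_eq.trans hi.cod_eq).trans dσ]
      equiv := hσ
      cell_iso := dσ ▸ hD }
  refine ⟨D.toFunctor, ?_, VertAdj.functor_ext (funext ?_) ?_ ?_⟩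
  · exact one_ext rfl
  · rintro (_ | _)
    · exact h₀
    · exact (p.cod_ver σ).symm.trans ((congrArg _ pσ).trans cR)
  · rintro (_ | _)
    · exact (congrArg p.ver (D.toFunctor_ver_letter .zero)).trans pσ
    · exact (congrArg p.ver (D.toFunctor_ver_letter .one)).trans pσ''
  · refine (congrArg p.sq D.toFunctor_cell).trans ?_
    change p.sq (P.hc (P.vc (P.hid σ) K') H) = _
    have j : B.hc (p.sq K') κ = B.hid (R.ver ⟨.one, 1⟩) := by
      rw [← pK, ← pσ'', ← p.sq_hid, ← k2]
      exact (p.sq_hc (bK'.rgt.trans bK.lft.symm)).symm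
    rw [p.sq_hc (by grind), p.sq_vc (by grind), p.sq_hid, pσ]
    have bp := (p.map_isVertIso hK').bdry
    have d1 : B.ver.dom (p.ver σ'') = B.ver.cod (R.ver ⟨.zero, 1⟩) := by
      rw [pσ'', dR', cR]
    -- Substituting the equation that defines κ makes the image of `K'` cancel against κ. So the
    -- image of the new cell is a left inverse of `cellinv`, and hence equals the prescribed cell.
    have x : B.hc (B.hc (B.vc (B.hid (R.ver ⟨.zero, 1⟩)) (p.sq K')) (p.sq H)) cellinv =
        B.hid (B.ver.cc (R.ver ⟨.zero, 1⟩) (R.ver ⟨.one, 1⟩)) := by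
      rw [hassoc (by grind) (by grind), ← eκ, ← hid_vc_hc (by grind) (by grind) (by grind), j,
        B.hid_cc (by grind)]
    refine B.sqh.inv_unique (k := cellinv) ?_ (bci.rgt.trans bc.lft.symm)
      (x.trans (congrArg B.hid ?_)) (i2.trans (congrArg B.hid bc.rgt.symm))
    · refine (B.sqh.cod_cc ?_).trans (bpH.rgt.trans bci.lft.symm)
      grind
    · grind

end
end DblCat

/-! ### Functoriality of the pseudo hom double category -/

theorem DblFunctor.map_sqv_isIso {A B : DblCat.{u}} (F : DblFunctor A B) {α : A.Sq}
    (h : A.sqv.IsIso α) : B.sqv.IsIso (F.sq α) := by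
  obtain ⟨β, h1, h2, h3, h4⟩ := h
  refine ⟨F.sq β, ?_, ?_, ?_, ?_⟩
  · exact (F.top_sq _).trans ((congrArg F.hor h1).trans (F.bot_sq _).symm)
  · exact (F.bot_sq _).trans ((congrArg F.hor h2).trans (F.top_sq _).symm)
  · exact (F.sq_vc h1.symm).symm.trans ((congrArg F.sq h3).trans ((F.sq_vid _).trans
      (congrArg _ (F.top_sq _).symm)))
  · exact (F.sq_vc h2).symm.trans ((congrArg F.sq h4).trans ((F.sq_vid _).trans
      (congrArg _ (F.bot_sq _).symm)))

namespace HorPs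

section
variable {Y X A : DblCat.{u}}

theorem hor_boundary (h : HorPs X A) (f : X.Hor) :
    A.hor.cod (h.app (X.hor.dom f)) = A.hor.dom (h.tgt.hor f) ∧
      A.hor.cod (h.src.hor f) = A.hor.dom (h.app (X.hor.cod f)) := by
  rw [h.cod_app, h.dom_app, h.tgt.dom_hor, h.src.cod_hor]
  exact ⟨rfl, rfl⟩

/-- The image of a transformation under a double functor. -/
def map (h : HorPs Y X) (F : DblFunctor X A) : HorPs Y A where
  src := h.src.comp F
  tgt := h.tgt.comp F
  app y := F.hor (h.app y)
  appVer w := F.sq (h.appVer w)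
  appHor f := F.sq (h.appHor f)
  dom_app a := (F.dom_hor _).trans (congrArg F.obj (h.dom_app a))
  cod_app a := (F.cod_hor _).trans (congrArg F.obj (h.cod_app a))
  appVer_bdry w := F.map_bdry (h.appVer_bdry w)
  appHor_bdry f := (F.map_bdry (h.appHor_bdry f)).cast (F.hor_cc (h.hor_boundary f).1)
    (F.hor_cc (h.hor_boundary f).2) (F.ver_id _) (F.ver_id _)
  appHor_iso f := F.map_sqv_isIso (h.appHor_iso f)
  appVer_id a := (congrArg F.sq (h.appVer_id a)).trans (F.sq_vid _)
  appVer_cc w z e := (congrArg F.sq (h.appVer_cc w z e)).trans (F.sq_vc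
    ((h.appVer_bdry w).bot.trans ((congrArg h.app e).trans (h.appVer_bdry z).top.symm)))
  appHor_id a := (congrArg F.sq (h.appHor_id a)).trans (F.sq_vid _)
  appHor_cc f g e := by
    have b := h.appHor_bdry f
    have b' := h.appHor_bdry g
    have v := HorPs.src_vid_bdry h.tgt g
    have v' := HorPs.src_vid_bdry h.src f
    have c1 := h.hor_boundary f
    have c2 := h.hor_boundary g
    have t := h.tgt.hor_cc e
    rw [← e] at b' v c2
    rw [h.appHor_cc f g e]
    have l := b.hc v
    have l' := v'.hc b'
    have m : A.vid (F.hor (h.tgt.hor g)) = F.sq (X.vid (h.tgt.hor g)) := (F.sq_vid _).symm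
    have m' : A.vid (F.hor (h.src.hor f)) = F.sq (X.vid (h.src.hor f)) := (F.sq_vid _).symm
    refine Eq.trans ?_ (congrArg₂ (fun x y => A.vc (A.hc _ x) (A.hc y _)) m m').symm
    rw [← F.sq_hc (b.rgt.trans v.lft.symm), ← F.sq_hc (v'.rgt.trans b'.lft.symm)]
    refine F.sq_vc (l.bot.trans (Eq.trans ?_ l'.top.symm))
    exact X.hor.cc_assoc c1.2 c2.1
  naturality α := by
    have b1 := h.appVer_bdry (Y.lft α)
    have b2 := h.appVer_bdry (Y.rgt α)
    have t1 : Y.hor.dom (Y.top α) = Y.ver.dom (Y.lft α) := Y.top_fun.dom α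
    have t2 : Y.hor.cod (Y.top α) = Y.ver.dom (Y.rgt α) := Y.top_fun.cod α
    have t3 : Y.hor.dom (Y.bot α) = Y.ver.cod (Y.lft α) := Y.bot_fun.dom α
    have t4 : Y.hor.cod (Y.bot α) = Y.ver.cod (Y.rgt α) := Y.bot_fun.cod α
    have s1 := HorPs.sq_bdry h.src α
    have s2 := HorPs.sq_bdry h.tgt α
    have b3 := h.appHor_bdry (Y.top α)
    have b4 := h.appHor_bdry (Y.bot α)
    have l := b1.hc s2
    have r := s1.hc b2
    rw [t1, t2] at b3
    rw [t3, t4] at b4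
    refine Eq.trans ?_ ((congrArg F.sq (h.naturality α)).trans ?_)
    · refine (congrArg (A.vc · _) (F.sq_hc (b1.rgt.trans s2.lft.symm)).symm).trans ?_
      exact (F.sq_vc (l.bot.trans b4.top.symm)).symm
    · refine Eq.trans ?_ (congrArg (A.vc _ ·) (F.sq_hc (s1.rgt.trans b2.lft.symm)))
      exact (F.sq_vc (b3.bot.trans r.top.symm))

/-- The restriction of a transformation along a double functor. -/
def precomp (h : HorPs X A) (S : DblFunctor Y X) : HorPs Y A where
  src := S.comp h.src
  tgt := S.comp h.tgt
  app y := h.app (S.obj y)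
  appVer w := h.appVer (S.ver w)
  appHor f := h.appHor (S.hor f)
  dom_app a := h.dom_app _
  cod_app a := h.cod_app _
  appVer_bdry w := (h.appVer_bdry (S.ver w)).cast (congrArg h.app (S.dom_ver w))
    (congrArg h.app (S.cod_ver w)) rfl rfl
  appHor_bdry f := by
    have := h.appHor_bdry (S.hor f)
    rwa [S.dom_hor, S.cod_hor] at this
  appHor_iso f := h.appHor_iso _
  appVer_id a := (congrArg h.appVer (S.ver_id a)).trans (h.appVer_id _)
  appVer_cc w z e := (congrArg h.appVer (S.ver_cc e)).trans
    (h.appVer_cc _ _ (by rw [S.cod_ver, S.dom_ver, e]))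
  appHor_id a := (congrArg h.appHor (S.hor_id a)).trans (h.appHor_id _)
  appHor_cc f g e := (congrArg h.appHor (S.hor_cc e)).trans
    (h.appHor_cc _ _ (by rw [S.cod_hor, S.dom_hor, e]))
  naturality α := by
    have := h.naturality (S.sq α)
    rwa [S.lft_sq, S.rgt_sq, S.top_sq, S.bot_sq] at this

end

end HorPs

namespace PsMod

section
variable {Y X A : DblCat.{u}}

/-- The image of a modification under a double functor. -/
def map (m : PsMod Y X) (F : DblFunctor X A) : PsMod Y A where
  top := m.top.map F
  bot := m.bot.map F
  lft := m.lft.map F.transpose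
  rgt := m.rgt.map F.transpose
  tl := congrArg (DblFunctor.comp · F) m.tl
  tr := congrArg (DblFunctor.comp · F) m.tr
  bl := congrArg (DblFunctor.comp · F) m.bl
  br := congrArg (DblFunctor.comp · F) m.br
  app y := F.sq (m.app y)
  app_bdry y := F.map_bdry (m.app_bdry y)
  ver_coh w := by
    have tl : m.top.src.ver w = m.lft.src.hor w := congrArg (fun F => DblFunctor.ver F w) m.tl
    have tr : m.top.tgt.ver w = m.rgt.src.hor w := congrArg (fun F => DblFunctor.ver F w) m.tr
    have bl : m.bot.src.ver w = m.lft.tgt.hor w := congrArg (fun F => DblFunctor.ver F w) m.bl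
    have br : m.bot.tgt.ver w = m.rgt.tgt.hor w := congrArg (fun F => DblFunctor.ver F w) m.br
    have a1 := (m.top.appVer_bdry w).cast rfl rfl tl tr
    have a2 := (m.bot.appVer_bdry w).cast rfl rfl bl br
    have b1 := m.app_bdry (Y.ver.dom w)
    have b2 := m.app_bdry (Y.ver.cod w)
    have L := (m.lft.appHor_bdry w).transpose
    have R := (m.rgt.appHor_bdry w).transpose
    have l := a1.vc b2
    have r := b1.vc a2
    refine Eq.trans ?_ ((congrArg F.sq (m.ver_coh w)).trans ?_)
    · refine (congrArg (A.hc _ ·) (F.sq_vc (a1.bot.trans b2.top.symm)).symm).trans ?_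
      exact (F.sq_hc (L.rgt.trans l.lft.symm)).symm
    · refine Eq.trans ?_ (congrArg (A.hc · _) (F.sq_vc (b1.bot.trans a2.top.symm)))
      exact (F.sq_hc (r.rgt.trans R.lft.symm))
  hor_coh f := by
    have tl : m.top.src.hor f = m.lft.src.ver f := congrArg (fun F => DblFunctor.hor F f) m.tl
    have tr : m.top.tgt.hor f = m.rgt.src.ver f := congrArg (fun F => DblFunctor.hor F f) m.tr
    have bl : m.bot.src.hor f = m.lft.tgt.ver f := congrArg (fun F => DblFunctor.hor F f) m.bl
    have br : m.bot.tgt.hor f = m.rgt.tgt.ver f := congrArg (fun F => DblFunctor.hor F f) m.br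
    have a1 := (m.lft.appVer_bdry f).transpose.cast tl.symm bl.symm rfl rfl
    have a2 := (m.rgt.appVer_bdry f).transpose.cast tr.symm br.symm rfl rfl
    have b1 := m.app_bdry (Y.hor.dom f)
    have b2 := m.app_bdry (Y.hor.cod f)
    have L := m.top.appHor_bdry f
    have R := m.bot.appHor_bdry f
    have l := a1.hc b2
    have r := b1.hc a2
    refine Eq.trans ?_ ((congrArg F.sq (m.hor_coh f)).trans ?_)
    · refine (congrArg (A.vc _ ·) (F.sq_hc (a1.rgt.trans b2.lft.symm)).symm).trans ?_
      exact (F.sq_vc (L.bot.trans l.top.symm)).symm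
    · refine Eq.trans ?_ (congrArg (A.vc · _) (F.sq_hc (b1.rgt.trans a2.lft.symm)))
      exact (F.sq_vc (r.bot.trans R.top.symm))

end
end PsMod

namespace HorPs
variable {Y X A : DblCat.{u}}

theorem map_id (G : DblFunctor Y X) (F : DblFunctor X A) :
    (HorPs.id G).map F = HorPs.id (G.comp F) :=
  HorPs.ext rfl rfl (funext fun _ => F.hor_id _) (funext fun _ => F.sq_hid _)
    (funext fun _ => F.sq_vid _)

theorem map_comp (h k : HorPs Y X) (F : DblFunctor X A) (e : h.tgt = k.src)
    (e' : (h.map F).tgt = (k.map F).src) :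
    (HorPs.comp h k e).map F = HorPs.comp (h.map F) (k.map F) e' := by
  have c : ∀ y, X.hor.cod (h.app y) = X.hor.dom (k.app y) := fun y => by
    rw [h.cod_app, k.dom_app, e]
  refine HorPs.ext rfl rfl (funext fun y => F.hor_cc (c y)) (funext fun w => ?_)
    (funext fun f => ?_)
  · have b := h.appVer_bdry w
    have b' := k.appVer_bdry w
    rw [← e] at b'
    exact F.sq_hc (b.rgt.trans b'.lft.symm)
  · have b1 := (h.app_vid_bdry (Y.hor.dom f))
    have b1' := k.appHor_bdry f
    have b2 := (h.appHor_bdry f)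
    have b2' := k.app_vid_bdry (Y.hor.cod f)
    have c1 := (h.hor_boundary f)
    have c2 := (k.hor_boundary f)
    rw [← e] at b1' b2' c2
    have l := b1.hc b1'
    have r := b2.hc b2'
    change F.sq (X.vc (X.hc (X.vid _) (k.appHor f)) (X.hc (h.appHor f) (X.vid _))) =
      A.vc (A.hc (A.vid (F.hor _)) (F.sq (k.appHor f))) (A.hc (F.sq (h.appHor f)) (A.vid (F.hor _)))
    rw [F.sq_vc (l.bot.trans (Eq.trans ?_ r.top.symm)), F.sq_hc (b1.rgt.trans b1'.lft.symm),
      F.sq_hc (b2.rgt.trans b2'.lft.symm), F.sq_vid, F.sq_vid]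
    exact (X.hor.cc_assoc c1.1 c2.2).symm

end HorPs

namespace PsMod
variable {Y X A : DblCat.{u}}

theorem map_hid (r : VerPs Y X) (F : DblFunctor X A) :
    (PsMod.hid r).map F = PsMod.hid (r.map F.transpose) :=
  PsMod.ext (HorPs.map_id _ _) (HorPs.map_id _ _) rfl rfl (funext fun _ => F.sq_hid _)

theorem map_hcomp (m n : PsMod Y X) (F : DblFunctor X A) (e : m.rgt = n.lft)
    (e' : (m.map F).rgt = (n.map F).lft) :
    (PsMod.hcomp m n e).map F = PsMod.hcomp (m.map F) (n.map F) e' := by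
  refine PsMod.ext (HorPs.map_comp _ _ _ (m.top_comp n e) ((m.map F).top_comp (n.map F) e'))
    (HorPs.map_comp _ _ _ (m.bot_comp n e) ((m.map F).bot_comp (n.map F) e')) rfl rfl
    (funext fun y => ?_)
  have b := m.app_bdry y
  have b' := n.app_bdry y
  rw [← e] at b'
  exact F.sq_hc (b.rgt.trans b'.lft.symm)

end PsMod

/-- Postcomposition with a double functor. -/
noncomputable def DblFunctor.postComp {X A : DblCat.{u}} (Y : DblCat.{u}) (F : DblFunctor X A) :
    DblFunctor (psHom Y X) (psHom Y A) where
  obj G := G.comp F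
  hor h := h.map F
  ver r := HorPs.map r F.transpose
  sq m := m.map F
  hor_fun := CatStr.IsFun.of_comp (fun _ => rfl) (fun _ => rfl) (fun G => HorPs.map_id G F)
    (fun h k e e' => HorPs.map_comp h k F e e')
  ver_fun := CatStr.IsFun.of_comp (fun _ => rfl) (fun _ => rfl)
    (fun G => HorPs.map_id G.transpose F.transpose)
    (fun h k e e' => HorPs.map_comp h k F.transpose (congrArg DblFunctor.transpose e)
      (congrArg DblFunctor.transpose e'))
  sqh_fun := CatStr.IsFun.of_comp (fun _ => rfl) (fun _ => rfl) (fun r => PsMod.map_hid r F)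
    (fun m n e e' => PsMod.map_hcomp m n F e e')
  sqv_fun := CatStr.IsFun.of_comp (fun _ => rfl) (fun _ => rfl)
    (fun h => congrArg PsMod.transpose (PsMod.map_hid (Y := Y.transpose) (X := X.transpose)
      (A := A.transpose) h F.transpose))
    (fun m n e e' => congrArg PsMod.transpose (PsMod.map_hcomp m.transpose n.transpose F.transpose e e'))

/-! ### Interchange of horizontal with vertical transformations -/

namespace HorPs
variable {Y X A : DblCat.{u}}

/-- Naturality at a square with identity top and bottom. -/
theorem naturality_of_ids (h : HorPs X A) {q : X.Sq} {a b : X.Obj} (ht : X.top q = X.hor.id a)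
    (hb : X.bot q = X.hor.id b) :
    A.hc (h.appVer (X.lft q)) (h.tgt.sq q) = A.hc (h.src.sq q) (h.appVer (X.rgt q)) := by
  have n := h.naturality q
  have b1 := h.appVer_bdry (X.lft q)
  have b2 := h.appVer_bdry (X.rgt q)
  have s1 := HorPs.sq_bdry h.src q
  have s2 := HorPs.sq_bdry h.tgt q
  have e1 := X.dom_top q
  have e2 := X.cod_top q
  have e3 := X.dom_bot q
  have e4 := X.cod_bot q
  rw [ht, X.hor.dom_id] at e1
  rw [ht, X.hor.cod_id] at e2
  rw [hb, X.hor.dom_id] at e3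
  rw [hb, X.hor.cod_id] at e4
  rw [ht, h.appHor_id] at n
  rw [hb, h.appHor_id] at n
  rw [← e1, ← e3] at b1
  rw [← e2, ← e4] at b2
  rw [ht, hb, h.tgt.hor_id, h.tgt.hor_id] at s2
  rw [ht, hb, h.src.hor_id, h.src.hor_id] at s1
  have l := b1.hc s2
  have r := s1.hc b2
  rw [A.hor.cc_id (h.cod_app _), A.hor.cc_id (h.cod_app _)] at l
  rw [A.hor.id_cc (h.dom_app _).symm, A.hor.id_cc (h.dom_app _).symm] at r
  exact l.vc_vid.symm.trans (n.trans r.vid_vc)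

/-- The interchange modification of a horizontal transformation after a vertical one. -/
def cell (h : HorPs X A) (θ : VerPs Y X) : PsMod Y A where
  top := h.precomp θ.dom
  bot := h.precomp θ.cod
  lft := θ.map h.src.transpose
  rgt := θ.map h.tgt.transpose
  tl := rfl
  tr := rfl
  bl := rfl
  br := rfl
  app y := h.appVer (θ.app y)
  app_bdry y := (h.appVer_bdry (θ.app y)).cast (congrArg h.app (θ.dom_app y))
    (congrArg h.app (θ.cod_app y)) rfl rfl
  ver_coh w := by
    have b := (θ.appHor_bdry w).transpose
    have c := θ.hor_boundary w
    -- The coherence along vertical morphisms is naturality of `h` at the invertible components of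
    -- θ; the coherence along horizontal morphisms is naturality at the other component squares of
    -- θ.
    have n := h.naturality_of_ids b.top b.bot
    have e1 := h.appVer_cc _ _ c.1
    have e2 := h.appVer_cc _ _ c.2
    have e3 : h.appVer (X.lft (θ.appHor w)) = _ := (congrArg h.appVer b.lft).trans e1
    have e4 : h.appVer (X.rgt (θ.appHor w)) = _ := (congrArg h.appVer b.rgt).trans e2
    rw [e3, e4] at n
    exact n.symm
  hor_coh f := by
    have b := (θ.appVer_bdry f).transpose
    have n := h.naturality (θ.appVer f)
    have e1 := congrArg h.appVer b.lft
    have e2 := congrArg h.appVer b.rgt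
    have e3 := congrArg h.appHor b.top
    have e4 := congrArg h.appHor b.bot
    exact (congrArg₂ A.vc e3.symm (congrArg (A.hc _) e2.symm)).trans (n.symm.trans
      (congrArg₂ A.vc (congrArg (A.hc · _) e1) e4))

end HorPs

namespace PsMod
variable {X A : DblCat.{u}}

/-- Modifications with the same boundary and the same components are equal. -/
theorem ext_of_bdry {m n : PsMod X A} {f g : HorPs X A} {v w : VerPs X A}
    (hm : (psHom X A).HasBdry m f g v w) (hn : (psHom X A).HasBdry n f g v w)
    (h : ∀ x, m.app x = n.app x) : m = n :=
  PsMod.ext (hm.top.trans hn.top.symm) (hm.bot.trans hn.bot.symm) (hm.lft.trans hn.lft.symm)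
    (hm.rgt.trans hn.rgt.symm) (funext h)

theorem bdry_app {m : PsMod X A} {f g : HorPs X A} {v w : VerPs X A}
    (h : (psHom X A).HasBdry m f g v w) (x : X.Obj) :
    A.HasBdry (m.app x) (f.app x) (g.app x) (v.app x) (w.app x) := (evalAt X A x).map_bdry h

theorem app_hc {m n : (psHom X A).Sq} (h : (psHom X A).rgt m = (psHom X A).lft n) (x : X.Obj) :
    ((psHom X A).hc m n).app x = A.hc (m.app x) (n.app x) := (evalAt X A x).sq_hc h

theorem app_vc {m n : (psHom X A).Sq} (h : (psHom X A).bot m = (psHom X A).top n) (x : X.Obj) :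
    ((psHom X A).vc m n).app x = A.vc (m.app x) (n.app x) := (evalAt X A x).sq_vc h

end PsMod

/-! ### Codiscrete double categories -/

namespace DblCat

/-- Every compatible boundary has exactly one filler. -/
structure IsCodisc (P : DblCat.{u}) : Prop where
  ex : ∀ (f g : P.Hor) (v w : P.Ver), P.hor.dom f = P.ver.dom v → P.hor.cod f = P.ver.dom w →
    P.hor.dom g = P.ver.cod v → P.hor.cod g = P.ver.cod w → ∃ α, P.HasBdry α f g v w
  uniq : ∀ {α β : P.Sq} {f g : P.Hor} {v w : P.Ver}, P.HasBdry α f g v w → P.HasBdry β f g v w →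
    α = β

namespace IsCodisc
variable {P : DblCat.{u}}

theorem transpose (h : P.IsCodisc) : P.transpose.IsCodisc where
  ex f g v w a b c d := by
    obtain ⟨α, hα⟩ := h.ex v w f g a.symm c.symm b.symm d.symm
    exact ⟨α, hα.transpose⟩
  uniq a b := h.uniq a.transpose b.transpose

/-- The filler of the reversed boundary is an inverse, because both composites are fillers of the
boundary of an identity square. -/
theorem isVertIso (h : P.IsCodisc) {α : P.Sq} {v w : P.Ver}
    (hα : P.HasBdry α (P.hor.id (P.ver.dom v)) (P.hor.id (P.ver.cod v)) v w) :
    P.IsVertIso α v w := by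
  have d : P.ver.dom w = P.ver.dom v := hα.tr.symm.trans (P.hor.cod_id _)
  have c : P.ver.cod w = P.ver.cod v := hα.br.symm.trans (P.hor.cod_id _)
  obtain ⟨β, hβ⟩ := h.ex (P.hor.id (P.ver.dom v)) (P.hor.id (P.ver.cod v)) w v (by grind) (by grind)
    (by grind) (by grind)
  refine .of_inv (β := β) hα hβ.lft hβ.rgt ?_ ?_
  · exact h.uniq ((hα.hc hβ).cast (by grind) (by grind) rfl rfl) (hasBdry_hid P rfl rfl)
  · exact h.uniq ((hβ.hc hα).cast (by grind) (by grind) rfl rfl) (hasBdry_hid P d c)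

theorem vIso (h : P.IsCodisc) {v w : P.Ver} (hd : P.ver.dom v = P.ver.dom w)
    (hc : P.ver.cod v = P.ver.cod w) : P.VIso v w := by
  obtain ⟨β, hβ⟩ := h.ex (P.hor.id (P.ver.dom v)) (P.hor.id (P.ver.cod v)) v w (by grind) (by grind)
    (by grind) (by grind)
  exact ⟨β, h.isVertIso hβ⟩

theorem isVertInv (h : P.IsCodisc) {v w : P.Ver} (hd : P.ver.dom w = P.ver.cod v)
    (hc : P.ver.cod w = P.ver.dom v) : P.IsVertInv v w :=
  ⟨hd, hc, h.vIso (by grind) (by grind), h.vIso (by grind) (by grind)⟩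

/-- Both structure squares exist as fillers, and each companion equation compares two fillers of one
boundary. So any horizontal morphism with the right endpoints is a companion. -/
theorem hasComp (h : P.IsCodisc) {w : P.Ver} {f : P.Hor} (hd : P.hor.dom f = P.ver.dom w)
    (hc : P.hor.cod f = P.ver.cod w) : P.HasComp w := by
  obtain ⟨φ, hφ⟩ := h.ex f (P.hor.id (P.ver.cod w)) w (P.ver.id (P.ver.cod w)) (by grind) (by grind)
    (by grind) (by grind)
  obtain ⟨ψ, hψ⟩ := h.ex (P.hor.id (P.ver.dom w)) f (P.ver.id (P.ver.dom w)) w (by grind) (by grind)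
    (by grind) (by grind)
  refine ⟨f, φ, ψ, hφ, hψ, ?_, ?_⟩
  · exact h.uniq ((hψ.hc hφ).cast (by grind) (by grind) rfl rfl) (hasBdry_vid P hd hc)
  · exact h.uniq ((hψ.vc hφ).cast rfl rfl (by grind) (by grind)) (hasBdry_hid P rfl rfl)

theorem hop (h : P.IsCodisc) : P.hop.IsCodisc where
  ex f g v w a b c d := by
    obtain ⟨α, hα⟩ := h.ex f g w v b a d c
    exact ⟨α, hα.top, hα.bot, hα.rgt, hα.lft⟩
  uniq a b := h.uniq ⟨a.top, a.bot, a.rgt, a.lft⟩ ⟨b.top, b.bot, b.rgt, b.lft⟩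

theorem hasConj (h : P.IsCodisc) {w : P.Ver} {f : P.Hor} (hd : P.hor.dom f = P.ver.cod w)
    (hc : P.hor.cod f = P.ver.dom w) : P.HasConj w :=
  hasConj_iff.2 (h.hop.hasComp hc hd)

end IsCodisc

/-- A square of `Sq C` is no more than its boundary, as the 2-cell filling it exists and is unique.
-/
theorem isCodisc_sqOf {O M : Type u} (C : CatStr O M) : (sqOf C).IsCodisc where
  ex f g v w a b c d := ⟨⟨f, g, v, w, a, b, c, d⟩, rfl, rfl, rfl, rfl⟩
  uniq := by
    rintro ⟨⟩ ⟨⟩ f g v w ⟨rfl, rfl, rfl, rfl⟩ ⟨h1, h2, h3, h4⟩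
    exact (Quad.ext h1 h2 h3 h4).symm

end DblCat

/-- Transformations of double functors with a codiscrete target are given by any family of
morphisms. -/
theorem DblCat.IsCodisc.exists_horPs {Y X : DblCat.{u}} (h : X.IsCodisc) (F G : DblFunctor Y X)
    (k : Y.Obj → X.Hor) (hd : ∀ y, X.hor.dom (k y) = F.obj y)
    (hc : ∀ y, X.hor.cod (k y) = G.obj y) :
    ∃ θ : HorPs Y X, θ.src = F ∧ θ.tgt = G ∧ θ.app = k := by
  have c1 : ∀ f : Y.Hor, X.hor.cod (k (Y.hor.dom f)) = X.hor.dom (G.hor f) := fun f =>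
    (hc _).trans (G.dom_hor f).symm
  have c2 : ∀ f : Y.Hor, X.hor.cod (F.hor f) = X.hor.dom (k (Y.hor.cod f)) := fun f =>
    (F.cod_hor f).trans (hd _).symm
  -- The components at morphisms are taken to be the unique fillers. Each axiom then equates two
  -- squares with the same boundary, and the work lies only in comparing boundaries.
  have exV := fun w : Y.Ver => h.ex (k (Y.ver.dom w)) (k (Y.ver.cod w)) (F.ver w) (G.ver w)
    ((hd _).trans (F.dom_ver w).symm) ((hc _).trans (G.dom_ver w).symm)
    ((hd _).trans (F.cod_ver w).symm) ((hc _).trans (G.cod_ver w).symm)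
  have exH := fun f : Y.Hor => h.ex (X.hor.cc (k (Y.hor.dom f)) (G.hor f))
    (X.hor.cc (F.hor f) (k (Y.hor.cod f))) (X.ver.id (F.obj (Y.hor.dom f)))
    (X.ver.id (G.obj (Y.hor.cod f))) (by rw [X.hor.dom_cc, hd, X.ver.dom_id])
    (by rw [X.hor.cod_cc (c1 f), G.cod_hor, X.ver.dom_id])
    (by rw [X.hor.dom_cc, F.dom_hor, X.ver.cod_id])
    (by rw [X.hor.cod_cc (c2 f), hc, X.ver.cod_id])
  choose aV bV using exV
  choose aH bH using exH
  refine ⟨{ src := F, tgt := G, app := k, appVer := aV, appHor := aH, dom_app := hd, cod_app := hc,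
            appVer_bdry := bV, appHor_bdry := bH, appHor_iso := fun f => ?_, appVer_id := fun a => ?_,
            appVer_cc := fun w z e => ?_, appHor_id := fun a => ?_, appHor_cc := fun f g e => ?_,
            naturality := fun α => ?_ }, rfl, rfl, rfl⟩
  · have b := bH f
    have t := b.tl; have t2 := b.tr; have t3 := b.bl; have t4 := b.br
    have i : X.transpose.IsVertIso (aH f) (X.hor.cc (k (Y.hor.dom f)) (G.hor f))
        (X.hor.cc (F.hor f) (k (Y.hor.cod f))) :=
      h.transpose.isVertIso (b.transpose.cast (congrArg X.ver.id (by grind))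
        (congrArg X.ver.id (by grind)) rfl rfl)
    exact i.iso
  · refine h.uniq ((bV _).cast ?_ ?_ (F.ver_id a) (G.ver_id a)) (DblCat.hasBdry_vid X (hd a) (hc a))
    · rw [Y.ver.dom_id]
    · rw [Y.ver.cod_id]
  · have b := bV z
    rw [← e] at b
    refine h.uniq ((bV _).cast ?_ ?_ (F.ver_cc e) (G.ver_cc e)) ((bV w).vc b)
    · rw [Y.ver.dom_cc]
    · rw [Y.ver.cod_cc e]
  · refine h.uniq ((bH _).cast ?_ ?_ ?_ ?_) (DblCat.hasBdry_vid X (hd a) (hc a))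
    · rw [G.hor_id, Y.hor.dom_id, X.hor.cc_id (hc a)]
    · rw [F.hor_id, Y.hor.cod_id, X.hor.id_cc (hd a).symm]
    · rw [Y.hor.dom_id]
    · rw [Y.hor.cod_id]
  · have b := bH g
    have d1 := c1 g
    have d2 := c2 g
    rw [← e] at b d1
    have v1 := DblCat.hasBdry_vid X (f := G.hor g) (a := G.obj (Y.hor.cod f)) (by rw [G.dom_hor, e])
      (G.cod_hor g)
    have v2 := DblCat.hasBdry_vid X (F.dom_hor f) (F.cod_hor f)
    have a1 := X.hor.cc_assoc (c1 f) ((G.cod_hor f).trans ((congrArg G.obj e).trans (G.dom_hor g).symm))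
    have a2 := X.hor.cc_assoc (c2 f) d1
    have a3 := X.hor.cc_assoc ((F.cod_hor f).trans ((F.dom_hor g).trans (congrArg F.obj e.symm)).symm) d2
    have l := (bH f).hc v1
    have r := v2.hc b
    refine h.uniq (bH _) ((l.vc (r.cast a2.symm rfl rfl rfl)).cast ?_ ?_ ?_ ?_)
    · rw [a1, Y.hor.dom_cc, G.hor_cc e]
    · rw [← a3, Y.hor.cod_cc e, F.hor_cc e]
    · rw [X.ver.id_cc (X.ver.dom_id _).symm, Y.hor.dom_cc]
    · rw [X.ver.id_cc (X.ver.dom_id _).symm, Y.hor.cod_cc e]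
  · have b1 := bV (Y.lft α)
    have b2 := bV (Y.rgt α)
    have b3 := bH (Y.top α)
    have b4 := bH (Y.bot α)
    rw [Y.dom_top, Y.cod_top] at b3
    rw [Y.dom_bot, Y.cod_bot] at b4
    have l := (b1.hc (HorPs.sq_bdry G α)).vc b4
    have r := b3.vc ((HorPs.sq_bdry F α).hc b2)
    refine h.uniq l (r.cast rfl rfl ?_ ?_)
    · rw [X.ver.id_cc, X.ver.cc_id]
      · exact (F.cod_ver _)
      · exact (F.dom_ver _).symm
    · rw [X.ver.id_cc, X.ver.cc_id]
      · exact (G.cod_ver _)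
      · exact (G.dom_ver _).symm

namespace DblCat

/-- A modification is determined by its boundary and its components, so uniqueness holds pointwise.
For existence, take fillers as components; the coherence conditions hold since both sides fill the
same boundary. -/
theorem isCodisc_psHom {X : DblCat.{u}} (Y : DblCat.{u}) (h : X.IsCodisc) : (psHom Y X).IsCodisc where
  uniq a b := PsMod.ext_of_bdry a b fun x => by
    exact h.uniq (PsMod.bdry_app a x) (PsMod.bdry_app b x)
  ex f g v w e1 e2 e3 e4 := by
    have f1 : f.src = v.dom := e1
    have f2 : f.tgt = w.dom := e2
    have f3 : g.src = v.cod := e3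
    have f4 : g.tgt = w.cod := e4
    have ex := fun y : Y.Obj => h.ex (f.app y) (g.app y) (v.app y) (w.app y)
      (by
        have t : f.src.obj y = v.src.obj y := congrArg (fun F => DblFunctor.obj F y) f1
        exact (f.dom_app y).trans (t.trans (v.dom_app y).symm))
      (by
        have t : f.tgt.obj y = w.src.obj y := congrArg (fun F => DblFunctor.obj F y) f2
        exact (f.cod_app y).trans (t.trans (w.dom_app y).symm))
      (by
        have t : g.src.obj y = v.tgt.obj y := congrArg (fun F => DblFunctor.obj F y) f3
        exact (g.dom_app y).trans (t.trans (v.cod_app y).symm))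
      (by
        have t : g.tgt.obj y = w.tgt.obj y := congrArg (fun F => DblFunctor.obj F y) f4
        exact (g.cod_app y).trans (t.trans (w.cod_app y).symm))
    choose a b using ex
    refine ⟨⟨f, g, v, w, f1, f2, f3, f4, a, b, fun u => ?_, fun k => ?_⟩, rfl, rfl, rfl, rfl⟩
    · have t1 : f.src.ver u = v.src.hor u := congrArg (fun F => DblFunctor.ver F u) f1
      have t2 : f.tgt.ver u = w.src.hor u := congrArg (fun F => DblFunctor.ver F u) f2
      have t3 : g.src.ver u = v.tgt.hor u := congrArg (fun F => DblFunctor.ver F u) f3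
      have t4 : g.tgt.ver u = w.tgt.hor u := congrArg (fun F => DblFunctor.ver F u) f4
      have B1 := (f.appVer_bdry u).cast rfl rfl t1 t2
      have B2 := (g.appVer_bdry u).cast rfl rfl t3 t4
      have L := (v.appHor_bdry u).transpose
      have R := (w.appHor_bdry u).transpose
      have p := L.hc (B1.vc (b (Y.ver.cod u)))
      have q := ((b (Y.ver.dom u)).vc B2).hc R
      refine h.uniq p (q.cast ?_ ?_ ?_ ?_)
      · rw [X.hor.id_cc, X.hor.cc_id]
        · exact (f.cod_app _).trans (congrArg (fun F => DblFunctor.obj F _) f2)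
        · exact ((f.dom_app _).trans (congrArg (fun F => DblFunctor.obj F _) f1)).symm
      · rw [X.hor.id_cc, X.hor.cc_id]
        · exact (g.cod_app _).trans (congrArg (fun F => DblFunctor.obj F _) f4)
        · exact ((g.dom_app _).trans (congrArg (fun F => DblFunctor.obj F _) f3)).symm
      · rfl
      · rfl
    · have t1 : f.src.hor k = v.src.ver k := congrArg (fun F => DblFunctor.hor F k) f1
      have t2 : f.tgt.hor k = w.src.ver k := congrArg (fun F => DblFunctor.hor F k) f2
      have t3 : g.src.hor k = v.tgt.ver k := congrArg (fun F => DblFunctor.hor F k) f3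
      have t4 : g.tgt.hor k = w.tgt.ver k := congrArg (fun F => DblFunctor.hor F k) f4
      have B1 := (v.appVer_bdry k).transpose.cast t1.symm t3.symm rfl rfl
      have B2 := (w.appVer_bdry k).transpose.cast t2.symm t4.symm rfl rfl
      have p := (f.appHor_bdry k).vc (B1.hc (b (Y.hor.cod k)))
      have q := ((b (Y.hor.dom k)).hc B2).vc (g.appHor_bdry k)
      refine h.uniq p (q.cast rfl rfl ?_ ?_)
      · rw [X.ver.id_cc, X.ver.cc_id]
        · exact (v.cod_app _).trans (congrArg (fun F => DblFunctor.obj F _) f3).symm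
        · exact ((v.dom_app _).trans (congrArg (fun F => DblFunctor.obj F _) f1).symm).symm
      · rw [X.ver.id_cc, X.ver.cc_id]
        · exact (w.cod_app _).trans (congrArg (fun F => DblFunctor.obj F _) f4).symm
        · exact ((w.dom_app _).trans (congrArg (fun F => DblFunctor.obj F _) f2).symm).symm

end DblCat

/-! ### Invertible modifications -/

/-- Transport of a commutative square along inverses. -/
theorem CatStr.conj_swap {O M : Type u} (C : CatStr O M) {V W a a' b b' : M}
    (h₁ : C.cod V = C.dom a) (h₂ : C.cod a = C.dom a') (h₃ : C.cod a' = C.dom a)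
    (h₄ : C.cod b = C.dom W) (h₅ : C.cod b' = C.dom b) (h₆ : C.dom b = C.dom V)
    (h₇ : C.cod W = C.cod a)
    (e : C.cc V a = C.cc b W) (ea : C.cc a a' = C.id (C.dom a)) (eb : C.cc b' b = C.id (C.dom b')) :
    C.cc W a' = C.cc b' V := by
  have h₈ : C.dom W = C.dom b' := by
    have := C.cod_cc h₅
    rw [eb, C.cod_id] at this
    rw [← h₄, ← this]
  calc C.cc W a' = C.cc (C.cc (C.cc b' b) W) a' := by rw [eb, C.id_cc h₈.symm]
    _ = C.cc (C.cc b' (C.cc V a)) a' := by rw [C.cc_assoc h₅ h₄, e]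
    _ = C.cc b' (C.cc V (C.cc a a')) := by grind
    _ = C.cc b' V := by rw [ea, C.cc_id h₁]

namespace PsMod
variable {X A : DblCat.{u}}

/-- A modification with identity top and bottom has an inverse if its components have inverses. -/
theorem exists_inverse {m : PsMod X A} {F G : DblFunctor X A} {v w : VerPs X A}
    (hm : (psHom X A).HasBdry m (HorPs.id F) (HorPs.id G) v w)
    (hi : ∀ x, A.sqh.IsIso (m.app x)) :
    ∃ n : PsMod X A, (psHom X A).HasBdry n (HorPs.id F) (HorPs.id G) w v ∧
      ∀ x, A.hc (m.app x) (n.app x) = A.hid (v.app x) ∧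
        A.hc (n.app x) (m.app x) = A.hid (w.app x) := by
  rcases m with ⟨t, b, l, r, tl, tr, bl, br, app, bdry, vcoh, hcoh⟩
  obtain ⟨h1, h2, h3, h4⟩ := hm
  have h1 : t = _ := h1
  have h2 : b = _ := h2
  have h3 : l = v := h3
  have h4 : r = w := h4
  subst h1 h2 h3 h4
  have dl : ∀ x, F.obj x = A.ver.dom (l.app x) := fun x =>
    (congrArg (fun F => DblFunctor.obj F x) tl).trans (l.dom_app x).symm
  have cl : ∀ x, G.obj x = A.ver.cod (l.app x) := fun x =>
    (congrArg (fun F => DblFunctor.obj F x) bl).trans (l.cod_app x).symm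
  have iso : ∀ x, A.IsVertIso (app x) (l.app x) (r.app x) := fun x =>
    ⟨(bdry x).cast (congrArg A.hor.id (dl x)) (congrArg A.hor.id (cl x)) rfl rfl, hi x⟩
  choose n hn e1 e2 using fun x => (iso x).exists_inv
  have bn : ∀ x, A.HasBdry (n x) (A.hor.id (F.obj x)) (A.hor.id (G.obj x)) (r.app x) (l.app x) := by
    intro x
    have b := (hn x).bdry
    exact b.cast (congrArg A.hor.id (((iso x).dom_eq.trans (dl x).symm)))
      (congrArg A.hor.id (((iso x).cod_eq.trans (cl x).symm))) rfl rfl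
  refine ⟨⟨HorPs.id F, HorPs.id G, r, l, tr, tl, br, bl, n, bn, fun u => ?_, fun f => ?_⟩,
    ⟨rfl, rfl, rfl, rfl⟩, fun x => ⟨e1 x, e2 x⟩⟩
  · have t1 : F.ver u = l.src.hor u := congrArg (fun F => DblFunctor.ver F u) tl
    have t2 : F.ver u = r.src.hor u := congrArg (fun F => DblFunctor.ver F u) tr
    have t3 : G.ver u = l.tgt.hor u := congrArg (fun F => DblFunctor.ver F u) bl
    have t4 : G.ver u = r.tgt.hor u := congrArg (fun F => DblFunctor.ver F u) br
    have L := (l.appHor_bdry u).transpose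
    have R := (r.appHor_bdry u).transpose
    have c := vcoh u
    have bF := HorPs.src_hid_bdry F u
    have bG := HorPs.src_hid_bdry G u
    have L1 : A.rgt (l.appHor u) = A.ver.cc (F.ver u) (l.app (X.ver.cod u)) := by
      rw [t1]; exact L.rgt
    have L2 : A.lft (l.appHor u) = A.ver.cc (l.app (X.ver.dom u)) (G.ver u) := by
      rw [t3]; exact L.lft
    have R1 : A.rgt (r.appHor u) = A.ver.cc (F.ver u) (r.app (X.ver.cod u)) := by
      rw [t2]; exact R.rgt
    have R2 : A.lft (r.appHor u) = A.ver.cc (r.app (X.ver.dom u)) (G.ver u) := by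
      rw [t4]; exact R.lft
    have a1 := bF.vc (bdry (X.ver.cod u))
    have a2 := bF.vc (bn (X.ver.cod u))
    have b1 := (bdry (X.ver.dom u)).vc bG
    have b2 := (bn (X.ver.dom u)).vc bG
    -- The coherence for the inverses is the one for `m` transported along the whiskered components,
    -- whose inverses are the whiskered inverses.
    refine A.sqh.conj_swap (a := A.vc (A.hid (F.ver u)) (app (X.ver.cod u)))
      (b := A.vc (app (X.ver.dom u)) (A.hid (G.ver u))) (L1.trans a1.lft.symm)
      (a1.rgt.trans a2.lft.symm) (a2.rgt.trans a1.lft.symm) (b1.rgt.trans R2.symm)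
      (b2.rgt.trans b1.lft.symm) (b1.lft.trans L2.symm) (R1.trans a1.rgt.symm) c ?_ ?_
    · refine (DblCat.hid_vc_hc ((bdry _).rgt.trans (bn _).lft.symm) ?_ ?_).symm.trans ?_
      · rw [F.cod_ver]; exact (bdry _).top
      · rw [F.cod_ver]; exact (bn _).top
      · rw [e1]
        refine (A.hid_cc ?_).symm.trans (congrArg _ a1.lft.symm)
        rw [F.cod_ver, dl]
    · refine (DblCat.hc_vc_hid ((bn _).rgt.trans (bdry _).lft.symm) ?_ ?_).symm.trans ?_
      · rw [G.dom_ver]; exact (bn _).bot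
      · rw [G.dom_ver]; exact (bdry _).bot
      · rw [e2]
        refine (A.hid_cc ?_).symm.trans (congrArg _ b2.lft.symm)
        rw [G.dom_ver, cl]; exact (iso _).cod_eq
  · have t1 : F.hor f = l.src.ver f := congrArg (fun F => DblFunctor.hor F f) tl
    have t2 : F.hor f = r.src.ver f := congrArg (fun F => DblFunctor.hor F f) tr
    have t3 : G.hor f = l.tgt.ver f := congrArg (fun F => DblFunctor.hor F f) bl
    have t4 : G.hor f = r.tgt.ver f := congrArg (fun F => DblFunctor.hor F f) br
    have L := (l.appVer_bdry f).transpose.cast t1.symm t3.symm rfl rfl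
    have R := (r.appVer_bdry f).transpose.cast t2.symm t4.symm rfl rfl
    have dF := F.dom_hor f
    have cF := F.cod_hor f
    have dG := G.dom_hor f
    have cG := G.cod_hor f
    have eF := A.hor.cc_id cF
    have eF' := A.hor.id_cc dF.symm
    have eG := A.hor.cc_id cG
    have eG' := A.hor.id_cc dG.symm
    have a1 := (L.hc (bdry (X.hor.cod f))).cast eF eG rfl rfl
    have a2 := (R.hc (bn (X.hor.cod f))).cast eF eG rfl rfl
    have b1 := ((bdry (X.hor.dom f)).hc R).cast eF' eG' rfl rfl
    have b2 := ((bn (X.hor.dom f)).hc L).cast eF' eG' rfl rfl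
    have c : A.hc (l.appVer f) (app (X.hor.cod f)) = A.hc (app (X.hor.dom f)) (r.appVer f) :=
      a1.vid_vc.symm.trans ((hcoh f).trans b1.vc_vid)
    refine a2.vid_vc.trans (Eq.trans ?_ b2.vc_vid.symm)
    have x1 := bdry (X.hor.dom f)
    have x2 := bdry (X.hor.cod f)
    have y1 := bn (X.hor.dom f)
    have y2 := bn (X.hor.cod f)
    exact A.sqh.conj_swap (L.rgt.trans x2.lft.symm) (x2.rgt.trans y2.lft.symm)
      (y2.rgt.trans x2.lft.symm) (x1.rgt.trans R.lft.symm) (y1.rgt.trans x1.lft.symm)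
      (x1.lft.trans L.lft.symm) (R.rgt.trans x2.rgt.symm) c ((e1 _).trans (congrArg _ x2.lft.symm))
      ((e2 _).trans (congrArg _ y1.lft.symm))

/-- Invertibility of such a modification can be tested at objects: the pointwise inverses satisfy
the coherence conditions, and equations between modifications with a common boundary hold as soon as
they hold for components. -/
theorem isVertIso_of_app {m : PsMod X A} {F G : DblFunctor X A} {v w : VerPs X A}
    (hm : (psHom X A).HasBdry m (HorPs.id F) (HorPs.id G) v w)
    (hi : ∀ x, A.sqh.IsIso (m.app x)) : (psHom X A).IsVertIso m v w := by
  obtain ⟨n, hn, e⟩ := exists_inverse hm hi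
  have dF : F = v.dom := hm.tl
  have dG : G = v.cod := hm.bl
  subst dF dG
  have a := (hm.hc hn).cast ((psHom X A).hor.id_cc rfl) ((psHom X A).hor.id_cc rfl) rfl rfl
  have b := (hn.hc hm).cast ((psHom X A).hor.id_cc rfl) ((psHom X A).hor.id_cc rfl) rfl rfl
  refine .of_inv hm hn.lft hn.rgt ?_ ?_
  · refine ext_of_bdry a (DblCat.hasBdry_hid (psHom X A) rfl rfl) fun x => ?_
    exact (app_hc (hm.rgt.trans hn.lft.symm) x).trans (e x).1
  · refine ext_of_bdry b (DblCat.hasBdry_hid (psHom X A) ?_ ?_) fun x => ?_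
    · exact hm.tr.symm
    · exact hm.br.symm
    · exact (app_hc (hn.rgt.trans hm.lft.symm) x).trans (e x).2

/-- The inverse comes from the transposed double categories. The two equations are checked anew on
components, because they are needed in the vertical direction of the pseudo hom itself and not in
the pseudo hom of the transposes. -/
theorem transpose_isVertIso_of_app {m : PsMod X A} {F G : DblFunctor X A} {v w : HorPs X A}
    (hm : (psHom X A).HasBdry m v w (HorPs.id F.transpose) (HorPs.id G.transpose))
    (hi : ∀ x, A.sqv.IsIso (m.app x)) : (psHom X A).transpose.IsVertIso m v w := by
  obtain ⟨n, hn, e⟩ := exists_inverse (X := X.transpose) (A := A.transpose) (m := m.transpose)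
    (F := F.transpose) (G := G.transpose) (v := v) (w := w)
    ⟨hm.lft, hm.rgt, hm.top, hm.bot⟩ hi
  have hn' : (psHom X A).HasBdry n.transpose w v (HorPs.id F.transpose) (HorPs.id G.transpose) :=
    ⟨hn.lft, hn.rgt, hn.top, hn.bot⟩
  have dF : v.src = F := hm.tl
  have dG : v.tgt = G := hm.tr
  subst dF dG
  have a := (hm.vc hn').cast rfl rfl ((psHom X A).ver.id_cc rfl) ((psHom X A).ver.id_cc rfl)
  have b := (hn'.vc hm).cast rfl rfl ((psHom X A).ver.id_cc rfl) ((psHom X A).ver.id_cc rfl)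
  refine .of_inv (A := (psHom X A).transpose) hm.transpose hn'.top hn'.bot ?_ ?_
  · refine ext_of_bdry a (DblCat.hasBdry_vid (psHom X A) rfl rfl) fun x => ?_
    exact (app_vc (hm.bot.trans hn'.top.symm) x).trans (e x).1
  · refine ext_of_bdry b (DblCat.hasBdry_vid (psHom X A) ?_ ?_) fun x => ?_
    · exact hm.bl
    · exact hm.br
    · exact (app_vc (hn'.bot.trans hm.top.symm) x).trans (e x).2

end PsMod

/-! ### Transport of transformations along isomorphisms of components -/

theorem CatStr.cancel_left {O M : Type u} (C : CatStr O M) {r s a b : M} (h : C.cod r = C.dom s)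
    (hr : C.cc r s = C.id (C.cod s)) (ha : C.cod s = C.dom a) (hb : C.cod s = C.dom b)
    (e : C.cc s a = C.cc s b) : a = b := by
  rw [← C.id_cc ha, ← C.id_cc hb, ← hr, C.cc_assoc h ha, C.cc_assoc h hb, e]

namespace DblCat
variable {A : DblCat.{u}}

/-- Cancellation of an invertible square on the left of an identity square. -/
theorem vc_hc_cancel {θ θ' α β : A.Sq} {h k G g : A.Hor} {a b : A.Obj} {p q p' q' : A.Ver}
    (hθ : A.HasBdry θ h k (A.ver.id a) (A.ver.id b)) (hθ' : A.HasBdry θ' k h (A.ver.id a) (A.ver.id b))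
    (i : A.vc θ' θ = A.vid k) (hG : A.hor.dom G = b)
    (hα : A.HasBdry α (A.hor.cc k G) g p q) (hβ : A.HasBdry β (A.hor.cc k G) g p' q')
    (e : A.vc (A.hc θ (A.vid G)) α = A.vc (A.hc θ (A.vid G)) β) : α = β := by
  have hk := hθ.br
  have e1 : A.vc (A.hc θ' (A.vid G)) (A.hc θ (A.vid G)) = A.vid (A.hor.cc k G) := by
    rw [← vc_hc_vid (by grind) (by grind) (by grind), i, A.vid_cc (by grind)]
  refine A.sqv.cancel_left (r := A.hc θ' (A.vid G)) (s := A.hc θ (A.vid G)) ?_ ?_ ?_ ?_ e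
  · change A.bot _ = A.top _
    grind
  · refine e1.trans (congrArg A.vid ?_)
    change _ = A.bot _
    grind
  · change A.bot _ = A.top _
    grind
  · change A.bot _ = A.top _
    grind

/-- The composition law for transported components. It may be checked after composing with the
invertible θ at the source; there the equations `e1` and `e2` carry θ through the two factors in
turn and `e3` carries it through the composite. -/
theorem transport_cc {θx θx' θy θz hf hg hf' hg' hfg : A.Sq} {hx hy hz kx ky kz Ff Fg Gf Gg : A.Hor}
    {Fx Fy Fz Gx Gy Gz : A.Obj} (dFf : A.hor.dom Ff = Fx) (cFf : A.hor.cod Ff = Fy)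
    (dFg : A.hor.dom Fg = Fy) (cFg : A.hor.cod Fg = Fz) (dGf : A.hor.dom Gf = Gx)
    (cGf : A.hor.cod Gf = Gy) (dGg : A.hor.dom Gg = Gy) (cGg : A.hor.cod Gg = Gz)
    (bx : A.HasBdry θx hx kx (A.ver.id Fx) (A.ver.id Gx))
    (bx' : A.HasBdry θx' kx hx (A.ver.id Fx) (A.ver.id Gx)) (ix : A.vc θx' θx = A.vid kx)
    (by_ : A.HasBdry θy hy ky (A.ver.id Fy) (A.ver.id Gy))
    (bz : A.HasBdry θz hz kz (A.ver.id Fz) (A.ver.id Gz))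
    (bf : A.HasBdry hf (A.hor.cc hx Gf) (A.hor.cc Ff hy) (A.ver.id Fx) (A.ver.id Gy))
    (bf' : A.HasBdry hf' (A.hor.cc kx Gf) (A.hor.cc Ff ky) (A.ver.id Fx) (A.ver.id Gy))
    (bg : A.HasBdry hg (A.hor.cc hy Gg) (A.hor.cc Fg hz) (A.ver.id Fy) (A.ver.id Gz))
    (bg' : A.HasBdry hg' (A.hor.cc ky Gg) (A.hor.cc Fg kz) (A.ver.id Fy) (A.ver.id Gz))
    (bfg : A.HasBdry hfg (A.hor.cc kx (A.hor.cc Gf Gg)) (A.hor.cc (A.hor.cc Ff Fg) kz)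
      (A.ver.id Fx) (A.ver.id Gz))
    (e1 : A.vc (A.hc θx (A.vid Gf)) hf' = A.vc hf (A.hc (A.vid Ff) θy))
    (e2 : A.vc (A.hc θy (A.vid Gg)) hg' = A.vc hg (A.hc (A.vid Fg) θz))
    (e3 : A.vc (A.hc θx (A.vid (A.hor.cc Gf Gg))) hfg =
      A.vc (A.vc (A.hc hf (A.vid Gg)) (A.hc (A.vid Ff) hg)) (A.hc (A.vid (A.hor.cc Ff Fg)) θz)) :
    hfg = A.vc (A.hc hf' (A.vid Gg)) (A.hc (A.vid Ff) hg') := by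
  have kx1 := bx.bl; have kx2 := bx.br; have hx1 := bx.tl; have hx2 := bx.tr
  have ky1 := by_.bl; have ky2 := by_.br; have hy1 := by_.tl; have hy2 := by_.tr
  have kz1 := bz.bl; have kz2 := bz.br; have hz1 := bz.tl; have hz2 := bz.tr
  simp only [A.ver.dom_id, A.ver.cod_id] at *
  have b1 : A.HasBdry (A.hc hf' (A.vid Gg)) (A.hor.cc kx (A.hor.cc Gf Gg)) (A.hor.cc Ff (A.hor.cc ky Gg))
      (A.ver.id Fx) (A.ver.id Gz) := ⟨by grind, by grind, by grind, by grind⟩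
  have b2 : A.HasBdry (A.hc (A.vid Ff) hg') (A.hor.cc Ff (A.hor.cc ky Gg))
    (A.hor.cc (A.hor.cc Ff Fg) kz) (A.ver.id Fx) (A.ver.id Gz) := ⟨by grind, by grind, by grind, by grind⟩
  refine vc_hc_cancel bx bx' ix (G := A.hor.cc Gf Gg) (by grind) bfg (b1.vc b2) (e3.trans ?_)
  have s0 : A.hc θx (A.vid (A.hor.cc Gf Gg)) = A.hc (A.hc θx (A.vid Gf)) (A.vid Gg) := by
    rw [A.vid_cc (by grind), hassoc (by grind) (by grind)]
  have s1 : A.vc (A.hc θx (A.vid (A.hor.cc Gf Gg))) (A.hc hf' (A.vid Gg)) =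
      A.vc (A.hc hf (A.vid Gg)) (A.hc (A.hc (A.vid Ff) θy) (A.vid Gg)) := by
    rw [s0, ← vc_hc_vid (by grind) (by grind) (by grind), e1,
      vc_hc_vid (by grind) (by grind) (by grind)]
  have s2 : A.vc (A.hc (A.hc (A.vid Ff) θy) (A.vid Gg)) (A.hc (A.vid Ff) hg') =
      A.vc (A.hc (A.vid Ff) hg) (A.hc (A.vid (A.hor.cc Ff Fg)) θz) := by
    rw [hassoc (by grind) (by grind), ← vid_hc_vc (by grind) (by grind) (by grind), e2,
      vid_hc_vc (by grind) (by grind) (by grind), A.vid_cc (by grind), hassoc (by grind) (by grind)]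
  refine (vassoc (by grind) (by grind)).trans ?_
  rw [← s2, ← vassoc (by grind) (by grind), ← s1]
  exact vassoc (by grind) (by grind)

/-- The naturality axiom for transported components, again checked after composing with the
invertible θ at the source. The equations `e1` to `e4` move θ across each side of the axiom and
reduce it to the original `n`. -/
theorem transport_nat {θx θx' θx₁ θy θy₁ hf hg hf' hg' hu hu' hv hv' Fα Gα : A.Sq}
    {hx hx₁ hy hy₁ kx kx₁ ky ky₁ Ff Fg Gf Gg : A.Hor} {Fu Fv Gu Gv : A.Ver}
    {Fx Fx₁ Fy Fy₁ Gx Gx₁ Gy Gy₁ : A.Obj}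
    (bF : A.HasBdry Fα Ff Fg Fu Fv) (bG : A.HasBdry Gα Gf Gg Gu Gv)
    (bx : A.HasBdry θx hx kx (A.ver.id Fx) (A.ver.id Gx))
    (bx' : A.HasBdry θx' kx hx (A.ver.id Fx) (A.ver.id Gx)) (ix : A.vc θx' θx = A.vid kx)
    (bx₁ : A.HasBdry θx₁ hx₁ kx₁ (A.ver.id Fx₁) (A.ver.id Gx₁))
    (by_ : A.HasBdry θy hy ky (A.ver.id Fy) (A.ver.id Gy))
    (by₁ : A.HasBdry θy₁ hy₁ ky₁ (A.ver.id Fy₁) (A.ver.id Gy₁))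
    (bf : A.HasBdry hf (A.hor.cc hx Gf) (A.hor.cc Ff hy) (A.ver.id Fx) (A.ver.id Gy))
    (bf' : A.HasBdry hf' (A.hor.cc kx Gf) (A.hor.cc Ff ky) (A.ver.id Fx) (A.ver.id Gy))
    (bg : A.HasBdry hg (A.hor.cc hx₁ Gg) (A.hor.cc Fg hy₁) (A.ver.id Fx₁) (A.ver.id Gy₁))
    (bg' : A.HasBdry hg' (A.hor.cc kx₁ Gg) (A.hor.cc Fg ky₁) (A.ver.id Fx₁) (A.ver.id Gy₁))
    (bu : A.HasBdry hu hx hx₁ Fu Gu) (bu' : A.HasBdry hu' kx kx₁ Fu Gu)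
    (bv : A.HasBdry hv hy hy₁ Fv Gv) (bv' : A.HasBdry hv' ky ky₁ Fv Gv)
    (e1 : A.vc (A.hc θx (A.vid Gf)) hf' = A.vc hf (A.hc (A.vid Ff) θy))
    (e2 : A.vc (A.hc θx₁ (A.vid Gg)) hg' = A.vc hg (A.hc (A.vid Fg) θy₁))
    (e3 : A.vc θx hu' = A.vc hu θx₁) (e4 : A.vc θy hv' = A.vc hv θy₁)
    (n : A.vc (A.hc hu Gα) hg = A.vc hf (A.hc Fα hv)) :
    A.vc (A.hc hu' Gα) hg' = A.vc hf' (A.hc Fα hv') := by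
  have a1 := bx.bl; have a2 := bx.br; have a3 := bx.tl; have a4 := bx.tr
  have b1 := bx₁.bl; have b2 := bx₁.br; have b3 := bx₁.tl; have b4 := bx₁.tr
  have c1 := by_.bl; have c2 := by_.br; have c3 := by_.tl; have c4 := by_.tr
  have d1 := by₁.bl; have d2 := by₁.br; have d3 := by₁.tl; have d4 := by₁.tr
  have f1 := bu.bl; have f2 := bu.br; have f3 := bu.tl; have f4 := bu.tr
  have g1 := bv.bl; have g2 := bv.br; have g3 := bv.tl; have g4 := bv.tr
  have x1 := bF.bl; have x2 := bF.br; have x3 := bF.tl; have x4 := bF.tr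
  have y1 := bG.bl; have y2 := bG.br; have y3 := bG.tl; have y4 := bG.tr
  simp only [A.ver.dom_id, A.ver.cod_id] at *
  have l := (bu'.hc bG).vc bg'
  have r := bf'.vc (bF.hc bv')
  refine vc_hc_cancel bx bx' ix (G := Gf) (by grind) l r ?_
  have s1 : A.vc (A.hc θx (A.vid Gf)) (A.hc hu' Gα) = A.vc (A.hc hu Gα) (A.hc θx₁ (A.vid Gg)) := by
    rw [ichg (by grind) (by grind) (by grind) (by grind), e3,
      ichg (by grind) (by grind) (by grind) (by grind), bG.vid_vc, bG.vc_vid]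
  have s2 : A.vc (A.hc Fα hv) (A.hc (A.vid Fg) θy₁) = A.vc (A.hc (A.vid Ff) θy) (A.hc Fα hv') := by
    rw [ichg (by grind) (by grind) (by grind) (by grind), ← e4,
      ichg (by grind) (by grind) (by grind) (by grind), bF.vid_vc, bF.vc_vid]
  calc A.vc (A.hc θx (A.vid Gf)) (A.vc (A.hc hu' Gα) hg')
      = A.vc (A.vc (A.hc θx (A.vid Gf)) (A.hc hu' Gα)) hg' :=
        (vassoc (by grind) (by grind)).symm
    _ = A.vc (A.hc hu Gα) (A.vc (A.hc θx₁ (A.vid Gg)) hg') := by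
        rw [s1, vassoc (by grind) (by grind)]
    _ = A.vc (A.vc (A.hc hu Gα) hg) (A.hc (A.vid Fg) θy₁) := by
        rw [e2, vassoc (by grind) (by grind)]
    _ = A.vc hf (A.vc (A.hc Fα hv) (A.hc (A.vid Fg) θy₁)) := by
        rw [n, vassoc (by grind) (by grind)]
    _ = A.vc (A.vc hf (A.hc (A.vid Ff) θy)) (A.hc Fα hv') := by
        rw [s2, vassoc (by grind) (by grind)]
    _ = A.vc (A.hc θx (A.vid Gf)) (A.vc hf' (A.hc Fα hv')) := by
        rw [← e1, vassoc (by grind) (by grind)]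

end DblCat

namespace HorPs
variable {X A : DblCat.{u}}

/-- Transport of a horizontal transformation along isomorphisms of its components. -/
theorem exists_transport (h : HorPs X A) (k : X.Obj → A.Hor) (θ : X.Obj → A.Sq)
    (hθ : ∀ x, A.transpose.IsVertIso (θ x) (h.app x) (k x)) :
    ∃ (h' : HorPs X A) (K : PsMod X A), (psHom X A).transpose.IsVertIso K h h' ∧ K.app = θ ∧
      h'.app = k := by
  have hb : ∀ x, A.HasBdry (θ x) (h.app x) (k x) (A.ver.id (h.src.obj x)) (A.ver.id (h.tgt.obj x)) :=
    fun x => (hθ x).bdry.transpose.cast rfl rfl (congrArg A.ver.id (h.dom_app x))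
      (congrArg A.ver.id (h.cod_app x))
  choose θ' hθ' i1 i2 using fun x => (hθ x).exists_inv
  have hb' : ∀ x, A.HasBdry (θ' x) (k x) (h.app x) (A.ver.id (h.src.obj x))
      (A.ver.id (h.tgt.obj x)) := fun x =>
    (hθ' x).bdry.transpose.cast rfl rfl (congrArg A.ver.id ((hθ x).dom_eq.trans (h.dom_app x)))
      (congrArg A.ver.id ((hθ x).cod_eq.trans (h.cod_app x)))
  have i1 : ∀ x, A.vc (θ x) (θ' x) = A.vid (h.app x) := i1
  have i2 : ∀ x, A.vc (θ' x) (θ x) = A.vid (k x) := i2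
  have dk : ∀ x, A.hor.dom (k x) = h.src.obj x := fun x => (hb x).bl.trans (A.ver.cod_id _)
  have ck : ∀ x, A.hor.cod (k x) = h.tgt.obj x := fun x => (hb x).br.trans (A.ver.cod_id _)
  have bG := fun f => HorPs.src_vid_bdry h.tgt f
  have bF := fun f => HorPs.src_vid_bdry h.src f
  -- The only possible choice: conjugate the old components by θ.
  let aV : X.Ver → A.Sq := fun w => A.vc (θ' (X.ver.dom w)) (A.vc (h.appVer w) (θ (X.ver.cod w)))
  let aH : X.Hor → A.Sq := fun f => A.vc (A.hc (θ' (X.hor.dom f)) (A.vid (h.tgt.hor f)))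
    (A.vc (h.appHor f) (A.hc (A.vid (h.src.hor f)) (θ (X.hor.cod f))))
  have bV : ∀ w, A.HasBdry (aV w) (k (X.ver.dom w)) (k (X.ver.cod w)) (h.src.ver w) (h.tgt.ver w) :=
    fun w => ((hb' _).vc ((h.appVer_bdry w).vc (hb _))).cast rfl rfl
      (by rw [A.ver.cc_id (h.src.cod_ver w), A.ver.id_cc (h.src.dom_ver w).symm])
      (by rw [A.ver.cc_id (h.tgt.cod_ver w), A.ver.id_cc (h.tgt.dom_ver w).symm])
  have bH : ∀ f, A.HasBdry (aH f) (A.hor.cc (k (X.hor.dom f)) (h.tgt.hor f))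
      (A.hor.cc (h.src.hor f) (k (X.hor.cod f))) (A.ver.id (h.src.obj (X.hor.dom f)))
      (A.ver.id (h.tgt.obj (X.hor.cod f))) := fun f =>
    (((hb' _).hc (bG f)).vc ((h.appHor_bdry f).vc ((bF f).hc (hb _)))).cast rfl rfl
      (by rw [A.ver.cc_id (A.ver.cod_id _), A.ver.cc_id (A.ver.cod_id _)])
      (by rw [A.ver.cc_id (A.ver.cod_id _), A.ver.cc_id (A.ver.cod_id _)])
  -- These intertwining equations are both the coherence conditions of the modification with
  -- components θ and the tool by which composition and naturality are deduced for the new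
  -- transformation.
  have eV : ∀ w, A.vc (θ (X.ver.dom w)) (aV w) = A.vc (h.appVer w) (θ (X.ver.cod w)) := fun w => by
    have b1 := h.appVer_bdry w
    have r := b1.vc (hb (X.ver.cod w))
    refine (A.sqv.cc_assoc ((hb _).bot.trans (hb' _).top.symm)
      ((hb' _).bot.trans r.top.symm)).symm.trans ?_
    rw [show A.sqv.cc _ _ = _ from i1 _]
    exact r.vid_vc
  have eH : ∀ f, A.vc (A.hc (θ (X.hor.dom f)) (A.vid (h.tgt.hor f))) (aH f) =
      A.vc (h.appHor f) (A.hc (A.vid (h.src.hor f)) (θ (X.hor.cod f))) := fun f => by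
    have b1 := h.appHor_bdry f
    have r := b1.vc ((bF f).hc (hb (X.hor.cod f)))
    have l := (hb (X.hor.dom f)).hc (bG f)
    have l' := (hb' (X.hor.dom f)).hc (bG f)
    refine (A.sqv.cc_assoc (l.bot.trans l'.top.symm) (l'.bot.trans r.top.symm)).symm.trans ?_
    have e : A.vc (A.hc (θ (X.hor.dom f)) (A.vid (h.tgt.hor f)))
        (A.hc (θ' (X.hor.dom f)) (A.vid (h.tgt.hor f))) =
        A.vid (A.hor.cc (h.app (X.hor.dom f)) (h.tgt.hor f)) := by
      refine ((hb _).interchange (bG f) (hb' _) (bG f)).trans ?_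
      rw [i1, (bG f).vid_vc, A.vid_cc (h.hor_boundary f).1]
    rw [show A.sqv.cc _ _ = _ from e]
    exact r.vid_vc
  let h' : HorPs X A :=
    { src := h.src
      tgt := h.tgt
      app := k
      appVer := aV
      appHor := aH
      dom_app := dk
      cod_app := ck
      appVer_bdry := bV
      appHor_bdry := bH
      appHor_iso := fun f => by
        have j1 := (hb' (X.hor.dom f)).isIso_hc ((bG f).cast rfl rfl rfl rfl) (hθ' _).iso
          (A.sqv.isIso_id _)
        have j2 := (bF f).isIso_hc (hb (X.hor.cod f)) (A.sqv.isIso_id _) (hθ _).iso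
        have b1 := h.appHor_bdry f
        have b2 := (bF f).hc (hb (X.hor.cod f))
        have l' := (hb' (X.hor.dom f)).hc (bG f)
        exact A.sqv.isIso_cc j1 (A.sqv.isIso_cc (h.appHor_iso f) j2 (b1.bot.trans b2.top.symm))
          (l'.bot.trans ((A.sqv.dom_cc _ _).trans b1.top).symm)
      appVer_id := fun a => by
        change A.vc _ (A.vc _ _) = _
        rw [h.appVer_id, X.ver.dom_id, X.ver.cod_id, (hb a).vid_vc, i2]
      appVer_cc := fun w z e => by
        have b1 := hb' (X.ver.dom w)
        have b2 := h.appVer_bdry w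
        have b3 := hb (X.ver.cod w)
        have b4 := hb' (X.ver.cod w)
        have b5 := h.appVer_bdry z
        have b6 := hb (X.ver.cod z)
        have j := i1 (X.ver.cod w)
        change A.vc _ (A.vc _ _) = A.vc (A.vc _ (A.vc _ _)) (A.vc _ (A.vc _ _))
        rw [h.appVer_cc w z e, X.ver.dom_cc, X.ver.cod_cc e, ← e]
        rw [← e] at b5
        have k1 := b5.vc b6
        rw [(b1).vassoc (b2.vc b3) (b4.vc k1), b2.vassoc b3 (b4.vc k1), ← b3.vassoc b4 k1, j,
          k1.vid_vc, b2.vassoc b5 b6]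
      appHor_id := fun a => by
        have e := h.appHor_id a
        change A.vc (A.hc _ (A.vid _)) (A.vc _ (A.hc (A.vid _) _)) = _
        have b1 := (hb' a).hc_hid
        have b2 := (hb a).hid_hc
        rw [e, X.hor.dom_id, X.hor.cod_id, h.tgt.hor_id, h.src.hor_id, A.vid_id, A.vid_id, b1, b2,
          (hb a).vid_vc, i2]
      appHor_cc := fun f g e => by
        have c1 := h.appHor_bdry g
        have c2 := bH g
        have c3 := eH g
        have dG := h.tgt.dom_hor g
        have dF := h.src.dom_hor g
        rw [← e] at c1 c2 c3 dG dF
        have c4 := bH (X.hor.cc f g)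
        have c5 := eH (X.hor.cc f g)
        rw [h.tgt.hor_cc e, h.src.hor_cc e, X.hor.dom_cc, X.hor.cod_cc e] at c4 c5
        rw [h.appHor_cc f g e] at c5
        exact DblCat.transport_cc (h.src.dom_hor f) (h.src.cod_hor f) dF (h.src.cod_hor g)
          (h.tgt.dom_hor f) (h.tgt.cod_hor f) dG (h.tgt.cod_hor g) (hb _) (hb' _) (i2 _) (hb _) (hb _)
          (h.appHor_bdry f) (bH f) c1 c2 c4 (eH f) c3 c5
      naturality := fun α => by
        have t1 := X.dom_top α
        have t2 := X.cod_top α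
        have t3 := X.dom_bot α
        have t4 := X.cod_bot α
        have f1 := h.appHor_bdry (X.top α)
        have f2 := bH (X.top α)
        have f3 := eH (X.top α)
        have g1 := h.appHor_bdry (X.bot α)
        have g2 := bH (X.bot α)
        have g3 := eH (X.bot α)
        rw [t1, t2] at f1 f2 f3
        rw [t3, t4] at g1 g2 g3
        exact DblCat.transport_nat (HorPs.sq_bdry h.src α) (HorPs.sq_bdry h.tgt α) (hb _) (hb' _)
          (i2 _) (hb _) (hb _) (hb _) f1 f2 g1 g2 (h.appVer_bdry _) (bV _) (h.appVer_bdry _) (bV _)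
          f3 g3 (eV _) (eV _) (h.naturality α) }
  let K : PsMod X A :=
    { top := h
      bot := h'
      lft := HorPs.id h.src.transpose
      rgt := HorPs.id h.tgt.transpose
      tl := rfl
      tr := rfl
      bl := rfl
      br := rfl
      app := θ
      app_bdry := hb
      ver_coh := fun w => by
        have l := (h.appVer_bdry w).vc (hb (X.ver.cod w))
        have r := (hb (X.ver.dom w)).vc (bV w)
        rw [A.ver.cc_id (h.src.cod_ver w)] at l
        rw [A.ver.id_cc (h.tgt.dom_ver w).symm] at r
        exact l.hid_hc.trans ((eV w).symm.trans r.hc_hid.symm)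
      hor_coh := fun f => (eH f).symm }
  exact ⟨h', K, PsMod.transpose_isVertIso_of_app (F := h.src) (G := h.tgt) ⟨rfl, rfl, rfl, rfl⟩
    fun x => (hθ x).iso, rfl, rfl⟩

end HorPs

namespace DblCat

/-! ### Lifting of isomorphisms along the evaluation -/

theorem prod_isVertIso_iff {A B : DblCat.{u}} {α : (A.prod B).Sq} {v w : (A.prod B).Ver} :
    (A.prod B).IsVertIso α v w ↔ A.IsVertIso α.1 v.1 w.1 ∧ B.IsVertIso α.2 v.2 w.2 := by
  constructor
  · intro h
    let p : DblFunctor (A.prod B) A :=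
      { obj := Prod.fst, hor := Prod.fst, ver := Prod.fst, sq := Prod.fst
        hor_fun := ⟨fun _ => rfl, fun _ => rfl, fun _ => rfl, fun f g h =>
          congrArg Prod.fst (A.hor.prod_cc B.hor h)⟩
        ver_fun := ⟨fun _ => rfl, fun _ => rfl, fun _ => rfl, fun f g h =>
          congrArg Prod.fst (A.ver.prod_cc B.ver h)⟩
        sqh_fun := ⟨fun _ => rfl, fun _ => rfl, fun _ => rfl, fun f g h =>
          congrArg Prod.fst (A.sqh.prod_cc B.sqh h)⟩
        sqv_fun := ⟨fun _ => rfl, fun _ => rfl, fun _ => rfl, fun f g h =>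
          congrArg Prod.fst (A.sqv.prod_cc B.sqv h)⟩ }
    let q : DblFunctor (A.prod B) B :=
      { obj := Prod.snd, hor := Prod.snd, ver := Prod.snd, sq := Prod.snd
        hor_fun := ⟨fun _ => rfl, fun _ => rfl, fun _ => rfl, fun f g h =>
          congrArg Prod.snd (A.hor.prod_cc B.hor h)⟩
        ver_fun := ⟨fun _ => rfl, fun _ => rfl, fun _ => rfl, fun f g h =>
          congrArg Prod.snd (A.ver.prod_cc B.ver h)⟩
        sqh_fun := ⟨fun _ => rfl, fun _ => rfl, fun _ => rfl, fun f g h =>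
          congrArg Prod.snd (A.sqh.prod_cc B.sqh h)⟩
        sqv_fun := ⟨fun _ => rfl, fun _ => rfl, fun _ => rfl, fun f g h =>
          congrArg Prod.snd (A.sqv.prod_cc B.sqv h)⟩ }
    exact ⟨p.map_isVertIso h, q.map_isVertIso h⟩
  · rintro ⟨h, h'⟩
    obtain ⟨β, hβ, e1, e2⟩ := h.exists_inv
    obtain ⟨β', hβ', e1', e2'⟩ := h'.exists_inv
    have b := h.bdry
    have b' := h'.bdry
    have c := hβ.bdry
    have c' := hβ'.bdry
    refine .of_inv (A := A.prod B) (β := (β, β')) ⟨Prod.ext b.top b'.top, Prod.ext b.bot b'.bot,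
      Prod.ext b.lft b'.lft, Prod.ext b.rgt b'.rgt⟩ (Prod.ext c.lft c'.lft) (Prod.ext c.rgt c'.rgt) ?_ ?_
    · exact (A.sqh.prod_cc B.sqh (f := α) (g := (β, β')) (Prod.ext (b.rgt.trans c.lft.symm) (b'.rgt.trans c'.lft.symm))).trans
        (Prod.ext e1 e1')
    · exact (A.sqh.prod_cc B.sqh (f := (β, β')) (g := α) (Prod.ext (c.rgt.trans b.lft.symm) (c'.rgt.trans b'.lft.symm))).trans
        (Prod.ext e2 e2')

theorem prod_isVertEquiv {A B : DblCat.{u}} {w : (A.prod B).Ver} (h : (A.prod B).IsVertEquiv w) :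
    A.IsVertEquiv w.1 ∧ B.IsVertEquiv w.2 := by
  obtain ⟨z, η, ε, h1, h2, h3, h4⟩ := h
  rw [show (A.prod B).ver.cc w z = _ from A.ver.prod_cc B.ver h1.symm] at h3
  rw [show (A.prod B).ver.cc z w = _ from A.ver.prod_cc B.ver h2] at h4
  have h3 := prod_isVertIso_iff.1 h3
  have h4 := prod_isVertIso_iff.1 h4
  exact ⟨⟨z.1, η.1, ε.1, congrArg Prod.fst h1, congrArg Prod.fst h2, h3.1, h4.1⟩,
    ⟨z.2, η.2, ε.2, congrArg Prod.snd h1, congrArg Prod.snd h2, h3.2, h4.2⟩⟩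

/-- A function on two elements. -/
def Two.elim {T : Type u} (a b : T) : Two.{u} → T
  | .zero => a
  | .one => b

/-- `Sq E_adj` has no objects besides `0` and `1`, so an isomorphism in `A × A` out of the
evaluation of a transformation is exactly a family of isomorphisms out of all its components, along
which it can be transported. -/
theorem vIsoLift_pathEval_transpose (A : DblCat.{u}) :
    VIsoLift (DblFunctor.transpose (A := pathObj A) (B := A.prod A) (pathEval A)) := by
  intro v z κ hκ
  have h := (prod_isVertIso_iff (A := A.transpose) (B := A.transpose)).1 hκ
  obtain ⟨h', K, i, e, -⟩ := HorPs.exists_transport (X := sqEAdj) (A := A) v (Two.elim z.1 z.2)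
    (Two.elim κ.1 κ.2) (by rintro (_ | _); exacts [h.1, h.2])
  refine ⟨h', K, i, ?_⟩
  exact Prod.ext (congrFun e .zero) (congrFun e .one)

/-- Vertical transformations are horizontal ones between transposes, so the same transport applies
to them. -/
theorem vIsoLift_pathEval (A : DblCat.{u}) :
    @VIsoLift (pathObj A) (A.prod A) (pathEval A) := by
  intro v z κ hκ
  have h := prod_isVertIso_iff.1 hκ
  obtain ⟨h', K, i, e, -⟩ := HorPs.exists_transport (X := sqEAdj.transpose) (A := A.transpose) v
    (Two.elim z.1 z.2) (Two.elim κ.1 κ.2) (by rintro (_ | _); exacts [h.1, h.2])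
  have b := i.bdry
  -- Transport was carried out in the pseudo hom of the transposes; invertibility in the pseudo hom
  -- itself is regained from the components.
  refine ⟨h', K.transpose, PsMod.isVertIso_of_app (F := VerPs.dom v) (G := VerPs.cod v)
    ⟨b.top, b.bot, b.lft, b.rgt⟩ ?_, ?_⟩
  · have e' : K.transpose.app = _ := e
    rw [e']
    rintro (_ | _)
    exacts [h.1.iso, h.2.iso]
  · exact Prod.ext (congrFun e .zero) (congrFun e .one)

end DblCat

/-- The identity double functor. -/
abbrev DblFunctor.id (A : DblCat.{u}) : DblFunctor A A := CategoryStruct.id (obj := DblCat.{u}) A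

theorem DblFunctor.const_comp {Y X A : DblCat.{u}} (o : X.Obj) (F : DblFunctor X A) :
    (DblFunctor.const Y X o).comp F = DblFunctor.const Y A (F.obj o) :=
  DblFunctor.ext rfl (funext fun _ => F.hor_id o) (funext fun _ => F.ver_id o)
    (funext fun _ => (F.sq_vid _).trans (congrArg _ (F.hor_id o)))

namespace DblCat

/-! ### Contractions -/

/-- A vertical equivalence between the identity of `X` and the constant double functor at `o`. -/
structure Contraction (X : DblCat.{u}) (o : X.Obj) where
  τ : VerPs X X
  τ' : VerPs X X
  dom_τ : VerPs.dom τ = DblFunctor.id X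
  cod_τ : VerPs.cod τ = DblFunctor.const X X o
  dom_τ' : VerPs.dom τ' = DblFunctor.const X X o
  cod_τ' : VerPs.cod τ' = DblFunctor.id X
  app_τ : τ.app o = X.ver.id o
  app_τ' : τ'.app o = X.ver.id o
  inv : (psHom X X).IsVertInv τ τ'
  comp : (psHom X X).HasComp τ
  conj : (psHom X X).HasConj τ
  comp' : (psHom X X).HasComp τ'
  conj' : (psHom X X).HasConj τ'

/-- Connecting morphisms in both directions, vertical and horizontal, extend to transformations by
codiscreteness. As the pseudo hom is codiscrete too, these are automatically inverse to each other
and form the required companions and conjoints. -/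
theorem IsCodisc.exists_contraction {X : DblCat.{u}} (h : X.IsCodisc) (o : X.Obj)
    (v v' : X.Obj → X.Ver) (dv : ∀ x, X.ver.dom (v x) = x) (cv : ∀ x, X.ver.cod (v x) = o)
    (dv' : ∀ x, X.ver.dom (v' x) = o) (cv' : ∀ x, X.ver.cod (v' x) = x)
    (f f' : X.Obj → X.Hor) (df : ∀ x, X.hor.dom (f x) = x) (cf : ∀ x, X.hor.cod (f x) = o)
    (df' : ∀ x, X.hor.dom (f' x) = o) (cf' : ∀ x, X.hor.cod (f' x) = x)
    (hv : v o = X.ver.id o) (hv' : v' o = X.ver.id o) : Nonempty (Contraction X o) := by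
  obtain ⟨τ, a1, a2, a3⟩ := h.transpose.exists_horPs (DblFunctor.id X).transpose
    (DblFunctor.const X X o).transpose v dv cv
  obtain ⟨τ', b1, b2, b3⟩ := h.transpose.exists_horPs (DblFunctor.const X X o).transpose
    (DblFunctor.id X).transpose v' dv' cv'
  obtain ⟨t, c1, c2, -⟩ := h.exists_horPs (DblFunctor.id X) (DblFunctor.const X X o) f df cf
  obtain ⟨t', d1, d2, -⟩ := h.exists_horPs (DblFunctor.const X X o) (DblFunctor.id X) f' df' cf'
  have H := isCodisc_psHom X h
  have a1' : VerPs.dom τ = DblFunctor.id X := congrArg DblFunctor.transpose a1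
  have a2' : VerPs.cod τ = DblFunctor.const X X o := congrArg DblFunctor.transpose a2
  have b1' : VerPs.dom τ' = DblFunctor.const X X o := congrArg DblFunctor.transpose b1
  have b2' : VerPs.cod τ' = DblFunctor.id X := congrArg DblFunctor.transpose b2
  exact ⟨⟨τ, τ', a1', a2', b1', b2', by rw [a3, hv], by rw [b3, hv'],
    H.isVertInv (b1'.trans a2'.symm) (b2'.trans a1'.symm),
    H.hasComp (f := t) (c1.trans a1'.symm) (c2.trans a2'.symm),
    H.hasConj (f := t') (d1.trans a2'.symm) (d2.trans a1'.symm),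
    H.hasComp (f := t') (d1.trans b1'.symm) (d2.trans b2'.symm),
    H.hasConj (f := t) (c1.trans b2'.symm) (c2.trans b1'.symm)⟩⟩

theorem exists_contraction_sqEAdj : Nonempty (Contraction sqEAdj.{u} Two.zero) := by
  -- The shortest words from `x` to `zero`, and below those from `zero` to `x`. They are empty at
  -- `zero`, as the normalisation of a contraction at its centre demands.
  let a : Two.{u} → AltWord.{u} := fun x => ⟨x, match x with | .zero => 0 | .one => 1⟩
  have da : ∀ x, eAdjCat.dom (a x) = x := fun _ => rfl
  have ca : ∀ x, eAdjCat.cod (a x) = .zero := by rintro (_ | _) <;> rfl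
  let b : Two.{u} → AltWord.{u} := fun x => ⟨.zero, match x with | .zero => 0 | .one => 1⟩
  have db : ∀ x, eAdjCat.dom (b x) = .zero := fun _ => rfl
  have cb : ∀ x, eAdjCat.cod (b x) = x := by rintro (_ | _) <;> rfl
  exact (isCodisc_sqOf eAdjCat).exists_contraction Two.zero a b da ca db cb a b da ca db cb rfl rfl

theorem HasComp.map {A B : DblCat.{u}} (F : DblFunctor A B) {w : A.Ver} (h : A.HasComp w) :
    B.HasComp (F.ver w) := by
  obtain ⟨f, φ, ψ, h⟩ := h
  exact ⟨_, _, _, F.map_isCompanionPair h⟩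

theorem HasConj.map {A B : DblCat.{u}} (F : DblFunctor A B) {w : A.Ver} (h : A.HasConj w) :
    B.HasConj (F.ver w) := by
  obtain ⟨f, φ, ψ, h⟩ := h
  exact ⟨_, _, _, F.map_isConjointPair h⟩

end DblCat

/-! ### Transformations between constant double functors -/

namespace HorPs
variable {X A : DblCat.{u}}

/-- Constant double functors take all squares to identities, so the whiskerings in the axioms of a
transformation disappear and only vertical composites remain. -/
theorem const_naturality (h : HorPs X A) {a c : A.Obj} (hs : h.src = DblFunctor.const X A a)
    (ht : h.tgt = DblFunctor.const X A c) (q : X.Sq) :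
    A.vc (h.appVer (X.lft q)) (h.appHor (X.bot q)) = A.vc (h.appHor (X.top q)) (h.appVer (X.rgt q)) := by
  have n := h.naturality q
  have b1 := h.appVer_bdry (X.lft q)
  have b2 := h.appVer_bdry (X.rgt q)
  rw [hs, ht] at b1 b2 n
  have e1 : A.hc (h.appVer (X.lft q)) (A.vid (A.hor.id c)) = _ :=
    (congrArg (A.hc _) (A.vid_id c)).trans b1.hc_hid
  have e2 : A.hc (A.vid (A.hor.id a)) (h.appVer (X.rgt q)) = _ :=
    (congrArg (A.hc · _) (A.vid_id a)).trans b2.hid_hc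
  exact (congrArg (A.vc · _) e1.symm).trans (n.trans (congrArg (A.vc _) e2))

theorem const_appHor_cc (h : HorPs X A) {a c : A.Obj} (hs : h.src = DblFunctor.const X A a)
    (ht : h.tgt = DblFunctor.const X A c) {f g : X.Hor} (e : X.hor.cod f = X.hor.dom g) :
    h.appHor (X.hor.cc f g) = A.vc (h.appHor f) (h.appHor g) := by
  have n := h.appHor_cc f g e
  have b1 := h.appHor_bdry f
  have b2 := h.appHor_bdry g
  rw [hs, ht] at b1 b2 n
  have e1 : A.hc (h.appHor f) (A.vid (A.hor.id c)) = _ :=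
    (congrArg (A.hc _) (A.vid_id c)).trans b1.hc_hid
  have e2 : A.hc (A.vid (A.hor.id a)) (h.appHor g) = _ :=
    (congrArg (A.hc · _) (A.vid_id a)).trans b2.hid_hc
  exact n.trans (congrArg₂ A.vc e1 e2)

theorem const_appHor_bdry (h : HorPs X A) {a c : A.Obj} (hs : h.src = DblFunctor.const X A a)
    (ht : h.tgt = DblFunctor.const X A c) (f : X.Hor) :
    A.HasBdry (h.appHor f) (h.app (X.hor.dom f)) (h.app (X.hor.cod f)) (A.ver.id a) (A.ver.id c) := by
  have b := h.appHor_bdry f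
  have d := h.cod_app (X.hor.dom f)
  have d' := h.dom_app (X.hor.cod f)
  rw [hs, ht] at b
  rw [ht] at d
  rw [hs] at d'
  exact b.cast (A.hor.cc_id d) (A.hor.id_cc d'.symm) rfl rfl

/-- A transformation between constant double functors on a contractible double category is
isomorphic to a constant one. -/
theorem exists_mod_const (h : HorPs X A) {a c : A.Obj} (hs : h.src = DblFunctor.const X A a)
    (ht : h.tgt = DblFunctor.const X A c) {o : X.Obj} (t : HorPs X X)
    (t₁ : t.src = DblFunctor.id X) (t₂ : t.tgt = DblFunctor.const X X o) :
    ∃ m : PsMod X A, (psHom X A).HasBdry m h (HorPs.const X (h.app o))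
      (HorPs.id (DblFunctor.const X A a).transpose) (HorPs.id (DblFunctor.const X A c).transpose) ∧
      ∀ x, A.sqv.IsIso (m.app x) := by
  have dt : ∀ x, X.hor.dom (t.app x) = x := fun x => by rw [t.dom_app, t₁]; rfl
  have ct : ∀ x, X.hor.cod (t.app x) = o := fun x => by rw [t.cod_app, t₂]; rfl
  have b : ∀ x, A.HasBdry (h.appHor (t.app x)) (h.app x) (h.app o) (A.ver.id a) (A.ver.id c) :=
    fun x => by
      have := h.const_appHor_bdry hs ht (t.app x)
      rwa [dt, ct] at this
  have do_ : A.hor.dom (h.app o) = a := (h.dom_app o).trans (by rw [hs]; rfl)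
  have co : A.hor.cod (h.app o) = c := (h.cod_app o).trans (by rw [ht]; rfl)
  -- The component at `x` is the pseudo naturality square of `h` at the contracting morphism from
  -- `x` to `o`. With constant source and target it runs from the component at `x` to the one at
  -- `o`, and it is vertically invertible.
  refine ⟨⟨h, HorPs.const X (h.app o), HorPs.id (DblFunctor.const X A a).transpose,
    HorPs.id (DblFunctor.const X A c).transpose, hs, ht, ?_, ?_, fun x => h.appHor (t.app x), b,
    fun w => ?_, fun f => ?_⟩, ⟨rfl, rfl, rfl, rfl⟩, fun x => h.appHor_iso _⟩
  · exact congrArg (DblFunctor.const X A) do_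
  · exact congrArg (DblFunctor.const X A) co
  · have q := t.appVer_bdry w
    -- Coherence along `w` is naturality of `h` at the square with which `t` contracts `w`.
    have n := h.const_naturality hs ht (t.appVer w)
    have v := h.appVer_bdry w
    rw [q.lft, q.rgt, q.top, q.bot, t₁, t₂] at n
    rw [hs, ht] at v
    have e : h.appVer (X.ver.id o) = A.vid (h.app o) := h.appVer_id o
    have n' : A.vc (h.appVer w) (h.appHor (t.app (X.ver.cod w))) =
        A.vc (h.appHor (t.app (X.ver.dom w))) (A.vid (h.app o)) :=
      n.trans (congrArg (A.vc _) e)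
    have l := (v.vc (b (X.ver.cod w)))
    have r := (b (X.ver.dom w)).vc_vid
    have i : ∀ y : A.Obj, A.vid (A.hor.id y) = A.hid (A.ver.id y) := A.vid_id
    have l' : A.lft (A.vc (h.appVer w) (h.appHor (t.app (X.ver.cod w)))) = A.ver.id a :=
      l.lft.trans (A.ver.id_cc (A.ver.dom_id a).symm)
    change A.hc (A.hid (A.ver.id a)) (A.vc (h.appVer w) (h.appHor (t.app (X.ver.cod w)))) =
      A.hc (A.vc (h.appHor (t.app (X.ver.dom w))) (A.vid (h.app o))) (A.hid (A.ver.id c))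
    rw [n', r]
    exact (b _).hid_hc.trans (b _).hc_hid.symm
  · have q := t.appHor_bdry f
    -- Coherence along `f` is naturality of `h` at the pseudo naturality square of `t`, combined
    -- with compatibility of `h` with composition.
    have n := h.const_naturality hs ht (t.appHor f)
    rw [q.lft, q.rgt, q.top, q.bot, t₁, t₂] at n
    have k1 := h.const_appHor_bdry hs ht f
    have e1 : h.appVer (X.ver.id (X.hor.dom f)) = A.vid (h.app (X.hor.dom f)) := h.appVer_id _
    have e2 : h.appVer (X.ver.id o) = A.vid (h.app o) := h.appVer_id o
    have e3 : X.hor.cc (t.app (X.hor.dom f)) (X.hor.id o) = t.app (X.hor.dom f) := X.hor.cc_id (ct _)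
    have e4 := h.const_appHor_cc hs ht (f := f) (g := t.app (X.hor.cod f)) (dt _).symm
    have n' : A.vc (h.appVer (X.ver.id (X.hor.dom f))) (h.appHor (X.hor.cc f (t.app (X.hor.cod f)))) =
      A.vc (h.appHor (X.hor.cc (t.app (X.hor.dom f)) (X.hor.id o))) (h.appVer (X.ver.id o)) := n
    have k2 := k1.vc (b (X.hor.cod f))
    rw [e1, e2, e3, e4, k2.vid_vc] at n'
    have l : A.hc (A.vid (A.hor.id a)) (h.appHor (t.app (X.hor.cod f))) = h.appHor (t.app (X.hor.cod f)) :=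
      (congrArg (A.hc · _) (A.vid_id a)).trans (b _).hid_hc
    have r : A.hc (h.appHor (t.app (X.hor.dom f))) (A.vid (A.hor.id c)) = h.appHor (t.app (X.hor.dom f)) :=
      (congrArg (A.hc _) (A.vid_id c)).trans (b _).hc_hid
    change A.vc (h.appHor f) (A.hc (A.vid (A.hor.id a)) (h.appHor (t.app (X.hor.cod f)))) =
      A.vc (A.hc (h.appHor (t.app (X.hor.dom f))) (A.vid (A.hor.id c))) (A.vid (h.app o))
    rw [l, r, n']

end HorPs

/-! ### Functoriality and naturality of the interchange cells -/

namespace HorPs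
variable {Y X A : DblCat.{u}}

theorem cell_bdry (h : HorPs X A) (θ : VerPs Y X) :
    (psHom Y A).HasBdry (h.cell θ) (h.precomp (VerPs.dom θ)) (h.precomp (VerPs.cod θ))
      ((h.src.postComp Y).ver θ) ((h.tgt.postComp Y).ver θ) := ⟨rfl, rfl, rfl, rfl⟩

/-- The interchange cells respect identities and composition of vertical transformations because `h`
does so at each component. -/
theorem cell_id (h : HorPs X A) (S : DblFunctor Y X) :
    h.cell ((psHom Y X).ver.id S) = (psHom Y A).vid (h.precomp S) :=
  PsMod.ext rfl rfl ((h.src.postComp Y).ver_id S) ((h.tgt.postComp Y).ver_id S)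
    (funext fun _ => h.appVer_id _)

theorem cell_cc (h : HorPs X A) {θ θ' : (psHom Y X).Ver}
    (e : (psHom Y X).ver.cod θ = (psHom Y X).ver.dom θ') :
    h.cell ((psHom Y X).ver.cc θ θ') = (psHom Y A).vc (h.cell θ) (h.cell θ') := by
  have d : (psHom Y A).bot (h.cell θ) = (psHom Y A).top (h.cell θ') :=
    congrArg h.precomp e
  have b := h.cell_bdry ((psHom Y X).ver.cc θ θ')
  have b' := (h.cell_bdry θ).vc ((h.cell_bdry θ').cast (congrArg h.precomp e.symm) rfl rfl rfl)
  have e1 : VerPs.dom ((psHom Y X).ver.cc θ θ') = VerPs.dom θ := (psHom Y X).ver.dom_cc θ θ'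
  have e2 : VerPs.cod ((psHom Y X).ver.cc θ θ') = VerPs.cod θ' := (psHom Y X).ver.cod_cc e
  refine PsMod.ext_of_bdry (b.cast (congrArg h.precomp e1) (congrArg h.precomp e2)
    ((h.src.postComp Y).ver_cc e) ((h.tgt.postComp Y).ver_cc e)) b' fun y => ?_
  rw [PsMod.app_vc d]
  have e3 : ((psHom Y X).ver.cc θ θ').app y = X.ver.cc (θ.app y) (θ'.app y) :=
    (evalAt Y X y).ver_cc e
  refine (congrArg h.appVer e3).trans (h.appVer_cc _ _ ?_)
  exact (θ.cod_app y).trans ((congrArg (DblFunctor.obj · y) e).trans (θ'.dom_app y).symm)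

/-- At each object this is naturality of `h` at a square with identity top and bottom. Together with
functoriality it moves an equivalence of vertical transformations to one of cells. -/
theorem cell_naturality (h : HorPs X A) {q : (psHom Y X).Sq} {θ θ' : (psHom Y X).Ver}
    (hq : (psHom Y X).IsVertIso q θ θ') :
    (psHom Y A).hc ((h.src.postComp Y).sq q) (h.cell θ') =
      (psHom Y A).hc (h.cell θ) ((h.tgt.postComp Y).sq q) := by
  have b := hq.bdry
  have c := ((h.src.postComp Y).map_bdry b).cast ((h.src.postComp Y).hor_id (VerPs.dom θ))
    ((h.src.postComp Y).hor_id (VerPs.cod θ)) rfl rfl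
  have c' := ((h.tgt.postComp Y).map_bdry b).cast ((h.tgt.postComp Y).hor_id (VerPs.dom θ))
    ((h.tgt.postComp Y).hor_id (VerPs.cod θ)) rfl rfl
  have d := h.cell_bdry θ
  have d' := (h.cell_bdry θ').cast (congrArg h.precomp hq.dom_eq) (congrArg h.precomp hq.cod_eq)
    rfl rfl
  have k1 := c.hc d'
  have k2 := d.hc c'
  have l1 := k1.cast ((psHom Y A).hor.id_cc rfl) ((psHom Y A).hor.id_cc rfl) rfl rfl
  have l2 := k2.cast ((psHom Y A).hor.cc_id rfl) ((psHom Y A).hor.cc_id rfl) rfl rfl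
  refine PsMod.ext_of_bdry l1 l2 fun y => ?_
  rw [PsMod.app_hc (c.rgt.trans d'.lft.symm), PsMod.app_hc (d.rgt.trans c'.lft.symm)]
  have q' := PsMod.bdry_app b y
  have n := h.naturality_of_ids q'.top q'.bot
  rw [q'.lft, q'.rgt] at n
  exact n.symm

theorem precomp_const (h : HorPs X A) (o : X.Obj) :
    h.precomp (DblFunctor.const Y X o) = HorPs.const Y (h.app o) := by
  refine HorPs.ext ?_ ?_ rfl (funext fun _ => h.appVer_id o) (funext fun _ => h.appHor_id o)
  · exact (DblFunctor.const_comp o h.src).trans (congrArg _ (h.dom_app o).symm)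
  · exact (DblFunctor.const_comp o h.tgt).trans (congrArg _ (h.cod_app o).symm)

end HorPs

/-! ### Consequences of a contraction for the pseudo hom -/

namespace DblCat
variable {X A : DblCat.{u}} {o : X.Obj}

/-- The cell at θ' is the weak inverse. The isomorphisms on the sides are the images, under the
source and the target of `h`, of those relating θ and θ', and the two equations are naturality of
the cells combined with their functoriality. -/
theorem IsVertInv.isWeaklyVertInv_cell (h : HorPs X A) {Y : DblCat.{u}} {θ θ' : (psHom Y X).Ver}
    (i : (psHom Y X).IsVertInv θ θ') : (psHom Y A).IsWeaklyVertInv (h.cell θ) := by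
  have e := i.dom_eq
  have e' := i.cod_eq
  obtain ⟨ε, hε⟩ := i.inv
  obtain ⟨η, hη⟩ := i.inv'.symm
  have c1 : (psHom Y A).hc ((h.src.postComp Y).sq η) ((psHom Y A).vc (h.cell θ') (h.cell θ)) =
      (psHom Y A).hc ((psHom Y A).vid (h.precomp (VerPs.cod θ))) ((h.tgt.postComp Y).sq η) :=
    (congrArg _ (h.cell_cc e').symm).trans ((h.cell_naturality hη).trans
      (congrArg ((psHom Y A).hc · _) (h.cell_id (VerPs.cod θ))))
  have c2 : (psHom Y A).hc ((h.src.postComp Y).sq ε) ((psHom Y A).vid (h.precomp (VerPs.dom θ))) =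
      (psHom Y A).hc ((psHom Y A).vc (h.cell θ) (h.cell θ')) ((h.tgt.postComp Y).sq ε) :=
    (congrArg _ (h.cell_id (VerPs.dom θ)).symm).trans ((h.cell_naturality hε).trans
      (congrArg ((psHom Y A).hc · _) (h.cell_cc e.symm)))
  have iso : ∀ (F : DblFunctor X A) {q : (psHom Y X).Sq} {v w : (psHom Y X).Ver} {v' w' : (psHom Y A).Ver},
      (psHom Y X).IsVertIso q v w → (F.postComp Y).ver v = v' → (F.postComp Y).ver w = w' →
      (psHom Y A).IsVertIso ((F.postComp Y).sq q) v' w' := fun F q v w v' w' hq e1 e2 => by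
    subst e1 e2
    exact (F.postComp Y).map_isVertIso hq
  refine ⟨h.cell θ', (h.src.postComp Y).sq η, (h.tgt.postComp Y).sq η, (h.src.postComp Y).sq ε,
    (h.tgt.postComp Y).sq ε, congrArg h.precomp e, congrArg h.precomp e', ?_, ?_, ?_, ?_, c1, c2⟩
  · exact iso _ hη ((h.src.postComp Y).ver_id _) ((h.src.postComp Y).ver_cc e')
  · exact iso _ hη ((h.tgt.postComp Y).ver_id _) ((h.tgt.postComp Y).ver_cc e')
  · exact iso _ hε ((h.src.postComp Y).ver_cc e.symm) ((h.src.postComp Y).ver_id _)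
  · exact iso _ hε ((h.tgt.postComp Y).ver_cc e.symm) ((h.tgt.postComp Y).ver_id _)

theorem vIso_conj {P : DblCat.{u}} {r t t' s s' : P.Ver} (ht : P.IsVertInv t t')
    (hs : P.IsVertInv s s') (e : P.ver.dom r = P.ver.dom t) (e' : P.ver.cod r = P.ver.dom s) :
    P.VIso (P.ver.cc t (P.ver.cc (P.ver.cc t' (P.ver.cc r s)) s')) r := by
  have h1 := ht.dom_eq
  have h2 := ht.cod_eq
  have h3 := hs.dom_eq
  have h4 := hs.cod_eq
  have e1 : P.ver.cc t (P.ver.cc (P.ver.cc t' (P.ver.cc r s)) s') =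
      P.ver.cc (P.ver.cc t t') (P.ver.cc r (P.ver.cc s s')) := by
    rw [P.ver.cc_assoc (f := t') (by grind) (by grind), ← P.ver.cc_assoc (f := t) (by grind) (by grind),
      P.ver.cc_assoc (f := r) (by grind) (by grind)]
  refine (VIso.of_eq e1).trans ((VIso.cc ht.inv (VIso.cc (VIso.refl r) hs.inv (by grind))
    (by grind)).trans (VIso.of_eq ?_))
  rw [← e', P.ver.cc_id rfl, P.ver.id_cc e.symm]

namespace Contraction

/-- The component of a contraction at a double functor. -/
noncomputable abbrev leg (K : Contraction X o) (F : DblFunctor X A) : (psHom X A).Ver :=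
  (F.postComp X).ver K.τ

/-- The inverse of the component of a contraction at a double functor. -/
noncomputable abbrev leg' (K : Contraction X o) (F : DblFunctor X A) : (psHom X A).Ver :=
  (F.postComp X).ver K.τ'

variable (K : Contraction X o) (F : DblFunctor X A)

theorem dom_leg : (psHom X A).ver.dom (K.leg F) = F := congrArg (DblFunctor.comp · F) K.dom_τ

theorem cod_leg : (psHom X A).ver.cod (K.leg F) = DblFunctor.const X A (F.obj o) :=
  (congrArg (DblFunctor.comp · F) K.cod_τ).trans (DblFunctor.const_comp o F)

theorem dom_leg' : (psHom X A).ver.dom (K.leg' F) = DblFunctor.const X A (F.obj o) :=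
  (congrArg (DblFunctor.comp · F) K.dom_τ').trans (DblFunctor.const_comp o F)

theorem cod_leg' : (psHom X A).ver.cod (K.leg' F) = F := congrArg (DblFunctor.comp · F) K.cod_τ'

theorem isVertInv_leg : (psHom X A).IsVertInv (K.leg F) (K.leg' F) :=
  (F.postComp X).map_isVertInv K.inv

/-- This is `exists_mod_const` in the transposed double categories, where the vertical contraction τ
plays the role of the horizontal one. -/
theorem vIso_const (K : Contraction X o) {v : (psHom X A).Ver} {a c : A.Obj}
    (hd : (psHom X A).ver.dom v = DblFunctor.const X A a)
    (hc : (psHom X A).ver.cod v = DblFunctor.const X A c) :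
    (psHom X A).VIso v ((constPs X A).ver (((evalAt X A o).ver v))) := by
  obtain ⟨m, hm, i⟩ := HorPs.exists_mod_const (X := X.transpose) (A := A.transpose) v (a := a) (c := c)
    ((congrArg DblFunctor.transpose hd).trans (DblFunctor.const_transpose X.transpose (A := A.transpose) a))
    ((congrArg DblFunctor.transpose hc).trans (DblFunctor.const_transpose X.transpose (A := A.transpose) c))
    K.τ (congrArg DblFunctor.transpose K.dom_τ)
    ((congrArg DblFunctor.transpose K.cod_τ).trans (DblFunctor.const_transpose X.transpose (A := X.transpose) o))
  refine ⟨m.transpose, PsMod.isVertIso_of_app (F := VerPs.dom v) (G := VerPs.cod v)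
    ⟨?_, ?_, hm.top, hm.bot⟩ i⟩
  · exact hm.lft.trans (congrArg HorPs.id ((DblFunctor.const_transpose X a).trans hd.symm))
  · exact hm.rgt.trans (congrArg HorPs.id ((DblFunctor.const_transpose X c).trans hc.symm))

end Contraction

namespace Contraction
variable {X A : DblCat.{u}} {o : X.Obj}

/-- Any vertical transformation is isomorphic to a conjugate of a constant one. -/
theorem exists_vIso (K : Contraction X o) (r : (psHom X A).Ver) : ∃ w : A.Ver,
    A.ver.dom w = DblFunctor.obj ((psHom X A).ver.dom r) o ∧
    A.ver.cod w = DblFunctor.obj ((psHom X A).ver.cod r) o ∧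
    (psHom X A).VIso ((psHom X A).ver.cc (K.leg ((psHom X A).ver.dom r))
      ((psHom X A).ver.cc ((constPs X A).ver w) (K.leg' ((psHom X A).ver.cod r)))) r := by
  let F : DblFunctor X A := (psHom X A).ver.dom r
  let G : DblFunctor X A := (psHom X A).ver.cod r
  -- Conjugating by the legs turns `r` into a transformation between constant double functors, to
  -- which `vIso_const` applies.
  let v : (psHom X A).Ver := (psHom X A).ver.cc (K.leg' F) ((psHom X A).ver.cc r (K.leg G))
  have a1 : (psHom X A).ver.cod (K.leg' F) = (psHom X A).ver.dom r := K.cod_leg' F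
  have a2 : (psHom X A).ver.cod r = (psHom X A).ver.dom (K.leg G) := (K.dom_leg G).symm
  have a3 : (psHom X A).ver.cod (K.leg' F) = (psHom X A).ver.dom ((psHom X A).ver.cc r (K.leg G)) :=
    a1.trans ((psHom X A).ver.dom_cc _ _).symm
  have d : (psHom X A).ver.dom v = DblFunctor.const X A (F.obj o) :=
    ((psHom X A).ver.dom_cc _ _).trans (K.dom_leg' F)
  have c : (psHom X A).ver.cod v = DblFunctor.const X A (G.obj o) :=
    ((psHom X A).ver.cod_cc a3).trans (((psHom X A).ver.cod_cc a2).trans (K.cod_leg G))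
  have i := K.vIso_const d c
  have c' : (psHom X A).ver.cod v = (psHom X A).ver.dom (K.leg' G) := c.trans (K.dom_leg' G).symm
  refine ⟨(evalAt X A o).ver v, ?_, ?_, ?_⟩
  · exact ((evalAt X A o).dom_ver v).trans (congrArg (DblFunctor.obj · o) d)
  · exact ((evalAt X A o).cod_ver v).trans (congrArg (DblFunctor.obj · o) c)
  · refine (VIso.cc (VIso.refl (K.leg F)) (VIso.cc i.symm (VIso.refl (K.leg' G)) ?_) ?_).trans
      (vIso_conj (K.isVertInv_leg F) (K.isVertInv_leg G) (K.dom_leg F).symm a2)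
    · exact i.cod_eq.trans c'
    · exact (K.cod_leg F).trans (d.symm.trans (i.dom_eq.symm.trans ((psHom X A).ver.dom_cc _ _).symm))

/-- Legs inherit companions and conjoints from the contraction by postcomposition, and constant
transformations inherit them from `A`. Every vertical transformation is a composite of these up to
isomorphism. -/
theorem isEquipment_psHom (K : Contraction X o) (hA : A.IsEquipment) :
    (psHom X A).IsEquipment := by
  intro r
  obtain ⟨w, hd, hc, i⟩ := K.exists_vIso r
  have e1 : (psHom X A).ver.cod ((constPs X A).ver w) =
      (psHom X A).ver.dom (K.leg' ((psHom X A).ver.cod r)) :=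
    ((constPs X A).cod_ver w).trans ((congrArg (DblFunctor.const X A) hc).trans (K.dom_leg' _).symm)
  have e2 : (psHom X A).ver.cod (K.leg ((psHom X A).ver.dom r)) =
      (psHom X A).ver.dom ((psHom X A).ver.cc ((constPs X A).ver w)
        (K.leg' ((psHom X A).ver.cod r))) :=
    (K.cod_leg _).trans ((congrArg (DblFunctor.const X A) hd.symm).trans
      (((constPs X A).dom_ver w).symm.trans ((psHom X A).ver.dom_cc _ _).symm))
  refine ⟨?_, ?_⟩
  · exact ((K.comp.map _).cc ((HasComp.map (constPs X A) (hA w).1).cc (K.comp'.map _) e1) e2).of_vIso i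
  · exact ((K.conj.map _).cc ((HasConj.map (constPs X A) (hA w).2).cc (K.conj'.map _) e1) e2).of_vIso i

/-- The legs connect every double functor with a constant one, and everything between constants is
essentially constant. No companions in `A` are used. -/
theorem isBiequivalence_constPs (K : Contraction X o) : (constPs X A).IsBiequivalence where
  w1 F := ⟨DblFunctor.obj F o, K.leg F, K.dom_leg F, K.cod_leg F, (K.isVertInv_leg F).isVertEquiv⟩
  w2 a c v hd hc := by
    obtain ⟨β, hβ⟩ := K.vIso_const hd hc
    refine ⟨_, β, ?_, ?_, hβ⟩
    · exact ((evalAt X A o).dom_ver v).trans (congrArg (DblFunctor.obj · o) hd)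
    · exact ((evalAt X A o).cod_ver v).trans (congrArg (DblFunctor.obj · o) hc)
  w3 h := by
    -- The interchange cell of `h` with τ runs from `h` to the constant transformation at its
    -- component at `o`, and its sides are legs.
    refine ⟨HorPs.app h o, HorPs.cell h K.τ, ?_, ?_, (K.isVertInv_leg (HorPs.src h)).isVertEquiv,
      (K.isVertInv_leg (HorPs.tgt h)).isVertEquiv, K.inv.isWeaklyVertInv_cell h⟩
    · exact congrArg (HorPs.precomp h) K.dom_τ
    · exact (congrArg (HorPs.precomp h) K.cod_τ).trans (HorPs.precomp_const h o)
  w4 f g v w β h1 h2 h3 h4 hβ := by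
    have b := PsMod.bdry_app hβ
    -- Coherence along the vertical morphism from `x` to `o` involves only identity squares of the
    -- constant data, so it says that the components at `x` and at `o` agree.
    have key : ∀ x, PsMod.app β x = PsMod.app β o := fun x => by
      have dt : X.ver.dom (K.τ.app x) = x := (K.τ.dom_app x).trans (congrArg (DblFunctor.obj · x) K.dom_τ)
      have ct : X.ver.cod (K.τ.app x) = o := (K.τ.cod_app x).trans (congrArg (DblFunctor.obj · x) K.cod_τ)
      have c := PsMod.ver_coh β (K.τ.app x)
      have e1 : PsMod.lft β = _ := hβ.lft
      have e2 : PsMod.rgt β = _ := hβ.rgt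
      have e3 : PsMod.top β = _ := hβ.top
      have e4 : PsMod.bot β = _ := hβ.bot
      rw [e1, e2, e3, e4, dt, ct] at c
      have l : A.vc (A.vid f) (PsMod.app β o) = _ := (b o).vid_vc
      have r : A.vc (PsMod.app β x) (A.vid g) = _ := (b x).vc_vid
      have c' : A.hc (A.hid v) (A.vc (A.vid f) (PsMod.app β o)) =
        A.hc (A.vc (PsMod.app β x) (A.vid g)) (A.hid w) := c
      rw [l, r] at c'
      exact ((b x).hc_hid.symm.trans c'.symm).trans (b o).hid_hc
    refine ⟨PsMod.app β o, ⟨b o, ?_⟩, fun α hα => ?_⟩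
    · exact PsMod.ext_of_bdry ((constPs X A).map_bdry (b o)) hβ fun x => (key x).symm
    · exact congrArg (fun m => PsMod.app m o) hα.2

end Contraction

/-! ### Lifting equivalences along the evaluation -/

theorem vIso_cancel {P : DblCat.{u}} {t f e e' x : P.Ver} (ht : P.IsVertInv t f)
    (he : P.IsVertInv e e') (h : P.ver.cod t = P.ver.dom e) (h' : P.ver.dom x = P.ver.dom t) :
    P.VIso (P.ver.cc t (P.ver.cc e (P.ver.cc e' (P.ver.cc f x)))) x := by
  have h1 := ht.dom_eq
  have h2 := ht.cod_eq
  have h3 := he.dom_eq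
  have h4 := he.cod_eq
  have e1 : P.ver.cc t (P.ver.cc e (P.ver.cc e' (P.ver.cc f x))) =
      P.ver.cc t (P.ver.cc (P.ver.cc e e') (P.ver.cc f x)) := by
    rw [P.ver.cc_assoc (f := e) (by grind) (by grind)]
  have e2 : P.ver.cc t (P.ver.cc (P.ver.id (P.ver.dom e)) (P.ver.cc f x)) =
      P.ver.cc (P.ver.cc t f) x := by
    rw [P.ver.id_cc (by grind), P.ver.cc_assoc (by grind) (by grind)]
  refine (VIso.of_eq e1).trans ((VIso.cc (VIso.refl t) (VIso.cc he.inv (VIso.refl _) (by grind))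
    (by grind)).trans ((VIso.of_eq e2).trans ((VIso.cc ht.inv (VIso.refl x) (by grind)).trans
    (VIso.of_eq (P.ver.id_cc h'.symm)))))

/-- With `y` inverse to `z₀` and `s` the arrow `0 → 1`, extend the equivalence `y`, `F s`, `z₁` to a
double functor `G`. Then σ is the leg of `F`, the constant at `z₀` and the inverse leg of `G`. Its
component at `0` is `z₀`; the one at `1` is a composite in which everything before `z₁` cancels up
to isomorphism. -/
theorem exists_equiv_of_components {A : DblCat.{u}} (hA : ∀ w, A.HasComp w)
    (F : DblFunctor sqEAdj A) {z₀ z₁ : A.Ver} (h₀ : A.IsVertEquiv z₀) (h₁ : A.IsVertEquiv z₁)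
    (d₀ : A.ver.dom z₀ = F.obj .zero) (d₁ : A.ver.dom z₁ = F.obj .one) :
    ∃ σ : (psHom sqEAdj A).Ver, (psHom sqEAdj A).IsVertEquiv σ ∧
      (psHom sqEAdj A).ver.dom σ = F ∧ A.VIso ((evalAt sqEAdj A .zero).ver σ) z₀ ∧
      A.VIso ((evalAt sqEAdj A .one).ver σ) z₁ := by
  obtain ⟨K⟩ := exists_contraction_sqEAdj.{u}
  have C : sqEAdj.{u}.IsCodisc := isCodisc_sqOf eAdjCat
  obtain ⟨y, hy⟩ := isVertEquiv_iff.1 h₀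
  have y1 := hy.dom_eq
  have y2 := hy.cod_eq
  let s : sqEAdj.{u}.Ver := (⟨.zero, 1⟩ : AltWord.{u})
  let s' : sqEAdj.{u}.Ver := (⟨.one, 1⟩ : AltWord.{u})
  have ds : A.ver.dom (F.ver s) = F.obj .zero := F.dom_ver s
  have cs : A.ver.cod (F.ver s) = F.obj .one := F.cod_ver s
  have hs : A.IsVertEquiv (F.ver s) :=
    (F.map_isVertInv (C.isVertInv (v := s) (w := s') rfl rfl)).isVertEquiv
  have e1 : A.ver.cod (F.ver s) = A.ver.dom z₁ := by rw [cs, d₁]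
  have e2 : A.ver.cod y = A.ver.dom (A.ver.cc (F.ver s) z₁) := by rw [A.ver.dom_cc, y2, d₀, ds]
  -- Existence of companions in `A` is needed here, to give `G` values on horizontal morphisms.
  obtain ⟨G, hG, hG'⟩ := exists_sqEAdj_functor hA
    (fun x => match x with | .zero => A.ver.cod z₀ | .one => A.ver.cod z₁)
    (g := A.ver.cc y (A.ver.cc (F.ver s) z₁)) (by rw [A.ver.dom_cc]; exact y1)
    (by rw [A.ver.cod_cc e2, A.ver.cod_cc e1]) (hy.symm.isVertEquiv.cc (hs.cc h₁ e1) e2)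
  have hG₀ : G.obj .zero = A.ver.cod z₀ := congrFun hG _
  have a1 : (psHom sqEAdj A).ver.cod ((constPs sqEAdj A).ver z₀) =
      (psHom sqEAdj A).ver.dom (K.leg' G) :=
    ((constPs sqEAdj A).cod_ver z₀).trans
      ((congrArg (DblFunctor.const sqEAdj A) hG₀.symm).trans (K.dom_leg' _).symm)
  have a2 : (psHom sqEAdj A).ver.cod (K.leg F) =
      (psHom sqEAdj A).ver.dom ((psHom sqEAdj A).ver.cc ((constPs sqEAdj A).ver z₀) (K.leg' G)) :=
    (K.cod_leg _).trans ((congrArg (DblFunctor.const sqEAdj A) d₀.symm).trans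
      (((constPs sqEAdj A).dom_ver z₀).symm.trans ((psHom sqEAdj A).ver.dom_cc _ _).symm))
  have ev : ∀ x, (evalAt sqEAdj A x).ver ((psHom sqEAdj A).ver.cc (K.leg F)
      ((psHom sqEAdj A).ver.cc ((constPs sqEAdj A).ver z₀) (K.leg' G))) =
      A.ver.cc (F.ver (K.τ.app x)) (A.ver.cc z₀ (G.ver (K.τ'.app x))) := fun x =>
    ((evalAt sqEAdj A x).ver_cc a2).trans (congrArg (A.ver.cc _) ((evalAt sqEAdj A x).ver_cc a1))
  refine ⟨_, (K.isVertInv_leg F).isVertEquiv.cc (((constPs sqEAdj A).map_isVertEquiv h₀).cc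
    (K.isVertInv_leg G).symm.isVertEquiv a1) a2, ((psHom sqEAdj A).ver.dom_cc _ _).trans (K.dom_leg F),
    VIso.of_eq ((ev .zero).trans ?_), (VIso.of_eq (ev .one)).trans ?_⟩
  · have f₀ : F.ver (K.τ.app .zero) = A.ver.id (F.obj .zero) :=
      (congrArg F.ver K.app_τ).trans (F.ver_id _)
    have g₀ : G.ver (K.τ'.app .zero) = A.ver.id (G.obj .zero) :=
      (congrArg G.ver K.app_τ').trans (G.ver_id _)
    rw [f₀, g₀, A.ver.cc_id hG₀.symm, A.ver.id_cc d₀.symm]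
  · have dt : sqEAdj.ver.dom (K.τ.app .one) = .one :=
      (K.τ.dom_app _).trans (congrArg (DblFunctor.obj · _) K.dom_τ)
    have ct : sqEAdj.ver.cod (K.τ.app .one) = .zero :=
      (K.τ.cod_app _).trans (congrArg (DblFunctor.obj · _) K.cod_τ)
    have dt' : sqEAdj.ver.dom (K.τ'.app .one) = .zero :=
      (K.τ'.dom_app _).trans (congrArg (DblFunctor.obj · _) K.dom_τ')
    have ct' : sqEAdj.ver.cod (K.τ'.app .one) = .one :=
      (K.τ'.cod_app _).trans (congrArg (DblFunctor.obj · _) K.cod_τ')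
    -- By codiscreteness of the shape, the contracting morphism at `1` is inverse to `s`, and its
    -- opposite is isomorphic to `s`; double functors preserve both facts.
    have i := F.map_isVertInv (C.isVertInv (v := K.τ.app .one) (w := s) ct.symm dt.symm)
    have j := G.map_vIso (C.vIso (v := K.τ'.app .one) (w := s) dt' ct')
    rw [hG'] at j
    have k1 : A.ver.cod (F.ver (K.τ.app .one)) = A.ver.dom z₀ := by rw [F.cod_ver, ct, d₀]
    have k2 : A.ver.cod z₀ = A.ver.dom (G.ver (K.τ'.app .one)) := by rw [G.dom_ver, dt', hG₀]
    have k3 : A.ver.dom z₁ = A.ver.dom (F.ver (K.τ.app .one)) := by rw [F.dom_ver, dt, d₁]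
    exact (VIso.cc (VIso.refl _) (VIso.cc (VIso.refl z₀) j k2)
      (k1.trans (A.ver.dom_cc _ _).symm)).trans (vIso_cancel i hy k1 k3)

/-- The components of the equivalence just built agree with the prescribed ones only up to
isomorphism. Lifting that isomorphism makes them agree strictly. -/
theorem vEquivLift_pathEval {A : DblCat.{u}} (hA : ∀ w, A.HasComp w) :
    @VEquivLift (pathObj A) (A.prod A) (pathEval A) := by
  intro F z hz d
  obtain ⟨h₀, h₁⟩ := prod_isVertEquiv hz
  obtain ⟨σ, hσ, dσ, ⟨κ₀, i₀⟩, ⟨κ₁, i₁⟩⟩ := exists_equiv_of_components hA F h₀ h₁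
    (congrArg Prod.fst d) (congrArg Prod.snd d)
  obtain ⟨σ', m, hm, e⟩ := vIsoLift_pathEval A σ z (κ₀, κ₁) (prod_isVertIso_iff.2 ⟨i₀, i₁⟩)
  refine ⟨σ', hσ.of_vIso ⟨m, hm⟩, hm.dom_eq.trans dσ, ?_⟩
  have a := DblFunctor.rgt_sq (A := pathObj A) (B := A.prod A) (pathEval A) m
  rw [hm.bdry.rgt, e] at a
  exact a.symm.trans (prod_isVertIso_iff.2 ⟨i₀, i₁⟩ :
    (A.prod A).IsVertIso (κ₀, κ₁) ((pathEval A).ver σ) z).bdry.rgt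

/-- The generators ask for lifts of vertical equivalences, companions, conjoints and invertible
cells of both kinds. Companions and conjoints exist upstairs since the path object is an equipment,
and the lifted isomorphisms give them the prescribed images. -/
theorem naiveFib_pathEval {A : DblCat.{u}} (hA : A.IsEquipment) : naiveFib (pathEval A) := by
  obtain ⟨K⟩ := exists_contraction_sqEAdj.{u}
  have hP := K.isEquipment_psHom hA
  rintro _ _ _ (_ | _ | _ | _ | _)
  · exact rlp_obj (P := pathObj A) (vIsoLift_pathEval A) (vEquivLift_pathEval fun w => (hA w).1)
  · exact rlp_companion (P := pathObj A) (vIsoLift_pathEval_transpose A) fun w => (hP w).1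
  · exact rlp_conjoint (P := pathObj A) (vIsoLift_pathEval_transpose A) fun w => (hP w).2
  · exact rlp_horIso (P := pathObj A) (vIsoLift_pathEval_transpose A)
  · exact rlp_verIso (P := pathObj A) (vIsoLift_pathEval A)

end DblCat

/-- Let `A` be an equipment.  Then the pseudo hom double category from `Sq E_adj` to `A` is an
equipment, and `A ⟶ ⟦Sq E_adj, A⟧_ps ⟶ A × A` is a path object for `A`. -/
theorem mainTheorem6 (A : DblCat.{u}) (hA : A.IsEquipment) :
    (pathObj A).IsEquipment ∧ IsPathObject (pathConst A) (pathEval A) := by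
  obtain ⟨K⟩ := DblCat.exists_contraction_sqEAdj.{u}
  have hP : (pathObj A).IsEquipment := K.isEquipment_psHom hA
  -- Evaluating constant data returns the original data definitionally, hence the strict
  -- factorisation of the diagonal.
  exact ⟨hP, rfl, ⟨hA, hP, K.isBiequivalence_constPs⟩, DblCat.naiveFib_pathEval hA⟩
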